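/- **Setting.** One observes $Z_i = X_i+\varepsilon_i$, $1\le i\le n$, where $X_1,X_2,\dots$ are i.i.d. with unknown density $g$ on $\mathbb R$, independent of the i.i.d. $\varepsilon_1,\varepsilon_2,\dots$ with known density $f_\varepsilon$. Write $u^*(x)=\int e^{ixt}u(t)\,dt$. Assume that for some constants $\kappa_0,\kappa_0'>0$ and all $x\in\mathbb R$ $$\kappa_0 (x^2+1)^{-\gamma/2}e^{-\alpha|x|^\rho}\le |f_\varepsilon^*(x)|\le \kappa_0'(x^2+1)^{-\gamma/2}e^{-\alpha|x|^\rho},$$ where either $\alpha=\rho=0$ and $\gamma>1$, or $\alpha>0$, $\rho>0$ and $\gamma\ge 0$. For $\lambda=(b,a,r,L)$ let $\mathcal S(\lambda)$ be the set of continuous probability densities $g$ with $\int |g^*(x)|^2(x^2+1)^b e^{2a|x|^r}dx\le 2\pi L$. Fix $x_0\in\mathbb R$; the aim is to estimate $\theta(g)=g(x_0)$, and an estimator $\theta_n$ is a measurable function of $Z_1,\dots,Z_n$. Let $\Lambda=[\underline b,\overline b]\times[\underline a,\overline a]\times[\underline r,\overline r]\times[\underline L,\overline L]$ (non-empty intervals,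 $\underline L>0$). Write "$r=0$ on $\Lambda$" if $\underline a=\overline a=\underline r=\overline r=0$ and $\underline b>1/2$, and "$r>0$ on $\Lambda$" if $\underline a>0$, $\underline r>0$ and $\underline b\ge 0$. A squared rate $\phi_{n,\lambda}^2$ is *attained on $\Lambda$* if there are estimators $\theta_n$, not depending on $\lambda\in\Lambda$, and a constant $C$ with $$\mathbb E_g|\theta_n-\theta(g)|^2\le C\phi_{n,\lambda}^2\quad\text{for all large } n,\text{ all }\lambda\in\Lambda,\ g\in\mathcal S(\lambda),$$ and it is *a lower bound on $\Lambda$* if there is $c>0$ such that for all large $n$ $$\inf_{\theta_n}\sup_{\lambda\in\Lambda}\sup_{g\in\mathcal S(\lambda)}\phi_{n,\lambda}^{-2}\,\mathbb E_g|\theta_n-\theta(g)|^2\ge c,$$ the infimum being over all estimators. When $r>0$ and $\rho>0$, let $m_n=m_n(\lambda)>0$ be any quantity such that, for all large $n$ and all $\lambda\in\Lambda$, $m_n^{2b+2\gamma}\exp\{2\alpha(\pi m_n)^\rho+2a(\pi m_n)^r\}$ lies between two positive constant multiples of $n$ (constants not depending on $n,\lambda$), and put $$B_m=m^{-2b+1-r}e^{-2a(\pi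 m)^r},\qquad V_m=m^{2\gamma+1-\rho}e^{2\alpha(\pi m)^\rho}/n .$$ For $s\in\mathbb R$ let $(D_s)$ be the condition: there are $C,M$ such that $f_\varepsilon^*$ is differentiable at every $u$ with $|u|\ge M$ and $|(f_\varepsilon^*)'(u)|\le C|u|^{-s}e^{-\alpha|u|^\rho}$ there. **Theorem 4.1.** In each of the following cases $\phi_{n,\lambda}^2$ is attained on $\Lambda$, and under the stated additional conditions it is also a lower bound on $\Lambda$. 1. $r=0$ on $\Lambda$, $\rho=0$: $\phi^2_{n,\lambda}=(n/\ln n)^{-(2b-1)/(2b+2\gamma)}$; lower bound if $\underline b<\overline b$ and $(D_{\gamma+1})$ holds. 2. $r>0$ on $\Lambda$, $\rho=0$: $\phi^2_{n,\lambda}=\ln\ln(n)\,(\ln n)^{(2\gamma+1)/r}/n$; lower bound if $\underline r<\overline r$ and $(D_{\gamma+1})$ holds. 3. $r=0$ on $\Lambda$, $\rho>0$: $\phi^2_{n,\lambda}=(\ln n)^{-(2b-1)/\rho}$; lower bound if $(D_{1-\rho})$ holds. 4. $r>0$ on $\Lambda$, $\overline r<\rho$: $\phi^2_{n,\lambda}=B_{m_n}$;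 lower bound if $(D_{1-\rho})$ holds. 5. $r>0$ on $\Lambda$, $0<\rho\le 1$, $\rho\le\underline r$: $\phi^2_{n,\lambda}=m_n^{\rho}V_{m_n}$; lower bound if $\underline r<\overline r$ and $(D_\gamma)$ holds. Moreover, if $0<\rho\le 1$, $\rho\le r$, $a>0$, $b\ge 0$ and $L>0$, then for the single class $\mathcal S(b,a,r,L)$ (that is, $\Lambda=\{(b,a,r,L)\}$) the rate $\varphi_n^2=V_{m_n}$ is attained and, if $(D_\gamma)$ holds, it is also a lower bound, so that it is the minimax rate. -/

import Mathlib

open MeasureTheory Filter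

noncomputable section

namespace Deconv

/-- Fourier transform `u*(x) = ∫ e^{ixt} u(t) dt`. -/
def ft (u : ℝ → ℝ) (x : ℝ) : ℂ :=
  ∫ t : ℝ, Complex.exp (Complex.I * (x : ℂ) * (t : ℂ)) * ((u t : ℝ) : ℂ)

/-- Probability densities on the real line. -/
structure IsDensity (u : ℝ → ℝ) : Prop where
  nonneg : ∀ x, 0 ≤ u x
  integrable : Integrable u
  integral_eq_one : ∫ x, u x = 1

/-- The probability measure with density `u`. -/
def law (u : ℝ → ℝ) : Measure ℝ := volume.withDensity fun x => ENNReal.ofReal (u x)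

/-- The noise density `f` satisfies
`κ₀ (x²+1)^{-γ/2} e^{-α|x|^ρ} ≤ |f*(x)| ≤ κ₁ (x²+1)^{-γ/2} e^{-α|x|^ρ}`.  Either the noise is
ordinary smooth (`α = ρ = 0`, and then `γ > 1`) or it is supersmooth (`α, ρ > 0`, `γ ≥ 0`). -/
structure IsNoise (f : ℝ → ℝ) (γ α ρ : ℝ) : Prop where
  density : IsDensity f
  params : (α = 0 ∧ ρ = 0 ∧ 1 < γ) ∨ (0 < α ∧ 0 < ρ ∧ 0 ≤ γ)
  bounds : ∃ κ₀ κ₁ : ℝ, 0 < κ₀ ∧ ∀ x : ℝ,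
    κ₀ * (x ^ 2 + 1) ^ (-γ / 2) * Real.exp (-α * |x| ^ ρ) ≤ ‖ft f x‖ ∧
    ‖ft f x‖ ≤ κ₁ * (x ^ 2 + 1) ^ (-γ / 2) * Real.exp (-α * |x| ^ ρ)

/-- `f*` is differentiable near infinity and `|(f*)'(u)| ≤ C |u|^{-s} e^{-α|u|^ρ}` there. -/
def DerivDecay (f : ℝ → ℝ) (s α ρ : ℝ) : Prop :=
  ∃ C M : ℝ, ∀ u : ℝ, M ≤ |u| → DifferentiableAt ℝ (ft f) u ∧
    ‖deriv (ft f) u‖ ≤ C * |u| ^ (-s) * Real.exp (-α * |u| ^ ρ)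

/-- Smoothness parameters `(b, a, r, L)`. -/
structure Smoothness where
  b : ℝ
  a : ℝ
  r : ℝ
  L : ℝ

/-- The smoothness class: densities `g` with
`∫ |g*(x)|² (x²+1)^b e^{2a|x|^r} dx ≤ 2πL`.  Such a density has a continuous version (when `b > 1/2`
or `a, r > 0`), which is the one whose value at a point is meant. -/
def smoothClass (l : Smoothness) : Set (ℝ → ℝ) :=
  {g | IsDensity g ∧ Continuous g ∧
    ∫⁻ x : ℝ, ENNReal.ofReal
      (‖ft g x‖ ^ 2 * (x ^ 2 + 1) ^ l.b * Real.exp (2 * l.a * |x| ^ l.r))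
      ≤ ENNReal.ofReal (2 * Real.pi * l.L)}

/-- Boxes of smoothness parameters. -/
def box (lo hi : Smoothness) : Set Smoothness :=
  {l | (lo.b ≤ l.b ∧ l.b ≤ hi.b) ∧ (lo.a ≤ l.a ∧ l.a ≤ hi.a) ∧
    (lo.r ≤ l.r ∧ l.r ≤ hi.r) ∧ (lo.L ≤ l.L ∧ l.L ≤ hi.L)}

/-- The box `[b₋, b₊] × {0} × {0} × [L₋, L₊]` with `b₋ > 1/2`, `L₋ > 0` (Sobolev classes). -/
structure SobolevBox (lo hi : Smoothness) : Prop where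
  lo_a : lo.a = 0
  hi_a : hi.a = 0
  lo_r : lo.r = 0
  hi_r : hi.r = 0
  b_pos : 1 / 2 < lo.b
  b_le : lo.b ≤ hi.b
  L_pos : 0 < lo.L
  L_le : lo.L ≤ hi.L

/-- The box `[b₋, b₊] × [a₋, a₊] × [r₋, r₊] × [L₋, L₊]` with
`b₋ ≥ 0` and `a₋, r₋, L₋ > 0` (classes of supersmooth densities). -/
structure SupersmoothBox (lo hi : Smoothness) : Prop where
  b_nonneg : 0 ≤ lo.b
  b_le : lo.b ≤ hi.b
  a_pos : 0 < lo.a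
  a_le : lo.a ≤ hi.a
  r_pos : 0 < lo.r
  r_le : lo.r ≤ hi.r
  L_pos : 0 < lo.L
  L_le : lo.L ≤ hi.L

/-- Law of the sample `(Z₁, …, Zₙ)`: the `Zᵢ = Xᵢ + εᵢ` are i.i.d., `Xᵢ` with density `g`
independent of `εᵢ` with density `f`. -/
def sampleLaw (f g : ℝ → ℝ) (n : ℕ) : Measure (Fin n → ℝ) :=
  Measure.pi fun _ => (law g).conv (law f)

/-- Quadratic risk `E_g |T(Z₁, …, Zₙ) - g(x₀)|²`. -/
def risk (f : ℝ → ℝ) (x₀ : ℝ) (n : ℕ) (T : (Fin n → ℝ) → ℝ) (g : ℝ → ℝ) : ENNReal :=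
  ∫⁻ z, ENNReal.ofReal ((T z - g x₀) ^ 2) ∂(sampleLaw f g n)

/-- Some sequence of estimators, the same for all parameters in `Λ`, attains the squared rate `φ2`
uniformly over the classes with parameter in `Λ`. -/
def Attained (f : ℝ → ℝ) (x₀ : ℝ) (Λ : Set Smoothness) (φ2 : ℕ → Smoothness → ℝ) : Prop :=
  ∃ T : (n : ℕ) → (Fin n → ℝ) → ℝ, (∀ n, Measurable (T n)) ∧
    ∃ C : ℝ, ∀ᶠ n in atTop, ∀ l ∈ Λ, ∀ g ∈ smoothClass l,
      risk f x₀ n (T n) g ≤ ENNReal.ofReal (C * φ2 n l)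

/-- For some `c > 0` and all large `n`,
`inf_T sup_{l ∈ Λ} sup_{g ∈ smoothClass l} φ2(n,l)⁻¹ E_g |T - g(x₀)|² ≥ c`, the infimum being over
all estimators based on `n` observations. -/
def LowerBound (f : ℝ → ℝ) (x₀ : ℝ) (Λ : Set Smoothness) (φ2 : ℕ → Smoothness → ℝ) : Prop :=
  ∃ c : ℝ, 0 < c ∧ ∀ᶠ n in atTop,
    ENNReal.ofReal c ≤ ⨅ (T : (Fin n → ℝ) → ℝ) (_ : Measurable T),
      ⨆ l ∈ Λ, ⨆ g ∈ smoothClass l, risk f x₀ n T g / ENNReal.ofReal (φ2 n l)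

/-- `m n l` is of the order of the solution of
`m^{2b+2γ} exp(2α(πm)^ρ + 2a(πm)^r) = n`, uniformly in `l ∈ Λ`: the left-hand side lies between
two constant positive multiples of `n`. -/
def IsCutoff (γ α ρ : ℝ) (Λ : Set Smoothness) (m : ℕ → Smoothness → ℝ) : Prop :=
  ∃ c₁ c₂ : ℝ, 0 < c₁ ∧ ∀ᶠ n : ℕ in atTop, ∀ l ∈ Λ, 0 < m n l ∧
    c₁ * n ≤ (m n l) ^ (2 * l.b + 2 * γ) * Real.exp
      (2 * α * (Real.pi * m n l) ^ ρ + 2 * l.a * (Real.pi * m n l) ^ l.r) ∧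
    (m n l) ^ (2 * l.b + 2 * γ) * Real.exp
      (2 * α * (Real.pi * m n l) ^ ρ + 2 * l.a * (Real.pi * m n l) ^ l.r) ≤ c₂ * n

/-- `B_m = m^{-2b+1-r} e^{-2a(πm)^r}`. -/
def biasTerm (l : Smoothness) (m : ℝ) : ℝ :=
  m ^ (-2 * l.b + 1 - l.r) * Real.exp (-2 * l.a * (Real.pi * m) ^ l.r)

/-- `V_m = m^{2γ+1-ρ} e^{2α(πm)^ρ} / n`. -/
def varTerm (γ α ρ : ℝ) (n : ℕ) (m : ℝ) : ℝ :=
  m ^ (2 * γ + 1 - ρ) * Real.exp (2 * α * (Real.pi * m) ^ ρ) / n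

/-- Adaptive squared rate, Sobolev classes and ordinary smooth noise. -/
def rateSobOrd (γ : ℝ) (n : ℕ) (l : Smoothness) : ℝ :=
  ((n : ℝ) / Real.log n) ^ (-(2 * l.b - 1) / (2 * l.b + 2 * γ))

/-- Adaptive squared rate, Sobolev classes and supersmooth noise. -/
def rateSobSuper (ρ : ℝ) (n : ℕ) (l : Smoothness) : ℝ :=
  (Real.log n) ^ (-(2 * l.b - 1) / ρ)

/-- Adaptive squared rate, supersmooth classes and ordinary smooth noise. -/
def rateSuperOrd (γ : ℝ) (n : ℕ) (l : Smoothness) : ℝ :=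
  Real.log (Real.log n) * (Real.log n) ^ ((2 * γ + 1) / l.r) / n

end Deconv

end

open MeasureTheory Filter

noncomputable section

namespace Deconv

/-! Upper bounds. Cutting the Fourier inversion formula at frequency `M` and dividing by `f*` gives
the deconvolution kernel. Its empirical mean is unbiased for the truncated inversion integral, so
its bias is at most the tail integral of `|g*|` beyond `M`. By Cauchy-Schwarz against the weight of
the class, the squared bias is of order `M^{1-2b}` for Sobolev classes and `M^{1-2b-r} e^{-2aM^r}`
for supersmooth ones. The second moment of the kernel is at most the integral of `|f*|` over the
line times that of `|f*|^{-2}` over `[-M, M]`, by Schur's test (`lintegral_norm_sq_fourier_le`) and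
`|g*| ≤ 1`.

To avoid knowing the class, one cutoff is selected from a grid by comparing estimators pairwise. A
Bernstein-type bound (`lintegral_sq_sub_le`) shows that the squared deviation at cutoff `k` exceeds
`4 x_k v_k / n` only by an amount of expectation `O(v_k e^{-x_k} / n)`. With `x_k` about `log v_k +
2 log k` these excesses are summable, and the oracle inequality `exists_adaptive_estimator` follows.
The selection costs a factor `x_k`: the logarithm of the cutoff for ordinary smooth noise, `M^ρ` for
supersmooth noise. Nothing is lost when the bias dominates. For Sobolev classes under supersmooth
noise one cutoff free of the class suffices. For `r < ρ`, lowering `M^ρ` by a multiple of `log M`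
removes the variance, penalty included, and changes the bias by a constant factor. For a single
class no selection is made.

Lower bounds. Two densities are compared: `g₀`, with Cauchy tails and Fourier transform supported
near the origin, and `g₁ = g₀ + H`, where `H` is a small wave with Fourier transform on two narrow
bands of high frequency. Smearing by the noise keeps the Cauchy lower bound, so the chi-square
distance `X` between single observations is controlled by the integral of `(1+z²)(f*H)²` (here a
convolution), that is, by the Fourier transform of this convolution and its derivative on the bands;
this is the role of `(D_s)`. The inequality `risk_two_point` reads `Δ² ≤ 2 R(g₁) + 2 e^{nX} R(g₀)`,
where `Δ` is the gap between the values at `x₀`.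

If both densities are taken in one class, `nX` must stay bounded. Since `g₀` lies in every class
considered, it may instead be charged with the faster rate of a smoother class. Then `nX` may grow
like the logarithm of the ratio of the two rates, which allows a larger wave and produces the loss:
`log n`, `log log n` or `m^ρ`. The statements `lowerBound_of_waves` and `lowerBound_of_bands` reduce
each case to a choice of frequency, width and amplitude. -/

/-! ### Fourier transforms of densities and laws -/

theorem IsDensity.isProbabilityMeasure {u : ℝ → ℝ} (hu : IsDensity u) :
    IsProbabilityMeasure (law u) := by
  constructor
  rw [law, withDensity_apply _ MeasurableSet.univ, Measure.restrict_univ,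
    ← ofReal_integral_eq_lintegral_ofReal hu.integrable (ae_of_all _ hu.nonneg),
    hu.integral_eq_one, ENNReal.ofReal_one]

theorem IsDensity.integral_law {E : Type*} [NormedAddCommGroup E] [NormedSpace ℝ E]
    {u : ℝ → ℝ} (hu : IsDensity u) (φ : ℝ → E) :
    ∫ x, φ x ∂(law u) = ∫ x, u x • φ x := by
  have hm : AEMeasurable (fun x => (u x).toNNReal) :=
    hu.integrable.aestronglyMeasurable.aemeasurable.real_toNNReal
  have : law u = volume.withDensity fun x => ((u x).toNNReal : ENNReal) := rfl
  rw [this, integral_withDensity_eq_integral_smul₀ hm]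
  refine integral_congr_ae (ae_of_all _ fun x => ?_)
  simp only [NNReal.smul_def, Real.coe_toNNReal _ (hu.nonneg x)]

theorem IsDensity.ft_eq_charFun {u : ℝ → ℝ} (hu : IsDensity u) (x : ℝ) :
    ft u x = charFun (law u) x := by
  rw [charFun_apply_real, hu.integral_law, ft]
  refine integral_congr_ae (ae_of_all _ fun t => ?_)
  simp only [Complex.real_smul]
  rw [mul_comm]
  congr 2
  ring_nf

/-- A change of sign and scale relates the probabilistic convention to the one with `e^{-2πixt}`;
inversion, continuity and convolution are transferred through it. -/
theorem ft_eq_fourier (u : ℝ → ℝ) (x : ℝ) :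
    ft u x = FourierTransform.fourier (fun t => (u t : ℂ)) (-x / (2 * Real.pi)) := by
  rw [Real.fourier_real_eq_integral_exp_smul, ft]
  refine integral_congr_ae (ae_of_all _ fun t => ?_)
  simp only [smul_eq_mul]
  congr 2
  push_cast
  have : (Real.pi : ℂ) ≠ 0 := by exact_mod_cast Real.pi_ne_zero
  field_simp

theorem continuous_ft {u : ℝ → ℝ} (hu : Integrable u) : Continuous (ft u) := by
  have : ft u = fun x => FourierTransform.fourier (fun t => (u t : ℂ)) (-x / (2 * Real.pi)) :=
    funext (ft_eq_fourier u)
  rw [this]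
  exact (VectorFourier.fourierIntegral_continuous Real.continuous_fourierChar
    (L := innerₗ ℝ) (by exact continuous_inner) hu.ofReal).comp (by fun_prop)

theorem IsDensity.norm_ft_le_one {u : ℝ → ℝ} (hu : IsDensity u) (x : ℝ) : ‖ft u x‖ ≤ 1 := by
  have := hu.isProbabilityMeasure
  rw [hu.ft_eq_charFun]
  exact norm_charFun_le_one x

theorem norm_cexp_I_mul (a b : ℝ) : ‖Complex.exp (Complex.I * a * b)‖ = 1 := by
  have : Complex.I * a * b = ((a * b : ℝ) : ℂ) * Complex.I := by push_cast; ring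
  rw [this, Complex.norm_exp_ofReal_mul_I]

theorem norm_cexp_neg_I_mul (a b : ℝ) : ‖Complex.exp (-Complex.I * a * b)‖ = 1 := by
  have : -Complex.I * a * b = ((-(a * b) : ℝ) : ℂ) * Complex.I := by push_cast; ring
  rw [this, Complex.norm_exp_ofReal_mul_I]

/-- Fourier inversion. -/
theorem ft_inversion {u : ℝ → ℝ} (hc : Continuous u) (hu : Integrable u)
    (hft : Integrable (ft u)) (x : ℝ) :
    (u x : ℂ) = (1 / (2 * Real.pi) : ℂ) * ∫ y : ℝ, Complex.exp (-Complex.I * y * x) * ft u y := by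
  have hpi : (Real.pi : ℂ) ≠ 0 := by exact_mod_cast Real.pi_ne_zero
  have hF : ∀ y : ℝ, FourierTransform.fourier (fun t => (u t : ℂ)) y = ft u (-2 * Real.pi * y) := by
    intro y
    rw [ft_eq_fourier]
    field_simp
  have hint : Integrable (FourierTransform.fourier (fun t => (u t : ℂ))) := by
    have : FourierTransform.fourier (fun t => (u t : ℂ)) = fun y => ft u (-2 * Real.pi * y) :=
      funext hF
    rw [this]
    exact hft.comp_mul_left' (by simp [Real.pi_ne_zero])
  have h := congrFun (Continuous.fourierInv_fourier_eq (by fun_prop) hu.ofReal hint) x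
  rw [← h, Real.fourierInv_eq']
  simp only [hF, smul_eq_mul]
  have h2 := Measure.integral_comp_mul_left
    (fun y : ℝ => Complex.exp (-Complex.I * y * x) * ft u y) (-2 * Real.pi)
  have h3 : |(-2 * Real.pi)⁻¹| = 1 / (2 * Real.pi) := by
    rw [abs_inv, abs_mul]
    simp [abs_of_pos Real.pi_pos]
  rw [h3] at h2
  calc _ = ∫ y : ℝ, Complex.exp (-Complex.I * ((-2 * Real.pi * y : ℝ) : ℂ) * x) *
        ft u (-2 * Real.pi * y) := by
        refine integral_congr_ae (ae_of_all _ fun y => ?_)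
        simp only
        congr 2
        simp
        ring
    _ = _ := by
        rw [h2]
        simp

/-- The Fourier transform of a convolution, on the level of laws. -/
theorem charFun_law_conv {u v : ℝ → ℝ} (hu : IsDensity u) (hv : IsDensity v) (x : ℝ) :
    charFun ((law u).conv (law v)) x = ft u x * ft v x := by
  have := hu.isProbabilityMeasure
  have := hv.isProbabilityMeasure
  rw [charFun_conv, hu.ft_eq_charFun, hv.ft_eq_charFun]

/-! ### Schur's test and half of Plancherel -/

/-- Schur's test for the quadratic form with kernel `charFun μ (x - y)`. -/
theorem lintegral_norm_sq_fourier_le (μ : Measure ℝ) [IsFiniteMeasure μ]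
    (hμ : Integrable (charFun μ)) {a : ℝ → ℂ} (ha : Integrable a)
    (ha2 : Integrable fun x => ‖a x‖ ^ 2) :
    ∫⁻ z, ENNReal.ofReal (‖∫ x : ℝ, a x * Complex.exp (Complex.I * x * z)‖ ^ 2) ∂μ ≤
      ENNReal.ofReal ((∫ x, ‖charFun μ x‖) * ∫ x, ‖a x‖ ^ 2) := by
  set F : ℝ → ℂ := fun z => ∫ x : ℝ, a x * Complex.exp (Complex.I * x * z) with hF
  -- the integrand on the product space
  have hFbd : ∀ z, ‖F z‖ ≤ ∫ x, ‖a x‖ := by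
    intro z
    refine (norm_integral_le_integral_norm _).trans (le_of_eq ?_)
    refine integral_congr_ae (ae_of_all _ fun x => ?_)
    simp only [norm_mul, norm_cexp_I_mul, mul_one]
  have hFc : Continuous F := by
    refine continuous_of_dominated (bound := fun x => ‖a x‖) ?_ ?_ ha.norm ?_
    · intro z
      exact ha.aestronglyMeasurable.mul (by fun_prop)
    · intro z
      refine ae_of_all _ fun x => ?_
      rw [norm_mul, norm_cexp_I_mul, mul_one]
    · exact ae_of_all _ fun x => by fun_prop
  have hsq : ∀ z, ((‖F z‖ ^ 2 : ℝ) : ℂ) = ∫ p : ℝ × ℝ,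
      (a p.1 * (starRingEnd ℂ) (a p.2)) * Complex.exp (Complex.I * (p.1 - p.2 : ℝ) * z) := by
    intro z
    have e1 : ((‖F z‖ ^ 2 : ℝ) : ℂ) = F z * (starRingEnd ℂ) (F z) := by
      rw [Complex.mul_conj, Complex.normSq_eq_norm_sq]
    have e2 : (starRingEnd ℂ) (F z) =
        ∫ y : ℝ, (starRingEnd ℂ) (a y * Complex.exp (Complex.I * y * z)) := by
      rw [hF, ← integral_conj]
    rw [e1, e2, hF, ← integral_prod_mul]
    refine integral_congr_ae (ae_of_all _ fun p => ?_)
    simp only [map_mul, ← Complex.exp_conj, Complex.conj_I, Complex.conj_ofReal]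
    have : Complex.exp (Complex.I * (p.1 - p.2 : ℝ) * z) =
        Complex.exp (Complex.I * p.1 * z) * Complex.exp (-Complex.I * p.2 * z) := by
      rw [← Complex.exp_add]; congr 1; push_cast; ring
    rw [this]; ring
  have hab : Integrable (fun p : ℝ × ℝ => a p.1 * (starRingEnd ℂ) (a p.2)) := by
    have ha' : Integrable (fun y => (starRingEnd ℂ) (a y)) :=
      (Complex.conjLIE.toContinuousLinearEquiv : ℂ →L[ℝ] ℂ).integrable_comp ha
    exact ha.mul_prod ha'
  have hInt : Integrable (fun z => ‖F z‖ ^ 2) μ := by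
    refine Integrable.of_bound (C := (∫ x, ‖a x‖) ^ 2) (by fun_prop) ?_
    refine ae_of_all _ fun z => ?_
    rw [Real.norm_of_nonneg (by positivity)]
    exact pow_le_pow_left₀ (norm_nonneg _) (hFbd z) 2
  rw [← ofReal_integral_eq_lintegral_ofReal hInt (ae_of_all _ fun z => by positivity)]
  refine ENNReal.ofReal_le_ofReal ?_
  -- Joint integrability allows `z` to be integrated first; the squared modulus then becomes a
  -- quadratic form in `a` whose kernel is the characteristic function of `μ`.
  have hG : Integrable (fun q : ℝ × (ℝ × ℝ) => (a q.2.1 * (starRingEnd ℂ) (a q.2.2)) *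
      Complex.exp (Complex.I * (q.2.1 - q.2.2 : ℝ) * q.1)) (μ.prod volume) := by
    have h1 : Integrable (fun q : ℝ × (ℝ × ℝ) => (1 : ℂ) * (a q.2.1 * (starRingEnd ℂ) (a q.2.2)))
        (μ.prod volume) := (integrable_const (1 : ℂ)).mul_prod hab
    refine h1.mono ?_ ?_
    · refine AEStronglyMeasurable.mul ?_ (Continuous.aestronglyMeasurable (by fun_prop))
      exact hab.aestronglyMeasurable.comp_snd
    · refine ae_of_all _ fun q => ?_
      rw [norm_mul, norm_cexp_I_mul, mul_one, one_mul]
  have hswap : ((∫ z, ‖F z‖ ^ 2 ∂μ : ℝ) : ℂ) =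
      ∫ p : ℝ × ℝ, (a p.1 * (starRingEnd ℂ) (a p.2)) * charFun μ (p.1 - p.2) := by
    rw [← integral_complex_ofReal]
    simp_rw [hsq]
    rw [integral_integral_swap hG]
    refine integral_congr_ae (ae_of_all _ fun p => ?_)
    simp only
    rw [integral_const_mul, charFun_apply_real]
    congr 1
    refine integral_congr_ae (ae_of_all _ fun z => ?_)
    simp only
    congr 1
    ring
  set c : ℝ → ℝ := fun x => ‖charFun μ x‖ with hc
  have hceven : ∀ x, c (-x) = c x := fun x => by simp only [hc, charFun_neg, RCLike.norm_conj]
  -- After `|a(x)a(y)| ≤ (|a(x)|² + |a(y)|²)/2` the form splits into two halves. Each is the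
  -- integral of a convolution, hence a product of integrals; evenness of `c` makes the two halves
  -- equal.
  have hG1 : Integrable (fun p : ℝ × ℝ => ‖a p.2‖ ^ 2 * c (p.1 - p.2)) :=
    Integrable.convolution_integrand (ContinuousLinearMap.mul ℝ ℝ) ha2 hμ.norm
  have hG2eq : (fun p : ℝ × ℝ => ‖a p.1‖ ^ 2 * c (p.1 - p.2)) =
      (fun p : ℝ × ℝ => ‖a p.2‖ ^ 2 * c (p.1 - p.2)) ∘ Prod.swap := by
    ext p
    simp only [Function.comp, Prod.fst_swap, Prod.snd_swap]
    rw [← hceven, neg_sub]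
  have hG2 : Integrable (fun p : ℝ × ℝ => ‖a p.1‖ ^ 2 * c (p.1 - p.2)) := by
    rw [hG2eq]; exact hG1.swap
  have hI1 : ∫ p : ℝ × ℝ, ‖a p.2‖ ^ 2 * c (p.1 - p.2) = (∫ x, c x) * ∫ x, ‖a x‖ ^ 2 := by
    have := integral_convolution (ContinuousLinearMap.mul ℝ ℝ) ha2 hμ.norm
    have e : ∫ p : ℝ × ℝ, ‖a p.2‖ ^ 2 * c (p.1 - p.2) =
      ∫ x, ∫ y, ‖a y‖ ^ 2 * c (x - y) := integral_prod _ hG1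
    rw [e, mul_comm]
    simpa [convolution_def] using this
  have hI2 : ∫ p : ℝ × ℝ, ‖a p.1‖ ^ 2 * c (p.1 - p.2) = (∫ x, c x) * ∫ x, ‖a x‖ ^ 2 := by
    rw [← hI1, hG2eq]
    exact integral_prod_swap (μ := volume) (ν := volume) (fun p : ℝ × ℝ => ‖a p.2‖ ^ 2 * c (p.1 - p.2))
  calc ∫ z, ‖F z‖ ^ 2 ∂μ = ‖((∫ z, ‖F z‖ ^ 2 ∂μ : ℝ) : ℂ)‖ := by
        rw [Complex.norm_real, Real.norm_of_nonneg (integral_nonneg fun z => by positivity)]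
    _ ≤ ∫ p : ℝ × ℝ, ((1 / 2) * (‖a p.1‖ ^ 2 * c (p.1 - p.2)) +
          (1 / 2) * (‖a p.2‖ ^ 2 * c (p.1 - p.2))) := by
        rw [hswap]
        refine norm_integral_le_of_norm_le ((hG2.const_mul _).add (hG1.const_mul _)) ?_
        refine ae_of_all _ fun p => ?_
        rw [norm_mul, norm_mul, RCLike.norm_conj]
        have : ‖a p.1‖ * ‖a p.2‖ ≤ (1 / 2) * (‖a p.1‖ ^ 2 + ‖a p.2‖ ^ 2) := by
          nlinarith [sq_nonneg (‖a p.1‖ - ‖a p.2‖)]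
        have := mul_le_mul_of_nonneg_right this (norm_nonneg (charFun μ (p.1 - p.2)))
        simp only [hc]
        linarith
    _ = _ := by
        rw [integral_add (hG2.const_mul _) (hG1.const_mul _), integral_const_mul,
          integral_const_mul, hI1, hI2]
        ring

/-- Half of Plancherel's theorem, for functions in `L¹ ∩ L²`. -/
theorem lintegral_norm_sq_fourier_le_volume {a : ℝ → ℂ} (ha : Integrable a)
    (ha2 : Integrable fun x => ‖a x‖ ^ 2) :
    ∫⁻ z : ℝ, ENNReal.ofReal (‖∫ x : ℝ, a x * Complex.exp (Complex.I * x * z)‖ ^ 2) ≤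
      ENNReal.ofReal (2 * Real.pi * ∫ x, ‖a x‖ ^ 2) := by
  set G : ℝ → ENNReal := fun z =>
    ENNReal.ofReal (‖∫ x : ℝ, a x * Complex.exp (Complex.I * x * z)‖ ^ 2) with hGdef
  have hGm : Measurable G := by
    have hFc : Continuous fun z : ℝ => ∫ x : ℝ, a x * Complex.exp (Complex.I * x * z) := by
      refine continuous_of_dominated (bound := fun x => ‖a x‖) ?_ ?_ ha.norm ?_
      · intro z
        exact ha.aestronglyMeasurable.mul (by fun_prop)
      · intro z
        refine ae_of_all _ fun x => ?_
        rw [norm_mul, norm_cexp_I_mul, mul_one]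
      · exact ae_of_all _ fun x => by fun_prop
    exact (by fun_prop : Continuous fun z : ℝ =>
      ‖∫ x : ℝ, a x * Complex.exp (Complex.I * x * z)‖ ^ 2).measurable.ennreal_ofReal
  -- Gaussian regularisation
  have key : ∀ k : ℕ, ∫⁻ z, ENNReal.ofReal (Real.exp (-z ^ 2 / (2 * (k + 1 : ℝ)))) * G z ≤
      ENNReal.ofReal (2 * Real.pi * ∫ x, ‖a x‖ ^ 2) := by
    intro k
    set v : NNReal := (k + 1 : NNReal) with hv
    have hv0 : v ≠ 0 := by positivity
    have hvr : (v : ℝ) = k + 1 := by simp [hv]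
    have hvpos : (0 : ℝ) < v := by rw [hvr]; positivity
    have hcf : ∀ t : ℝ, ‖charFun (ProbabilityTheory.gaussianReal 0 v) t‖ =
        Real.exp (-(v / 2) * t ^ 2) := by
      intro t
      rw [ProbabilityTheory.charFun_gaussianReal, Complex.norm_exp]
      congr 1
      have : (t * (0 : ℝ) * Complex.I - v * t ^ 2 / 2 : ℂ) = ((-(v / 2) * t ^ 2 : ℝ) : ℂ) := by
        push_cast; ring
      rw [this, Complex.ofReal_re]
    have hcfi : Integrable (charFun (ProbabilityTheory.gaussianReal 0 v)) := by
      rw [← integrable_norm_iff continuous_charFun.aestronglyMeasurable]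
      simp_rw [hcf]
      exact integrable_exp_neg_mul_sq (by positivity)
    have h := lintegral_norm_sq_fourier_le (ProbabilityTheory.gaussianReal 0 v) hcfi ha ha2
    simp_rw [hcf] at h
    rw [integral_gaussian, ProbabilityTheory.gaussianReal_of_var_ne_zero _ hv0,
      lintegral_withDensity_eq_lintegral_mul _ (ProbabilityTheory.measurable_gaussianPDF _ _)
      (by exact hGm)] at h
    have hs : 0 < Real.sqrt (2 * Real.pi * v) := Real.sqrt_pos.2 (by positivity)
    have e1 : ∫⁻ z, ENNReal.ofReal (Real.exp (-z ^ 2 / (2 * (k + 1 : ℝ)))) * G z =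
        ENNReal.ofReal (Real.sqrt (2 * Real.pi * v)) *
          ∫⁻ z, (ProbabilityTheory.gaussianPDF 0 v * G) z := by
      rw [← lintegral_const_mul _ ((ProbabilityTheory.measurable_gaussianPDF _ _).mul hGm)]
      refine lintegral_congr fun z => ?_
      rw [Pi.mul_apply, ← mul_assoc, ProbabilityTheory.gaussianPDF,
        ← ENNReal.ofReal_mul hs.le, ProbabilityTheory.gaussianPDFReal, ← mul_assoc,
        mul_inv_cancel₀ hs.ne', one_mul, hvr, sub_zero]
    rw [e1]
    refine (mul_le_mul_right h _).trans (le_of_eq ?_)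
    rw [← ENNReal.ofReal_mul hs.le]
    congr 1
    rw [← mul_assoc, ← Real.sqrt_mul (by positivity)]
    -- The normalisation `√(2πv)` of the Gaussian density times the integral `√(2π/v)` of its
    -- characteristic function is `2π` for every `v`. The bound is therefore uniform in `k`, and
    -- Fatou's lemma removes the Gaussian factor.
    have : 2 * Real.pi * v * (Real.pi / (v / 2)) = (2 * Real.pi) ^ 2 := by
      field_simp
    rw [this, Real.sqrt_sq (by positivity)]
  have hlim : ∀ z, Tendsto (fun k : ℕ => ENNReal.ofReal (Real.exp (-z ^ 2 / (2 * (k + 1 : ℝ)))) * G z)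
      atTop (nhds (G z)) := by
    intro z
    have h1 : Tendsto (fun k : ℕ => Real.exp (-z ^ 2 / (2 * (k + 1 : ℝ)))) atTop (nhds 1) := by
      rw [← Real.exp_zero]
      refine (Real.continuous_exp.tendsto 0).comp ?_
      refine Tendsto.div_atTop tendsto_const_nhds ?_
      exact Tendsto.const_mul_atTop (by norm_num)
        (tendsto_atTop_add_const_right _ _ tendsto_natCast_atTop_atTop)
    have h2 := ENNReal.Tendsto.mul_const (b := G z) (ENNReal.tendsto_ofReal h1)
      (Or.inr (by simp [hGdef]))
    simpa using h2
  calc ∫⁻ z, G z = ∫⁻ z, liminf (fun k : ℕ =>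
        ENNReal.ofReal (Real.exp (-z ^ 2 / (2 * (k + 1 : ℝ)))) * G z) atTop := by
        refine lintegral_congr fun z => ?_
        rw [(hlim z).liminf_eq]
    _ ≤ liminf (fun k : ℕ => ∫⁻ z,
        ENNReal.ofReal (Real.exp (-z ^ 2 / (2 * (k + 1 : ℝ)))) * G z) atTop :=
        lintegral_liminf_le fun k => by fun_prop
    _ ≤ _ := by
        refine liminf_le_of_le (by isBoundedDefault) fun b hb => ?_
        obtain ⟨k, hk⟩ := hb.exists
        exact hk.trans (key k)

/-! ### The deconvolution kernel: size, second moment, bias -/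

/-- Fourier side of the deconvolution kernel with cutoff `M`. -/
def kernelFt (f : ℝ → ℝ) (x₀ M : ℝ) : ℝ → ℂ :=
  (Set.Icc (-M) M).indicator fun x => Complex.exp (-Complex.I * x * x₀) / ft f x

/-- The deconvolution kernel with cutoff `M` for estimation at `x₀`. -/
def kernelFn (f : ℝ → ℝ) (x₀ M z : ℝ) : ℝ :=
  (1 / (2 * Real.pi)) * (∫ x : ℝ, kernelFt f x₀ M x * Complex.exp (Complex.I * x * z)).re

/-- `∫_{-M}^{M} |f*|^{-2}`. -/
def invSqInt (f : ℝ → ℝ) (M : ℝ) : ℝ := ∫ x in Set.Icc (-M) M, (‖ft f x‖ ^ 2)⁻¹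

/-- `∫_{|x|>M} |g*|`. -/
def tailInt (g : ℝ → ℝ) (M : ℝ) : ℝ := ∫ x in (Set.Icc (-M) M)ᶜ, ‖ft g x‖

section
variable {f : ℝ → ℝ} (hf : IsDensity f) (hne : ∀ x, ft f x ≠ 0) (x₀ M : ℝ)

include hf hne in
theorem continuous_inv_ft : Continuous fun x : ℝ => Complex.exp (-Complex.I * x * x₀) / ft f x :=
  (by fun_prop : Continuous fun x : ℝ => Complex.exp (-Complex.I * x * x₀)).div
    (continuous_ft hf.integrable) hne

include hf hne in
theorem integrable_kernelFt : Integrable (kernelFt f x₀ M) := by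
  rw [kernelFt, integrable_indicator_iff measurableSet_Icc]
  exact (continuous_inv_ft hf hne x₀).integrableOn_Icc

theorem norm_kernelFt_sq : (fun x => ‖kernelFt f x₀ M x‖ ^ 2) =
    (Set.Icc (-M) M).indicator fun x => (‖ft f x‖ ^ 2)⁻¹ := by
  ext x
  by_cases hx : x ∈ Set.Icc (-M) M
  · simp only [kernelFt, Set.indicator_of_mem hx, norm_div, norm_cexp_neg_I_mul]
    simp
  · simp only [kernelFt, Set.indicator_of_notMem hx]
    simp

include hf hne in
theorem continuous_inv_sq_ft : Continuous fun x : ℝ => (‖ft f x‖ ^ 2)⁻¹ :=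
  Continuous.inv₀ (by have := continuous_ft hf.integrable; fun_prop)
    fun x => by have := hne x; positivity

include hf hne in
theorem integrable_kernelFt_sq : Integrable fun x => ‖kernelFt f x₀ M x‖ ^ 2 := by
  rw [norm_kernelFt_sq, integrable_indicator_iff measurableSet_Icc]
  exact (continuous_inv_sq_ft hf hne).integrableOn_Icc

theorem integral_kernelFt_sq : ∫ x, ‖kernelFt f x₀ M x‖ ^ 2 = invSqInt f M := by
  rw [norm_kernelFt_sq, integral_indicator measurableSet_Icc, invSqInt]

include hf hne in
theorem continuous_kernelFn : Continuous (kernelFn f x₀ M) := by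
  refine continuous_const.mul (Complex.continuous_re.comp ?_)
  have ha := integrable_kernelFt hf hne x₀ M
  refine continuous_of_dominated (bound := fun x => ‖kernelFt f x₀ M x‖) ?_ ?_ ha.norm ?_
  · intro z
    exact ha.aestronglyMeasurable.mul (by fun_prop)
  · intro z
    refine ae_of_all _ fun x => ?_
    rw [norm_mul, norm_cexp_I_mul, mul_one]
  · exact ae_of_all _ fun x => by fun_prop

theorem abs_kernelFn_le_norm (z : ℝ) : |kernelFn f x₀ M z| ≤
    (1 / (2 * Real.pi)) * ‖∫ x : ℝ, kernelFt f x₀ M x * Complex.exp (Complex.I * x * z)‖ := by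
  rw [kernelFn, abs_mul, abs_of_pos (by positivity)]
  gcongr
  exact Complex.abs_re_le_norm _

theorem invSqInt_nonneg : 0 ≤ invSqInt f M := integral_nonneg fun x => by positivity

include hf hne in
-- Cauchy-Schwarz on an interval of length `2M`: the kernel is bounded by the `L¹` norm of its
-- Fourier side, whose square is at most `2M` times the squared `L²` norm. The sup norm enters the
-- deviation bound only through this.
theorem kernelFn_sq_le (hM : 0 < M) (z : ℝ) :
    (kernelFn f x₀ M z) ^ 2 ≤ (1 / (2 * Real.pi)) ^ 2 * (2 * M * invSqInt f M) := by
  set A := ∫ x, ‖kernelFt f x₀ M x‖ with hA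
  have h1 : |kernelFn f x₀ M z| ≤ (1 / (2 * Real.pi)) * A := by
    refine (abs_kernelFn_le_norm x₀ M z).trans ?_
    gcongr
    refine (norm_integral_le_integral_norm _).trans (le_of_eq ?_)
    refine integral_congr_ae (ae_of_all _ fun x => ?_)
    simp only [norm_mul, norm_cexp_I_mul, mul_one]
  have hcs : A ^ 2 ≤ 2 * M * invSqInt f M := by
    have hi1 := (integrable_kernelFt hf hne x₀ M).norm
    have hi2 := integrable_kernelFt_sq hf hne x₀ M
    -- `t` is the mean of `|kernelFt|` over `[-M, M]`; Cauchy-Schwarz is read off from the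
    -- nonnegativity of the integrated squared distance to the mean.
    set t := A / (2 * M) with ht
    have hnn : 0 ≤ ∫ x in Set.Icc (-M) M, (‖kernelFt f x₀ M x‖ - t) ^ 2 :=
      integral_nonneg fun x => by positivity
    have e : ∫ x in Set.Icc (-M) M, (‖kernelFt f x₀ M x‖ - t) ^ 2 =
        (∫ x in Set.Icc (-M) M, ‖kernelFt f x₀ M x‖ ^ 2) -
        2 * t * (∫ x in Set.Icc (-M) M, ‖kernelFt f x₀ M x‖) + 2 * M * t ^ 2 := by
      have : ∀ x, (‖kernelFt f x₀ M x‖ - t) ^ 2 =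
        ‖kernelFt f x₀ M x‖ ^ 2 - 2 * t * ‖kernelFt f x₀ M x‖ + t ^ 2 := fun x => by ring
      simp_rw [this]
      have i1 : IntegrableOn (fun x => 2 * t * ‖kernelFt f x₀ M x‖) (Set.Icc (-M) M) :=
        (hi1.const_mul _).integrableOn
      have i2 : IntegrableOn (fun x => ‖kernelFt f x₀ M x‖ ^ 2 - 2 * t * ‖kernelFt f x₀ M x‖)
        (Set.Icc (-M) M) := hi2.integrableOn.sub i1
      rw [integral_add i2 (integrable_const _), integral_sub hi2.integrableOn i1,
        integral_const_mul]
      congr 1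
      simp only [integral_const, smul_eq_mul, measureReal_restrict_apply_univ]
      rw [Real.volume_real_Icc_of_le (by linarith)]
      ring
    have e1 : ∫ x in Set.Icc (-M) M, ‖kernelFt f x₀ M x‖ = A := by
      rw [hA]
      refine setIntegral_eq_integral_of_forall_compl_eq_zero fun x hx => ?_
      simp [kernelFt, Set.indicator_of_notMem hx]
    have e2 : ∫ x in Set.Icc (-M) M, ‖kernelFt f x₀ M x‖ ^ 2 = invSqInt f M := by
      rw [← integral_kernelFt_sq x₀ M]
      refine setIntegral_eq_integral_of_forall_compl_eq_zero fun x hx => ?_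
      simp [kernelFt, Set.indicator_of_notMem hx]
    rw [e, e1, e2] at hnn
    have : A = 2 * M * t := by rw [ht]; field_simp
    rw [this] at hnn ⊢
    nlinarith
  calc (kernelFn f x₀ M z) ^ 2 = |kernelFn f x₀ M z| ^ 2 := (sq_abs _).symm
    _ ≤ ((1 / (2 * Real.pi)) * A) ^ 2 := pow_le_pow_left₀ (abs_nonneg _) h1 2
    _ = (1 / (2 * Real.pi)) ^ 2 * A ^ 2 := by ring
    _ ≤ _ := by gcongr

include hf hne in
-- The observations have characteristic function `g* f*`, dominated by `|f*|` because `|g*| ≤ 1`.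
-- Schur's test thus gives a bound free of `g`.
theorem integral_kernelFn_sq_le (hfi : Integrable (ft f)) {g : ℝ → ℝ} (hg : IsDensity g) :
    ∫ z, (kernelFn f x₀ M z) ^ 2 ∂((law g).conv (law f)) ≤
      (1 / (2 * Real.pi)) ^ 2 * ((∫ x, ‖ft f x‖) * invSqInt f M) := by
  have := hg.isProbabilityMeasure
  have := hf.isProbabilityMeasure
  have hle : ∀ x, ‖charFun ((law g).conv (law f)) x‖ ≤ ‖ft f x‖ := by
    intro x
    rw [charFun_law_conv hg hf, norm_mul]
    exact mul_le_of_le_one_left (norm_nonneg _) (hg.norm_ft_le_one x)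
  have hci : Integrable (charFun ((law g).conv (law f))) :=
    hfi.mono continuous_charFun.aestronglyMeasurable (ae_of_all _ hle)
  have h := lintegral_norm_sq_fourier_le ((law g).conv (law f)) hci
    (integrable_kernelFt hf hne x₀ M) (integrable_kernelFt_sq hf hne x₀ M)
  rw [integral_kernelFt_sq] at h
  have hm : AEStronglyMeasurable (fun z => (kernelFn f x₀ M z) ^ 2) ((law g).conv (law f)) :=
    ((continuous_kernelFn hf hne x₀ M).pow 2).aestronglyMeasurable
  rw [integral_eq_lintegral_of_nonneg_ae (ae_of_all _ fun z => by positivity) hm]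
  refine ENNReal.toReal_le_of_le_ofReal ?_ ?_
  · have := invSqInt_nonneg (f := f) M
    have : 0 ≤ ∫ x, ‖ft f x‖ := integral_nonneg fun x => norm_nonneg _
    positivity
  calc ∫⁻ z, ENNReal.ofReal ((kernelFn f x₀ M z) ^ 2) ∂((law g).conv (law f))
      ≤ ∫⁻ z, ENNReal.ofReal ((1 / (2 * Real.pi)) ^ 2) * ENNReal.ofReal
        (‖∫ x : ℝ, kernelFt f x₀ M x * Complex.exp (Complex.I * x * z)‖ ^ 2)
          ∂((law g).conv (law f)) := by
        refine lintegral_mono fun z => ?_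
        rw [← ENNReal.ofReal_mul (by positivity), ← mul_pow, ← sq_abs (kernelFn f x₀ M z)]
        exact ENNReal.ofReal_le_ofReal
          (pow_le_pow_left₀ (abs_nonneg _) (abs_kernelFn_le_norm x₀ M z) 2)
    _ = ENNReal.ofReal ((1 / (2 * Real.pi)) ^ 2) * ∫⁻ z, ENNReal.ofReal
        (‖∫ x : ℝ, kernelFt f x₀ M x * Complex.exp (Complex.I * x * z)‖ ^ 2)
          ∂((law g).conv (law f)) := lintegral_const_mul' _ _ ENNReal.ofReal_ne_top
    _ ≤ _ := by
        rw [ENNReal.ofReal_mul (by positivity)]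
        refine mul_le_mul_right (h.trans (ENNReal.ofReal_le_ofReal ?_)) _
        refine mul_le_mul_of_nonneg_right ?_ (invSqInt_nonneg M)
        exact integral_mono hci.norm hfi.norm hle

include hf hne in
-- The factor `f*` that the noise contributes to the characteristic function of an observation
-- cancels the denominator of the kernel, leaving the truncated inversion integral of `g*`.
theorem integral_kernelFn {g : ℝ → ℝ} (hg : IsDensity g) :
    ∫ z, kernelFn f x₀ M z ∂((law g).conv (law f)) =
      (1 / (2 * Real.pi)) *
        (∫ x in Set.Icc (-M) M, Complex.exp (-Complex.I * x * x₀) * ft g x).re := by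
  have := hg.isProbabilityMeasure
  have := hf.isProbabilityMeasure
  set μ := (law g).conv (law f) with hμ
  have ha := integrable_kernelFt hf hne x₀ M
  have hG : Integrable (fun q : ℝ × ℝ => kernelFt f x₀ M q.2 *
      Complex.exp (Complex.I * q.2 * q.1)) (μ.prod volume) := by
    have h1 : Integrable (fun q : ℝ × ℝ => (1 : ℂ) * kernelFt f x₀ M q.2)
        (μ.prod volume) := (integrable_const (1 : ℂ)).mul_prod ha
    refine h1.mono ?_ ?_
    · exact ha.aestronglyMeasurable.comp_snd.mul (Continuous.aestronglyMeasurable (by fun_prop))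
    · refine ae_of_all _ fun q => ?_
      rw [norm_mul, norm_cexp_I_mul, mul_one, one_mul]
  have hre : ∫ z, (∫ x : ℝ, kernelFt f x₀ M x * Complex.exp (Complex.I * x * z)).re ∂μ =
      (∫ z : ℝ, (∫ x : ℝ, kernelFt f x₀ M x * Complex.exp (Complex.I * x * z)) ∂μ).re :=
    integral_re (𝕜 := ℂ) hG.integral_prod_left
  simp only [kernelFn]
  rw [integral_const_mul, hre, integral_integral_swap hG]
  congr 2
  rw [← integral_indicator measurableSet_Icc]
  refine integral_congr_ae (ae_of_all _ fun x => ?_)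
  simp only
  rw [integral_const_mul]
  have : ∫ z, Complex.exp (Complex.I * x * z) ∂μ = ft g x * ft f x := by
    rw [← charFun_law_conv hg hf, charFun_apply_real]
    refine integral_congr_ae (ae_of_all _ fun z => ?_)
    simp only
    congr 1
    ring
  rw [this]
  by_cases hx : x ∈ Set.Icc (-M) M
  · simp only [kernelFt, Set.indicator_of_mem hx]
    field_simp [hne x]
  · simp only [kernelFt, Set.indicator_of_notMem hx, zero_mul]

include hf hne in
theorem abs_integral_kernelFn_sub_le {g : ℝ → ℝ} (hg : IsDensity g) (hgc : Continuous g)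
    (hgi : Integrable (ft g)) :
    |∫ z, kernelFn f x₀ M z ∂((law g).conv (law f)) - g x₀| ≤
      (1 / (2 * Real.pi)) * tailInt g M := by
  rw [integral_kernelFn hf hne x₀ M hg]
  have hinv := ft_inversion hgc hg.integrable hgi x₀
  set F : ℝ → ℂ := fun x => Complex.exp (-Complex.I * x * x₀) * ft g x with hF
  have hFi : Integrable F := by
    refine hgi.mono ?_ (ae_of_all _ fun x => ?_)
    · exact (Continuous.aestronglyMeasurable (by fun_prop)).mul hgi.aestronglyMeasurable
    · rw [hF, norm_mul, norm_cexp_neg_I_mul, one_mul]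
  have hg0 : g x₀ = (1 / (2 * Real.pi)) * (∫ x, F x).re := by
    have := congrArg Complex.re hinv
    rw [Complex.ofReal_re] at this
    rw [this]
    have e : (1 / (2 * Real.pi) : ℂ) = ((1 / (2 * Real.pi) : ℝ) : ℂ) := by push_cast; ring
    rw [e, Complex.re_ofReal_mul]
  have hsplit := integral_add_compl (measurableSet_Icc (a := -M) (b := M)) hFi
  rw [hg0, ← hsplit, Complex.add_re]
  have e : (1 / (2 * Real.pi)) * (∫ x in Set.Icc (-M) M, F x).re - (1 / (2 * Real.pi)) *
      ((∫ x in Set.Icc (-M) M, F x).re + (∫ x in (Set.Icc (-M) M)ᶜ, F x).re) =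
      -((1 / (2 * Real.pi)) * (∫ x in (Set.Icc (-M) M)ᶜ, F x).re) := by ring
  rw [e, abs_neg, abs_mul, abs_of_pos (by positivity)]
  gcongr
  refine (Complex.abs_re_le_norm _).trans ((norm_integral_le_integral_norm _).trans (le_of_eq ?_))
  rw [tailInt]
  refine integral_congr_ae (ae_of_all _ fun x => ?_)
  simp only [hF, norm_mul, norm_cexp_neg_I_mul, one_mul]

end

/-! ### Deviations of an empirical mean -/

theorem exp_le_one_add_add_sq {y : ℝ} (hy : |y| ≤ 1) : Real.exp y ≤ 1 + y + y ^ 2 := by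
  have := Real.abs_exp_sub_one_sub_id_le hy
  have := abs_le.1 this
  linarith [this.2]

/-- Empirical mean of `ψ` over the sample. -/
def empMean (ψ : ℝ → ℝ) (n : ℕ) (z : Fin n → ℝ) : ℝ := (∑ i, ψ (z i)) / n

theorem measurable_empMean {ψ : ℝ → ℝ} (hψ : Measurable ψ) (n : ℕ) :
    Measurable (empMean ψ n) := by
  unfold empMean
  fun_prop

/-- This converts exponential moments into a bound on the expected excess of `z²` over `q²` without
integrating tail probabilities. Where `u = |z| - q` is positive, the excess is `2qu + u²`, and both
`su` and `(su)²/2` are at most `e^{su}`. -/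
theorem sq_sub_sq_le_exp {s q z : ℝ} (hs : 0 < s) (hq : 0 < q) :
    z ^ 2 - q ^ 2 ≤ (2 * q / s + 2 / s ^ 2) * Real.exp (-(s * q)) *
      (Real.exp (s * z) + Real.exp (-s * z)) := by
  have habs : Real.exp (s * |z|) ≤ Real.exp (s * z) + Real.exp (-s * z) := by
    rcases abs_cases z with ⟨h, _⟩ | ⟨h, _⟩ <;> rw [h]
    · linarith [Real.exp_pos (-s * z)]
    · rw [mul_neg, ← neg_mul]; linarith [Real.exp_pos (s * z)]
  rcases le_or_gt (|z|) q with h | h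
  · have : z ^ 2 ≤ q ^ 2 := by rw [← sq_abs]; exact pow_le_pow_left₀ (abs_nonneg _) h 2
    have : 0 ≤ (2 * q / s + 2 / s ^ 2) * Real.exp (-(s * q)) *
      (Real.exp (s * z) + Real.exp (-s * z)) := by positivity
    linarith
  · set u := |z| - q with hu
    have hu0 : 0 < u := by linarith
    have hz : z ^ 2 - q ^ 2 = 2 * q * u + u ^ 2 := by rw [← sq_abs, hu]; ring
    have h1 : s * u ≤ Real.exp (s * u) := by linarith [Real.add_one_le_exp (s * u)]
    have h2 : (s * u) ^ 2 / 2 ≤ Real.exp (s * u) := by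
      have := Real.quadratic_le_exp_of_nonneg (by positivity : 0 ≤ s * u)
      nlinarith
    have h3 : 2 * q * u + u ^ 2 ≤ (2 * q / s + 2 / s ^ 2) * Real.exp (s * u) := by
      have e1 : 2 * q * u = 2 * q / s * (s * u) := by field_simp
      have e2 : u ^ 2 = 2 / s ^ 2 * ((s * u) ^ 2 / 2) := by field_simp
      rw [e1, e2, add_mul]
      gcongr
    have e : Real.exp (s * u) = Real.exp (-(s * q)) * Real.exp (s * |z|) := by
      rw [← Real.exp_add, hu]; ring_nf
    rw [hz]
    refine h3.trans ?_
    rw [e, ← mul_assoc]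
    gcongr

section
variable {μ : Measure ℝ} [IsProbabilityMeasure μ] {ψ : ℝ → ℝ} {S v : ℝ}

theorem integrable_of_sq_le (hψ : Measurable ψ) (hS : ∀ z, ψ z ^ 2 ≤ S) : Integrable ψ μ := by
  refine Integrable.of_bound (C := Real.sqrt S) hψ.aestronglyMeasurable (ae_of_all _ fun z => ?_)
  exact Real.abs_le_sqrt (hS z)

/-- The Bernstein mechanism: `|ψ - m| ≤ 2√S`, so `4t²S ≤ 1` keeps the exponent in `[-1, 1]`, where
`e^y ≤ 1 + y + y²`. The linear term has mean zero and the quadratic one is at most `t²` times the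
second moment. -/
theorem integral_exp_le (hψ : Measurable ψ) (hS : ∀ z, ψ z ^ 2 ≤ S) (hv : ∫ z, ψ z ^ 2 ∂μ ≤ v)
    {t : ℝ} (ht : 4 * t ^ 2 * S ≤ 1) :
    ∫ z, Real.exp (t * (ψ z - ∫ y, ψ y ∂μ)) ∂μ ≤ Real.exp (t ^ 2 * v) := by
  set m := ∫ y, ψ y ∂μ with hm
  have hi := integrable_of_sq_le (μ := μ) hψ hS
  have hi2 : Integrable (fun z => ψ z ^ 2) μ := by
    refine Integrable.of_bound (C := S) (by fun_prop) (ae_of_all _ fun z => ?_)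
    rw [Real.norm_of_nonneg (by positivity)]; exact hS z
  have hS0 : 0 ≤ S := (sq_nonneg _).trans (hS 0)
  have hmS : m ^ 2 ≤ S := by
    have : |m| ≤ Real.sqrt S := by
      have := norm_integral_le_of_norm_le_const (μ := μ) (f := ψ) (C := Real.sqrt S)
        (ae_of_all _ fun z => Real.abs_le_sqrt (hS z))
      simpa using this
    calc m ^ 2 = |m| ^ 2 := (sq_abs m).symm
      _ ≤ Real.sqrt S ^ 2 := pow_le_pow_left₀ (abs_nonneg _) this 2
      _ = S := Real.sq_sqrt hS0
  have hbd : ∀ z, |t * (ψ z - m)| ≤ 1 := by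
    intro z
    rw [← sq_le_one_iff_abs_le_one]
    have : (ψ z - m) ^ 2 ≤ 4 * S := by nlinarith [hS z, sq_nonneg (ψ z + m)]
    nlinarith [sq_nonneg t, mul_le_mul_of_nonneg_left this (sq_nonneg t)]
  have iA : Integrable (fun z => t * (ψ z - m)) μ := (hi.sub (integrable_const _)).const_mul _
  have iB : Integrable (fun z => (t * (ψ z - m)) ^ 2) μ := by
    refine Integrable.of_bound (C := 1) (by fun_prop) (ae_of_all _ fun z => ?_)
    rw [Real.norm_of_nonneg (by positivity), sq_le_one_iff_abs_le_one]
    exact hbd z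
  have iA' : Integrable (fun z => 1 + t * (ψ z - m)) μ := (integrable_const _).add iA
  calc ∫ z, Real.exp (t * (ψ z - m)) ∂μ
      ≤ ∫ z, (1 + t * (ψ z - m) + (t * (ψ z - m)) ^ 2) ∂μ := by
        refine integral_mono_of_nonneg (ae_of_all _ fun z => (Real.exp_pos _).le)
          (iA'.add iB) (ae_of_all _ fun z => exp_le_one_add_add_sq (hbd z))
    _ = 1 + t ^ 2 * (∫ z, ψ z ^ 2 ∂μ - m ^ 2) := by
        rw [integral_add iA' iB, integral_add (integrable_const _) iA, integral_const_mul,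
          integral_sub hi (integrable_const _)]
        have : ∀ z, (t * (ψ z - m)) ^ 2 = t ^ 2 * (ψ z ^ 2 - 2 * m * ψ z + m ^ 2) :=
          fun z => by ring
        simp_rw [this]
        have i1 : Integrable (fun z => 2 * m * ψ z) μ := hi.const_mul _
        have i2 : Integrable (fun z => ψ z ^ 2 - 2 * m * ψ z) μ := hi2.sub i1
        rw [integral_const_mul, integral_add i2 (integrable_const _), integral_sub hi2 i1,
          integral_const_mul, ← hm]
        simp only [integral_const, probReal_univ, one_smul]
        ring
    _ ≤ 1 + t ^ 2 * v := by nlinarith [sq_nonneg t, sq_nonneg m, mul_nonneg (sq_nonneg t) (sq_nonneg m), mul_le_mul_of_nonneg_left hv (sq_nonneg t)]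
    _ ≤ _ := by linarith [Real.add_one_le_exp (t ^ 2 * v)]

theorem exp_empMean_eq (n : ℕ) (hn : 0 < n) (m s : ℝ) (z : Fin n → ℝ) :
    Real.exp (s * (empMean ψ n z - m)) = ∏ i, Real.exp (s / n * (ψ (z i) - m)) := by
  rw [← Real.exp_sum, ← Finset.mul_sum, Finset.sum_sub_distrib, empMean]
  congr 1
  have : (n : ℝ) ≠ 0 := by positivity
  simp
  field_simp

theorem integral_exp_empMean_le (hψ : Measurable ψ) (hS : ∀ z, ψ z ^ 2 ≤ S)
    (hv : ∫ z, ψ z ^ 2 ∂μ ≤ v) {n : ℕ} (hn : 0 < n) {s : ℝ} (hs : 4 * s ^ 2 * S ≤ n ^ 2) :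
    Integrable (fun z => Real.exp (s * (empMean ψ n z - ∫ y, ψ y ∂μ))) (Measure.pi fun _ => μ) ∧
    ∫ z, Real.exp (s * (empMean ψ n z - ∫ y, ψ y ∂μ)) ∂(Measure.pi fun _ => μ) ≤
      Real.exp (s ^ 2 * v / n) := by
  have hn' : (0 : ℝ) < n := by exact_mod_cast hn
  set m := ∫ y, ψ y ∂μ with hm
  have ht : 4 * (s / n) ^ 2 * S ≤ 1 := by
    have : 4 * (s / n) ^ 2 * S = 4 * s ^ 2 * S / n ^ 2 := by field_simp
    rw [this, div_le_one (by positivity)]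
    exact hs
  have h := integral_exp_le hψ hS hv ht
  rw [← hm] at h
  simp_rw [exp_empMean_eq n hn]
  constructor
  · refine Integrable.fintype_prod (f := fun _ : Fin n => fun y => Real.exp (s / n * (ψ y - m))) fun i => ?_
    refine Integrable.of_bound (C := Real.exp (|s / n| * (Real.sqrt S + |m|))) (by fun_prop)
      (ae_of_all _ fun z => ?_)
    rw [Real.norm_of_nonneg (Real.exp_pos _).le, Real.exp_le_exp]
    refine (le_abs_self _).trans ?_
    rw [abs_mul]
    gcongr
    refine (abs_sub _ _).trans ?_
    gcongr
    exact Real.abs_le_sqrt (hS z)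
  · rw [integral_fintype_prod_eq_pow (fun y => Real.exp (s / n * (ψ y - m))), Fintype.card_fin]
    calc _ ≤ Real.exp ((s / n) ^ 2 * v) ^ n :=
        pow_le_pow_left₀ (integral_nonneg fun z => (Real.exp_pos _).le) h n
      _ = _ := by
        rw [← Real.exp_nat_mul]
        congr 1
        field_simp

/-- Deviation bound for the empirical mean of a bounded function. -/
theorem lintegral_sq_sub_le (hψ : Measurable ψ) (hS : ∀ z, ψ z ^ 2 ≤ S)
    (hv : ∫ z, ψ z ^ 2 ∂μ ≤ v) (hv0 : 0 < v) {n : ℕ} (hn : 0 < n) {x : ℝ} (hx : 1 ≤ x)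
    (hxS : 4 * x * S ≤ n * v) :
    ∫⁻ z, ENNReal.ofReal ((empMean ψ n z - ∫ y, ψ y ∂μ) ^ 2 - 4 * x * v / n)
      ∂(Measure.pi fun _ => μ) ≤ ENNReal.ofReal (12 * (v / n) * Real.exp (-x)) := by
  have hn' : (0 : ℝ) < n := by exact_mod_cast hn
  have hx0 : 0 < x := by linarith
  set m := ∫ y, ψ y ∂μ with hm
  -- With this `s` the exponential moment bound is `e^x`, while `q² = 4xv/n` is the target level and
  -- `sq = 2x`. The threshold contributes `e^{-2x}`, so a net factor `e^{-x}` survives.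
  set s := Real.sqrt (n * x / v) with hs
  set q := 2 * v / n * s with hq
  have hs0 : 0 < s := Real.sqrt_pos.2 (by positivity)
  have hq0 : 0 < q := by positivity
  have hs2 : s ^ 2 = n * x / v := Real.sq_sqrt (by positivity)
  have hq2 : q ^ 2 = 4 * x * v / n := by
    rw [hq, mul_pow, hs2]; field_simp; ring
  have hsq : s * q = 2 * x := by
    have : s * q = 2 * v / n * s ^ 2 := by rw [hq]; ring
    rw [this, hs2]; field_simp
  have hc : 2 * q / s + 2 / s ^ 2 ≤ 6 * (v / n) := by
    have e1 : 2 * q / s = 4 * (v / n) := by rw [hq]; field_simp; ring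
    have e2 : 2 / s ^ 2 = 2 * (v / n) / x := by rw [hs2]; field_simp
    rw [e1, e2]
    have : 2 * (v / n) / x ≤ 2 * (v / n) := div_le_self (by positivity) hx
    linarith
  have hcond : 4 * s ^ 2 * S ≤ n ^ 2 := by
    rw [hs2]
    have : 4 * (n * x / v) * S = n / v * (4 * x * S) := by field_simp
    rw [this]
    calc (n / v : ℝ) * (4 * x * S) ≤ n / v * (n * v) := by gcongr
      _ = n ^ 2 := by field_simp
  obtain ⟨i1, h1⟩ := integral_exp_empMean_le hψ hS hv hn hcond
  obtain ⟨i2, h2⟩ := integral_exp_empMean_le hψ hS hv hn (s := -s) (by rw [neg_sq]; exact hcond)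
  rw [neg_sq] at h2
  have hsv : s ^ 2 * v / n = x := by rw [hs2]; field_simp
  rw [hsv] at h1 h2
  rw [← hm] at h1 h2 i1 i2
  calc ∫⁻ z, ENNReal.ofReal ((empMean ψ n z - m) ^ 2 - 4 * x * v / n) ∂(Measure.pi fun _ => μ)
      ≤ ∫⁻ z, ENNReal.ofReal ((2 * q / s + 2 / s ^ 2) * Real.exp (-(s * q)) *
        (Real.exp (s * (empMean ψ n z - m)) + Real.exp (-s * (empMean ψ n z - m))))
          ∂(Measure.pi fun _ => μ) := by
        refine lintegral_mono fun z => ENNReal.ofReal_le_ofReal ?_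
        rw [← hq2]
        exact sq_sub_sq_le_exp hs0 hq0
    _ = ENNReal.ofReal (∫ z, (2 * q / s + 2 / s ^ 2) * Real.exp (-(s * q)) *
        (Real.exp (s * (empMean ψ n z - m)) + Real.exp (-s * (empMean ψ n z - m)))
          ∂(Measure.pi fun _ => μ)) := by
        have i3 : Integrable (fun z => (2 * q / s + 2 / s ^ 2) * Real.exp (-(s * q)) *
          (Real.exp (s * (empMean ψ n z - m)) + Real.exp (-s * (empMean ψ n z - m))))
            (Measure.pi fun _ => μ) := (i1.add i2).const_mul _
        rw [ofReal_integral_eq_lintegral_ofReal i3 (ae_of_all _ fun z => by positivity)]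
    _ ≤ _ := by
        refine ENNReal.ofReal_le_ofReal ?_
        rw [integral_const_mul, integral_add i1 i2, hsq]
        calc _ ≤ 6 * (v / n) * Real.exp (-(2 * x)) * (Real.exp x + Real.exp x) := by gcongr
          _ = 12 * (v / n) * (Real.exp (-(2 * x)) * Real.exp x) := by ring
          _ = _ := by rw [← Real.exp_add]; ring_nf

end

/-! ### Selection among estimators by pairwise comparison -/

/-- Minimal value of `c` on `{0, …, N}`, and the value of `e` at a minimiser. -/
def minSel (c e : ℕ → ℝ) : ℕ → ℝ × ℝ
  | 0 => (c 0, e 0)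
  | k + 1 => if c (k + 1) < (minSel c e k).1 then (c (k + 1), e (k + 1)) else minSel c e k

theorem minSel_spec (c e : ℕ → ℝ) (N : ℕ) :
    ∃ i ≤ N, minSel c e N = (c i, e i) ∧ ∀ j ≤ N, c i ≤ c j := by
  induction N with
  | zero => exact ⟨0, le_rfl, rfl, fun j hj => by rw [Nat.le_zero.1 hj]⟩
  | succ k ih =>
    obtain ⟨i, hi, he, hmin⟩ := ih
    by_cases h : c (k + 1) < (minSel c e k).1
    · refine ⟨k + 1, le_rfl, by simp [minSel, h], fun j hj => ?_⟩
      rw [he] at h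
      rcases Nat.le_succ_iff.1 hj with hj | rfl
      · exact h.le.trans (hmin j hj)
      · exact le_rfl
    · refine ⟨i, by omega, by rw [minSel, if_neg h, he], fun j hj => ?_⟩
      rw [he, not_lt] at h
      rcases Nat.le_succ_iff.1 hj with hj | rfl
      · exact hmin j hj
      · exact h

/-- Scanning the indices one by one replaces an abstract argmin: each stage is a case distinction on
a measurable set, so the value at the selected index is measurable in the data. -/
theorem measurable_minSel {Ω : Type*} [MeasurableSpace Ω] {c e : ℕ → Ω → ℝ}
    (hc : ∀ k, Measurable (c k)) (he : ∀ k, Measurable (e k)) (N : ℕ) :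
    Measurable fun z => minSel (fun k => c k z) (fun k => e k z) N := by
  induction N with
  | zero => exact (hc 0).prodMk (he 0)
  | succ k ih =>
    simp only [minSel]
    exact Measurable.ite (measurableSet_lt (hc _) ih.fst) ((hc _).prodMk (he _)) ih

/-- Excess of the distance between two estimators over the penalty. -/
def lepskiExcess (p e : ℕ → ℝ) (j k : ℕ) : ℝ :=
  if j < k then max 0 ((e k - e j) ^ 2 - 6 * p k) else 0

/-- Largest excess over the indices up to `N`. -/
def lepskiSup (p e : ℕ → ℝ) (N j : ℕ) : ℝ :=
  (Finset.range (N + 1)).sup' Finset.nonempty_range_add_one (lepskiExcess p e j)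

/-- Selection criterion. -/
def lepskiCrit (p e : ℕ → ℝ) (N j : ℕ) : ℝ := lepskiSup p e N j + 6 * p j

/-- Adaptive choice among the estimators `e 0, …, e N` with penalties `p`. -/
def lepskiEst (p e : ℕ → ℝ) (N : ℕ) : ℝ := (minSel (lepskiCrit p e N) e N).2

theorem measurable_lepskiEst {Ω : Type*} [MeasurableSpace Ω] (p : ℕ → ℝ) {e : ℕ → Ω → ℝ}
    (he : ∀ k, Measurable (e k)) (N : ℕ) :
    Measurable fun z => lepskiEst p (fun k => e k z) N := by
  have hex : ∀ j k, Measurable fun z => lepskiExcess p (fun k => e k z) j k := by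
    intro j k
    unfold lepskiExcess
    by_cases h : j < k
    · simp only [h, if_true]
      have := he j
      have := he k
      fun_prop
    · simp only [h, if_false]
      exact measurable_const
  have hsup : ∀ j, Measurable fun z => lepskiSup p (fun k => e k z) N j := by
    intro j
    unfold lepskiSup
    have := Finset.measurable_sup' (s := Finset.range (N + 1)) Finset.nonempty_range_add_one
      (f := fun k z => lepskiExcess p (fun k => e k z) j k) (fun k _ => hex j k)
    convert this using 1
    ext z
    rw [Finset.sup'_apply]
  exact (measurable_minSel (c := fun j z => lepskiCrit p (fun k => e k z) N j)
    (fun j => (hsup j).add measurable_const) he N).snd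

theorem lepskiExcess_le_sup (p e : ℕ → ℝ) {N j k : ℕ} (hk : k ≤ N) :
    lepskiExcess p e j k ≤ lepskiSup p e N j :=
  Finset.le_sup' (lepskiExcess p e j) (Finset.mem_range.2 (by omega))

theorem lepskiSup_nonneg (p e : ℕ → ℝ) (N j : ℕ) : 0 ≤ lepskiSup p e N j := by
  refine le_trans ?_ (lepskiExcess_le_sup p e (Nat.zero_le N))
  unfold lepskiExcess
  split_ifs
  · exact le_max_left _ _
  · exact le_rfl

theorem sq_sub_le_lepskiSup (p e : ℕ → ℝ) {N j k : ℕ} (hk : k ≤ N) (hjk : j < k) :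
    (e k - e j) ^ 2 ≤ lepskiSup p e N j + 6 * p k := by
  have := lepskiExcess_le_sup p e (j := j) hk
  rw [lepskiExcess, if_pos hjk] at this
  linarith [le_max_right 0 ((e k - e j) ^ 2 - 6 * p k)]

/-- Oracle inequality for the adaptive choice, in terms of the deviations `e k - m k`. -/
theorem lepskiEst_sq_le {p e m β : ℕ → ℝ} {θ : ℝ} (hp : Monotone p) (hp0 : ∀ k, 0 ≤ p k)
    (hβ : Antitone β) (hm : ∀ k, |m k - θ| ≤ β k) {N j : ℕ} (hj : j ≤ N) :
    (lepskiEst p e N - θ) ^ 2 ≤ 52 * (β j ^ 2 + p j +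
      ∑ k ∈ Finset.range (N + 1), max 0 ((e k - m k) ^ 2 - p k)) := by
  set W := ∑ k ∈ Finset.range (N + 1), max 0 ((e k - m k) ^ 2 - p k) with hW
  have hWk : ∀ k ≤ N, (e k - m k) ^ 2 - p k ≤ W := fun k hk =>
    (le_max_right _ _).trans (Finset.single_le_sum
      (f := fun k => max 0 ((e k - m k) ^ 2 - p k)) (fun k _ => le_max_left _ _)
      (Finset.mem_range.2 (by omega)))
  have hW0 : 0 ≤ W := Finset.sum_nonneg fun k _ => le_max_left _ _
  obtain ⟨i, hi, hsel, hmin⟩ := minSel_spec (lepskiCrit p e N) e N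
  have hest : lepskiEst p e N = e i := by rw [lepskiEst, hsel]
  rw [hest]
  have hcj := hmin j hj
  unfold lepskiCrit at hcj
  have hAi := lepskiSup_nonneg p e N i
  have hpj := hp0 j
  have hβsq : ∀ k, (m k - θ) ^ 2 ≤ β k ^ 2 := fun k => by
    rw [← sq_abs]; exact pow_le_pow_left₀ (abs_nonneg _) (hm k) 2
  -- For `j < k`, `e k - e j` is the sum of two deviations and of `m k - m j`, whose square is at
  -- most `4 β_j²`. Splitting into three gives `6W + 3(p k + p j) + 12 β_j²`, and `p j ≤ p k` lets
  -- `6 p k` absorb the penalties.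
  have hA : lepskiSup p e N j ≤ 6 * W + 12 * β j ^ 2 := by
    refine Finset.sup'_le _ _ fun k hk => ?_
    have hk : k ≤ N := by have := Finset.mem_range.1 hk; omega
    unfold lepskiExcess
    split_ifs with hjk
    · refine max_le (by positivity) ?_
      have h1 := hWk k hk
      have h2 := hWk j hj
      have h3 := hp hjk.le
      have hβk : β k ^ 2 ≤ β j ^ 2 :=
        pow_le_pow_left₀ ((abs_nonneg _).trans (hm k)) (hβ hjk.le) 2
      have h4 : (m k - m j) ^ 2 ≤ 4 * β j ^ 2 := by
        nlinarith [hβsq k, hβsq j, sq_nonneg ((m k - θ) + (m j - θ))]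
      nlinarith [sq_nonneg ((e k - m k) + (e j - m j)), sq_nonneg ((e k - m k) - (m k - m j)),
        sq_nonneg ((e j - m j) + (m k - m j))]
    · positivity
  -- The comparison is always charged to the smaller of the two indices. If `i < j`, minimality
  -- bounds the supremum at `i` by the criterion at `j`; if `j < i`, it bounds the penalty `6 p i`
  -- by the same quantity.
  have hdist : (e i - e j) ^ 2 ≤ 2 * lepskiSup p e N j + 12 * p j := by
    have hAj := lepskiSup_nonneg p e N j
    rcases lt_trichotomy i j with h | h | h
    · have := sq_sub_le_lepskiSup p e hj h
      nlinarith [hp0 i]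
    · rw [h]; nlinarith
    · have := sq_sub_le_lepskiSup p e hi h
      linarith
  -- The error is at most `2(e i - e j)² + 4(e j - m j)² + 4(m j - θ)²`. The coefficient of `β_j²`
  -- is then `2·24 + 4 = 52`, which exceeds those of `p j` and `W`.
  have h1 := hWk j hj
  have h2 := hβsq j
  nlinarith [sq_nonneg ((e i - e j) - (e j - θ)), sq_nonneg ((e j - m j) - (m j - θ))]

/-! ### Oracle inequality for the selected deconvolution estimator -/

theorem tailInt_antitone {g : ℝ → ℝ} (hg : Integrable (ft g)) : Antitone (tailInt g) := by
  intro M M' h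
  refine setIntegral_mono_set hg.norm.integrableOn (ae_of_all _ fun _ => norm_nonneg _) ?_
  exact LE.le.eventuallyLE (Set.compl_subset_compl.2 (Set.Icc_subset_Icc (by linarith) h))

theorem tailInt_nonneg (g : ℝ → ℝ) (M : ℝ) : 0 ≤ tailInt g M :=
  integral_nonneg fun _ => norm_nonneg _

/-- Oracle inequality for the adaptive deconvolution estimator. -/
theorem exists_adaptive_estimator {f : ℝ → ℝ} (hf : IsDensity f) (hne : ∀ x, ft f x ≠ 0)
    (hfi : Integrable (ft f)) (x₀ : ℝ) {n : ℕ} (hn : 0 < n) (N : ℕ) {M v x : ℕ → ℝ}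
    (hM0 : ∀ k, 0 < M k) (hM : Monotone M) (hv0 : ∀ k, 0 < v k) (hv : Monotone v)
    (hx1 : ∀ k, 1 ≤ x k) (hx : Monotone x)
    (hvar : ∀ k, (∫ y, ‖ft f y‖) * invSqInt f (M k) ≤ v k)
    (hxM : ∀ k ≤ N, 8 * x k * M k ≤ n * ∫ y, ‖ft f y‖) :
    ∃ T : (Fin n → ℝ) → ℝ, Measurable T ∧ ∀ g : ℝ → ℝ, IsDensity g → Continuous g →
      Integrable (ft g) → ∀ j ≤ N, risk f x₀ n T g ≤ ENNReal.ofReal (624 *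
        (tailInt g (M j) ^ 2 + x j * v j / n +
          ∑ k ∈ Finset.range (N + 1), v k / n * Real.exp (-x k))) := by
  have hn' : (0 : ℝ) < n := by exact_mod_cast hn
  -- The penalty is exactly the level above which `lintegral_sq_sub_le` controls the squared
  -- deviation.
  set p : ℕ → ℝ := fun k => 4 * x k * v k / n with hp
  set e : ℕ → (Fin n → ℝ) → ℝ := fun k => empMean (kernelFn f x₀ (M k)) n with he
  have hψ : ∀ k, Measurable (kernelFn f x₀ (M k)) := fun k =>
    (continuous_kernelFn hf hne x₀ (M k)).measurable
  have hem : ∀ k, Measurable (e k) := fun k => measurable_empMean (hψ k) n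
  have hc1 : (1 / (2 * Real.pi)) ^ 2 ≤ 1 := by
    refine pow_le_one₀ (by positivity) ?_
    rw [div_le_one (by positivity)]
    linarith [Real.pi_gt_three]
  refine ⟨fun z => lepskiEst p (fun k => e k z) N, measurable_lepskiEst p hem N, ?_⟩
  intro g hg hgc hgi j hj
  have := hg.isProbabilityMeasure
  have := hf.isProbabilityMeasure
  set μ := (law g).conv (law f) with hμ
  set m : ℕ → ℝ := fun k => ∫ z, kernelFn f x₀ (M k) z ∂μ with hm
  have hpm : Monotone p := by
    intro a b hab
    simp only [hp]
    have h0 : 0 ≤ x b := zero_le_one.trans (hx1 b)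
    have h1 := hx hab
    have h2 := hv hab
    have h3 := hx1 a
    have h4 := hv0 a
    gcongr
  have hp0 : ∀ k, 0 ≤ p k := fun k => by
    have h3 := hx1 k
    have h4 := hv0 k
    simp only [hp]; positivity
  have hdet : ∀ z, (lepskiEst p (fun k => e k z) N - g x₀) ^ 2 ≤
      52 * (tailInt g (M j) ^ 2 + p j) +
        52 * ∑ k ∈ Finset.range (N + 1), max 0 ((e k z - m k) ^ 2 - p k) := by
    intro z
    rw [← mul_add]
    refine lepskiEst_sq_le (β := fun k => tailInt g (M k)) hpm hp0
      ((tailInt_antitone hgi).comp_monotone hM) (fun k => ?_) hj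
    refine (abs_integral_kernelFn_sub_le hf hne x₀ (M k) hg hgc hgi).trans ?_
    refine mul_le_of_le_one_left (tailInt_nonneg _ _) ?_
    rw [div_le_one (by positivity)]
    linarith [Real.pi_gt_three]
  have hdev : ∀ k ≤ N, ∫⁻ z, ENNReal.ofReal (max 0 ((e k z - m k) ^ 2 - p k))
      ∂(Measure.pi fun _ : Fin n => μ) ≤ ENNReal.ofReal (12 * (v k / n) * Real.exp (-x k)) := by
    intro k hk
    have hJ := invSqInt_nonneg (f := f) (M k)
    have h := lintegral_sq_sub_le (μ := μ) (ψ := kernelFn f x₀ (M k)) (v := v k) (x := x k)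
      (hψ k) (kernelFn_sq_le hf hne x₀ (M k) (hM0 k))
      (((integral_kernelFn_sq_le hf hne x₀ (M k) hfi hg).trans
        (mul_le_of_le_one_left (mul_nonneg (integral_nonneg fun _ => norm_nonneg _) hJ) hc1)).trans
          (hvar k)) (hv0 k) hn (hx1 k) ?_
    · refine le_trans (le_of_eq ?_) h
      refine lintegral_congr fun z => ?_
      rw [ENNReal.ofReal_max, ENNReal.ofReal_zero, max_eq_right zero_le]
    -- This is the small-exponent condition of the Bernstein bound. Both the sup norm and the
    -- variance proxy carry the factor `invSqInt`, so only `8 x_k M_k ≤ n ∫|f*|` is needed.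
    · calc 4 * x k * ((1 / (2 * Real.pi)) ^ 2 * (2 * M k * invSqInt f (M k)))
          = (1 / (2 * Real.pi)) ^ 2 * ((8 * x k * M k) * invSqInt f (M k)) := by ring
        _ ≤ 1 * ((n * ∫ y, ‖ft f y‖) * invSqInt f (M k)) := by
            have := hxM k hk
            have h3 := hx1 k
            have h4 := hM0 k
            gcongr
        _ = n * ((∫ y, ‖ft f y‖) * invSqInt f (M k)) := by ring
        _ ≤ _ := by have := hvar k; gcongr
  have hmeas : ∀ k, Measurable fun z => ENNReal.ofReal (max 0 ((e k z - m k) ^ 2 - p k)) :=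
    fun k => by have := hem k; fun_prop
  have hA : 0 ≤ 52 * (tailInt g (M j) ^ 2 + p j) := by have := hp0 j; positivity
  have hB : ∀ k, 0 ≤ 12 * (v k / n) * Real.exp (-x k) := fun k => by have := hv0 k; positivity
  calc risk f x₀ n (fun z => lepskiEst p (fun k => e k z) N) g
      ≤ ∫⁻ z, (ENNReal.ofReal (52 * (tailInt g (M j) ^ 2 + p j)) + ENNReal.ofReal 52 *
          ∑ k ∈ Finset.range (N + 1), ENNReal.ofReal (max 0 ((e k z - m k) ^ 2 - p k)))
            ∂(Measure.pi fun _ : Fin n => μ) := by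
        refine lintegral_mono fun z => ?_
        refine (ENNReal.ofReal_le_ofReal (hdet z)).trans (le_of_eq ?_)
        rw [ENNReal.ofReal_add hA (mul_nonneg (by norm_num)
          (Finset.sum_nonneg fun k _ => le_max_left _ _)), ENNReal.ofReal_mul
          (q := ∑ k ∈ Finset.range (N + 1), max 0 ((e k z - m k) ^ 2 - p k)) (by norm_num),
          ENNReal.ofReal_sum_of_nonneg fun k _ => le_max_left _ _]
    _ = ENNReal.ofReal (52 * (tailInt g (M j) ^ 2 + p j)) + ENNReal.ofReal 52 *
          ∑ k ∈ Finset.range (N + 1), ∫⁻ z, ENNReal.ofReal (max 0 ((e k z - m k) ^ 2 - p k))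
            ∂(Measure.pi fun _ : Fin n => μ) := by
        rw [lintegral_add_left measurable_const, lintegral_const, measure_univ, mul_one,
          lintegral_const_mul _ (Finset.measurable_sum _ fun k _ => hmeas k),
          lintegral_finsetSum _ fun k _ => hmeas k]
    _ ≤ ENNReal.ofReal (52 * (tailInt g (M j) ^ 2 + p j)) + ENNReal.ofReal 52 *
          ∑ k ∈ Finset.range (N + 1), ENNReal.ofReal (12 * (v k / n) * Real.exp (-x k)) := by
        gcongr with k hk
        exact hdev k (by have := Finset.mem_range.1 hk; omega)
    _ = ENNReal.ofReal (52 * (tailInt g (M j) ^ 2 + p j) +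
          52 * ∑ k ∈ Finset.range (N + 1), 12 * (v k / n) * Real.exp (-x k)) := by
        rw [ENNReal.ofReal_add hA (mul_nonneg (by norm_num)
          (Finset.sum_nonneg fun k _ => hB k)), ENNReal.ofReal_mul
          (q := ∑ k ∈ Finset.range (N + 1), 12 * (v k / n) * Real.exp (-x k)) (by norm_num),
          ENNReal.ofReal_sum_of_nonneg fun k _ => hB k]
    _ ≤ _ := by
        refine ENNReal.ofReal_le_ofReal ?_
        have e1 : ∑ k ∈ Finset.range (N + 1), 12 * (v k / n) * Real.exp (-x k) =
            12 * ∑ k ∈ Finset.range (N + 1), v k / n * Real.exp (-x k) := by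
          rw [Finset.mul_sum]
          exact Finset.sum_congr rfl fun k _ => by ring
        have e2 : p j = 4 * (x j * v j / n) := by simp only [hp]; ring
        have h1 : 0 ≤ x j * v j / n := by have := hp0 j; linarith
        -- The constant `624` is `52·12`: the oracle constant times that of the deviation bound.
        rw [e1, e2]
        nlinarith [sq_nonneg (tailInt g (M j))]

/-! ### Even functions -/

theorem integral_compl_Icc_of_even {φ : ℝ → ℝ} (hφ : Integrable φ) (he : ∀ x, φ (-x) = φ x)
    {M : ℝ} (hM : 0 ≤ M) : ∫ x in (Set.Icc (-M) M)ᶜ, φ x = 2 * ∫ x in Set.Ioi M, φ x := by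
  have hset : (Set.Icc (-M) M)ᶜ = Set.Iio (-M) ∪ Set.Ioi M := by
    ext x
    simp only [Set.mem_compl_iff, Set.mem_Icc, not_and_or, not_le, Set.mem_union, Set.mem_Iio,
      Set.mem_Ioi]
  have hd : Disjoint (Set.Iio (-M)) (Set.Ioi M) := by
    rw [Set.disjoint_left]
    intro x hx hx'
    simp only [Set.mem_Iio, Set.mem_Ioi] at hx hx'
    linarith
  rw [hset, setIntegral_union hd measurableSet_Ioi hφ.integrableOn hφ.integrableOn,
    ← integral_Iic_eq_integral_Iio, ← integral_comp_neg_Ioi]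
  simp_rw [he]
  ring

theorem integral_Icc_of_even {φ : ℝ → ℝ} (hφ : Continuous φ) (he : ∀ x, φ (-x) = φ x)
    {M : ℝ} (hM : 0 ≤ M) : ∫ x in Set.Icc (-M) M, φ x = 2 * ∫ x in (0 : ℝ)..M, φ x := by
  rw [integral_Icc_eq_integral_Ioc, ← intervalIntegral.integral_of_le (by linarith),
    ← intervalIntegral.integral_add_adjacent_intervals (b := 0) (hφ.intervalIntegrable _ _)
      (hφ.intervalIntegrable _ _)]
  have : ∫ x in (-M)..0, φ x = ∫ x in (0 : ℝ)..M, φ x := by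
    have := intervalIntegral.integral_comp_neg (a := -M) (b := 0) φ
    rw [neg_zero, neg_neg] at this
    rw [← this]
    simp_rw [he]
  rw [this]
  ring

theorem integrable_of_even {φ : ℝ → ℝ} (hφ : IntegrableOn φ (Set.Ioi 0)) (he : ∀ x, φ (-x) = φ x) :
    Integrable φ := by
  have h1 : IntegrableOn φ (Set.Iio 0) := by
    have h := ((Measure.measurePreserving_neg (volume : Measure ℝ)).integrableOn_comp_preimage
      (Homeomorph.neg ℝ).measurableEmbedding (f := φ) (s := Set.Ioi 0)).2 hφ
    have e1 : (Neg.neg ⁻¹' Set.Ioi (0 : ℝ)) = Set.Iio 0 := by ext x; simp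
    have e2 : φ ∘ Neg.neg = φ := funext he
    rwa [e1, e2] at h
  have h2 : IntegrableOn φ (Set.Iic 0) := (integrableOn_Iic_iff_integrableOn_Iio (by simp)).2 h1
  rw [← integrableOn_univ, ← Set.Iic_union_Ioi (a := (0 : ℝ))]
  exact h2.union hφ

theorem integrable_exp_neg_abs_rpow {c r : ℝ} (hc : 0 < c) (hr : 0 < r) :
    Integrable fun x : ℝ => Real.exp (-c * |x| ^ r) := by
  refine integrable_of_even ?_ fun x => by rw [abs_neg]
  have h := integrableOn_rpow_mul_exp_neg_mul_rpow (p := r) (s := 0) (b := c) (by norm_num) hr hc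
  refine h.congr_fun (fun x hx => ?_) measurableSet_Ioi
  simp only [Real.rpow_zero, one_mul, abs_of_pos (Set.mem_Ioi.1 hx)]

theorem integrable_sq_add_one_rpow {p : ℝ} (hp : 1 / 2 < p) :
    Integrable fun x : ℝ => (x ^ 2 + 1) ^ (-p) := by
  have h := integrable_rpow_neg_one_add_norm_sq (E := ℝ) (μ := volume) (r := 2 * p)
    (by simp; linarith)
  refine h.congr (ae_of_all _ fun x => ?_)
  simp only [Real.norm_eq_abs, sq_abs]
  rw [add_comm]
  congr 1
  ring

/-! ### The noise -/

theorem IsNoise.ft_ne_zero {f : ℝ → ℝ} {γ α ρ : ℝ} (hf : IsNoise f γ α ρ) (x : ℝ) :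
    ft f x ≠ 0 := by
  obtain ⟨κ₀, κ₁, hκ, h⟩ := hf.bounds
  have := (h x).1
  rw [← norm_pos_iff]
  exact lt_of_lt_of_le (by positivity) this

theorem IsNoise.gamma_nonneg {f : ℝ → ℝ} {γ α ρ : ℝ} (hf : IsNoise f γ α ρ) : 0 ≤ γ := by
  rcases hf.params with ⟨_, _, h⟩ | ⟨_, _, h⟩ <;> linarith

theorem IsNoise.alpha_nonneg {f : ℝ → ℝ} {γ α ρ : ℝ} (hf : IsNoise f γ α ρ) : 0 ≤ α := by
  rcases hf.params with ⟨h, _⟩ | ⟨h, _⟩ <;> linarith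

theorem IsNoise.rho_nonneg {f : ℝ → ℝ} {γ α ρ : ℝ} (hf : IsNoise f γ α ρ) : 0 ≤ ρ := by
  rcases hf.params with ⟨_, h, _⟩ | ⟨_, h, _⟩ <;> linarith

theorem IsNoise.alpha_pos {f : ℝ → ℝ} {γ α ρ : ℝ} (hf : IsNoise f γ α ρ) (hρ : 0 < ρ) :
    0 < α := by
  rcases hf.params with ⟨_, h, _⟩ | ⟨h, _, _⟩
  · exact absurd h hρ.ne'
  · exact h

theorem IsNoise.ordinary {f : ℝ → ℝ} {γ α ρ : ℝ} (hf : IsNoise f γ α ρ) (hρ : ρ = 0) :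
    α = 0 ∧ 1 < γ := by
  rcases hf.params with ⟨h, _, h'⟩ | ⟨_, h, _⟩
  · exact ⟨h, h'⟩
  · exact absurd hρ h.ne'

theorem sq_add_one_rpow_le_one {p : ℝ} (hp : 0 ≤ p) (x : ℝ) : (x ^ 2 + 1) ^ (-p) ≤ 1 :=
  Real.rpow_le_one_of_one_le_of_nonpos (by nlinarith [sq_nonneg x]) (by linarith)

theorem IsNoise.integrable_ft {f : ℝ → ℝ} {γ α ρ : ℝ} (hf : IsNoise f γ α ρ) :
    Integrable (ft f) := by
  obtain ⟨κ₀, κ₁, hκ, h⟩ := hf.bounds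
  have hm := (continuous_ft hf.density.integrable).aestronglyMeasurable (μ := volume)
  have hκ₁ : 0 ≤ κ₁ := by
    have := (norm_nonneg _).trans (h 0).2
    by_contra hcon
    push Not at hcon
    have : κ₁ * (0 ^ 2 + 1) ^ (-γ / 2) * Real.exp (-α * |0| ^ ρ) < 0 := by
      have h1 : (0 : ℝ) < (0 ^ 2 + 1) ^ (-γ / 2) := by positivity
      exact mul_neg_of_neg_of_pos (mul_neg_of_neg_of_pos hcon h1) (Real.exp_pos _)
    linarith
  rcases hf.params with ⟨rfl, rfl, hγ⟩ | ⟨hα, hρ, hγ⟩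
  · refine Integrable.mono' ((integrable_sq_add_one_rpow (p := γ / 2) (by linarith)).const_mul κ₁)
      hm (ae_of_all _ fun x => ?_)
    refine (h x).2.trans (le_of_eq ?_)
    rw [neg_zero, zero_mul, Real.exp_zero, mul_one, neg_div]
  · refine Integrable.mono' ((integrable_exp_neg_abs_rpow hα hρ).const_mul κ₁)
      hm (ae_of_all _ fun x => ?_)
    refine (h x).2.trans ?_
    gcongr
    rw [neg_div]
    exact mul_le_of_le_one_right hκ₁ (sq_add_one_rpow_le_one (by positivity) x)

theorem IsNoise.integral_norm_ft_pos {f : ℝ → ℝ} {γ α ρ : ℝ} (hf : IsNoise f γ α ρ) :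
    0 < ∫ x, ‖ft f x‖ := by
  rw [integral_pos_iff_support_of_nonneg (fun x => norm_nonneg _) hf.integrable_ft.norm]
  have : Function.support (fun x => ‖ft f x‖) = Set.univ := by
    ext x; simp [hf.ft_ne_zero x]
  rw [this]
  simp

theorem continuous_noise_weight {α ρ : ℝ} (hρ : 0 ≤ ρ) (γ : ℝ) : Continuous fun x : ℝ =>
    (x ^ 2 + 1) ^ γ * Real.exp (2 * α * |x| ^ ρ) := by
  have h1 : Continuous fun x : ℝ => (x ^ 2 + 1) ^ γ :=
    Continuous.rpow_const (by fun_prop) fun x => Or.inl (by positivity)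
  have h2 : Continuous fun x : ℝ => |x| ^ ρ :=
    Continuous.rpow_const (by fun_prop) fun x => Or.inr hρ
  fun_prop

theorem IsNoise.exists_invSqInt_le {f : ℝ → ℝ} {γ α ρ : ℝ} (hf : IsNoise f γ α ρ) :
    ∃ C : ℝ, 0 < C ∧ ∀ M : ℝ, 0 ≤ M → invSqInt f M ≤
      C * ∫ x in (0 : ℝ)..M, (x ^ 2 + 1) ^ γ * Real.exp (2 * α * |x| ^ ρ) := by
  obtain ⟨κ₀, κ₁, hκ, h⟩ := hf.bounds
  refine ⟨2 * (κ₀ ^ 2)⁻¹, by positivity, fun M hM => ?_⟩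
  have hc := continuous_noise_weight (α := α) hf.rho_nonneg γ
  have he := integral_Icc_of_even hc (fun x => by rw [abs_neg, neg_sq]) hM
  rw [mul_comm 2, mul_assoc, ← he, ← integral_const_mul, invSqInt]
  refine setIntegral_mono ?_ ?_ fun x => ?_
  · exact (continuous_inv_sq_ft hf.density hf.ft_ne_zero).integrableOn_Icc
  · exact (hc.const_mul _).integrableOn_Icc
  · have h1 : 0 < κ₀ * (x ^ 2 + 1) ^ (-γ / 2) * Real.exp (-α * |x| ^ ρ) := by positivity
    have h2 := inv_anti₀ (by positivity) (pow_le_pow_left₀ h1.le (h x).1 2)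
    refine h2.trans (le_of_eq ?_)
    have e1 : ((x ^ 2 + 1 : ℝ) ^ (-γ / 2)) ^ 2 = ((x ^ 2 + 1) ^ γ)⁻¹ := by
      rw [← Real.rpow_natCast, ← Real.rpow_mul (by positivity), ← Real.rpow_neg (by positivity)]
      congr 1
      push_cast
      ring
    have e2 : Real.exp (-α * |x| ^ ρ) ^ 2 = (Real.exp (2 * α * |x| ^ ρ))⁻¹ := by
      rw [← Real.exp_nat_mul, ← Real.exp_neg]
      congr 1
      push_cast
      ring
    rw [mul_pow, mul_pow, e1, e2, mul_inv, mul_inv, inv_inv, inv_inv, mul_assoc]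

theorem sq_add_one_rpow_le {x p : ℝ} (hp : 0 ≤ p) (hx : 1 ≤ x) :
    (x ^ 2 + 1) ^ p ≤ 2 ^ p * x ^ (2 * p) := by
  rw [Real.rpow_mul (by linarith), ← Real.mul_rpow (by norm_num) (by positivity)]
  refine Real.rpow_le_rpow (by positivity) ?_ hp
  rw [Real.rpow_two]
  nlinarith

/-- Crude bound on the variance. -/
theorem IsNoise.exists_variance_le {f : ℝ → ℝ} {γ α ρ : ℝ} (hf : IsNoise f γ α ρ) :
    ∃ C : ℝ, 0 < C ∧ ∀ M : ℝ, 1 ≤ M → (∫ y, ‖ft f y‖) * invSqInt f M ≤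
      C * (M ^ (2 * γ + 1) * Real.exp (2 * α * M ^ ρ)) := by
  obtain ⟨C, hC, h⟩ := hf.exists_invSqInt_le
  have hD := hf.integral_norm_ft_pos
  have hα := hf.alpha_nonneg
  refine ⟨(∫ y, ‖ft f y‖) * (C * 2 ^ γ), by positivity, fun M hM => ?_⟩
  have h1 : ∫ x in (0 : ℝ)..M, (x ^ 2 + 1) ^ γ * Real.exp (2 * α * |x| ^ ρ) ≤
      2 ^ γ * (M ^ (2 * γ + 1) * Real.exp (2 * α * M ^ ρ)) := by
    calc _ ≤ ∫ x in (0 : ℝ)..M, (M ^ 2 + 1) ^ γ * Real.exp (2 * α * M ^ ρ) := by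
          refine intervalIntegral.integral_mono_on (by linarith)
            ((continuous_noise_weight hf.rho_nonneg γ).intervalIntegrable _ _)
            intervalIntegrable_const fun x hx => ?_
          have hx0 := hx.1
          have hxM := hx.2
          have := hf.gamma_nonneg
          have := hf.rho_nonneg
          rw [abs_of_nonneg hx0]
          gcongr
      _ = M * ((M ^ 2 + 1) ^ γ * Real.exp (2 * α * M ^ ρ)) := by
          rw [intervalIntegral.integral_const, sub_zero, smul_eq_mul]
      _ ≤ M * ((2 ^ γ * M ^ (2 * γ)) * Real.exp (2 * α * M ^ ρ)) := by
          gcongr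
          exact sq_add_one_rpow_le hf.gamma_nonneg hM
      _ = _ := by
          rw [Real.rpow_add (by linarith), Real.rpow_one]; ring
  calc _ ≤ (∫ y, ‖ft f y‖) * (C * (2 ^ γ * (M ^ (2 * γ + 1) * Real.exp (2 * α * M ^ ρ)))) := by
        gcongr
        exact (h M (by linarith)).trans (by gcongr)
    _ = _ := by ring

/-- The derivative is factored so that the bracket tends to `c r` at infinity when `r > 0`: up to a
constant, `x^p e^{c x^r}` is then a primitive of `x^{p+r-1} e^{c x^r}`. Both the sharp variance
bound (`c > 0`) and the sharp bias bound (`c < 0`) rest on this. -/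
theorem hasDerivAt_rpow_mul_exp {p c r x : ℝ} (hx : 0 < x) :
    HasDerivAt (fun y : ℝ => y ^ p * Real.exp (c * y ^ r))
      ((p * x ^ (-r) + c * r) * (x ^ (p + r - 1) * Real.exp (c * x ^ r))) x := by
  have h1 := Real.hasDerivAt_rpow_const (x := x) (p := p) (Or.inl hx.ne')
  have h2 := ((Real.hasDerivAt_rpow_const (x := x) (p := r) (Or.inl hx.ne')).const_mul c).exp
  refine (h1.mul h2).congr_deriv ?_
  have e1 : x ^ (p - 1) = x ^ (-r) * x ^ (p + r - 1) := by
    rw [← Real.rpow_add hx]; congr 1; ring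
  have e2 : x ^ p * x ^ (r - 1) = x ^ (p + r - 1) := by
    rw [← Real.rpow_add hx]; congr 1; ring
  rw [e1]
  linear_combination (c * r * Real.exp (c * x ^ r)) * e2

/-- Sharp bound on the variance for supersmooth noise with `ρ ≤ 1`. -/
theorem IsNoise.exists_variance_le_of_le_one {f : ℝ → ℝ} {γ α ρ : ℝ} (hf : IsNoise f γ α ρ)
    (hρ : 0 < ρ) (hρ1 : ρ ≤ 1) :
    ∃ C : ℝ, 0 < C ∧ ∀ M : ℝ, 1 ≤ M → (∫ y, ‖ft f y‖) * invSqInt f M ≤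
      C * (M ^ (2 * γ + 1 - ρ) * Real.exp (2 * α * M ^ ρ)) := by
  obtain ⟨C, hC, h⟩ := hf.exists_invSqInt_le
  have hD := hf.integral_norm_ft_pos
  have hα := hf.alpha_pos hρ
  have hγ := hf.gamma_nonneg
  -- `D` is chosen so that the derivative of `D * G` dominates the integrand on `[1, M]`. The
  -- assumption `ρ ≤ 1` makes the discarded term `(2γ+1-ρ)x^{-ρ}` nonnegative; the interval `[0,
  -- 1]`, where powers may be singular, is bounded separately.
  set D := (2 ^ γ : ℝ) / (2 * α * ρ) with hDdef
  refine ⟨(∫ y, ‖ft f y‖) * (C * (2 ^ γ + D)), by positivity, fun M hM => ?_⟩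
  have hM0 : 0 < M := by linarith
  set G : ℝ → ℝ := fun y => y ^ (2 * γ + 1 - ρ) * Real.exp (2 * α * y ^ ρ) with hG
  have hint : ∀ a b, IntervalIntegrable
    (fun x : ℝ => (x ^ 2 + 1) ^ γ * Real.exp (2 * α * |x| ^ ρ)) volume a b := fun a b =>
      (continuous_noise_weight hf.rho_nonneg γ).intervalIntegrable _ _
  have hGM : Real.exp (2 * α) ≤ G M := by
    have h1 : 1 ≤ M ^ (2 * γ + 1 - ρ) := Real.one_le_rpow hM (by linarith)
    have h2 : 1 ≤ M ^ ρ := Real.one_le_rpow hM hρ.le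
    calc Real.exp (2 * α) = 1 * Real.exp (2 * α * 1) := by rw [one_mul, mul_one]
      _ ≤ _ := by simp only [hG]; gcongr
  have h1 : ∫ x in (0 : ℝ)..1, (x ^ 2 + 1) ^ γ * Real.exp (2 * α * |x| ^ ρ) ≤ 2 ^ γ * G M := by
    calc _ ≤ ∫ x in (0 : ℝ)..1, (2 : ℝ) ^ γ * Real.exp (2 * α * 1) := by
          refine intervalIntegral.integral_mono_on (by linarith) (hint _ _)
            intervalIntegrable_const fun x hx => ?_
          have hx0 := hx.1
          have hx1 := hx.2
          rw [abs_of_nonneg hx0]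
          have := Real.rpow_le_one hx0 hx1 hρ.le
          have : x ^ 2 + 1 ≤ 2 := by nlinarith
          gcongr
      _ = 2 ^ γ * Real.exp (2 * α) := by
          rw [intervalIntegral.integral_const, sub_zero, smul_eq_mul, one_mul, mul_one]
      _ ≤ _ := by gcongr
  have h2 : ∫ x in (1 : ℝ)..M, (x ^ 2 + 1) ^ γ * Real.exp (2 * α * |x| ^ ρ) ≤ D * G M := by
    have hder : ∀ x : ℝ, 0 < x → HasDerivAt (fun y => D * G y) (D * (((2 * γ + 1 - ρ) * x ^ (-ρ) +
        2 * α * ρ) * (x ^ (2 * γ + 1 - ρ + ρ - 1) * Real.exp (2 * α * x ^ ρ)))) x := fun x hx =>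
      (hasDerivAt_rpow_mul_exp hx).const_mul D
    have := intervalIntegral.integral_le_sub_of_hasDeriv_right_of_le (a := 1) (b := M)
      (g := fun y => D * G y) hM
      (fun x hx => (hder x (by linarith [hx.1])).continuousAt.continuousWithinAt)
      (fun x hx => (hder x (by linarith [hx.1])).hasDerivWithinAt)
      (φ := fun x : ℝ => (x ^ 2 + 1) ^ γ * Real.exp (2 * α * |x| ^ ρ))
      (continuous_noise_weight hf.rho_nonneg γ).integrableOn_Icc ?_
    · refine this.trans ?_
      have : 0 ≤ D * G 1 := by simp only [hG]; positivity
      linarith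
    · intro x hx
      have hx1 : 1 ≤ x := hx.1.le
      have hx0 : 0 < x := by linarith
      rw [abs_of_pos hx0]
      have e : 2 * γ + 1 - ρ + ρ - 1 = 2 * γ := by ring
      rw [e]
      have hb := sq_add_one_rpow_le hγ hx1
      have hpos : 0 ≤ (2 * γ + 1 - ρ) * x ^ (-ρ) :=
        mul_nonneg (by linarith) (Real.rpow_nonneg hx0.le _)
      calc (x ^ 2 + 1) ^ γ * Real.exp (2 * α * x ^ ρ)
          ≤ (2 ^ γ * x ^ (2 * γ)) * Real.exp (2 * α * x ^ ρ) := by gcongr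
        _ = D * ((0 + 2 * α * ρ) * (x ^ (2 * γ) * Real.exp (2 * α * x ^ ρ))) := by
            rw [hDdef]; field_simp; ring
        _ ≤ _ := by gcongr
  calc _ ≤ (∫ y, ‖ft f y‖) * (C * ((2 ^ γ + D) * G M)) := by
        gcongr
        refine (h M (by linarith)).trans ?_
        rw [← intervalIntegral.integral_add_adjacent_intervals (hint 0 1) (hint 1 M), add_mul]
        gcongr
    _ = _ := by ring

/-! ### Bias over the smoothness classes -/

/-- The weight `(x²+1)^b e^{2a|x|^r}` defining the smoothness class. -/
def weight (l : Smoothness) (x : ℝ) : ℝ :=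
  (x ^ 2 + 1) ^ l.b * Real.exp (2 * l.a * |x| ^ l.r)

theorem weight_pos (l : Smoothness) (x : ℝ) : 0 < weight l x := by
  unfold weight; positivity

theorem weight_neg (l : Smoothness) (x : ℝ) : weight l (-x) = weight l x := by
  simp only [weight, neg_sq, abs_neg]

theorem continuous_weight {l : Smoothness} (hr : 0 ≤ l.r) : Continuous (weight l) :=
  continuous_noise_weight hr l.b

theorem weight_inv (l : Smoothness) (x : ℝ) :
    (weight l x)⁻¹ = (x ^ 2 + 1) ^ (-l.b) * Real.exp (-(2 * l.a) * |x| ^ l.r) := by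
  rw [weight, mul_inv, ← Real.rpow_neg (by positivity), ← Real.exp_neg, neg_mul]

/-- Parameters of a single Sobolev class or class of supersmooth densities. -/
def Admissible (l : Smoothness) : Prop :=
  0 < l.L ∧ ((l.a = 0 ∧ l.r = 0 ∧ 1 / 2 < l.b) ∨ (0 < l.a ∧ 0 < l.r ∧ 0 ≤ l.b))

theorem Admissible.r_nonneg {l : Smoothness} (h : Admissible l) : 0 ≤ l.r := by
  rcases h.2 with ⟨_, h, _⟩ | ⟨_, h, _⟩ <;> linarith

theorem SobolevBox.admissible {lo hi l : Smoothness} (h : SobolevBox lo hi) (hl : l ∈ box lo hi) :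
    Admissible l := by
  obtain ⟨⟨hb, _⟩, ⟨ha, ha'⟩, ⟨hr, hr'⟩, ⟨hL, _⟩⟩ := hl
  have h1 := h.lo_a; have h2 := h.hi_a; have h3 := h.lo_r; have h4 := h.hi_r
  have h5 := h.b_pos; have h6 := h.L_pos
  exact ⟨by linarith, Or.inl ⟨by linarith, by linarith, by linarith⟩⟩

theorem SupersmoothBox.admissible {lo hi l : Smoothness} (h : SupersmoothBox lo hi)
    (hl : l ∈ box lo hi) : Admissible l := by
  obtain ⟨⟨hb, _⟩, ⟨ha, ha'⟩, ⟨hr, hr'⟩, ⟨hL, _⟩⟩ := hl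
  have h1 := h.b_nonneg; have h2 := h.a_pos; have h3 := h.r_pos; have h4 := h.L_pos
  exact ⟨by linarith, Or.inr ⟨by linarith, by linarith, by linarith⟩⟩

theorem Admissible.integrable_weight_inv {l : Smoothness} (h : Admissible l) :
    Integrable fun x => (weight l x)⁻¹ := by
  have hm : AEStronglyMeasurable (fun x => (weight l x)⁻¹) volume :=
    ((continuous_weight h.r_nonneg).inv₀ fun x => (weight_pos l x).ne').aestronglyMeasurable
  have hpos : ∀ x, ‖(weight l x)⁻¹‖ = (weight l x)⁻¹ := fun x =>
    Real.norm_of_nonneg (inv_pos.2 (weight_pos l x)).le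
  rcases h.2 with ⟨ha, hr, hb⟩ | ⟨ha, hr, hb⟩
  · refine (integrable_sq_add_one_rpow hb).mono' hm (ae_of_all _ fun x => ?_)
    rw [hpos, weight_inv, ha]
    simp
  · refine (integrable_exp_neg_abs_rpow (c := 2 * l.a) (by positivity) hr).mono' hm
      (ae_of_all _ fun x => ?_)
    rw [hpos, weight_inv]
    exact mul_le_of_le_one_left (Real.exp_pos _).le (sq_add_one_rpow_le_one hb x)

theorem integrable_sq_mul_weight {l : Smoothness} (hl : Admissible l) {g : ℝ → ℝ}
    (hg : g ∈ smoothClass l) : Integrable (fun x => ‖ft g x‖ ^ 2 * weight l x) ∧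
      ∫ x, ‖ft g x‖ ^ 2 * weight l x ≤ 2 * Real.pi * l.L := by
  obtain ⟨hd, hc, hle⟩ := hg
  have hcont : Continuous fun x => ‖ft g x‖ ^ 2 * weight l x := by
    have := continuous_ft hd.integrable
    have := continuous_weight hl.r_nonneg
    fun_prop
  have hnn : ∀ x, 0 ≤ ‖ft g x‖ ^ 2 * weight l x := fun x => by
    have := weight_pos l x; positivity
  have e : ∀ x, ‖ft g x‖ ^ 2 * (x ^ 2 + 1) ^ l.b * Real.exp (2 * l.a * |x| ^ l.r) =
      ‖ft g x‖ ^ 2 * weight l x := fun x => by rw [weight, mul_assoc]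
  simp_rw [e] at hle
  constructor
  · refine ⟨hcont.aestronglyMeasurable, ?_⟩
    rw [hasFiniteIntegral_iff_ofReal (ae_of_all _ hnn)]
    exact lt_of_le_of_lt hle ENNReal.ofReal_lt_top
  · rw [integral_eq_lintegral_of_nonneg_ae (ae_of_all _ hnn) hcont.aestronglyMeasurable]
    have := hl.1
    exact ENNReal.toReal_le_of_le_ofReal (by positivity) hle

/-- The arithmetic-geometric inequality with a free parameter: `t = 1` yields integrability of `g*`
on a class, and optimising over `t` after integration yields weighted Cauchy-Schwarz. -/
theorem norm_le_weight {t w y : ℝ} (ht : 0 < t) (hw : 0 < w) :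
    y ≤ t / 2 * (y ^ 2 * w) + 1 / (2 * t) * w⁻¹ := by
  have h : t / 2 * (y ^ 2 * w) + 1 / (2 * t) * w⁻¹ - y = (t * y * w - 1) ^ 2 / (2 * t * w) := by
    field_simp
    ring
  have : 0 ≤ (t * y * w - 1) ^ 2 / (2 * t * w) := by positivity
  linarith

theorem integrable_ft_of_mem {l : Smoothness} (hl : Admissible l) {g : ℝ → ℝ}
    (hg : g ∈ smoothClass l) : Integrable (ft g) := by
  refine Integrable.mono' (((integrable_sq_mul_weight hl hg).1.const_mul (1 / 2)).add
    (hl.integrable_weight_inv.const_mul (1 / 2)))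
    (continuous_ft hg.1.integrable).aestronglyMeasurable (ae_of_all _ fun x => ?_)
  have := norm_le_weight (y := ‖ft g x‖) one_pos (weight_pos l x)
  simpa using this

theorem tailInt_sq_le {l : Smoothness} (hl : Admissible l) {g : ℝ → ℝ}
    (hg : g ∈ smoothClass l) (M : ℝ) :
    tailInt g M ^ 2 ≤ 2 * Real.pi * l.L * ∫ x in (Set.Icc (-M) M)ᶜ, (weight l x)⁻¹ := by
  obtain ⟨hi, hle⟩ := integrable_sq_mul_weight hl hg
  have hwi := hl.integrable_weight_inv
  set A := 2 * Real.pi * l.L with hA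
  have hA0 : 0 < A := by have := hl.1; positivity
  set Q := ∫ x in (Set.Icc (-M) M)ᶜ, (weight l x)⁻¹ with hQ
  have hQ0 : 0 ≤ Q := integral_nonneg fun x => (inv_pos.2 (weight_pos l x)).le
  have key : ∀ t : ℝ, 0 < t → tailInt g M ≤ t / 2 * A + 1 / (2 * t) * Q := by
    intro t ht
    calc tailInt g M ≤ ∫ x in (Set.Icc (-M) M)ᶜ,
          (t / 2 * (‖ft g x‖ ^ 2 * weight l x) + 1 / (2 * t) * (weight l x)⁻¹) := by
          refine setIntegral_mono (integrable_ft_of_mem hl hg).norm.integrableOn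
            ((hi.const_mul _).add (hwi.const_mul _)).integrableOn fun x => ?_
          exact norm_le_weight ht (weight_pos l x)
      _ = t / 2 * (∫ x in (Set.Icc (-M) M)ᶜ, ‖ft g x‖ ^ 2 * weight l x) + 1 / (2 * t) * Q := by
          rw [integral_add (hi.const_mul _).integrableOn (hwi.const_mul _).integrableOn,
            integral_const_mul, integral_const_mul]
      _ ≤ _ := by
          have : ∫ x in (Set.Icc (-M) M)ᶜ, ‖ft g x‖ ^ 2 * weight l x ≤ A :=
            (setIntegral_le_integral hi (ae_of_all _ fun x => by
              have := weight_pos l x; positivity)).trans hle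
          gcongr
  have hT := tailInt_nonneg g M
  rcases hT.eq_or_lt with h0 | h0
  · rw [← h0, zero_pow two_ne_zero]; positivity
  -- With this parameter the first term is exactly half of the tail integral and is absorbed on the
  -- left.
  · have := key (tailInt g M / A) (by positivity)
    have e : tailInt g M / A / 2 * A = tailInt g M / 2 := by field_simp
    rw [e] at this
    have e2 : 1 / (2 * (tailInt g M / A)) * Q = A * Q / (2 * tailInt g M) := by field_simp
    rw [e2] at this
    have h3 : tailInt g M / 2 ≤ A * Q / (2 * tailInt g M) := by linarith
    rw [le_div_iff₀ (by positivity)] at h3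
    nlinarith

theorem sq_add_one_rpow_neg_le {x b : ℝ} (hb : 0 ≤ b) (hx : 0 < x) :
    (x ^ 2 + 1) ^ (-b) ≤ x ^ (-2 * b) := by
  rw [neg_mul, ← mul_neg, Real.rpow_mul hx.le, Real.rpow_two]
  exact Real.rpow_le_rpow_of_nonpos (by positivity) (by linarith) (by linarith)

/-- Squared bias over a Sobolev class. -/
theorem tailInt_sq_le_sobolev {l : Smoothness} (hL : 0 < l.L) (ha : l.a = 0) (hr : l.r = 0)
    (hb : 1 / 2 < l.b) {g : ℝ → ℝ} (hg : g ∈ smoothClass l) {M : ℝ} (hM : 0 < M) :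
    tailInt g M ^ 2 ≤ 4 * Real.pi * l.L / (2 * l.b - 1) * M ^ (-(2 * l.b - 1)) := by
  have hl : Admissible l := ⟨hL, Or.inl ⟨ha, hr, hb⟩⟩
  refine (tailInt_sq_le hl hg M).trans ?_
  rw [integral_compl_Icc_of_even hl.integrable_weight_inv
    (fun x => by rw [weight_neg]) hM.le]
  have h1 : ∫ x in Set.Ioi M, (weight l x)⁻¹ ≤ ∫ x in Set.Ioi M, x ^ (-2 * l.b) := by
    refine setIntegral_mono_on hl.integrable_weight_inv.integrableOn
      (integrableOn_Ioi_rpow_of_lt (by linarith) hM) measurableSet_Ioi fun x hx => ?_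
    rw [weight_inv, ha]
    simpa using sq_add_one_rpow_neg_le (by linarith : 0 ≤ l.b) (hM.trans hx)
  rw [integral_Ioi_rpow_of_lt (by linarith) hM] at h1
  have e : -M ^ (-2 * l.b + 1) / (-2 * l.b + 1) =
      (2 * l.b - 1)⁻¹ * M ^ (-(2 * l.b - 1)) := by
    have h2 : -2 * l.b + 1 = -(2 * l.b - 1) := by ring
    rw [h2, neg_div_neg_eq, div_eq_inv_mul]
  rw [e] at h1
  calc _ ≤ 2 * Real.pi * l.L * (2 * ((2 * l.b - 1)⁻¹ * M ^ (-(2 * l.b - 1)))) := by gcongr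
    _ = _ := by rw [div_eq_mul_inv]; ring

/-- The function `-G/(ar)` has derivative `(2 + (2b-1+r) x^{-r}/(ar)) φ(x)`. Since `b, r ≥ 0` and
`x^{-r} ≤ ar` beyond `M`, the bracket is at least `1`, so `φ` integrates to at most `G(M)/(ar)`. -/
theorem integral_Ioi_rpow_mul_exp_le {b a r M : ℝ} (ha : 0 < a) (hr : 0 < r) (hb : 0 ≤ b)
    (hM : 0 < M) (hMr : M ^ (-r) ≤ a * r)
    (hi : IntegrableOn (fun x : ℝ => x ^ (-2 * b) * Real.exp (-(2 * a) * x ^ r)) (Set.Ioi M)) :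
    ∫ x in Set.Ioi M, x ^ (-2 * b) * Real.exp (-(2 * a) * x ^ r) ≤
      1 / (a * r) * (M ^ (-2 * b + 1 - r) * Real.exp (-2 * a * M ^ r)) := by
  set φ : ℝ → ℝ := fun x => x ^ (-2 * b) * Real.exp (-(2 * a) * x ^ r) with hφ
  set G : ℝ → ℝ := fun x => x ^ (-2 * b + 1 - r) * Real.exp (-(2 * a) * x ^ r) with hG
  have hder : ∀ x : ℝ, 0 < x → HasDerivAt (fun y => -(1 / (a * r)) * G y)
      (-(1 / (a * r)) * (((-2 * b + 1 - r) * x ^ (-r) + -(2 * a) * r) *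
        (x ^ (-2 * b + 1 - r + r - 1) * Real.exp (-(2 * a) * x ^ r)))) x := fun x hx =>
    (hasDerivAt_rpow_mul_exp hx).const_mul _
  have hfin : ∀ R : ℝ, M ≤ R → ∫ x in M..R, φ x ≤ 1 / (a * r) * G M := by
    intro R hR
    have := intervalIntegral.integral_le_sub_of_hasDeriv_right_of_le (a := M) (b := R)
      (g := fun y => -(1 / (a * r)) * G y) hR
      (fun x hx => (hder x (by linarith [hx.1])).continuousAt.continuousWithinAt)
      (fun x hx => (hder x (by linarith [hx.1])).hasDerivWithinAt)
      (φ := φ) ?_ ?_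
    · refine this.trans ?_
      have hGR : 0 ≤ G R := by
        have : 0 < R := by linarith
        simp only [hG]; positivity
      have : 0 ≤ 1 / (a * r) * G R := by positivity
      linarith
    · rw [integrableOn_Icc_iff_integrableOn_Ioc]
      exact hi.mono_set Set.Ioc_subset_Ioi_self
    · intro x hx
      have hx0 : 0 < x := hM.trans hx.1
      have e : -2 * b + 1 - r + r - 1 = -2 * b := by ring
      rw [e]
      have hxr : x ^ (-r) ≤ a * r :=
        (Real.rpow_le_rpow_of_nonpos hM hx.1.le (by linarith)).trans hMr
      have hxr0 : 0 ≤ x ^ (-r) := Real.rpow_nonneg hx0.le _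
      have hk : 1 ≤ -(1 / (a * r)) * ((-2 * b + 1 - r) * x ^ (-r) + -(2 * a) * r) := by
        rw [neg_mul, ← mul_neg, one_div, ← div_eq_inv_mul, le_div_iff₀ (by positivity)]
        nlinarith
      calc φ x = 1 * φ x := (one_mul _).symm
        _ ≤ -(1 / (a * r)) * ((-2 * b + 1 - r) * x ^ (-r) + -(2 * a) * r) * φ x := by
            have : 0 ≤ φ x := by simp only [hφ]; positivity
            gcongr
        _ = _ := by simp only [hφ]; ring
  have hlim := intervalIntegral_tendsto_integral_Ioi M hi tendsto_id
  have := le_of_tendsto hlim (eventually_ge_atTop M |>.mono fun R hR => hfin R hR)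
  refine this.trans (le_of_eq ?_)
  simp only [hG, neg_mul]

/-- Squared bias over a class of supersmooth densities. -/
theorem tailInt_sq_le_supersmooth {l : Smoothness} (hL : 0 < l.L) (ha : 0 < l.a) (hr : 0 < l.r)
    (hb : 0 ≤ l.b) {g : ℝ → ℝ} (hg : g ∈ smoothClass l) {M : ℝ} (hM : 0 < M)
    (hMr : M ^ (-l.r) ≤ l.a * l.r) :
    tailInt g M ^ 2 ≤ 4 * Real.pi * l.L / (l.a * l.r) *
      (M ^ (-2 * l.b + 1 - l.r) * Real.exp (-2 * l.a * M ^ l.r)) := by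
  have hl : Admissible l := ⟨hL, Or.inr ⟨ha, hr, hb⟩⟩
  refine (tailInt_sq_le hl hg M).trans ?_
  rw [integral_compl_Icc_of_even hl.integrable_weight_inv
    (fun x => by rw [weight_neg]) hM.le]
  have hi : IntegrableOn (fun x : ℝ => x ^ (-2 * l.b) * Real.exp (-(2 * l.a) * x ^ l.r))
      (Set.Ioi M) := by
    have h0 : IntegrableOn (fun x : ℝ => M ^ (-2 * l.b) * Real.exp (-(2 * l.a) * |x| ^ l.r))
      (Set.Ioi M) := ((integrable_exp_neg_abs_rpow (c := 2 * l.a) (by positivity) hr).const_mul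
        _).integrableOn
    refine Integrable.mono' h0 ?_ ?_
    · refine (ContinuousOn.aestronglyMeasurable ?_ measurableSet_Ioi)
      intro x hx
      have hx0 : 0 < x := hM.trans hx
      exact (hasDerivAt_rpow_mul_exp hx0).continuousAt.continuousWithinAt
    · rw [ae_restrict_iff' measurableSet_Ioi]
      refine ae_of_all _ fun x hx => ?_
      have hx0 : 0 < x := hM.trans hx
      rw [Real.norm_of_nonneg (by positivity), abs_of_pos hx0]
      refine mul_le_mul_of_nonneg_right ?_ (Real.exp_pos _).le
      exact Real.rpow_le_rpow_of_nonpos hM (le_of_lt hx) (by linarith)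
  have h1 : ∫ x in Set.Ioi M, (weight l x)⁻¹ ≤
      ∫ x in Set.Ioi M, x ^ (-2 * l.b) * Real.exp (-(2 * l.a) * x ^ l.r) := by
    refine setIntegral_mono_on hl.integrable_weight_inv.integrableOn hi
      measurableSet_Ioi fun x hx => ?_
    have hx0 : 0 < x := hM.trans hx
    rw [weight_inv, abs_of_pos hx0]
    gcongr
    exact sq_add_one_rpow_neg_le hb hx0
  have h2 := integral_Ioi_rpow_mul_exp_le ha hr hb hM hMr hi
  calc _ ≤ 2 * Real.pi * l.L * (2 * (1 / (l.a * l.r) *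
        (M ^ (-2 * l.b + 1 - l.r) * Real.exp (-2 * l.a * M ^ l.r)))) := by
        gcongr
        exact h1.trans h2
    _ = _ := by rw [one_div, div_eq_mul_inv]; ring

/-! ### From the oracle inequality to attained rates -/

/-- A sufficient condition for a rate to be attained by one cutoff for each sample size. -/
theorem attained_of_cutoff {f : ℝ → ℝ} {γ α ρ : ℝ} (hf : IsNoise f γ α ρ) (x₀ : ℝ)
    {Λ : Set Smoothness} (hΛ : ∀ l ∈ Λ, Admissible l) {φ2 : ℕ → Smoothness → ℝ} (M v : ℕ → ℝ) (C : ℝ)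
    (h : ∀ᶠ n : ℕ in atTop, 0 < M n ∧ 0 < v n ∧ (∫ y, ‖ft f y‖) * invSqInt f (M n) ≤ v n ∧
      8 * M n ≤ n * ∫ y, ‖ft f y‖)
    (h' : ∀ᶠ n : ℕ in atTop, ∀ l ∈ Λ, ∀ g ∈ smoothClass l,
      tailInt g (M n) ^ 2 + v n / n ≤ C * φ2 n l) :
    Attained f x₀ Λ φ2 := by
  have key : ∀ n : ℕ, ∃ T : (Fin n → ℝ) → ℝ, Measurable T ∧
      ((0 < n ∧ 0 < M n ∧ 0 < v n ∧ (∫ y, ‖ft f y‖) * invSqInt f (M n) ≤ v n ∧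
        8 * M n ≤ n * ∫ y, ‖ft f y‖) → ∀ g : ℝ → ℝ, IsDensity g → Continuous g →
        Integrable (ft g) → risk f x₀ n T g ≤ ENNReal.ofReal (624 *
          (tailInt g (M n) ^ 2 + v n / n + v n / n))) := by
    intro n
    by_cases hc : (0 < n ∧ 0 < M n ∧ 0 < v n ∧ (∫ y, ‖ft f y‖) * invSqInt f (M n) ≤ v n ∧
        8 * M n ≤ n * ∫ y, ‖ft f y‖)
    · obtain ⟨hn, hM, hv, hvar, hMn⟩ := hc
      -- A grid with the single index `0` and weight `1` makes the adaptive estimator an ordinary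
      -- kernel estimator.
      obtain ⟨T, hT, hr⟩ := exists_adaptive_estimator hf.density hf.ft_ne_zero hf.integrable_ft x₀
        hn 0 (M := fun _ => M n) (v := fun _ => v n) (x := fun _ => 1) (fun _ => hM)
        monotone_const (fun _ => hv) monotone_const (fun _ => le_rfl) monotone_const
        (fun _ => hvar) (fun _ _ => by linarith)
      refine ⟨T, hT, fun _ g hg hgc hgi => (hr g hg hgc hgi 0 le_rfl).trans ?_⟩
      refine ENNReal.ofReal_le_ofReal ?_
      have hn' : (0 : ℝ) < n := by exact_mod_cast hn
      have : v n / n * Real.exp (-1) ≤ v n / n :=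
        mul_le_of_le_one_right (by positivity) (Real.exp_le_one_iff.2 (by norm_num))
      simp only [one_mul, zero_add, Finset.range_one, Finset.sum_singleton]
      gcongr
    -- Sample sizes for which the conditions fail receive a trivial estimator; they do not affect an
    -- eventual statement.
    · exact ⟨fun _ => 0, measurable_const, fun h => absurd h hc⟩
  choose T hT hr using key
  refine ⟨T, hT, 1248 * C, ?_⟩
  filter_upwards [h, h', eventually_gt_atTop 0] with n h1 h2 hn l hl g hg
  refine (hr n ⟨hn, h1⟩ g hg.1 hg.2.1 (integrable_ft_of_mem (hΛ l hl) hg)).trans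
    (ENNReal.ofReal_le_ofReal ?_)
  have := h2 l hl g hg
  nlinarith [sq_nonneg (tailInt g (M n))]

/-- Weights making the sum of the deviation bounds finite. -/
def gridWeight (v : ℕ → ℝ) (k : ℕ) : ℝ := 1 + Real.log (v k) + 2 * Real.log (k + 1)

/-- The weights are designed so that `v_k e^{-x_k} = e^{-1}/(k+1)²`: the `log v_k` term cancels the
variance, and the remaining logarithm makes the series converge independently of the grid length. -/
theorem sum_gridWeight_le {v : ℕ → ℝ} (hv : ∀ k, 1 ≤ v k) (N : ℕ) :
    ∑ k ∈ Finset.range (N + 1), v k * Real.exp (-gridWeight v k) ≤ 2 := by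
  have h1 : ∀ k : ℕ, v k * Real.exp (-gridWeight v k) ≤ 1 / ((k : ℝ) + 1) ^ 2 := by
    intro k
    have hv0 : 0 < v k := by linarith [hv k]
    have hk : (0 : ℝ) < (k : ℝ) + 1 := by positivity
    have e : -gridWeight v k = -1 + -Real.log (v k) + -(2 * Real.log (k + 1)) := by
      unfold gridWeight; ring
    rw [e, Real.exp_add, Real.exp_add, Real.exp_neg (Real.log (v k)), Real.exp_log hv0,
      Real.exp_neg (2 * _)]
    have e2 : Real.exp (2 * Real.log (k + 1)) = ((k : ℝ) + 1) ^ 2 := by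
      rw [two_mul, Real.exp_add, Real.exp_log hk, sq]
    rw [e2]
    have e3 : v k * (Real.exp (-1) * (v k)⁻¹ * (((k : ℝ) + 1) ^ 2)⁻¹) =
        Real.exp (-1) * (1 / ((k : ℝ) + 1) ^ 2) := by field_simp
    rw [e3]
    exact mul_le_of_le_one_left (by positivity) (Real.exp_le_one_iff.2 (by norm_num))
  refine (Finset.sum_le_sum fun k _ => h1 k).trans ?_
  -- Telescoping comparison of the inverse squares with `1/n - 1/(n+1)`.
  have h2 : ∀ n : ℕ, ∑ k ∈ Finset.range (n + 1), 1 / ((k : ℝ) + 1) ^ 2 ≤ 2 - 1 / ((n : ℝ) + 1) := by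
    intro n
    induction n with
    | zero => norm_num
    | succ n ih =>
      rw [Finset.sum_range_succ]
      refine (add_le_add_left ih _).trans ?_
      have hn : (0 : ℝ) ≤ n := Nat.cast_nonneg n
      push_cast
      have : 1 / ((n : ℝ) + 1) - 1 / ((n : ℝ) + 1 + 1) - 1 / ((n : ℝ) + 1 + 1) ^ 2 =
        1 / (((n : ℝ) + 1) * ((n : ℝ) + 1 + 1) ^ 2) := by
        field_simp
        ring
      have h3 : 0 ≤ 1 / (((n : ℝ) + 1) * ((n : ℝ) + 1 + 1) ^ 2) := by positivity
      linarith
  refine (h2 N).trans ?_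
  have : (0 : ℝ) ≤ 1 / ((N : ℝ) + 1) := by positivity
  linarith

/-- A sufficient condition for a rate to be attained by the adaptive estimator. -/
theorem attained_of_grid {f : ℝ → ℝ} {γ α ρ : ℝ} (hf : IsNoise f γ α ρ) (x₀ : ℝ)
    {Λ : Set Smoothness} (hΛ : ∀ l ∈ Λ, Admissible l) {φ2 : ℕ → Smoothness → ℝ}
    {M v : ℕ → ℝ} {N : ℕ → ℕ} (C : ℝ) (hM0 : ∀ k, 0 < M k) (hM : Monotone M)
    (hv1 : ∀ k, 1 ≤ v k) (hv : Monotone v)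
    (hvar : ∀ k, (∫ y, ‖ft f y‖) * invSqInt f (M k) ≤ v k)
    (hN : ∀ᶠ n : ℕ in atTop, 8 * gridWeight v (N n) * M (N n) ≤ n * ∫ y, ‖ft f y‖)
    (h : ∀ᶠ n : ℕ in atTop, ∀ l ∈ Λ, ∃ j ≤ N n, ∀ g ∈ smoothClass l,
      tailInt g (M j) ^ 2 + gridWeight v j * v j / n ≤ C * φ2 n l) :
    Attained f x₀ Λ φ2 := by
  have hv0 : ∀ k, 0 < v k := fun k => by linarith [hv1 k]
  have hx1 : ∀ k, 1 ≤ gridWeight v k := fun k => by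
    have h1 := Real.log_nonneg (hv1 k)
    have h2 : 0 ≤ Real.log ((k : ℝ) + 1) := Real.log_nonneg (by linarith [Nat.cast_nonneg (α := ℝ) k])
    unfold gridWeight; linarith
  have hx : Monotone (gridWeight v) := by
    intro a b hab
    have h1 := Real.log_le_log (hv0 a) (hv hab)
    have h2 : Real.log ((a : ℝ) + 1) ≤ Real.log ((b : ℝ) + 1) :=
      Real.log_le_log (by positivity) (by have : (a : ℝ) ≤ b := by exact_mod_cast hab
                                          linarith)
    unfold gridWeight; linarith
  have key : ∀ n : ℕ, ∃ T : (Fin n → ℝ) → ℝ, Measurable T ∧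
      ((0 < n ∧ 8 * gridWeight v (N n) * M (N n) ≤ n * ∫ y, ‖ft f y‖) → ∀ g : ℝ → ℝ,
        IsDensity g → Continuous g → Integrable (ft g) → ∀ j ≤ N n,
        risk f x₀ n T g ≤ ENNReal.ofReal (624 *
          (tailInt g (M j) ^ 2 + gridWeight v j * v j / n + 2 / n))) := by
    intro n
    by_cases hc : (0 < n ∧ 8 * gridWeight v (N n) * M (N n) ≤ n * ∫ y, ‖ft f y‖)
    · obtain ⟨hn, hMn⟩ := hc
      have hxM : ∀ k ≤ N n, 8 * gridWeight v k * M k ≤ n * ∫ y, ‖ft f y‖ := by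
        intro k hk
        refine le_trans ?_ hMn
        have h1 := hx hk
        have h2 := hM hk
        have h3 := hx1 (N n)
        have h4 := hM0 k
        gcongr
      obtain ⟨T, hT, hr⟩ := exists_adaptive_estimator hf.density hf.ft_ne_zero hf.integrable_ft x₀
        hn (N n) hM0 hM hv0 hv hx1 hx hvar hxM
      refine ⟨T, hT, fun _ g hg hgc hgi j hj => (hr g hg hgc hgi j hj).trans ?_⟩
      refine ENNReal.ofReal_le_ofReal ?_
      have : ∑ k ∈ Finset.range (N n + 1), v k / n * Real.exp (-gridWeight v k) ≤ 2 / n := by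
        have e : ∑ k ∈ Finset.range (N n + 1), v k / n * Real.exp (-gridWeight v k) =
          (∑ k ∈ Finset.range (N n + 1), v k * Real.exp (-gridWeight v k)) / n := by
          rw [Finset.sum_div]
          exact Finset.sum_congr rfl fun k _ => by ring
        rw [e]
        have := sum_gridWeight_le hv1 (N n)
        gcongr
      gcongr
    · exact ⟨fun _ => 0, measurable_const, fun h => absurd h hc⟩
  choose T hT hr using key
  -- The constant `1872` is `3·624`: the remainder `2/n` is at most twice the variance term, since
  -- both the weight and `v` are at least `1`.
  refine ⟨T, hT, 1872 * C, ?_⟩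
  filter_upwards [hN, h, eventually_gt_atTop 0] with n h1 h2 hn l hl g hg
  obtain ⟨j, hj, hjg⟩ := h2 l hl
  have hn' : (0 : ℝ) < n := by exact_mod_cast hn
  refine (hr n ⟨hn, h1⟩ g hg.1 hg.2.1 (integrable_ft_of_mem (hΛ l hl) hg) j hj).trans
    (ENNReal.ofReal_le_ofReal ?_)
  have := hjg g hg
  have h4 : 2 / (n : ℝ) ≤ 2 * (gridWeight v j * v j / n) := by
    have : 1 ≤ gridWeight v j * v j := one_le_mul_of_one_le_of_one_le (hx1 j) (hv1 j)
    calc 2 / (n : ℝ) = 2 * (1 / n) := by ring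
      _ ≤ _ := by gcongr
  nlinarith [sq_nonneg (tailInt g (M j))]

/-! ### Uniform comparison of powers and logarithms -/

/-- The exponents occurring in the rates vary with the class and may have either sign; one constant
must serve all of them over a bounded box. -/
theorem rpow_le_of_abs_le {c p P : ℝ} (hc : 0 < c) (hp : |p| ≤ P) :
    c ^ p ≤ (max c c⁻¹) ^ P := by
  have hm : 1 ≤ max c c⁻¹ := by
    rcases le_total 1 c with h | h
    · exact h.trans (le_max_left _ _)
    · exact (one_le_inv_iff₀.2 ⟨hc, h⟩).trans (le_max_right _ _)
  obtain ⟨h1, h2⟩ := abs_le.1 hp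
  rcases le_total 0 p with h | h
  · calc c ^ p ≤ (max c c⁻¹) ^ p := Real.rpow_le_rpow hc.le (le_max_left _ _) h
      _ ≤ _ := Real.rpow_le_rpow_of_exponent_le hm h2
  · calc c ^ p = (c⁻¹) ^ (-p) := by rw [Real.inv_rpow hc.le, Real.rpow_neg hc.le, inv_inv]
      _ ≤ (max c c⁻¹) ^ (-p) := Real.rpow_le_rpow (by positivity) (le_max_right _ _) (by linarith)
      _ ≤ _ := Real.rpow_le_rpow_of_exponent_le hm (by linarith)

/-- Comparability of powers of comparable numbers, uniformly over bounded exponents. -/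
theorem rpow_le_mul_rpow {x y K p P : ℝ} (hx : 0 < x) (hy : 0 < y)
    (h1 : x ≤ K * y) (h2 : y ≤ K * x) (hp : |p| ≤ P) : x ^ p ≤ K ^ P * y ^ p := by
  have hxy : x = x / y * y := by field_simp
  have hq : 0 < x / y := by positivity
  calc x ^ p = (x / y) ^ p * y ^ p := by
        rw [← Real.mul_rpow hq.le hy.le, ← hxy]
    _ ≤ _ := by
        refine mul_le_mul_of_nonneg_right ?_ (by positivity)
        refine (rpow_le_of_abs_le hq hp).trans ?_
        refine Real.rpow_le_rpow (by positivity) ?_ ((abs_nonneg p).trans hp)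
        refine max_le ?_ ?_
        · rwa [div_le_iff₀ hy]
        · rwa [inv_div, div_le_iff₀ hx]

theorem eventually_log_rpow_le {c s : ℝ} (r : ℝ) (hc : 0 < c) (hs : 0 < s) :
    ∀ᶠ n : ℕ in atTop, Real.log n ^ r ≤ c * (n : ℝ) ^ s := by
  have h := ((isLittleO_log_rpow_rpow_atTop r hs).def hc).and (eventually_ge_atTop (1 : ℝ))
  filter_upwards [tendsto_natCast_atTop_atTop.eventually h] with n hn
  obtain ⟨h1, h2⟩ := hn
  rw [Real.norm_of_nonneg (Real.rpow_nonneg (Real.log_nonneg h2) _),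
    Real.norm_of_nonneg (by positivity)] at h1
  exact h1

theorem eventually_le_log (K : ℝ) : ∀ᶠ n : ℕ in atTop, K ≤ Real.log n :=
  (Real.tendsto_log_atTop.comp tendsto_natCast_atTop_atTop).eventually_ge_atTop K

theorem eventually_le_log_log (K : ℝ) : ∀ᶠ n : ℕ in atTop, K ≤ Real.log (Real.log n) :=
  (Real.tendsto_log_atTop.comp
    (Real.tendsto_log_atTop.comp tendsto_natCast_atTop_atTop)).eventually_ge_atTop K

theorem eventually_le_natCast (K : ℝ) : ∀ᶠ n : ℕ in atTop, K ≤ (n : ℝ) :=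
  tendsto_natCast_atTop_atTop.eventually_ge_atTop K

/-! ### Grids of cutoffs for ordinary smooth and for supersmooth noise -/

/-- The cutoffs are the integers up to about `n^{1/3}`. The variances are polynomial in the cutoff,
so the weights are of order `1 + log s`, which is the price of selection. The range satisfies the
Bernstein condition, because weight times cutoff is `O(n^{2/3})`, and it contains the Sobolev
balancing frequencies because `2b + 2γ > 3`. -/
theorem attained_of_ordinary_grid {f : ℝ → ℝ} {γ α ρ : ℝ} (hf : IsNoise f γ α ρ) (hρ : ρ = 0)
    (x₀ : ℝ) {Λ : Set Smoothness} (hΛ : ∀ l ∈ Λ, Admissible l) {φ2 : ℕ → Smoothness → ℝ} (C : ℝ)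
    (h : ∀ᶠ n : ℕ in atTop, ∀ l ∈ Λ, ∃ s : ℕ, 1 ≤ s ∧ (s : ℝ) ≤ (n : ℝ) ^ (1 / 3 : ℝ) + 1 ∧
      ∀ g ∈ smoothClass l, tailInt g s ^ 2 + (1 + Real.log s) * (s : ℝ) ^ (2 * γ + 1) / n ≤
        C * φ2 n l) :
    Attained f x₀ Λ φ2 := by
  obtain ⟨hα, hγ⟩ := hf.ordinary hρ
  obtain ⟨C₀, hC₀, hvar⟩ := hf.exists_variance_le
  simp only [hα, mul_zero, zero_mul, Real.exp_zero, mul_one] at hvar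
  have hD := hf.integral_norm_ft_pos
  set D := ∫ y, ‖ft f y‖ with hDdef
  set Cv := max C₀ 1 with hCv
  have hCv1 : 1 ≤ Cv := le_max_right _ _
  set v : ℕ → ℝ := fun k => Cv * ((k : ℝ) + 1) ^ (2 * γ + 1) with hv
  set A := 1 + Real.log Cv + (2 * γ + 3) with hA
  have hlogCv := Real.log_nonneg hCv1
  have hA1 : 1 ≤ A := by linarith
  have hk1 : ∀ k : ℕ, (1 : ℝ) ≤ (k : ℝ) + 1 := fun k => by linarith [Nat.cast_nonneg (α := ℝ) k]
  have hgw : ∀ k, gridWeight v k ≤ A * (1 + Real.log ((k : ℝ) + 1)) := by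
    intro k
    have h0 := hk1 k
    have hl : 0 ≤ Real.log ((k : ℝ) + 1) := Real.log_nonneg h0
    have e : gridWeight v k = 1 + Real.log Cv + (2 * γ + 3) * Real.log ((k : ℝ) + 1) := by
      simp only [gridWeight, hv]
      rw [Real.log_mul (by positivity) (by positivity), Real.log_rpow (by positivity)]
      ring
    rw [e, hA]
    nlinarith
  have hv1 : ∀ k, 1 ≤ v k := fun k =>
    one_le_mul_of_one_le_of_one_le hCv1 (Real.one_le_rpow (hk1 k) (by linarith))
  refine attained_of_grid hf x₀ hΛ (M := fun k => (k : ℝ) + 1) (v := v)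
    (N := fun n => ⌊(n : ℝ) ^ (1 / 3 : ℝ)⌋₊) ((1 + A * Cv) * C) (fun k => by positivity)
    (fun a b hab => by have : (a : ℝ) ≤ b := by exact_mod_cast hab
                       simpa using this) hv1 ?_ ?_ ?_ ?_
  · intro a b hab
    have : (a : ℝ) ≤ b := by exact_mod_cast hab
    simp only [hv]
    gcongr
  · intro k
    refine (hvar _ (hk1 k)).trans ?_
    simp only [hv]
    gcongr
    exact le_max_left _ _
  · filter_upwards [(tendsto_rpow_atTop (by norm_num : (0 : ℝ) < 1 / 3)).comp
      tendsto_natCast_atTop_atTop |>.eventually_ge_atTop (max 1 (32 * A / D))] with n hn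
    simp only [Function.comp] at hn
    set y := (n : ℝ) ^ (1 / 3 : ℝ) with hy
    have hy1 : 1 ≤ y := (le_max_left _ _).trans hn
    have hy2 : 32 * A / D ≤ y := (le_max_right _ _).trans hn
    rw [div_le_iff₀ hD] at hy2
    have hy3 : y ^ 3 = n := by
      rw [hy, ← Real.rpow_natCast, ← Real.rpow_mul (by positivity)]
      norm_num
    set k := ⌊y⌋₊ with hk
    have hky : (k : ℝ) ≤ y := Nat.floor_le (by linarith)
    have h0 := hk1 k
    have hlog : 1 + Real.log ((k : ℝ) + 1) ≤ (k : ℝ) + 1 := by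
      linarith [Real.log_le_sub_one_of_pos (by positivity : (0 : ℝ) < (k : ℝ) + 1)]
    calc 8 * gridWeight v k * ((k : ℝ) + 1) ≤ 8 * (A * ((k : ℝ) + 1)) * ((k : ℝ) + 1) := by
          gcongr
          exact (hgw k).trans (by gcongr)
      _ ≤ 8 * (A * (2 * y)) * (2 * y) := by gcongr <;> linarith
      _ = (32 * A) * y ^ 2 := by ring
      _ ≤ (y * D) * y ^ 2 := by gcongr
      _ = n * D := by rw [← hy3]; ring
  · filter_upwards [h, eventually_gt_atTop 0] with n hn hn0 l hl
    obtain ⟨s, hs1, hsn, hs⟩ := hn l hl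
    have hn' : (0 : ℝ) < n := by exact_mod_cast hn0
    have hcast : ((s - 1 : ℕ) : ℝ) + 1 = s := by
      rw [Nat.cast_sub hs1]; push_cast; ring
    -- Index `k` carries the cutoff `k + 1`, so the cutoff `s` sits at index `s - 1`; this is why
    -- `s` may exceed `n^{1/3}` by one.
    refine ⟨s - 1, Nat.le_floor (by linarith), fun g hg => ?_⟩
    have hsg := hs g hg
    have hw := hgw (s - 1)
    have hs1' : (1 : ℝ) ≤ s := by exact_mod_cast hs1
    have hlog := Real.log_nonneg hs1'
    rw [hcast] at hw ⊢
    have hX : 0 ≤ (1 + Real.log s) * (s : ℝ) ^ (2 * γ + 1) / n := by positivity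
    have h2 : gridWeight v (s - 1) * v (s - 1) / n ≤
        A * Cv * ((1 + Real.log s) * (s : ℝ) ^ (2 * γ + 1) / n) := by
      simp only [hv]
      rw [hcast]
      calc _ ≤ A * (1 + Real.log s) * (Cv * (s : ℝ) ^ (2 * γ + 1)) / n := by gcongr
        _ = _ := by ring
    have hAC : 0 ≤ A * Cv := by positivity
    nlinarith [sq_nonneg (tailInt g s)]

/-- The cutoffs are `s^{1/ρ}` with `s` an integer, so the exponential `e^{2αM^ρ}` grows by the
constant factor `e^{2α}` from one to the next. The weights are of order `s = M^ρ`, which raises the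
power of `s` from `q` to `q + 1`. The range up to `(log n)²` contains the values `s = O(log n)` that
matter, while weight times cutoff stays polylogarithmic. -/
theorem attained_of_supersmooth_grid {f : ℝ → ℝ} {γ α ρ : ℝ} (hf : IsNoise f γ α ρ) (hρ : 0 < ρ)
    (x₀ : ℝ) {Λ : Set Smoothness} (hΛ : ∀ l ∈ Λ, Admissible l) {φ2 : ℕ → Smoothness → ℝ} {q : ℝ}
    (hq : 0 ≤ q) (hvar : ∃ C₀ : ℝ, 0 < C₀ ∧ ∀ M : ℝ, 1 ≤ M → (∫ y, ‖ft f y‖) * invSqInt f M ≤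
      C₀ * (M ^ (q * ρ) * Real.exp (2 * α * M ^ ρ))) (C : ℝ)
    (h : ∀ᶠ n : ℕ in atTop, ∀ l ∈ Λ, ∃ s : ℕ, 1 ≤ s ∧ (s : ℝ) ≤ Real.log n ^ (2 : ℝ) ∧
      ∀ g ∈ smoothClass l, tailInt g ((s : ℝ) ^ (1 / ρ)) ^ 2 +
        (s : ℝ) ^ (q + 1) * Real.exp (2 * α * s) / n ≤ C * φ2 n l) :
    Attained f x₀ Λ φ2 := by
  have hα := hf.alpha_pos hρ
  obtain ⟨C₀, hC₀, hvar⟩ := hvar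
  have hD := hf.integral_norm_ft_pos
  set D := ∫ y, ‖ft f y‖ with hDdef
  set Cv := max C₀ 1 with hCv
  have hCv1 : 1 ≤ Cv := le_max_right _ _
  set v : ℕ → ℝ := fun k => Cv * (((k : ℝ) + 1) ^ q * Real.exp (2 * α * ((k : ℝ) + 1))) with hv
  set A := 1 + Real.log Cv + q + 2 * α + 2 with hA
  have hlogCv := Real.log_nonneg hCv1
  have hA1 : 1 ≤ A := by linarith
  have hk1 : ∀ k : ℕ, (1 : ℝ) ≤ (k : ℝ) + 1 := fun k => by linarith [Nat.cast_nonneg (α := ℝ) k]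
  have hgw : ∀ k, gridWeight v k ≤ A * ((k : ℝ) + 1) := by
    intro k
    have h0 := hk1 k
    have hl : Real.log ((k : ℝ) + 1) ≤ (k : ℝ) + 1 :=
      (Real.log_le_sub_one_of_pos (by positivity)).trans (by linarith)
    have e : gridWeight v k = 1 + Real.log Cv + (q + 2) * Real.log ((k : ℝ) + 1) +
        2 * α * ((k : ℝ) + 1) := by
      simp only [gridWeight, hv]
      rw [Real.log_mul (by positivity) (by positivity), Real.log_mul (by positivity)
        (Real.exp_pos _).ne', Real.log_rpow (by positivity), Real.log_exp]
      ring
    rw [e, hA]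
    nlinarith
  have hv1 : ∀ k, 1 ≤ v k := fun k =>
    one_le_mul_of_one_le_of_one_le hCv1 (one_le_mul_of_one_le_of_one_le
      (Real.one_le_rpow (hk1 k) hq) (Real.one_le_exp (by positivity)))
  have hMρ : ∀ k : ℕ, (((k : ℝ) + 1) ^ (1 / ρ)) ^ ρ = (k : ℝ) + 1 := fun k => by
    rw [← Real.rpow_mul (by positivity), one_div, inv_mul_cancel₀ hρ.ne', Real.rpow_one]
  refine attained_of_grid hf x₀ hΛ (M := fun k => ((k : ℝ) + 1) ^ (1 / ρ)) (v := v)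
    (N := fun n => ⌊Real.log n ^ (2 : ℝ)⌋₊) ((1 + A * Cv) * C) (fun k => by positivity)
    ?_ hv1 ?_ ?_ ?_ ?_
  · intro a b hab
    have : (a : ℝ) ≤ b := by exact_mod_cast hab
    simp only
    gcongr
  · intro a b hab
    have : (a : ℝ) ≤ b := by exact_mod_cast hab
    simp only [hv]
    gcongr
  · intro k
    refine (hvar _ (Real.one_le_rpow (hk1 k) (by positivity))).trans ?_
    rw [mul_comm q ρ, Real.rpow_mul (by positivity), hMρ]
    simp only [hv]
    gcongr
    exact le_max_left _ _
  · have hc : 0 < D / (8 * A * 2 ^ (1 + 1 / ρ)) := by positivity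
    filter_upwards [eventually_log_rpow_le (2 * (1 + 1 / ρ)) hc one_pos,
      eventually_le_log 1] with n hn hlog
    set y := Real.log n ^ (2 : ℝ) with hy
    have hy1 : 1 ≤ y := Real.one_le_rpow hlog (by norm_num)
    set k := ⌊y⌋₊ with hk
    have hky : (k : ℝ) ≤ y := Nat.floor_le (by linarith)
    rw [Real.rpow_mul (by linarith), ← hy, Real.rpow_one] at hn
    calc 8 * gridWeight v k * ((k : ℝ) + 1) ^ (1 / ρ)
        ≤ 8 * (A * ((k : ℝ) + 1)) * ((k : ℝ) + 1) ^ (1 / ρ) := by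
          gcongr
          exact hgw k
      _ = 8 * A * ((k : ℝ) + 1) ^ (1 + 1 / ρ) := by
          rw [Real.rpow_add (by positivity), Real.rpow_one]; ring
      _ ≤ 8 * A * (2 * y) ^ (1 + 1 / ρ) := by
          gcongr
          linarith
      _ = 8 * A * 2 ^ (1 + 1 / ρ) * y ^ (1 + 1 / ρ) := by
          rw [Real.mul_rpow (by norm_num) (by linarith)]; ring
      _ ≤ 8 * A * 2 ^ (1 + 1 / ρ) * (D / (8 * A * 2 ^ (1 + 1 / ρ)) * n) := by gcongr
      _ = n * D := by field_simp
  · filter_upwards [h, eventually_gt_atTop 0] with n hn hn0 l hl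
    obtain ⟨s, hs1, hsn, hs⟩ := hn l hl
    have hn' : (0 : ℝ) < n := by exact_mod_cast hn0
    have hcast : ((s - 1 : ℕ) : ℝ) + 1 = s := by
      rw [Nat.cast_sub hs1]; push_cast; ring
    have hs1' : (1 : ℝ) ≤ s := by exact_mod_cast hs1
    refine ⟨s - 1, Nat.le_floor (by linarith), fun g hg => ?_⟩
    have hsg := hs g hg
    have hw := hgw (s - 1)
    rw [hcast] at hw ⊢
    have hX : 0 ≤ (s : ℝ) ^ (q + 1) * Real.exp (2 * α * s) / n := by positivity
    have h2 : gridWeight v (s - 1) * v (s - 1) / n ≤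
        A * Cv * ((s : ℝ) ^ (q + 1) * Real.exp (2 * α * s) / n) := by
      simp only [hv]
      rw [hcast, Real.rpow_add (by positivity), Real.rpow_one]
      calc _ ≤ A * s * (Cv * ((s : ℝ) ^ q * Real.exp (2 * α * s))) / n := by gcongr
        _ = _ := by ring
    have hAC : 0 ≤ A * Cv := by positivity
    nlinarith [sq_nonneg (tailInt g ((s : ℝ) ^ (1 / ρ)))]

/-! ### Upper bounds for ordinary smooth noise and for Sobolev classes -/

theorem natCeil_le_two_mul {t : ℝ} (ht : 1 ≤ t) : (⌈t⌉₊ : ℝ) ≤ 2 * t := by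
  linarith [Nat.ceil_lt_add_one (by linarith : 0 ≤ t)]

/-- The cutoff `t = (n / log n)^{1/(2b+2γ)}` balances the squared bias `t^{1-2b}` against the
penalised variance `t^{2γ+1} log n / n`; rounding it up to a grid point costs only a constant. -/
theorem attained_sobolev_ordinary {f : ℝ → ℝ} {γ α ρ : ℝ} (hf : IsNoise f γ α ρ) (hρ : ρ = 0)
    (x₀ : ℝ) {lo hi : Smoothness} (hbox : SobolevBox lo hi) :
    Attained f x₀ (box lo hi) (rateSobOrd γ) := by
  obtain ⟨hα, hγ⟩ := hf.ordinary hρ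
  have hb0 := hbox.b_pos
  have hL0 := hbox.L_pos
  have hLL := hbox.L_le
  set K := 4 * Real.pi * hi.L / (2 * lo.b - 1) with hK
  refine attained_of_ordinary_grid hf hρ x₀ (fun l hl => hbox.admissible hl)
    (K + 2 * 2 ^ (2 * γ + 1)) ?_
  filter_upwards [eventually_le_log 1, eventually_le_natCast 1] with n hlog hn1 l hl
  obtain ⟨hLl, hcase⟩ := hbox.admissible hl
  obtain ⟨⟨hb, _⟩, ⟨ha, ha'⟩, ⟨hr, hr'⟩, ⟨_, hL⟩⟩ := hl
  rw [hbox.lo_a] at ha; rw [hbox.hi_a] at ha'; rw [hbox.lo_r] at hr; rw [hbox.hi_r] at hr'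
  have ha0 : l.a = 0 := le_antisymm ha' ha
  have hr0 : l.r = 0 := le_antisymm hr' hr
  have hn0 : (0 : ℝ) < n := by linarith
  set u := (n : ℝ) / Real.log n with hu
  have hun : u ≤ n := div_le_self hn0.le hlog
  have hu1 : 1 ≤ u := by
    rw [hu, one_le_div (by linarith)]
    linarith [Real.log_le_sub_one_of_pos hn0]
  have hu0 : 0 < u := by linarith
  set e := 2 * l.b + 2 * γ with he
  have he3 : 3 ≤ e := by linarith
  set t := u ^ (1 / e) with ht
  have ht1 : 1 ≤ t := Real.one_le_rpow hu1 (by positivity)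
  have ht0 : 0 < t := by linarith
  have htn : t ≤ (n : ℝ) ^ (1 / 3 : ℝ) := by
    calc t ≤ u ^ (1 / 3 : ℝ) := Real.rpow_le_rpow_of_exponent_le hu1
          (one_div_le_one_div_of_le (by norm_num) he3)
      _ ≤ _ := Real.rpow_le_rpow hu0.le hun (by norm_num)
  have htn' : t ≤ n := by
    calc t ≤ u ^ (1 : ℝ) := Real.rpow_le_rpow_of_exponent_le hu1
          ((div_le_one (by linarith)).2 (by linarith))
      _ ≤ n := by rwa [Real.rpow_one]
  have hpow : ∀ p : ℝ, t ^ p = u ^ (p / e) := fun p => by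
    rw [ht, ← Real.rpow_mul hu0.le]; congr 1; ring
  have hts : t ≤ (⌈t⌉₊ : ℝ) := Nat.le_ceil t
  have hs1 : (1 : ℝ) ≤ (⌈t⌉₊ : ℝ) := ht1.trans hts
  refine ⟨⌈t⌉₊, by exact_mod_cast hs1, ?_, fun g hg => ?_⟩
  · linarith [Nat.ceil_lt_add_one ht0.le]
  have hrate : rateSobOrd γ n l = t ^ (-(2 * l.b - 1)) := by
    rw [rateSobOrd, hpow]
  rw [hrate]
  have h1 : tailInt g (⌈t⌉₊ : ℝ) ^ 2 ≤ K * t ^ (-(2 * l.b - 1)) := by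
    refine (tailInt_sq_le_sobolev hLl ha0 hr0 (by linarith) hg (by linarith)).trans ?_
    have : (⌈t⌉₊ : ℝ) ^ (-(2 * l.b - 1)) ≤ t ^ (-(2 * l.b - 1)) :=
      Real.rpow_le_rpow_of_nonpos ht0 hts (by linarith)
    have hd : 0 < 2 * lo.b - 1 := by linarith
    have hhi : 0 < hi.L := by linarith
    rw [hK]
    gcongr
  have h2 : (1 + Real.log (⌈t⌉₊ : ℝ)) * (⌈t⌉₊ : ℝ) ^ (2 * γ + 1) / n ≤
      2 * 2 ^ (2 * γ + 1) * t ^ (-(2 * l.b - 1)) := by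
    have hsn : (⌈t⌉₊ : ℝ) ≤ n := by exact_mod_cast Nat.ceil_le.2 htn'
    have hl1 : Real.log (⌈t⌉₊ : ℝ) ≤ Real.log n := Real.log_le_log (by linarith) hsn
    -- The defining equation of `t`: the variance `t^{2γ+1} log n / n` becomes the same power of `t`
    -- as the bias.
    have hinv : Real.log n / n = t ^ (-e) := by
      rw [hpow, neg_div, div_self (by linarith), Real.rpow_neg_one, hu, inv_div]
    calc _ ≤ (2 * Real.log n) * (2 * t) ^ (2 * γ + 1) / n := by
          gcongr
          · linarith
          · exact natCeil_le_two_mul ht1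
      _ = 2 * 2 ^ (2 * γ + 1) * (t ^ (2 * γ + 1) * (Real.log n / n)) := by
          rw [Real.mul_rpow (by norm_num) ht0.le]; ring
      _ = _ := by
          rw [hinv, ← Real.rpow_add ht0]
          congr 2
          rw [he]; ring
  rw [add_mul K]
  exact add_le_add h1 h2

/-- The bias bound for one class holds only beyond a threshold depending on `a` and `r`. The corner
`lo` of the box gives a threshold valid for all classes at once. -/
theorem SupersmoothBox.exists_tailInt_sq_le {lo hi : Smoothness} (h : SupersmoothBox lo hi) :
    ∃ K M₀ : ℝ, 0 < K ∧ 1 ≤ M₀ ∧ ∀ l ∈ box lo hi, ∀ g ∈ smoothClass l, ∀ M : ℝ, M₀ ≤ M →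
      tailInt g M ^ 2 ≤ K * (M ^ (-2 * l.b + 1 - l.r) * Real.exp (-2 * l.a * M ^ l.r)) := by
  have ha0 := h.a_pos
  have hr0 := h.r_pos
  have hL0 := h.L_pos
  have hLL := h.L_le
  have hhi : 0 < hi.L := by linarith
  -- The second entry solves `M^{-r} = a r` at the lower corner; the maximum with `1` makes larger
  -- `r` only help.
  set M₀ := max 1 ((lo.a * lo.r) ^ (-(1 / lo.r))) with hM₀
  have hM₀1 : 1 ≤ M₀ := le_max_left _ _
  refine ⟨4 * Real.pi * hi.L / (lo.a * lo.r), M₀, by positivity, hM₀1, ?_⟩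
  intro l hl g hg M hM
  obtain ⟨⟨hb, _⟩, ⟨ha, _⟩, ⟨hr, _⟩, ⟨hL, hL'⟩⟩ := hl
  have hb0 := h.b_nonneg
  have hla : 0 ≤ l.a := by linarith
  have hM0 : 0 < M := by linarith
  have hMr : M ^ (-l.r) ≤ l.a * l.r := by
    calc M ^ (-l.r) ≤ M ^ (-lo.r) :=
          Real.rpow_le_rpow_of_exponent_le (hM₀1.trans hM) (by linarith)
      _ ≤ ((lo.a * lo.r) ^ (-(1 / lo.r))) ^ (-lo.r) :=
          Real.rpow_le_rpow_of_nonpos (by positivity) ((le_max_right _ _).trans hM) (by linarith)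
      _ = lo.a * lo.r := by
          rw [← Real.rpow_mul (by positivity)]
          have : -(1 / lo.r) * -lo.r = 1 := by field_simp
          rw [this, Real.rpow_one]
      _ ≤ l.a * l.r := by gcongr
  refine (tailInt_sq_le_supersmooth (by linarith) (by linarith) (by linarith) (by linarith) hg hM0
    hMr).trans ?_
  have : 0 ≤ M ^ (-2 * l.b + 1 - l.r) * Real.exp (-2 * l.a * M ^ l.r) := by positivity
  gcongr

/-- Applied with `y = log n`: a cutoff which is a power of `log n` has logarithm of order `log log
n`, uniformly in the class. This is where the iterated logarithm of the rate comes from. -/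
theorem one_add_log_le {y c r r₀ u s : ℝ} (hr₀ : 0 < r₀) (hr : r₀ ≤ r) (hc : 0 < c) (hu1 : 1 ≤ u)
    (hu : u ≤ y / c) (hy : 1 ≤ Real.log y) (hs : 1 ≤ s) (hs2 : s ≤ 2 * u ^ (1 / r)) :
    1 + Real.log s ≤ (2 + (1 + |Real.log c|) / r₀) * Real.log y := by
  have hu0 : 0 < u := by linarith
  have hr1 : 0 < r := by linarith
  have hy0 : 0 < y := by
    have : 0 < y / c := by linarith
    exact (div_pos_iff_of_pos_right hc).1 this
  have h3 : Real.log s ≤ Real.log 2 + 1 / r * Real.log u := by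
    rw [← Real.log_rpow hu0, ← Real.log_mul (by norm_num) (by positivity)]
    exact Real.log_le_log (by linarith) hs2
  have h5 : Real.log u ≤ Real.log y - Real.log c := by
    rw [← Real.log_div hy0.ne' hc.ne']
    exact Real.log_le_log hu0 hu
  have h6 : Real.log u ≤ (1 + |Real.log c|) * Real.log y := by
    nlinarith [neg_abs_le (Real.log c), abs_nonneg (Real.log c)]
  have h7 : 1 / r * Real.log u ≤ 1 / r₀ * ((1 + |Real.log c|) * Real.log y) := by
    have := Real.log_nonneg hu1
    gcongr
  have h8 : Real.log 2 ≤ 1 := by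
    linarith [Real.log_le_sub_one_of_pos (by norm_num : (0 : ℝ) < 2)]
  have e : (2 + (1 + |Real.log c|) / r₀) * Real.log y = 2 * Real.log y +
    1 / r₀ * ((1 + |Real.log c|) * Real.log y) := by ring
  rw [e]
  linarith

/-- At the frequency `t` with `2a t^r = log n` the exponential factor of the squared bias is `1/n`,
so the bias is dominated by the variance, of order `(log n)^{(2γ+1)/r}/n`. Only the selection weight
is added. -/
theorem attained_supersmooth_ordinary {f : ℝ → ℝ} {γ α ρ : ℝ} (hf : IsNoise f γ α ρ) (hρ : ρ = 0)
    (x₀ : ℝ) {lo hi : Smoothness} (hbox : SupersmoothBox lo hi) :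
    Attained f x₀ (box lo hi) (rateSuperOrd γ) := by
  obtain ⟨hα, hγ⟩ := hf.ordinary hρ
  obtain ⟨K, M₀, hK, hM₀, htail⟩ := hbox.exists_tailInt_sq_le
  have ha0 := hbox.a_pos
  have hr0 := hbox.r_pos
  have haa := hbox.a_le
  have hb0 := hbox.b_nonneg
  have hai : 0 < hi.a := by linarith
  set P := (2 * γ + 1) / lo.r with hP
  set κ := (max (2 * lo.a) (2 * lo.a)⁻¹) ^ P with hκ
  have hκ0 : 0 < κ := by positivity
  set K₃ := 2 + (1 + |Real.log (2 * lo.a)|) / lo.r with hK₃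
  have hK₃0 : 0 < K₃ := by positivity
  refine attained_of_ordinary_grid hf hρ x₀ (fun l hl => hbox.admissible hl)
    ((K + K₃) * (2 ^ (2 * γ + 1) * κ)) ?_
  have hc : 0 < ((2 * lo.a) ^ (1 / lo.r)) := by positivity
  filter_upwards [eventually_le_log (2 * hi.a), eventually_le_log (2 * hi.a * M₀ ^ hi.r),
    eventually_log_rpow_le (1 / lo.r) hc (by norm_num : (0 : ℝ) < 1 / 3),
    eventually_le_log_log 1, eventually_le_log 1, eventually_gt_atTop 0]
    with n hy1 hy2 hy3 hll hlog hn l hl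
  obtain ⟨⟨hb, _⟩, ⟨ha, ha'⟩, ⟨hr, hr'⟩, _⟩ := id hl
  have hn0 : (0 : ℝ) < n := by exact_mod_cast hn
  set y := Real.log n with hy
  have hla : 0 < l.a := by linarith
  have hlr : 0 < l.r := by linarith
  set u := y / (2 * l.a) with hu
  have hu1 : 1 ≤ u := by rw [hu, one_le_div (by positivity)]; linarith
  have hu0 : 0 < u := by linarith
  have huu : u ≤ y / (2 * lo.a) := by rw [hu]; gcongr
  set t := u ^ (1 / l.r) with ht
  have ht1 : 1 ≤ t := Real.one_le_rpow hu1 (by positivity)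
  have ht0 : 0 < t := by linarith
  have htr : t ^ l.r = u := by
    rw [ht, ← Real.rpow_mul hu0.le, one_div, inv_mul_cancel₀ hlr.ne', Real.rpow_one]
  have htn : t ≤ (n : ℝ) ^ (1 / 3 : ℝ) := by
    calc t ≤ u ^ (1 / lo.r) := Real.rpow_le_rpow_of_exponent_le hu1
          (one_div_le_one_div_of_le hr0 hr)
      _ ≤ (y / (2 * lo.a)) ^ (1 / lo.r) := Real.rpow_le_rpow hu0.le huu (by positivity)
      _ = y ^ (1 / lo.r) / (2 * lo.a) ^ (1 / lo.r) := Real.div_rpow (by linarith) (by positivity) _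
      _ ≤ _ := by rw [div_le_iff₀ hc, mul_comm]; exact hy3
  have htM : M₀ ≤ t := by
    have h1 : M₀ ^ l.r ≤ t ^ l.r := by
      rw [htr, hu, le_div_iff₀ (by positivity)]
      refine le_trans ?_ hy2
      rw [mul_comm]
      have : M₀ ^ l.r ≤ M₀ ^ hi.r := Real.rpow_le_rpow_of_exponent_le hM₀ hr'
      gcongr
    exact (Real.rpow_le_rpow_iff (by linarith) ht0.le hlr).1 h1
  have hts : t ≤ (⌈t⌉₊ : ℝ) := Nat.le_ceil t
  have hs1 : (1 : ℝ) ≤ (⌈t⌉₊ : ℝ) := ht1.trans hts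
  have hs2 := natCeil_le_two_mul ht1
  set s := ⌈t⌉₊ with hs
  refine ⟨s, by exact_mod_cast hs1, ?_, fun g hg => ?_⟩
  · linarith [Nat.ceil_lt_add_one ht0.le]
  have htpow : t ^ (2 * γ + 1) ≤ κ * y ^ ((2 * γ + 1) / l.r) := by
    have e : t ^ (2 * γ + 1) = u ^ ((2 * γ + 1) / l.r) := by
      rw [ht, ← Real.rpow_mul hu0.le]; congr 1; ring
    rw [e]
    calc u ^ ((2 * γ + 1) / l.r) ≤ (y / (2 * lo.a)) ^ ((2 * γ + 1) / l.r) :=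
          Real.rpow_le_rpow hu0.le huu (by positivity)
      _ = (2 * lo.a)⁻¹ ^ ((2 * γ + 1) / l.r) * y ^ ((2 * γ + 1) / l.r) := by
          rw [div_eq_inv_mul, Real.mul_rpow (by positivity) (by linarith)]
      _ ≤ κ * y ^ ((2 * γ + 1) / l.r) := by
          have h1 := rpow_le_of_abs_le (c := (2 * lo.a)⁻¹) (p := (2 * γ + 1) / l.r) (P := P)
            (by positivity) (by
              rw [abs_of_pos (by positivity), hP]
              gcongr)
          rw [inv_inv, max_comm] at h1
          gcongr
  have hspow : (s : ℝ) ^ (2 * γ + 1) ≤ 2 ^ (2 * γ + 1) * κ * y ^ ((2 * γ + 1) / l.r) := by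
    calc (s : ℝ) ^ (2 * γ + 1) ≤ (2 * t) ^ (2 * γ + 1) := by gcongr
      _ = 2 ^ (2 * γ + 1) * t ^ (2 * γ + 1) := Real.mul_rpow (by norm_num) ht0.le
      _ ≤ 2 ^ (2 * γ + 1) * (κ * y ^ ((2 * γ + 1) / l.r)) := by gcongr
      _ = _ := by ring
  have h1 : tailInt g s ^ 2 ≤ K * (2 ^ (2 * γ + 1) * κ) * rateSuperOrd γ n l := by
    refine (htail l hl g hg s (htM.trans hts)).trans ?_
    have e1 : Real.exp (-2 * l.a * (s : ℝ) ^ l.r) ≤ 1 / n := by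
      have : u ≤ (s : ℝ) ^ l.r := by rw [← htr]; gcongr
      have e : (1 : ℝ) / n = Real.exp (-y) := by
        rw [Real.exp_neg, hy, Real.exp_log hn0, one_div]
      rw [e, Real.exp_le_exp]
      have : y = 2 * l.a * u := by rw [hu]; field_simp
      nlinarith
    have e2 : (s : ℝ) ^ (-2 * l.b + 1 - l.r) ≤ (s : ℝ) ^ (2 * γ + 1) :=
      Real.rpow_le_rpow_of_exponent_le hs1 (by linarith)
    calc _ ≤ K * ((2 ^ (2 * γ + 1) * κ * y ^ ((2 * γ + 1) / l.r)) * (1 / n)) := by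
          gcongr
          exact e2.trans hspow
      _ = K * (2 ^ (2 * γ + 1) * κ) * (1 * y ^ ((2 * γ + 1) / l.r) / n) := by ring
      _ ≤ _ := by
          rw [rateSuperOrd]
          gcongr
  have h2 : (1 + Real.log s) * (s : ℝ) ^ (2 * γ + 1) / n ≤
      K₃ * (2 ^ (2 * γ + 1) * κ) * rateSuperOrd γ n l := by
    have hlogs := one_add_log_le hr0 hr (by positivity) hu1 huu hll hs1 hs2
    calc _ ≤ (K₃ * Real.log y) * (2 ^ (2 * γ + 1) * κ * y ^ ((2 * γ + 1) / l.r)) / n := by gcongr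
      _ = _ := by rw [rateSuperOrd]; ring
  calc _ ≤ _ := add_le_add h1 h2
    _ = _ := by ring

/-- No selection is needed: the bias is a negative power of `log n`, so every class may use the same
cutoff, at which the variance is a negative power of `n` up to logarithms. A constant factor in
`M^ρ` changes the bias only by a constant. -/
theorem attained_sobolev_supersmooth {f : ℝ → ℝ} {γ α ρ : ℝ} (hf : IsNoise f γ α ρ) (hρ : 0 < ρ)
    (x₀ : ℝ) {lo hi : Smoothness} (hbox : SobolevBox lo hi) :
    Attained f x₀ (box lo hi) (rateSobSuper ρ) := by
  have hα := hf.alpha_pos hρ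
  have hγ := hf.gamma_nonneg
  obtain ⟨C₀, hC₀, hvar⟩ := hf.exists_variance_le
  have hD := hf.integral_norm_ft_pos
  have hb0 := hbox.b_pos
  have hbb := hbox.b_le
  have hL0 := hbox.L_pos
  have hLL := hbox.L_le
  have hhi : 0 < hi.L := by linarith
  have hd : 0 < 2 * lo.b - 1 := by linarith
  set K := 4 * Real.pi * hi.L / (2 * lo.b - 1) with hK
  have hK0 : 0 < K := by positivity
  -- With `M^ρ = log n / (4α)` the exponential in the variance is `n^{1/2}`, half of what `n` could
  -- afford; the slack absorbs every power of `log n`.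
  set k := 1 / (4 * α) with hk
  have hk0 : 0 < k := by positivity
  set M : ℕ → ℝ := fun n => (k * Real.log n) ^ (1 / ρ) with hM
  set v : ℕ → ℝ := fun n => C₀ * ((M n) ^ (2 * γ + 1) * Real.exp (2 * α * (M n) ^ ρ)) with hv
  set P := (2 * hi.b - 1) / ρ with hP
  set κ := (max k k⁻¹) ^ P with hκ
  have hMρ : ∀ n : ℕ, 0 ≤ Real.log n → (M n) ^ ρ = k * Real.log n := fun n hn => by
    rw [hM, ← Real.rpow_mul (by positivity), one_div, inv_mul_cancel₀ hρ.ne', Real.rpow_one]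
  refine attained_of_cutoff hf x₀ (fun l hl => hbox.admissible hl) M v (K * κ + 1) ?_ ?_
  · have hc : 0 < (∫ y, ‖ft f y‖) / (8 * k ^ (1 / ρ)) := by positivity
    filter_upwards [eventually_le_log k⁻¹, eventually_log_rpow_le (1 / ρ) hc one_pos] with n h1 h2
    have hy0 : 0 < Real.log n := lt_of_lt_of_le (by positivity) h1
    have hM1 : 1 ≤ M n := by
      refine Real.one_le_rpow ?_ (by positivity)
      rwa [inv_le_iff_one_le_mul₀ hk0, mul_comm] at h1
    have hM0 : 0 < M n := by linarith
    refine ⟨hM0, by simp only [hv]; positivity, hvar _ hM1, ?_⟩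
    simp only [hM]
    rw [Real.mul_rpow hk0.le hy0.le]
    rw [Real.rpow_one] at h2
    calc 8 * (k ^ (1 / ρ) * Real.log n ^ (1 / ρ)) ≤
        8 * (k ^ (1 / ρ) * ((∫ y, ‖ft f y‖) / (8 * k ^ (1 / ρ)) * n)) := by gcongr
      _ = _ := by field_simp
  · set Q := (2 * γ + 1) / ρ with hQ
    have hc : 0 < 1 / (C₀ * k ^ Q) := by positivity
    filter_upwards [eventually_le_log 1, eventually_log_rpow_le (Q + P) hc
      (by norm_num : (0 : ℝ) < 1 / 2), eventually_gt_atTop 0] with n h1 h2 hn l hl g hg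
    obtain ⟨hLl, -⟩ := hbox.admissible hl
    obtain ⟨⟨hb, hb'⟩, ⟨ha, ha'⟩, ⟨hr, hr'⟩, ⟨_, hL⟩⟩ := hl
    rw [hbox.lo_a] at ha; rw [hbox.hi_a] at ha'; rw [hbox.lo_r] at hr; rw [hbox.hi_r] at hr'
    have ha0 : l.a = 0 := le_antisymm ha' ha
    have hr0 : l.r = 0 := le_antisymm hr' hr
    have hn0 : (0 : ℝ) < n := by exact_mod_cast hn
    set y := Real.log n with hy
    have hy0 : 0 < y := by linarith
    have hM0 : 0 < M n := by simp only [hM]; positivity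
    have hMpow : ∀ p : ℝ, (M n) ^ p = k ^ (p / ρ) * y ^ (p / ρ) := fun p => by
      simp only [hM]
      rw [← Real.mul_rpow hk0.le hy0.le, ← Real.rpow_mul (by positivity)]
      congr 1; ring
    have hexp : Real.exp (2 * α * (M n) ^ ρ) = (n : ℝ) ^ (1 / 2 : ℝ) := by
      rw [hMρ n hy0.le, Real.rpow_def_of_pos hn0, ← hy, hk]
      congr 1
      field_simp
      norm_num
    have hrate : rateSobSuper ρ n l = y ^ (-(2 * l.b - 1) / ρ) := rfl
    have t1 : tailInt g (M n) ^ 2 ≤ K * κ * rateSobSuper ρ n l := by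
      refine (tailInt_sq_le_sobolev hLl ha0 hr0 (by linarith) hg hM0).trans ?_
      rw [hMpow, hrate, hK]
      have h3 : k ^ (-(2 * l.b - 1) / ρ) ≤ κ := by
        refine rpow_le_of_abs_le hk0 ?_
        rw [neg_div, abs_neg, abs_of_pos (div_pos (by linarith) hρ), hP]
        gcongr
      calc _ ≤ 4 * Real.pi * hi.L / (2 * lo.b - 1) * (κ * y ^ (-(2 * l.b - 1) / ρ)) := by gcongr
        _ = _ := by ring
    have t2 : v n / n ≤ 1 * rateSobSuper ρ n l := by
      simp only [hv]
      rw [hexp, hMpow, hrate, one_mul, div_le_iff₀ hn0]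
      have h4 : y ^ (Q + P) = y ^ Q * y ^ P := Real.rpow_add hy0 _ _
      have h5 : 1 ≤ y ^ P * y ^ (-(2 * l.b - 1) / ρ) := by
        rw [← Real.rpow_add hy0]
        refine Real.one_le_rpow h1 ?_
        rw [hP, ← add_div]
        exact div_nonneg (by linarith) hρ.le
      have h6 : (n : ℝ) ^ (1 / 2 : ℝ) * (n : ℝ) ^ (1 / 2 : ℝ) = n := by
        rw [← Real.rpow_add hn0]; norm_num
      rw [h4, one_div, ← div_eq_inv_mul, le_div_iff₀ (by positivity)] at h2
      have h7 : 0 < y ^ Q := by positivity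
      have h8 : 0 < (n : ℝ) ^ (1 / 2 : ℝ) := by positivity
      have h9 : 0 < y ^ (-(2 * l.b - 1) / ρ) := by positivity
      calc C₀ * (k ^ Q * y ^ Q * (n : ℝ) ^ (1 / 2 : ℝ))
          = (C₀ * k ^ Q * y ^ Q) * (n : ℝ) ^ (1 / 2 : ℝ) * 1 := by ring
        _ ≤ (C₀ * k ^ Q * y ^ Q) * (n : ℝ) ^ (1 / 2 : ℝ) *
            (y ^ P * y ^ (-(2 * l.b - 1) / ρ)) := by gcongr
        _ = (y ^ Q * y ^ P * (C₀ * k ^ Q)) * ((n : ℝ) ^ (1 / 2 : ℝ) *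
            y ^ (-(2 * l.b - 1) / ρ)) := by ring
        _ ≤ (n : ℝ) ^ (1 / 2 : ℝ) * ((n : ℝ) ^ (1 / 2 : ℝ) * y ^ (-(2 * l.b - 1) / ρ)) := by gcongr
        _ = _ := by rw [← mul_assoc, h6, mul_comm]
    rw [add_mul (K * κ)]
    exact add_le_add t1 t2

/-! ### Cutoffs, and upper bounds for supersmooth densities and noise -/

/-- Bounded sets of parameters with nonnegative `b`, `a` and `r`. -/
def ParamsWithin (Λ : Set Smoothness) (B A R : ℝ) : Prop :=
  ∀ l ∈ Λ, (0 ≤ l.b ∧ l.b ≤ B) ∧ (0 ≤ l.a ∧ l.a ≤ A) ∧ (0 ≤ l.r ∧ l.r ≤ R)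

/-- The quantity which equals `n` up to constants at the cutoff `t = πm`. -/
def cutoffFn (γ α ρ : ℝ) (l : Smoothness) (t : ℝ) : ℝ :=
  t ^ (2 * l.b + 2 * γ) * Real.exp (2 * α * t ^ ρ + 2 * l.a * t ^ l.r)

theorem SupersmoothBox.paramsWithin {lo hi : Smoothness} (h : SupersmoothBox lo hi) :
    ParamsWithin (box lo hi) hi.b hi.a hi.r := by
  intro l hl
  obtain ⟨⟨hb, hb'⟩, ⟨ha, ha'⟩, ⟨hr, hr'⟩, _⟩ := hl
  have h1 := h.b_nonneg; have h2 := h.a_pos; have h3 := h.r_pos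
  exact ⟨⟨by linarith, hb'⟩, ⟨by linarith, ha'⟩, ⟨by linarith, hr'⟩⟩

section
variable {γ α ρ B A R : ℝ} {Λ : Set Smoothness} {m : ℕ → Smoothness → ℝ}

/-- Passing from `m` to the actual frequency `πm` alters the polynomial factor by at most
`π^{2B+2γ}`, so one two-sided constant serves all classes. -/
theorem IsCutoff.exists_bounds (hγ : 0 ≤ γ) (hm : IsCutoff γ α ρ Λ m)
    (hΛ : ParamsWithin Λ B A R) :
    ∃ c : ℝ, 1 ≤ c ∧ ∀ᶠ n : ℕ in atTop, ∀ l ∈ Λ, 0 < m n l ∧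
      (n : ℝ) ≤ c * cutoffFn γ α ρ l (Real.pi * m n l) ∧
      cutoffFn γ α ρ l (Real.pi * m n l) ≤ c * n := by
  obtain ⟨c₁, c₂, hc₁, h⟩ := hm
  set κ := (Real.pi) ^ (2 * B + 2 * γ) with hκ
  have hκ0 : 0 < κ := by have := Real.pi_pos; positivity
  refine ⟨max 1 (max (κ / c₁) (κ * c₂)), le_max_left _ _, ?_⟩
  filter_upwards [h] with n hn l hl
  obtain ⟨hm0, h1, h2⟩ := hn l hl
  obtain ⟨⟨hb, hb'⟩, _⟩ := hΛ l hl
  have hpi := Real.pi_pos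
  have hpi1 : 1 ≤ Real.pi := by linarith [Real.pi_gt_three]
  have hab : |2 * l.b + 2 * γ| ≤ 2 * B + 2 * γ := by
    rw [abs_of_nonneg (by positivity)]; linarith
  have e1 : (m n l) ^ (2 * l.b + 2 * γ) ≤ κ * (Real.pi * m n l) ^ (2 * l.b + 2 * γ) :=
    rpow_le_mul_rpow hm0 (by positivity) (by nlinarith [mul_pos hpi hm0]) (by rfl) hab
  have e2 : (Real.pi * m n l) ^ (2 * l.b + 2 * γ) ≤ κ * (m n l) ^ (2 * l.b + 2 * γ) :=
    rpow_le_mul_rpow (by positivity) hm0 (by rfl) (by nlinarith [mul_pos hpi hm0]) hab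
  set E := Real.exp (2 * α * (Real.pi * m n l) ^ ρ + 2 * l.a * (Real.pi * m n l) ^ l.r) with hE
  have hE0 : 0 < E := Real.exp_pos _
  refine ⟨hm0, ?_, ?_⟩
  · have h3 : c₁ * n ≤ κ * cutoffFn γ α ρ l (Real.pi * m n l) := by
      refine h1.trans ?_
      rw [cutoffFn, ← mul_assoc]
      gcongr
    have h4 : (n : ℝ) ≤ κ / c₁ * cutoffFn γ α ρ l (Real.pi * m n l) := by
      rw [div_mul_eq_mul_div, le_div_iff₀ hc₁, mul_comm]
      exact h3
    refine h4.trans ?_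
    have : 0 ≤ cutoffFn γ α ρ l (Real.pi * m n l) := by unfold cutoffFn; positivity
    gcongr
    exact (le_max_left _ _).trans (le_max_right _ _)
  · have h3 : cutoffFn γ α ρ l (Real.pi * m n l) ≤ κ * (c₂ * n) := by
      refine le_trans ?_ (mul_le_mul_of_nonneg_left h2 hκ0.le)
      rw [cutoffFn, ← mul_assoc]
      gcongr
    refine h3.trans ?_
    rw [← mul_assoc]
    gcongr
    exact (le_max_right _ _).trans (le_max_right _ _)

/-- The cutoffs tend to infinity uniformly: on frequencies below a fixed `K` the function `cutoffFn`
is bounded over all parameters in `Λ`, whereas at the cutoff it is at least `n / c`. -/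
theorem ParamsWithin.eventually_le (hΛ : ParamsWithin Λ B A R) (hγ : 0 ≤ γ) (hα : 0 ≤ α)
    (hρ : 0 ≤ ρ) {c : ℝ} (hc : 0 < c)
    (h : ∀ᶠ n : ℕ in atTop, ∀ l ∈ Λ, 0 < m n l ∧
      (n : ℝ) ≤ c * cutoffFn γ α ρ l (Real.pi * m n l) ∧
      cutoffFn γ α ρ l (Real.pi * m n l) ≤ c * n) (K : ℝ) :
    ∀ᶠ n : ℕ in atTop, ∀ l ∈ Λ, K ≤ Real.pi * m n l := by
  set K' := max K 1 with hK'
  have hK1 : 1 ≤ K' := le_max_right _ _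
  filter_upwards [h, eventually_le_natCast (c * (K' ^ (2 * B + 2 * γ) *
    Real.exp (2 * α * K' ^ ρ + 2 * A * K' ^ R)) + 1)] with n hn hbig l hl
  obtain ⟨hm0, h1, _⟩ := hn l hl
  obtain ⟨⟨hb, hb'⟩, ⟨ha, ha'⟩, ⟨hr, hr'⟩⟩ := hΛ l hl
  have hT : 0 < Real.pi * m n l := mul_pos Real.pi_pos hm0
  refine (le_max_left K 1).trans ?_
  by_contra hcon
  push Not at hcon
  have e1 : cutoffFn γ α ρ l (Real.pi * m n l) ≤ K' ^ (2 * B + 2 * γ) *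
      Real.exp (2 * α * K' ^ ρ + 2 * A * K' ^ R) := by
    unfold cutoffFn
    have e2 : (Real.pi * m n l) ^ (2 * l.b + 2 * γ) ≤ K' ^ (2 * B + 2 * γ) :=
      (Real.rpow_le_rpow hT.le hcon.le (by positivity)).trans
        (Real.rpow_le_rpow_of_exponent_le hK1 (by linarith))
    have e3 : (Real.pi * m n l) ^ l.r ≤ K' ^ R :=
      (Real.rpow_le_rpow hT.le hcon.le hr).trans
        (Real.rpow_le_rpow_of_exponent_le hK1 hr')
    have e4 : (Real.pi * m n l) ^ ρ ≤ K' ^ ρ := Real.rpow_le_rpow hT.le hcon.le hρ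
    have : 0 ≤ A := ha.trans ha'
    gcongr
  have := mul_le_mul_of_nonneg_left e1 hc.le
  linarith

/-- Every factor of `cutoffFn` except the noise exponential is at least `1` and can be dropped.
Hence `t^ρ = O(log n)`, which puts the cutoff inside the grid and makes it negligible against `n`.
-/
theorem rpow_le_log_of_cutoff {l : Smoothness} {t c : ℝ} {n : ℕ} (hγ : 0 ≤ γ) (hb : 0 ≤ l.b)
    (ha : 0 ≤ l.a) (hα : 0 < α) (ht : 1 ≤ t) (hc : 1 ≤ c) (hn : 0 < n)
    (h : cutoffFn γ α ρ l t ≤ c * n) :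
    t ^ ρ ≤ (Real.log c + Real.log n) / (2 * α) := by
  have hn' : (0 : ℝ) < n := by exact_mod_cast hn
  rw [le_div_iff₀ (by positivity), ← Real.log_mul (by linarith) hn'.ne',
    Real.le_log_iff_exp_le (by positivity)]
  refine le_trans ?_ h
  have h1 : 1 ≤ t ^ (2 * l.b + 2 * γ) := Real.one_le_rpow ht (by positivity)
  have h2 : 0 ≤ 2 * l.a * t ^ l.r := by positivity
  calc Real.exp (t ^ ρ * (2 * α)) = 1 * Real.exp (t ^ ρ * (2 * α)) := (one_mul _).symm
    _ ≤ _ := by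
        unfold cutoffFn
        gcongr
        linarith

/-- At the cutoff the bias bound is at most the variance bound times `t^{ρ-r}`. -/
theorem bias_le_of_cutoff {l : Smoothness} {t c : ℝ} {n : ℕ} (ht : 0 < t) (hn : 0 < n)
    (h : (n : ℝ) ≤ c * cutoffFn γ α ρ l t) :
    t ^ (-2 * l.b + 1 - l.r) * Real.exp (-2 * l.a * t ^ l.r) ≤
      c * (t ^ (2 * γ + 1 - l.r) * Real.exp (2 * α * t ^ ρ) / n) := by
  have hn' : (0 : ℝ) < n := by exact_mod_cast hn
  rw [← mul_div_assoc, le_div_iff₀ hn']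
  refine (mul_le_mul_of_nonneg_left h (by positivity)).trans (le_of_eq ?_)
  unfold cutoffFn
  have e1 : t ^ (2 * γ + 1 - l.r) = t ^ (-2 * l.b + 1 - l.r) * t ^ (2 * l.b + 2 * γ) := by
    rw [← Real.rpow_add ht]; congr 1; ring
  have e2 : Real.exp (2 * α * t ^ ρ) = Real.exp (-2 * l.a * t ^ l.r) *
      Real.exp (2 * α * t ^ ρ + 2 * l.a * t ^ l.r) := by
    rw [← Real.exp_add]; congr 1; ring
  rw [e1, e2]
  ring

end

theorem varTerm_eq {γ α ρ m : ℝ} (hm : 0 < m) (n : ℕ) :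
    (Real.pi * m) ^ (2 * γ + 1 - ρ) * Real.exp (2 * α * (Real.pi * m) ^ ρ) / n =
      Real.pi ^ (2 * γ + 1 - ρ) * varTerm γ α ρ n m := by
  rw [varTerm, Real.mul_rpow Real.pi_pos.le hm.le]
  ring

/-- Minimax upper bound over one class. -/
theorem attained_single {f : ℝ → ℝ} {γ α ρ : ℝ} (hf : IsNoise f γ α ρ) (hρ : 0 < ρ) (hρ1 : ρ ≤ 1)
    (x₀ : ℝ) {l : Smoothness} (hb : 0 ≤ l.b) (ha : 0 < l.a) (hr : ρ ≤ l.r) (hL : 0 < l.L)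
    {m : ℕ → Smoothness → ℝ} (hm : IsCutoff γ α ρ {l} m) :
    Attained f x₀ {l} (fun n l => varTerm γ α ρ n (m n l)) := by
  have hα := hf.alpha_pos hρ
  have hγ := hf.gamma_nonneg
  have hr0 : 0 < l.r := by linarith
  have hbox : SupersmoothBox l l := ⟨hb, le_rfl, ha, le_rfl, hr0, le_rfl, hL, le_rfl⟩
  have hmem : l ∈ box l l := ⟨⟨le_rfl, le_rfl⟩, ⟨le_rfl, le_rfl⟩, ⟨le_rfl, le_rfl⟩, le_rfl, le_rfl⟩
  obtain ⟨C₀, hC₀, hvar⟩ := hf.exists_variance_le_of_le_one hρ hρ1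
  obtain ⟨K, M₀, hK, hM₀, htail⟩ := hbox.exists_tailInt_sq_le
  have hD := hf.integral_norm_ft_pos
  have hΛ : ParamsWithin {l} l.b l.a l.r := fun l' hl' => by
    rw [Set.mem_singleton_iff.1 hl']
    exact ⟨⟨hb, le_rfl⟩, ⟨ha.le, le_rfl⟩, ⟨hr0.le, le_rfl⟩⟩
  obtain ⟨c, hc, hcut⟩ := hm.exists_bounds hγ hΛ
  have hlarge := hΛ.eventually_le hγ hα.le hρ.le (by linarith) hcut M₀
  set T : ℕ → ℝ := fun n => Real.pi * m n l with hT
  -- The class is known, so the cutoff `π m_n` itself may be used and no selection weight appears.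
  refine attained_of_cutoff hf x₀ (fun l' hl' => ?_) T
    (fun n => C₀ * ((T n) ^ (2 * γ + 1 - ρ) * Real.exp (2 * α * (T n) ^ ρ)))
    ((K * c + C₀) * Real.pi ^ (2 * γ + 1 - ρ)) ?_ ?_
  · rw [Set.mem_singleton_iff.1 hl']; exact hbox.admissible hmem
  · have hc' : 0 < (∫ y, ‖ft f y‖) / (8 * α⁻¹ ^ (1 / ρ)) := by positivity
    filter_upwards [hcut, hlarge, eventually_le_log (Real.log c), eventually_gt_atTop 0,
      eventually_log_rpow_le (1 / ρ) hc' one_pos] with n h1 h2 h3 hn h4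
    obtain ⟨hm0, _, hle⟩ := h1 l rfl
    have hT1 : 1 ≤ T n := hM₀.trans (h2 l rfl)
    have hT0 : 0 < T n := by linarith
    refine ⟨hT0, by positivity, hvar _ hT1, ?_⟩
    have h5 := rpow_le_log_of_cutoff hγ hb ha.le hα hT1 hc hn hle
    have hlogc := Real.log_nonneg hc
    have h6 : (T n) ^ ρ ≤ α⁻¹ * Real.log n := by
      refine h5.trans ?_
      rw [div_le_iff₀ (by positivity)]
      have : α⁻¹ * Real.log n * (2 * α) = 2 * Real.log n := by field_simp
      linarith
    have h7 : T n ≤ α⁻¹ ^ (1 / ρ) * Real.log n ^ (1 / ρ) := by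
      rw [← Real.mul_rpow (by positivity) (by linarith)]
      calc T n = ((T n) ^ ρ) ^ (1 / ρ) := by
            rw [← Real.rpow_mul hT0.le, mul_one_div_cancel hρ.ne', Real.rpow_one]
        _ ≤ _ := by gcongr
    rw [Real.rpow_one] at h4
    calc 8 * T n ≤ 8 * (α⁻¹ ^ (1 / ρ) * ((∫ y, ‖ft f y‖) / (8 * α⁻¹ ^ (1 / ρ)) * n)) := by
          linarith [mul_le_mul_of_nonneg_left h4 (by positivity : 0 ≤ α⁻¹ ^ (1 / ρ))]
      _ = _ := by field_simp
  · filter_upwards [hcut, hlarge, eventually_gt_atTop 0] with n h1 h2 hn l' hl' g hg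
    rw [Set.mem_singleton_iff.1 hl'] at hg ⊢
    obtain ⟨hm0, hge, _⟩ := h1 l rfl
    have hTM := h2 l rfl
    have hT1 : 1 ≤ T n := hM₀.trans hTM
    have hT0 : 0 < T n := by linarith
    have hn' : (0 : ℝ) < n := by exact_mod_cast hn
    have e := varTerm_eq (γ := γ) (α := α) (ρ := ρ) hm0 n
    have hb1 := bias_le_of_cutoff hT0 hn hge
    have ht := htail l hmem g hg (T n) hTM
    -- At the cutoff the bias is the variance times `T^{ρ-r}`; it does not dominate because `r ≥ ρ`.
    have hpow : (T n) ^ (2 * γ + 1 - l.r) ≤ (T n) ^ (2 * γ + 1 - ρ) :=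
      Real.rpow_le_rpow_of_exponent_le hT1 (by linarith)
    rw [mul_assoc (K * c + C₀), ← e, add_mul (K * c), mul_assoc K]
    refine add_le_add (ht.trans ?_) (le_of_eq (by rw [mul_div_assoc]))
    refine mul_le_mul_of_nonneg_left (hb1.trans ?_) hK.le
    gcongr

/-- Adaptive upper bound, supersmooth noise of small order. -/
theorem attained_supersmooth_supersmooth {f : ℝ → ℝ} {γ α ρ : ℝ} (hf : IsNoise f γ α ρ)
    (hρ : 0 < ρ) (hρ1 : ρ ≤ 1) (x₀ : ℝ) {lo hi : Smoothness} (hbox : SupersmoothBox lo hi)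
    {m : ℕ → Smoothness → ℝ} (hm : IsCutoff γ α ρ (box lo hi) m) :
    Attained f x₀ (box lo hi) (fun n l => (m n l) ^ ρ * varTerm γ α ρ n (m n l)) := by
  have hα := hf.alpha_pos hρ
  have hγ := hf.gamma_nonneg
  obtain ⟨C₀, hC₀, hvar⟩ := hf.exists_variance_le_of_le_one hρ hρ1
  obtain ⟨K, M₀, hK, hM₀, htail⟩ := hbox.exists_tailInt_sq_le
  have hΛ := hbox.paramsWithin
  obtain ⟨c, hc, hcut⟩ := hm.exists_bounds hγ hΛ
  have hlarge := hΛ.eventually_le hγ hα.le hρ.le (by linarith) hcut M₀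
  have hlogc := Real.log_nonneg hc
  set P := 2 * hi.b + 1 + hi.r with hP
  set κ := ((2 : ℝ) ^ (1 / ρ)) ^ P with hκ
  set κ₂ := (2 : ℝ) ^ ((2 * γ + 1) / ρ) * Real.exp (2 * α) with hκ₂
  refine attained_of_supersmooth_grid hf hρ x₀ (fun l hl => hbox.admissible hl)
    (q := (2 * γ + 1 - ρ) / ρ) (div_nonneg (by linarith) hρ.le)
    ⟨C₀, hC₀, by rw [div_mul_cancel₀ _ hρ.ne']; exact hvar⟩
    ((K * κ * c + κ₂) * Real.pi ^ (2 * γ + 1)) ?_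
  filter_upwards [hcut, hlarge, eventually_gt_atTop 0,
    eventually_le_log (max 1 (Real.log c / (2 * α) + 1 / (2 * α) + 1))] with n h1 h2 hn h3 l hl
  obtain ⟨hm0, hge, hle⟩ := h1 l hl
  obtain ⟨⟨hb, hb'⟩, ⟨ha, ha'⟩, ⟨hr, hr'⟩⟩ := hΛ l hl
  have hTM := h2 l hl
  set T := Real.pi * m n l with hT
  have hT1 : 1 ≤ T := hM₀.trans hTM
  have hT0 : 0 < T := by linarith
  have hn' : (0 : ℝ) < n := by exact_mod_cast hn
  have hTρ1 : 1 ≤ T ^ ρ := Real.one_le_rpow hT1 hρ.le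
  -- Rounding `T^ρ` up moves it by less than one. The variance exponential grows by at most
  -- `e^{2α}`, and the exponential factor of the bias can only decrease.
  set s := ⌈T ^ ρ⌉₊ with hs
  have hsT : T ^ ρ ≤ s := Nat.le_ceil _
  have hsT1 : (s : ℝ) ≤ T ^ ρ + 1 := (Nat.ceil_lt_add_one (by linarith)).le
  have hsT2 : (s : ℝ) ≤ 2 * T ^ ρ := by linarith
  have hs1 : (1 : ℝ) ≤ s := hTρ1.trans hsT
  have hs0 : (0 : ℝ) < s := by linarith
  refine ⟨s, by exact_mod_cast hs1, ?_, fun g hg => ?_⟩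
  · have h4 := rpow_le_log_of_cutoff hγ hb ha hα hT1 hc hn hle
    have h5 := (le_max_left _ _).trans h3
    have h6 := (le_max_right _ _).trans h3
    rw [Real.rpow_two]
    have h7 : (Real.log c + Real.log n) / (2 * α) ≤ (Real.log c / (2 * α) + 1 / (2 * α)) *
        Real.log n := by
      rw [add_div]
      have : 0 ≤ Real.log c / (2 * α) := by positivity
      nlinarith [this, (by ring : Real.log n / (2 * α) = 1 / (2 * α) * Real.log n)]
    nlinarith
  have hTs : T ≤ (s : ℝ) ^ (1 / ρ) := by
    calc T = (T ^ ρ) ^ (1 / ρ) := by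
          rw [← Real.rpow_mul hT0.le, mul_one_div_cancel hρ.ne', Real.rpow_one]
      _ ≤ _ := by gcongr
  have hTs2 : (s : ℝ) ^ (1 / ρ) ≤ 2 ^ (1 / ρ) * T := by
    calc (s : ℝ) ^ (1 / ρ) ≤ (2 * T ^ ρ) ^ (1 / ρ) := by gcongr
      _ = 2 ^ (1 / ρ) * T := by
          rw [Real.mul_rpow (by norm_num) (by positivity), ← Real.rpow_mul hT0.le,
            mul_one_div_cancel hρ.ne', Real.rpow_one]
  have htwo : (1 : ℝ) ≤ 2 ^ (1 / ρ) := Real.one_le_rpow (by norm_num) (by positivity)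
  have e : T ^ (2 * γ + 1) * Real.exp (2 * α * T ^ ρ) / n =
      Real.pi ^ (2 * γ + 1) * ((m n l) ^ ρ * varTerm γ α ρ n (m n l)) := by
    have e1 : (m n l) ^ ρ * (m n l) ^ (2 * γ + 1 - ρ) = (m n l) ^ (2 * γ + 1) := by
      rw [← Real.rpow_add hm0]; congr 1; ring
    rw [varTerm, hT, Real.mul_rpow Real.pi_pos.le hm0.le, ← e1]
    ring
  have t1 : tailInt g ((s : ℝ) ^ (1 / ρ)) ^ 2 ≤
      K * κ * c * (T ^ (2 * γ + 1) * Real.exp (2 * α * T ^ ρ) / n) := by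
    refine (htail l hl g hg _ (hTM.trans hTs)).trans ?_
    have h4 : ((s : ℝ) ^ (1 / ρ)) ^ (-2 * l.b + 1 - l.r) ≤ κ * T ^ (-2 * l.b + 1 - l.r) := by
      refine rpow_le_mul_rpow (by positivity) hT0 hTs2 (hTs.trans ?_) ?_
      · exact le_mul_of_one_le_left (by positivity) htwo
      · rw [abs_le]; constructor <;> linarith
    have h5 : Real.exp (-2 * l.a * ((s : ℝ) ^ (1 / ρ)) ^ l.r) ≤ Real.exp (-2 * l.a * T ^ l.r) := by
      rw [Real.exp_le_exp]
      have : T ^ l.r ≤ ((s : ℝ) ^ (1 / ρ)) ^ l.r := by gcongr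
      nlinarith
    have h6 := bias_le_of_cutoff hT0 hn hge
    calc K * (((s : ℝ) ^ (1 / ρ)) ^ (-2 * l.b + 1 - l.r) *
          Real.exp (-2 * l.a * ((s : ℝ) ^ (1 / ρ)) ^ l.r))
        ≤ K * ((κ * T ^ (-2 * l.b + 1 - l.r)) * Real.exp (-2 * l.a * T ^ l.r)) := by gcongr
      _ = K * κ * (T ^ (-2 * l.b + 1 - l.r) * Real.exp (-2 * l.a * T ^ l.r)) := by ring
      _ ≤ K * κ * (c * (T ^ (2 * γ + 1 - l.r) * Real.exp (2 * α * T ^ ρ) / n)) := by gcongr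
      _ ≤ K * κ * (c * (T ^ (2 * γ + 1) * Real.exp (2 * α * T ^ ρ) / n)) := by
          have : T ^ (2 * γ + 1 - l.r) ≤ T ^ (2 * γ + 1) :=
            Real.rpow_le_rpow_of_exponent_le hT1 (by linarith)
          gcongr
      _ = _ := by ring
  have t2 : (s : ℝ) ^ ((2 * γ + 1 - ρ) / ρ + 1) * Real.exp (2 * α * s) / n ≤
      κ₂ * (T ^ (2 * γ + 1) * Real.exp (2 * α * T ^ ρ) / n) := by
    have e2 : (2 * γ + 1 - ρ) / ρ + 1 = (2 * γ + 1) / ρ := by field_simp; ring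
    have e3 : (T ^ ρ) ^ ((2 * γ + 1) / ρ) = T ^ (2 * γ + 1) := by
      rw [← Real.rpow_mul hT0.le, mul_div_cancel₀ _ hρ.ne']
    rw [e2]
    calc (s : ℝ) ^ ((2 * γ + 1) / ρ) * Real.exp (2 * α * s) / n
        ≤ (2 * T ^ ρ) ^ ((2 * γ + 1) / ρ) * Real.exp (2 * α * (T ^ ρ + 1)) / n := by gcongr
      _ = κ₂ * (T ^ (2 * γ + 1) * Real.exp (2 * α * T ^ ρ) / n) := by
          rw [Real.mul_rpow (by norm_num) (by positivity), e3, mul_add, Real.exp_add, mul_one, hκ₂]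
          ring
  calc _ ≤ _ := add_le_add t1 t2
    _ = (K * κ * c + κ₂) * (T ^ (2 * γ + 1) * Real.exp (2 * α * T ^ ρ) / n) := by ring
    _ = _ := by rw [e]; ring

/-- Shifting the cutoff `t` to the power `ρ` by a logarithmic amount does not affect lower powers. -/
theorem exists_log_shift (κ : ℝ) {δ : ℝ} (hδ : 0 < δ) :
    ∃ T₀ : ℝ, 1 ≤ T₀ ∧ ∀ t : ℝ, T₀ ≤ t → κ * Real.log t + 1 ≤ 1 / 2 * t ^ δ := by
  have h1 := (isLittleO_log_rpow_atTop hδ).def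
    (by positivity : (0 : ℝ) < 1 / (4 * (|κ| + 1)))
  have h2 : ∀ᶠ t : ℝ in atTop, 4 ≤ t ^ δ := (tendsto_rpow_atTop hδ).eventually_ge_atTop 4
  obtain ⟨T₀, hT₀⟩ := (h1.and h2).exists_forall_of_atTop
  refine ⟨max 1 T₀, le_max_left _ _, fun t ht => ?_⟩
  obtain ⟨h3, h4⟩ := hT₀ t ((le_max_right _ _).trans ht)
  have ht1 : 1 ≤ t := (le_max_left _ _).trans ht
  have hlog := Real.log_nonneg ht1
  rw [Real.norm_of_nonneg hlog, Real.norm_of_nonneg (by positivity), one_div, ← div_eq_inv_mul,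
    le_div_iff₀ (by positivity)] at h3
  have h5 : κ * Real.log t ≤ |κ| * Real.log t := by gcongr; exact le_abs_self κ
  nlinarith [abs_nonneg κ]

theorem one_sub_le_rpow {y p : ℝ} (hy0 : 0 ≤ y) (hy : y ≤ 1) (hp : p ≤ 1) :
    1 - y ≤ (1 - y) ^ p := by
  rcases hy.eq_or_lt with rfl | h
  · simpa using Real.rpow_nonneg le_rfl p
  · calc 1 - y = (1 - y) ^ (1 : ℝ) := (Real.rpow_one _).symm
      _ ≤ _ := Real.rpow_le_rpow_of_exponent_ge (by linarith) (by linarith) hp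

/-- Lowering `T ^ ρ` by at most `T ^ (ρ - r)` lowers `T ^ r` by at most one. -/
theorem rpow_sub_one_le_of_shift {T s r ρ x : ℝ} (hT : 0 < T) (hr : 0 ≤ r) (hrρ : r ≤ ρ)
    (hρ : 0 < ρ) (hx0 : 0 ≤ x) (hx : x ≤ T ^ (ρ - r)) (hxT : x ≤ T ^ ρ) (hs : T ^ ρ - x ≤ s) :
    T ^ r - 1 ≤ (s ^ (1 / ρ)) ^ r := by
  have hTρ : 0 < T ^ ρ := by positivity
  have hs0 : 0 ≤ s := by linarith
  have e1 : (s ^ (1 / ρ)) ^ r = s ^ (r / ρ) := by rw [← Real.rpow_mul hs0]; congr 1; ring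
  have e2 : (T ^ ρ) ^ (r / ρ) = T ^ r := by rw [← Real.rpow_mul hT.le, mul_div_cancel₀ _ hρ.ne']
  have hy1 : x / T ^ ρ ≤ 1 := (div_le_one hTρ).2 hxT
  have hyT : T ^ ρ * (1 - x / T ^ ρ) = T ^ ρ - x := by field_simp
  have h4 : T ^ r * (1 - x / T ^ ρ) ≤ s ^ (r / ρ) := by
    rw [← e2]
    calc (T ^ ρ) ^ (r / ρ) * (1 - x / T ^ ρ) ≤ (T ^ ρ) ^ (r / ρ) * (1 - x / T ^ ρ) ^ (r / ρ) := by
          gcongr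
          exact one_sub_le_rpow (by positivity) hy1 ((div_le_one hρ).2 hrρ)
      _ = (T ^ ρ * (1 - x / T ^ ρ)) ^ (r / ρ) :=
        (Real.mul_rpow hTρ.le (by linarith)).symm
      _ ≤ _ := Real.rpow_le_rpow (mul_nonneg hTρ.le (by linarith)) (hyT.trans_le hs)
        (by positivity)
  have h5 : T ^ r * (x / T ^ ρ) ≤ 1 := by
    have e3 : T ^ ρ = T ^ r * T ^ (ρ - r) := by rw [← Real.rpow_add hT]; congr 1; ring
    rw [← mul_div_assoc, div_le_one hTρ, e3]
    gcongr
  rw [e1]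
  linarith

/-- Lowering `T^ρ` by `(ρ/α) log T` multiplies the noise exponential by `T^{-2ρ}`. One factor
`T^{-ρ}` pays for the selection weight; the other turns `T^{2γ+1}` into `T^{2γ+1-ρ} ≤ T^{2γ+1-r}`,
the size of the bias at the cutoff. The crude variance bound is therefore enough, for every `ρ > 0`.
-/
theorem shifted_variance_le {γ α ρ c n s T : ℝ} {l : Smoothness} (hγ : 0 ≤ γ) (hα : 0 < α)
    (hρ : 0 < ρ) (hrρ : l.r ≤ ρ) (hT : 1 ≤ T) (hn : 0 < n) (hs : 0 ≤ s)
    (hsT : s ≤ T ^ ρ - ρ / α * Real.log T) (hle : cutoffFn γ α ρ l T ≤ c * n) :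
    s ^ ((2 * γ + 1) / ρ + 1) * Real.exp (2 * α * s) / n ≤
      c * (T ^ (-2 * l.b + 1 - l.r) * Real.exp (-2 * l.a * T ^ l.r)) := by
  have hT0 : 0 < T := by linarith
  have hlog := Real.log_nonneg hT
  have hsT' : s ≤ T ^ ρ := by
    have : 0 ≤ ρ / α * Real.log T := by positivity
    linarith
  have e2 : (T ^ ρ) ^ ((2 * γ + 1) / ρ + 1) = T ^ (2 * γ + 1 + ρ) := by
    rw [← Real.rpow_mul hT0.le]; congr 1; field_simp
  have e3 : Real.exp (2 * α * (T ^ ρ - ρ / α * Real.log T)) =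
      Real.exp (2 * α * T ^ ρ) * T ^ (-(2 * ρ)) := by
    rw [Real.rpow_def_of_pos hT0 (-(2 * ρ)), ← Real.exp_add]
    congr 1
    field_simp
    ring
  have e4 : T ^ (2 * γ + 1 + ρ) * T ^ (-(2 * ρ)) ≤
      T ^ (-2 * l.b + 1 - l.r) * T ^ (2 * l.b + 2 * γ) := by
    rw [← Real.rpow_add hT0, ← Real.rpow_add hT0]
    exact Real.rpow_le_rpow_of_exponent_le hT (by linarith)
  rw [div_le_iff₀ hn]
  calc s ^ ((2 * γ + 1) / ρ + 1) * Real.exp (2 * α * s)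
      ≤ (T ^ ρ) ^ ((2 * γ + 1) / ρ + 1) * Real.exp (2 * α * (T ^ ρ - ρ / α * Real.log T)) := by
        gcongr
    _ = (T ^ (2 * γ + 1 + ρ) * T ^ (-(2 * ρ))) * Real.exp (2 * α * T ^ ρ) := by
        rw [e2, e3]; ring
    _ ≤ (T ^ (-2 * l.b + 1 - l.r) * T ^ (2 * l.b + 2 * γ)) * Real.exp (2 * α * T ^ ρ) := by
        gcongr
    _ = (T ^ (-2 * l.b + 1 - l.r) * Real.exp (-2 * l.a * T ^ l.r)) * cutoffFn γ α ρ l T := by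
        have : Real.exp (2 * α * T ^ ρ) = Real.exp (-2 * l.a * T ^ l.r) *
            Real.exp (2 * α * T ^ ρ + 2 * l.a * T ^ l.r) := by
          rw [← Real.exp_add]; congr 1; ring
        rw [cutoffFn, this]
        ring
    _ ≤ (T ^ (-2 * l.b + 1 - l.r) * Real.exp (-2 * l.a * T ^ l.r)) * (c * n) := by gcongr
    _ = _ := by ring

set_option maxHeartbeats 1000000 in
/-- Adaptive upper bound when the noise is smoother than the densities. -/
theorem attained_smoother_noise {f : ℝ → ℝ} {γ α ρ : ℝ} (hf : IsNoise f γ α ρ)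
    (hρ : 0 < ρ) (x₀ : ℝ) {lo hi : Smoothness} (hbox : SupersmoothBox lo hi) (hir : hi.r < ρ)
    {m : ℕ → Smoothness → ℝ} (hm : IsCutoff γ α ρ (box lo hi) m) :
    Attained f x₀ (box lo hi) (fun n l => biasTerm l (m n l)) := by
  have hα := hf.alpha_pos hρ
  have hγ := hf.gamma_nonneg
  obtain ⟨C₀, hC₀, hvar⟩ := hf.exists_variance_le
  obtain ⟨K, M₀, hK, hM₀, htail⟩ := hbox.exists_tailInt_sq_le
  have hΛ := hbox.paramsWithin
  obtain ⟨c, hc, hcut⟩ := hm.exists_bounds hγ hΛ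
  have hlogc := Real.log_nonneg hc
  have hai : 0 < hi.a := by have := hbox.a_pos; have := hbox.a_le; linarith
  set k := ρ / α with hk
  have hk0 : 0 < k := by positivity
  obtain ⟨T₀, hT₀1, hT₀⟩ := exists_log_shift k (by linarith : 0 < ρ - hi.r)
  set D := (2 : ℝ) ^ (1 / ρ) with hD
  have hD1 : 1 ≤ D := Real.one_le_rpow (by norm_num) (by positivity)
  -- The threshold `D * M₀` guarantees that the lowered frequency, which is at least `T / D`, still
  -- lies beyond `M₀`, where the bias bound holds.
  have hlarge := hΛ.eventually_le hγ hα.le hρ.le (by linarith) hcut (max (max T₀ 2) (D * M₀))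
  set P := 2 * hi.b + 1 + hi.r with hP
  set κ := D ^ P with hκ
  refine attained_of_supersmooth_grid hf hρ x₀ (fun l hl => hbox.admissible hl)
    (q := (2 * γ + 1) / ρ) (by positivity)
    ⟨C₀, hC₀, by rw [div_mul_cancel₀ _ hρ.ne']; exact hvar⟩
    ((K * κ * Real.exp (2 * hi.a) + c) * Real.pi ^ P) ?_
  filter_upwards [hcut, hlarge, eventually_gt_atTop 0,
    eventually_le_log (max 1 (Real.log c / (2 * α) + 1 / (2 * α) + 1))] with n h1 h2 hn h3 l hl
  obtain ⟨hm0, hge, hle⟩ := h1 l hl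
  obtain ⟨⟨hb, hb'⟩, ⟨ha, ha'⟩, ⟨hr, hr'⟩⟩ := hΛ l hl
  have hlrρ : l.r < ρ := by linarith
  have hTbig := h2 l hl
  set T := Real.pi * m n l with hT
  have hTT₀ : T₀ ≤ T := (le_max_left _ _).trans ((le_max_left _ _).trans hTbig)
  have hTM : D * M₀ ≤ T := (le_max_right _ _).trans hTbig
  have hT1 : 1 ≤ T := hT₀1.trans hTT₀
  have hT0 : 0 < T := by linarith
  have hlogT := Real.log_nonneg hT1
  have hn' : (0 : ℝ) < n := by exact_mod_cast hn
  have hTρ1 : 1 ≤ T ^ ρ := Real.one_le_rpow hT1 hρ.le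
  have hTρ0 : 0 < T ^ ρ := by linarith
  have hshift := hT₀ T hTT₀
  have hpow1 : T ^ (ρ - hi.r) ≤ T ^ (ρ - l.r) :=
    Real.rpow_le_rpow_of_exponent_le hT1 (by linarith)
  have hpow2 : T ^ (ρ - l.r) ≤ T ^ ρ := Real.rpow_le_rpow_of_exponent_le hT1 (by linarith)
  set y := (k * Real.log T + 1) / T ^ ρ with hy
  have hy0 : 0 ≤ y := by positivity
  have hyT : T ^ ρ * (1 - y) = T ^ ρ - (k * Real.log T + 1) := by rw [hy]; field_simp
  have hy2 : y ≤ 1 / 2 := by rw [hy, div_le_iff₀ hTρ0]; linarith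
  have hkT : 0 ≤ k * Real.log T := by positivity
  have hz0 : 1 ≤ T ^ ρ - k * Real.log T := by linarith
  -- The grid point lies below the cutoff by `k log T` plus at most one for rounding. Since `r < ρ`,
  -- this shift is smaller than `T^{ρ-r}`, so `T^r` drops by at most one and the bias exponential
  -- changes by at most `e^{2a}`.
  set s := ⌊T ^ ρ - k * Real.log T⌋₊ with hs
  have hs_le : (s : ℝ) ≤ T ^ ρ - k * Real.log T := Nat.floor_le (by linarith)
  have hs_ge : T ^ ρ * (1 - y) ≤ s := by
    rw [hyT]; linarith [Nat.lt_floor_add_one (T ^ ρ - k * Real.log T)]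
  have hs1 : 1 ≤ s := Nat.le_floor (by simpa using hz0)
  have hs0 : (0 : ℝ) < s := by exact_mod_cast hs1
  have hsT : (s : ℝ) ≤ T ^ ρ := hs_le.trans (by linarith)
  have hTrt : (T ^ ρ) ^ (1 / ρ) = T := by
    rw [← Real.rpow_mul hT0.le, mul_one_div_cancel hρ.ne', Real.rpow_one]
  set M := (s : ℝ) ^ (1 / ρ) with hM
  have hM0 : 0 < M := by positivity
  have hMT : M ≤ T := by
    rw [← hTrt]
    exact Real.rpow_le_rpow hs0.le hsT (by positivity)
  have hTDM : T ≤ D * M := by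
    rw [hD, hM, ← Real.mul_rpow (by norm_num) hs0.le, ← hTrt]
    refine Real.rpow_le_rpow hTρ0.le ?_ (by positivity)
    linarith
  have hMM₀ : M₀ ≤ M := by
    have := hTM.trans hTDM
    exact le_of_mul_le_mul_left this (by linarith)
  have hMr : T ^ l.r - 1 ≤ M ^ l.r :=
    rpow_sub_one_le_of_shift hT0 (by linarith) hlrρ.le hρ (by positivity)
      (by linarith [Real.rpow_pos_of_pos hT0 (ρ - hi.r)])
      (by linarith [Real.rpow_pos_of_pos hT0 (ρ - hi.r)]) (hyT.symm.trans_le hs_ge)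
  have e : T ^ (-2 * l.b + 1 - l.r) * Real.exp (-2 * l.a * T ^ l.r) ≤
      Real.pi ^ P * biasTerm l (m n l) := by
    have hab : |-2 * l.b + 1 - l.r| ≤ P := by rw [abs_le]; constructor <;> linarith
    have hpi := Real.pi_pos
    have hpi1 : 1 ≤ Real.pi := by linarith [Real.pi_gt_three]
    have : T ^ (-2 * l.b + 1 - l.r) ≤ Real.pi ^ P * (m n l) ^ (-2 * l.b + 1 - l.r) :=
      rpow_le_mul_rpow hT0 hm0 le_rfl (by rw [hT]; nlinarith [mul_pos hpi hm0]) hab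
    rw [biasTerm, ← mul_assoc]
    gcongr
  refine ⟨s, hs1, ?_, fun g hg => ?_⟩
  · have h4 := rpow_le_log_of_cutoff hγ hb ha hα hT1 hc hn hle
    have h5 := (le_max_left _ _).trans h3
    have h6 := (le_max_right _ _).trans h3
    rw [Real.rpow_two]
    have h8 : Real.log n * (Real.log c / (2 * α) + 1 / (2 * α) + 1) ≤ Real.log n * Real.log n := by
      gcongr
    have h7 : (Real.log c + Real.log n) / (2 * α) ≤ (Real.log c / (2 * α) + 1 / (2 * α)) *
        Real.log n := by
      rw [add_div]
      have h9 : 0 ≤ Real.log c / (2 * α) := by positivity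
      have h10 := mul_le_mul_of_nonneg_left h5 h9
      have h11 : Real.log n / (2 * α) = 1 / (2 * α) * Real.log n := by ring
      linarith
    linarith
  have t1 : tailInt g M ^ 2 ≤ K * κ * Real.exp (2 * hi.a) *
      (T ^ (-2 * l.b + 1 - l.r) * Real.exp (-2 * l.a * T ^ l.r)) := by
    refine (htail l hl g hg _ hMM₀).trans ?_
    have h4 : M ^ (-2 * l.b + 1 - l.r) ≤ κ * T ^ (-2 * l.b + 1 - l.r) := by
      refine rpow_le_mul_rpow hM0 hT0 (hMT.trans ?_) hTDM ?_
      · exact le_mul_of_one_le_left hT0.le hD1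
      · rw [abs_le]; constructor <;> linarith
    have h5 : Real.exp (-2 * l.a * M ^ l.r) ≤
        Real.exp (2 * hi.a) * Real.exp (-2 * l.a * T ^ l.r) := by
      rw [← Real.exp_add, Real.exp_le_exp]
      have h6 := mul_le_mul_of_nonneg_left hMr (by linarith : 0 ≤ l.a)
      linarith
    calc K * (M ^ (-2 * l.b + 1 - l.r) * Real.exp (-2 * l.a * M ^ l.r))
        ≤ K * ((κ * T ^ (-2 * l.b + 1 - l.r)) *
          (Real.exp (2 * hi.a) * Real.exp (-2 * l.a * T ^ l.r))) := by gcongr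
      _ = _ := by ring
  have t2 := shifted_variance_le hγ hα hρ hlrρ.le hT1 hn' hs0.le hs_le hle
  calc _ ≤ _ := add_le_add t1 t2
    _ = (K * κ * Real.exp (2 * hi.a) + c) *
        (T ^ (-2 * l.b + 1 - l.r) * Real.exp (-2 * l.a * T ^ l.r)) := by ring
    _ ≤ (K * κ * Real.exp (2 * hi.a) + c) * (Real.pi ^ P * biasTerm l (m n l)) := by
        have : 0 ≤ K * κ * Real.exp (2 * hi.a) + c := by positivity
        gcongr
    _ = _ := by ring

/-! ### Two-point inequality for product laws -/

open ProbabilityTheory in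
/-- Tonelli's theorem for a product of functions of independent coordinates. -/
theorem lintegral_pi_prod {n : ℕ} (μ : Measure ℝ) [IsProbabilityMeasure μ]
    {q : Fin n → ℝ → ENNReal} (hq : ∀ i, Measurable (q i)) :
    ∫⁻ z, ∏ i, q i (z i) ∂(Measure.pi fun _ : Fin n => μ) = ∏ i, ∫⁻ x, q i x ∂μ := by
  have hind : iIndepFun (fun i (z : Fin n → ℝ) => q i (z i)) (Measure.pi fun _ : Fin n => μ) :=
    iIndepFun_pi (fun i => (hq i).aemeasurable)
  rw [lintegral_prod_eq_prod_lintegral_of_indepFun Finset.univ _ hind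
    fun i => (hq i).comp (measurable_pi_apply i)]
  refine Finset.prod_congr rfl fun i _ => ?_
  exact (measurePreserving_eval (fun _ : Fin n => μ) i).lintegral_comp (hq i)

theorem pi_withDensity {n : ℕ} (μ : Measure ℝ) [IsProbabilityMeasure μ] {q : ℝ → ENNReal}
    (hq : Measurable q) [IsProbabilityMeasure (μ.withDensity q)] :
    (Measure.pi fun _ : Fin n => μ.withDensity q) =
      (Measure.pi fun _ : Fin n => μ).withDensity fun z => ∏ i, q (z i) := by
  refine Measure.pi_eq fun s hs => ?_
  rw [withDensity_apply _ (MeasurableSet.univ_pi hs),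
    ← lintegral_indicator (MeasurableSet.univ_pi hs)]
  have h1 : ∀ z : Fin n → ℝ, (Set.univ.pi s).indicator (fun z => ∏ i, q (z i)) z =
      ∏ i, (s i).indicator q (z i) := by
    intro z
    by_cases hz : z ∈ Set.univ.pi s
    · rw [Set.indicator_of_mem hz]
      refine Finset.prod_congr rfl fun i _ => ?_
      rw [Set.indicator_of_mem (hz i (Set.mem_univ i))]
    · rw [Set.indicator_of_notMem hz]
      simp only [Set.mem_pi, Set.mem_univ, true_imp_iff, not_forall] at hz
      obtain ⟨i, hi⟩ := hz
      exact (Finset.prod_eq_zero (Finset.mem_univ i) (Set.indicator_of_notMem hi _)).symm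
  simp_rw [h1]
  rw [lintegral_pi_prod μ fun i => hq.indicator (hs i)]
  refine Finset.prod_congr rfl fun i _ => ?_
  rw [lintegral_indicator (hs i), withDensity_apply _ (hs i)]

/-- Two-point inequality: if `Q` has density `q` with respect to `P` and `∫ q² dP ≤ K`, then no
statistic is close to `θ₀` under `P` and close to `θ₁` under `Q`. -/
theorem two_point_le {Ω : Type*} [MeasurableSpace Ω] (P : Measure Ω)
    {q T : Ω → ℝ} (hq : Measurable q) (hq0 : ∀ z, 0 ≤ q z) (hT : Measurable T)
    [IsProbabilityMeasure (P.withDensity fun z => ENNReal.ofReal (q z))] {K : ℝ} (hK : 0 < K)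
    (hqK : ∫⁻ z, ENNReal.ofReal (q z ^ 2) ∂P ≤ ENNReal.ofReal K) (θ₀ θ₁ : ℝ) :
    ENNReal.ofReal ((θ₁ - θ₀) ^ 2) ≤
      2 * ∫⁻ z, ENNReal.ofReal ((T z - θ₁) ^ 2) ∂(P.withDensity fun z => ENNReal.ofReal (q z)) +
      2 * ENNReal.ofReal K * ∫⁻ z, ENNReal.ofReal ((T z - θ₀) ^ 2) ∂P := by
  set D := θ₁ - θ₀ with hD
  have hone : ∫⁻ z, ENNReal.ofReal (q z) ∂P = 1 := by
    have := measure_univ (μ := P.withDensity fun z => ENNReal.ofReal (q z))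
    rwa [withDensity_apply _ MeasurableSet.univ, Measure.restrict_univ] at this
  have hR1 : ∫⁻ z, ENNReal.ofReal ((T z - θ₁) ^ 2) ∂(P.withDensity fun z => ENNReal.ofReal (q z)) =
      ∫⁻ z, ENNReal.ofReal (q z * (T z - θ₁) ^ 2) ∂P := by
    rw [lintegral_withDensity_eq_lintegral_mul _ hq.ennreal_ofReal (by fun_prop)]
    refine lintegral_congr fun z => ?_
    rw [Pi.mul_apply, ENNReal.ofReal_mul (hq0 z)]
  -- Obtained from `D = (T - θ₀) - (T - θ₁)` and two weighted completions of squares. The weight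
  -- `D²/K` makes the `q²` term integrate to at most `D²`, so a third of the left side is given back
  -- and `2D²` remains. `K` may be large, which the adaptive bounds exploit.
  have hpt : ∀ z, 3 * D ^ 2 * q z ≤
      4 * (q z * (T z - θ₁) ^ 2) + (D ^ 2 / K * q z ^ 2 + 4 * K * (T z - θ₀) ^ 2) := by
    intro z
    have h1 : D * (T z - θ₀) * q z ≤ D ^ 2 / K * q z ^ 2 / 4 + K * (T z - θ₀) ^ 2 := by
      have h : D ^ 2 / K * q z ^ 2 / 4 + K * (T z - θ₀) ^ 2 - D * (T z - θ₀) * q z =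
          (D * q z / 2 - K * (T z - θ₀)) ^ 2 / K := by field_simp; ring
      have : 0 ≤ (D * q z / 2 - K * (T z - θ₀)) ^ 2 / K := by positivity
      linarith
    have h2 : 0 ≤ q z * (D / 2 + (T z - θ₁)) ^ 2 := mul_nonneg (hq0 z) (sq_nonneg _)
    have h3 : D * (T z - θ₀) * q z = D ^ 2 * q z + D * (T z - θ₁) * q z := by rw [hD]; ring
    nlinarith
  have hint : ENNReal.ofReal (3 * D ^ 2) ≤
      4 * ∫⁻ z, ENNReal.ofReal (q z * (T z - θ₁) ^ 2) ∂P + (ENNReal.ofReal (D ^ 2) +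
        4 * ENNReal.ofReal K * ∫⁻ z, ENNReal.ofReal ((T z - θ₀) ^ 2) ∂P) := by
    calc ENNReal.ofReal (3 * D ^ 2) = ∫⁻ z, ENNReal.ofReal (3 * D ^ 2 * q z) ∂P := by
          simp_rw [ENNReal.ofReal_mul (by positivity : 0 ≤ 3 * D ^ 2)]
          rw [lintegral_const_mul _ hq.ennreal_ofReal, hone, mul_one]
      _ ≤ ∫⁻ z, (4 * ENNReal.ofReal (q z * (T z - θ₁) ^ 2) +
            (ENNReal.ofReal (D ^ 2 / K) * ENNReal.ofReal (q z ^ 2) +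
              4 * ENNReal.ofReal K * ENNReal.ofReal ((T z - θ₀) ^ 2))) ∂P := by
          refine lintegral_mono fun z => (ENNReal.ofReal_le_ofReal (hpt z)).trans_eq ?_
          have := hq0 z
          rw [ENNReal.ofReal_add (by positivity) (by positivity),
            ENNReal.ofReal_add (by positivity) (by positivity),
            ENNReal.ofReal_mul (by positivity), ENNReal.ofReal_mul (by positivity),
            ENNReal.ofReal_mul (by positivity), ENNReal.ofReal_mul (by positivity)]
          norm_num
      _ = 4 * ∫⁻ z, ENNReal.ofReal (q z * (T z - θ₁) ^ 2) ∂P +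
          (ENNReal.ofReal (D ^ 2 / K) * ∫⁻ z, ENNReal.ofReal (q z ^ 2) ∂P +
            4 * ENNReal.ofReal K * ∫⁻ z, ENNReal.ofReal ((T z - θ₀) ^ 2) ∂P) := by
          rw [lintegral_add_left (by fun_prop), lintegral_add_left (by fun_prop),
            lintegral_const_mul _ (by fun_prop), lintegral_const_mul _ (by fun_prop),
            lintegral_const_mul _ (by fun_prop)]
      _ ≤ _ := by
          gcongr
          calc _ ≤ ENNReal.ofReal (D ^ 2 / K) * ENNReal.ofReal K := by gcongr
            _ = _ := by
              rw [← ENNReal.ofReal_mul (by positivity), div_mul_cancel₀ _ hK.ne']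
  rw [hR1]
  have h4 : ENNReal.ofReal (3 * D ^ 2) = 2 * ENNReal.ofReal (D ^ 2) + ENNReal.ofReal (D ^ 2) := by
    rw [ENNReal.ofReal_mul (by norm_num)]
    norm_num
    ring
  rw [h4, add_left_comm, add_comm (ENNReal.ofReal (D ^ 2))] at hint
  have h5 := ENNReal.le_of_add_le_add_right ENNReal.ofReal_ne_top hint
  have h6 : 2 * ENNReal.ofReal (D ^ 2) ≤
      2 * (2 * ∫⁻ z, ENNReal.ofReal (q z * (T z - θ₁) ^ 2) ∂P +
        2 * ENNReal.ofReal K * ∫⁻ z, ENNReal.ofReal ((T z - θ₀) ^ 2) ∂P) := by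
    refine h5.trans_eq ?_
    ring
  exact (ENNReal.mul_le_mul_iff_right (by norm_num) (by norm_num)).1 h6

/-- Two-point inequality for the risks, in terms of the densities of the observations. -/
theorem risk_two_point {f g₀ g₁ h₀ h₁ : ℝ → ℝ} (hh₀ : IsDensity h₀) (hh₁ : IsDensity h₁)
    (hm₀ : Measurable h₀) (hm₁ : Measurable h₁) (hpos : ∀ z, 0 < h₀ z)
    (hc₀ : (law g₀).conv (law f) = law h₀) (hc₁ : (law g₁).conv (law f) = law h₁) {X : ℝ}
    (hX : ∫⁻ z, ENNReal.ofReal (h₁ z ^ 2 / h₀ z) ≤ ENNReal.ofReal (1 + X)) (hX0 : 0 ≤ X)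
    (x₀ : ℝ) {n : ℕ} {T : (Fin n → ℝ) → ℝ} (hT : Measurable T) :
    ENNReal.ofReal ((g₁ x₀ - g₀ x₀) ^ 2) ≤
      2 * risk f x₀ n T g₁ + 2 * ENNReal.ofReal (Real.exp (n * X)) * risk f x₀ n T g₀ := by
  have := hh₀.isProbabilityMeasure
  have hp₁ := hh₁.isProbabilityMeasure
  set q : ℝ → ℝ := fun z => h₁ z / h₀ z with hq
  have hqm : Measurable q := hm₁.div hm₀
  have hq0 : ∀ z, 0 ≤ q z := fun z => div_nonneg (hh₁.nonneg z) (hpos z).le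
  have hlaw : law h₁ = (law h₀).withDensity fun z => ENNReal.ofReal (q z) := by
    rw [law, law, ← withDensity_mul _ (by fun_prop) (by fun_prop)]
    congr 1
    ext z
    rw [Pi.mul_apply, ← ENNReal.ofReal_mul (hpos z).le, hq, mul_div_cancel₀ _ (hpos z).ne']
  have hp₁' : IsProbabilityMeasure ((law h₀).withDensity fun z => ENNReal.ofReal (q z)) := by
    rwa [← hlaw]
  have hprod : ∀ z : Fin n → ℝ, ∏ i, ENNReal.ofReal (q (z i)) =
      ENNReal.ofReal (∏ i, q (z i)) := fun z =>
    (ENNReal.ofReal_prod_of_nonneg fun i _ => hq0 _).symm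
  have hpi : sampleLaw f g₁ n =
      (sampleLaw f g₀ n).withDensity fun z => ENNReal.ofReal (∏ i, q (z i)) := by
    rw [sampleLaw, sampleLaw, hc₀, hc₁, hlaw, pi_withDensity _ (by fun_prop)]
    simp_rw [hprod]
  have hprob : IsProbabilityMeasure (sampleLaw f g₁ n) := by
    rw [sampleLaw, hc₁]; infer_instance
  rw [hpi] at hprob
  have hQ : Measurable fun z : Fin n → ℝ => ∏ i, q (z i) :=
    Finset.measurable_prod _ fun i _ => hqm.comp (measurable_pi_apply i)
  -- Independence turns the second moment of the likelihood ratio into an `n`-th power, at most `(1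
  -- + X)^n ≤ e^{nX}`.
  have hK : ∫⁻ z, ENNReal.ofReal ((∏ i, q (z i)) ^ 2) ∂(sampleLaw f g₀ n) ≤
      ENNReal.ofReal (Real.exp (n * X)) := by
    have h1 : ∀ z : Fin n → ℝ, ENNReal.ofReal ((∏ i, q (z i)) ^ 2) =
        ∏ i, ENNReal.ofReal (q (z i) ^ 2) := by
      intro z
      rw [← Finset.prod_pow, ENNReal.ofReal_prod_of_nonneg fun i _ => sq_nonneg _]
    have h2 : ∫⁻ z, ENNReal.ofReal (q z ^ 2) ∂(law h₀) ≤ ENNReal.ofReal (1 + X) := by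
      rw [law, lintegral_withDensity_eq_lintegral_mul _ (by fun_prop) (by fun_prop)]
      refine le_trans (le_of_eq (lintegral_congr fun z => ?_)) hX
      rw [Pi.mul_apply, ← ENNReal.ofReal_mul (hpos z).le]
      congr 1
      have := (hpos z).ne'
      simp only [hq]
      field_simp
    rw [sampleLaw, hc₀]
    simp_rw [h1]
    rw [lintegral_pi_prod (law h₀) (q := fun _ z => ENNReal.ofReal (q z ^ 2)) fun i => by fun_prop]
    calc ∏ _i : Fin n, ∫⁻ z, ENNReal.ofReal (q z ^ 2) ∂(law h₀)
        ≤ ∏ _i : Fin n, ENNReal.ofReal (1 + X) := Finset.prod_le_prod' fun _ _ => h2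
      _ = ENNReal.ofReal ((1 + X) ^ n) := by
          rw [Finset.prod_const, Finset.card_univ, Fintype.card_fin,
            ENNReal.ofReal_pow (by linarith)]
      _ ≤ _ := by
          refine ENNReal.ofReal_le_ofReal ?_
          rw [Real.exp_nat_mul]
          gcongr
          linarith [Real.add_one_le_exp X]
  have key := two_point_le (sampleLaw f g₀ n) hQ
    (fun z => Finset.prod_nonneg fun i _ => hq0 _) hT (Real.exp_pos _) hK (g₀ x₀) (g₁ x₀)
  rwa [← hpi] at key

/-! ### Smearing by the noise and chi-square distances -/

/-- Convolution on the real line. -/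
def smear (f u : ℝ → ℝ) (z : ℝ) : ℝ := ∫ y, f y * u (z - y)

theorem smear_eq_convolution (f u : ℝ → ℝ) :
    smear f u = convolution f u (ContinuousLinearMap.mul ℝ ℝ) volume := rfl

theorem integrable_smear {f u : ℝ → ℝ} (hf : Integrable f) (hu : Integrable u) :
    Integrable (smear f u) := by
  rw [smear_eq_convolution]
  exact hf.integrable_convolution _ hu

theorem continuous_smear {f u : ℝ → ℝ} (hf : Integrable f) (hu : Continuous u) {C : ℝ}
    (hC : ∀ x, |u x| ≤ C) : Continuous (smear f u) := by
  rw [smear_eq_convolution]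
  refine BddAbove.continuous_convolution_right_of_integrable _ ⟨C, ?_⟩ hf hu
  rintro _ ⟨x, rfl⟩
  exact hC x

theorem integrable_smear_integrand {f u : ℝ → ℝ} (hf : Integrable f) (hu : Continuous u) {C : ℝ}
    (hC : ∀ x, |u x| ≤ C) (z : ℝ) : Integrable fun y => f y * u (z - y) := by
  refine hf.mul_bdd (c := C) ?_ (ae_of_all _ fun y => hC _)
  exact (hu.comp (continuous_const.sub continuous_id)).aestronglyMeasurable

theorem ft_smear {f u : ℝ → ℝ} (hf : Integrable f) (hu : Integrable u) (x : ℝ) :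
    ft (smear f u) x = ft f x * ft u x := by
  rw [ft_eq_fourier, ft_eq_fourier, ft_eq_fourier]
  refine Eq.trans ?_ (Real.fourier_mul_convolution_eq (hf.ofReal (𝕜 := ℂ)) (hu.ofReal (𝕜 := ℂ)) _)
  refine congrArg (fun v : ℝ → ℂ => FourierTransform.fourier v (-x / (2 * Real.pi))) ?_
  ext z
  simp only [smear, convolution, ContinuousLinearMap.mul_apply']
  rw [← integral_complex_ofReal]
  simp only [Complex.ofReal_mul]
  rfl

theorem ft_zero (u : ℝ → ℝ) : ft u 0 = ((∫ x, u x : ℝ) : ℂ) := by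
  rw [ft, ← integral_complex_ofReal]
  simp

theorem IsDensity.smear {f u : ℝ → ℝ} (hf : IsDensity f) (hu : IsDensity u) :
    IsDensity (smear f u) where
  nonneg z := integral_nonneg fun y => mul_nonneg (hf.nonneg _) (hu.nonneg _)
  integrable := integrable_smear hf.integrable hu.integrable
  integral_eq_one := by
    have h := ft_smear hf.integrable hu.integrable 0
    rw [ft_zero, ft_zero, ft_zero, hf.integral_eq_one, hu.integral_eq_one] at h
    rw [Complex.ofReal_one, mul_one] at h
    exact_mod_cast h

/-- Both measures have characteristic function `f* u*`; this gives access to actual densities of the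
observations, needed for likelihood ratios. -/
theorem law_conv_eq {f u : ℝ → ℝ} (hf : IsDensity f) (hu : IsDensity u) :
    (law u).conv (law f) = law (smear f u) := by
  have := hf.isProbabilityMeasure
  have := hu.isProbabilityMeasure
  have := (hf.smear hu).isProbabilityMeasure
  refine Measure.ext_of_charFun ?_
  ext x
  rw [charFun_law_conv hu hf, ← (hf.smear hu).ft_eq_charFun, ft_smear hf.integrable hu.integrable,
    mul_comm]

/-- Convolution with a probability density preserves lower bounds of Cauchy type. -/
theorem exists_le_smear {f : ℝ → ℝ} (hf : IsDensity f) {c : ℝ} (hc : 0 < c) :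
    ∃ c' : ℝ, 0 < c' ∧ ∀ u : ℝ → ℝ, Continuous u → (∃ C, ∀ x, |u x| ≤ C) →
      (∀ x, c / (1 + x ^ 2) ≤ u x) → ∀ z, c' / (1 + z ^ 2) ≤ smear f u z := by
  have hlim : Tendsto (fun R : ℕ => ∫ y in Set.Icc (-(R : ℝ)) R, f y) atTop (nhds 1) := by
    have h := (MeasureTheory.aecover_Icc (μ := (volume : Measure ℝ))
      (tendsto_neg_atTop_atBot.comp tendsto_natCast_atTop_atTop)
      (tendsto_natCast_atTop_atTop (R := ℝ))).integral_tendsto_of_countably_generated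
      hf.integrable
    rwa [hf.integral_eq_one] at h
  -- `[-R, R]` carries more than half of the mass of `f`, and for `|y| ≤ R` one has `1 + (z-y)² ≤
  -- 2(1+R²)(1+z²)`; this gives the constant `4(1+R²)`.
  obtain ⟨R, hR⟩ := (hlim.eventually (lt_mem_nhds (by norm_num : (1 / 2 : ℝ) < 1))).exists
  refine ⟨c / (4 * (1 + (R : ℝ) ^ 2)), by positivity, fun u hu ⟨C, hC⟩ hlow z => ?_⟩
  have hint := integrable_smear_integrand hf.integrable hu hC z
  have hu0 : ∀ x, 0 ≤ u x := fun x => le_trans (by positivity) (hlow x)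
  set d := c / (2 * (1 + (R : ℝ) ^ 2)) / (1 + z ^ 2) with hd
  have h1 : ∀ y ∈ Set.Icc (-(R : ℝ)) R, d * f y ≤ f y * u (z - y) := by
    intro y hy
    rw [mul_comm]
    refine mul_le_mul_of_nonneg_left (le_trans ?_ (hlow _)) (hf.nonneg y)
    rw [hd, div_div]
    refine div_le_div_of_nonneg_left hc.le (by positivity) ?_
    have : y ^ 2 ≤ (R : ℝ) ^ 2 := sq_le_sq' hy.1 hy.2
    nlinarith [sq_nonneg (z + y), mul_nonneg (sq_nonneg z) (sq_nonneg (R : ℝ))]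
  calc c / (4 * (1 + (R : ℝ) ^ 2)) / (1 + z ^ 2) = d * (1 / 2) := by rw [hd]; field_simp; norm_num
    _ ≤ d * ∫ y in Set.Icc (-(R : ℝ)) R, f y := by gcongr
    _ = ∫ y in Set.Icc (-(R : ℝ)) R, d * f y := (integral_const_mul _ _).symm
    _ ≤ ∫ y in Set.Icc (-(R : ℝ)) R, f y * u (z - y) :=
        setIntegral_mono_on (hf.integrable.const_mul d).integrableOn hint.integrableOn
          measurableSet_Icc h1
    _ ≤ smear f u z := setIntegral_le_integral hint
        (ae_of_all _ fun y => mul_nonneg (hf.nonneg _) (hu0 _))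

/-- A weighted `L²` bound through the Fourier transform and its derivative. -/
theorem lintegral_one_add_sq_mul_sq_le {k : ℝ → ℝ} (hc : Continuous k) (hk : Integrable k)
    (hK : Integrable (ft k)) (hd : Differentiable ℝ (ft k)) (hK' : Integrable (deriv (ft k)))
    (hK2 : Integrable fun x => ‖ft k x‖ ^ 2) (hK2' : Integrable fun x => ‖deriv (ft k) x‖ ^ 2) :
    ∫⁻ z, ENNReal.ofReal ((1 + z ^ 2) * k z ^ 2) ≤
      ENNReal.ofReal ((1 / (2 * Real.pi)) * ∫ x, (‖ft k x‖ ^ 2 + ‖deriv (ft k) x‖ ^ 2)) := by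
  have hpi := Real.pi_pos
  have hF : ∀ (u : ℝ → ℂ) (z : ℝ), ∫ x : ℝ, u (-x) * Complex.exp (Complex.I * x * z) =
      FourierTransform.fourier u (z / (2 * Real.pi)) := by
    intro u z
    rw [← integral_neg_eq_self, Real.fourier_real_eq_integral_exp_smul]
    refine integral_congr_ae (ae_of_all _ fun x => ?_)
    simp only [smul_eq_mul, neg_neg]
    rw [mul_comm]
    congr 2
    push_cast
    field_simp
  have h0 : ∀ z : ℝ, FourierTransform.fourier (ft k) (z / (2 * Real.pi)) =
      ((2 * Real.pi * k z : ℝ) : ℂ) := by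
    intro z
    have h := ft_inversion hc hk hK z
    rw [Complex.ofReal_mul, h, ← hF, ← integral_neg_eq_self]
    have : ((2 * Real.pi : ℝ) : ℂ) ≠ 0 := by exact_mod_cast (by positivity : 2 * Real.pi ≠ 0)
    push_cast at this ⊢
    rw [← mul_assoc, mul_one_div_cancel this, one_mul]
    refine integral_congr_ae (ae_of_all _ fun x => ?_)
    simp only [neg_neg]
    rw [mul_comm]
    congr 2
    ring
  -- Multiplication by `z` corresponds to differentiation of the Fourier transform, so the weight `1
  -- + z²` costs one derivative. This is why decay of `(f*)'` is assumed for the lower bounds.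
  have h1 : ∀ z : ℝ, FourierTransform.fourier (deriv (ft k)) (z / (2 * Real.pi)) =
      Complex.I * ((2 * Real.pi * (z * k z) : ℝ) : ℂ) := by
    intro z
    rw [Real.fourier_deriv hK hd hK']
    simp only [smul_eq_mul]
    rw [h0]
    have : (Real.pi : ℂ) ≠ 0 := by exact_mod_cast hpi.ne'
    push_cast
    field_simp
  have p0 := lintegral_norm_sq_fourier_le_volume (a := fun x => ft k (-x)) hK.comp_neg hK2.comp_neg
  have p1 := lintegral_norm_sq_fourier_le_volume (a := fun x => deriv (ft k) (-x)) hK'.comp_neg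
    hK2'.comp_neg
  simp_rw [hF] at p0 p1
  simp_rw [h0, Complex.norm_real] at p0
  simp_rw [h1, norm_mul, Complex.norm_I, one_mul, Complex.norm_real] at p1
  rw [integral_neg_eq_self (fun x => ‖ft k x‖ ^ 2)] at p0
  rw [integral_neg_eq_self (fun x => ‖deriv (ft k) x‖ ^ 2)] at p1
  have i0 : 0 ≤ ∫ x, ‖ft k x‖ ^ 2 := integral_nonneg fun x => by positivity
  have i1 : 0 ≤ ∫ x, ‖deriv (ft k) x‖ ^ 2 := integral_nonneg fun x => by positivity
  have hkm := hc.measurable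
  calc ∫⁻ z, ENNReal.ofReal ((1 + z ^ 2) * k z ^ 2)
      = ∫⁻ z, ENNReal.ofReal (1 / (2 * Real.pi) ^ 2) *
          (ENNReal.ofReal (‖2 * Real.pi * k z‖ ^ 2) +
            ENNReal.ofReal (‖2 * Real.pi * (z * k z)‖ ^ 2)) := by
        refine lintegral_congr fun z => ?_
        rw [← ENNReal.ofReal_add (by positivity) (by positivity),
          ← ENNReal.ofReal_mul (by positivity)]
        congr 1
        simp only [Real.norm_eq_abs, sq_abs]
        field_simp
    _ = ENNReal.ofReal (1 / (2 * Real.pi) ^ 2) *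
          ((∫⁻ z, ENNReal.ofReal (‖2 * Real.pi * k z‖ ^ 2)) +
            ∫⁻ z, ENNReal.ofReal (‖2 * Real.pi * (z * k z)‖ ^ 2)) := by
        rw [lintegral_const_mul _ (by fun_prop), lintegral_add_left (by fun_prop)]
    _ ≤ ENNReal.ofReal (1 / (2 * Real.pi) ^ 2) *
          (ENNReal.ofReal (2 * Real.pi * ∫ x, ‖ft k x‖ ^ 2) +
            ENNReal.ofReal (2 * Real.pi * ∫ x, ‖deriv (ft k) x‖ ^ 2)) := by gcongr
    _ = _ := by
        rw [integral_add hK2 hK2', ← ENNReal.ofReal_add (by positivity) (by positivity),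
          ← ENNReal.ofReal_mul (by positivity)]
        congr 1
        field_simp

/-- Chi-square distance between two densities, one of which has Cauchy tails. -/
theorem lintegral_sq_div_le {h k : ℝ → ℝ} (hh : IsDensity h) (hk : Integrable k)
    (hk0 : ∫ z, k z = 0) {c X : ℝ} (hc : 0 < c) (hX0 : 0 ≤ X)
    (hlow : ∀ z, c / (1 + z ^ 2) ≤ h z) (hkc : Continuous k)
    (hX : ∫⁻ z, ENNReal.ofReal ((1 + z ^ 2) * k z ^ 2) ≤ ENNReal.ofReal X) :
    ∫⁻ z, ENNReal.ofReal ((h z + k z) ^ 2 / h z) ≤ ENNReal.ofReal (1 + X / c) := by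
  have hpos : ∀ z, 0 < h z := fun z => lt_of_lt_of_le (by positivity) (hlow z)
  have hpt : ∀ z, 0 ≤ (1 + z ^ 2) * k z ^ 2 := fun z => by positivity
  have hint : Integrable fun z => (1 + z ^ 2) * k z ^ 2 := by
    refine ⟨(by fun_prop : Continuous fun z => (1 + z ^ 2) * k z ^ 2).aestronglyMeasurable, ?_⟩
    rw [hasFiniteIntegral_iff_ofReal (ae_of_all _ hpt)]
    exact hX.trans_lt ENNReal.ofReal_lt_top
  have hle : ∫ z, (1 + z ^ 2) * k z ^ 2 ≤ X := by
    rw [← ofReal_integral_eq_lintegral_ofReal hint (ae_of_all _ hpt)] at hX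
    exact (ENNReal.ofReal_le_ofReal_iff hX0).1 hX
  -- In the expansion `h + 2k + k²/h` the first term has integral one, the second zero, and the
  -- Cauchy lower bound on `h` turns the third into the weighted `L²` norm.
  have hb : ∀ z, (h z + k z) ^ 2 / h z ≤ h z + 2 * k z + (1 / c) * ((1 + z ^ 2) * k z ^ 2) := by
    intro z
    have e : (h z + k z) ^ 2 / h z = h z + 2 * k z + k z ^ 2 / h z := by
      have := (hpos z).ne'
      field_simp
      ring
    rw [e]
    have : k z ^ 2 / h z ≤ k z ^ 2 / (c / (1 + z ^ 2)) :=
      div_le_div_of_nonneg_left (sq_nonneg _) (by positivity) (hlow z)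
    have e2 : k z ^ 2 / (c / (1 + z ^ 2)) = (1 / c) * ((1 + z ^ 2) * k z ^ 2) := by
      field_simp
    linarith
  calc ∫⁻ z, ENNReal.ofReal ((h z + k z) ^ 2 / h z)
      ≤ ∫⁻ z, ENNReal.ofReal (h z + 2 * k z + (1 / c) * ((1 + z ^ 2) * k z ^ 2)) :=
        lintegral_mono fun z => ENNReal.ofReal_le_ofReal (hb z)
    _ = ENNReal.ofReal (∫ z, (h z + 2 * k z + (1 / c) * ((1 + z ^ 2) * k z ^ 2))) := by
        refine (ofReal_integral_eq_lintegral_ofReal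
          ((hh.integrable.add (hk.const_mul 2)).add (hint.const_mul _)) (ae_of_all _ fun z => ?_)).symm
        exact le_trans (div_nonneg (sq_nonneg _) (hpos z).le) (hb z)
    _ ≤ _ := by
        refine ENNReal.ofReal_le_ofReal ?_
        have hi : Integrable fun z => h z + 2 * k z := hh.integrable.add (hk.const_mul 2)
        rw [integral_add hi (hint.const_mul _),
          integral_add hh.integrable (hk.const_mul 2), integral_const_mul, integral_const_mul, hk0,
          hh.integral_eq_one]
        have : 1 / c * ∫ z, (1 + z ^ 2) * k z ^ 2 ≤ 1 / c * X := by gcongr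
        rw [one_div_mul_eq_div, one_div_mul_eq_div] at this
        linarith [one_div_mul_eq_div c (∫ z, (1 + z ^ 2) * k z ^ 2)]

/-! ### Band-limited waves and the base density -/

/-- A fixed even smooth bump function supported in `[-1, 1]`. -/
def bump : ContDiffBump (0 : ℝ) where
  rIn := 1 / 2
  rOut := 1
  rIn_pos := by norm_num
  rIn_lt_rOut := by norm_num

theorem bump_eq_zero {x : ℝ} (hx : 1 ≤ |x|) : bump x = 0 :=
  bump.zero_of_le_dist (by simpa [bump] using hx)

theorem bump_neg (x : ℝ) : bump (-x) = bump x := ContDiffBump.neg bump x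

theorem contDiff_bump {n : ℕ∞} : ContDiff ℝ n (bump : ℝ → ℝ) := bump.contDiff

theorem integrable_bump : Integrable (bump : ℝ → ℝ) := bump.integrable

theorem integral_bump_pos : 0 < ∫ x, bump x := bump.integral_pos

theorem exists_deriv_bump_le : ∃ C : ℝ, ∀ x, |deriv bump x| ≤ C := by
  have h : HasCompactSupport (deriv (bump : ℝ → ℝ)) := bump.hasCompactSupport.deriv
  have hc : Continuous (deriv (bump : ℝ → ℝ)) :=
    (contDiff_bump (n := 1)).continuous_deriv le_rfl
  obtain ⟨C, hC⟩ := h.exists_bound_of_continuous hc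
  exact ⟨C, hC⟩

/-- The inverse Fourier transform of `bump`. -/
def bumpHat (t : ℝ) : ℝ := 1 / (2 * Real.pi) * (ft bump t).re

theorem ft_neg_of_even {u : ℝ → ℝ} (hu : ∀ x, u (-x) = u x) (t : ℝ) :
    ft u (-t) = ft u t := by
  rw [ft, ft, ← integral_neg_eq_self]
  refine integral_congr_ae (ae_of_all _ fun x => ?_)
  simp only [hu]
  congr 2
  push_cast
  ring

theorem conj_ft (u : ℝ → ℝ) (t : ℝ) : (starRingEnd ℂ) (ft u t) = ft u (-t) := by
  rw [ft, ft, ← integral_conj]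
  refine integral_congr_ae (ae_of_all _ fun x => ?_)
  simp only [map_mul, Complex.conj_ofReal, ← Complex.exp_conj, Complex.conj_I]
  congr 2
  push_cast
  ring

theorem ft_bump (t : ℝ) : ft bump t = ((2 * Real.pi * bumpHat t : ℝ) : ℂ) := by
  have h : (starRingEnd ℂ) (ft bump t) = ft bump t := by
    rw [conj_ft, ft_neg_of_even bump_neg]
  have hpi := Real.pi_pos
  rw [bumpHat, ← mul_assoc, mul_one_div_cancel (by positivity), one_mul]
  exact (Complex.conj_eq_iff_re.1 h).symm

theorem continuous_bumpHat : Continuous bumpHat := by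
  have := continuous_ft integrable_bump
  unfold bumpHat
  fun_prop

theorem bumpHat_zero_pos : 0 < bumpHat 0 := by
  have hpi := Real.pi_pos
  rw [bumpHat, ft_zero, Complex.ofReal_re]
  have := integral_bump_pos
  positivity

/-- The bump is a Schwartz function, hence so is its Fourier transform; the seminorms of order `0`
and `2` give quadratic decay. -/
theorem exists_bumpHat_le : ∃ C : ℝ, ∀ t, |bumpHat t| ≤ C / (1 + t ^ 2) := by
  have hpi := Real.pi_pos
  have hs : HasCompactSupport fun x : ℝ => (bump x : ℂ) :=
    bump.hasCompactSupport.comp_left (g := fun y : ℝ => (y : ℂ)) Complex.ofReal_zero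
  have hd : ContDiff ℝ (⊤ : ℕ∞) fun x : ℝ => (bump x : ℂ) :=
    Complex.ofRealCLM.contDiff.comp contDiff_bump
  set φ : SchwartzMap ℝ ℂ := hs.toSchwartzMap hd with hφ
  set ψ : SchwartzMap ℝ ℂ := FourierTransform.fourier φ with hψ
  obtain ⟨C₀, hC₀, h₀⟩ := ψ.decay 0 0
  obtain ⟨C₂, hC₂, h₂⟩ := ψ.decay 2 0
  have hval : ∀ t, ψ (-t / (2 * Real.pi)) = ft bump t := by
    intro t
    rw [ft_eq_fourier, hψ, SchwartzMap.fourier_coe]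
    rfl
  refine ⟨1 / (2 * Real.pi) * (C₀ + (2 * Real.pi) ^ 2 * C₂), fun t => ?_⟩
  have e₀ := h₀ (-t / (2 * Real.pi))
  have e₂ := h₂ (-t / (2 * Real.pi))
  simp only [pow_zero, one_mul, norm_iteratedFDeriv_zero, hval] at e₀ e₂
  rw [Real.norm_eq_abs, sq_abs, neg_div, neg_sq, div_pow, div_mul_eq_mul_div,
    div_le_iff₀ (by positivity)] at e₂
  have hre := Complex.abs_re_le_norm (ft bump t)
  rw [le_div_iff₀ (by positivity), bumpHat, abs_mul, abs_of_pos (by positivity), mul_assoc]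
  gcongr
  nlinarith [norm_nonneg (ft bump t), sq_nonneg t, mul_le_mul_of_nonneg_right hre (sq_nonneg t)]

theorem integrable_bumpHat : Integrable bumpHat := by
  obtain ⟨C, hC⟩ := exists_bumpHat_le
  refine (integrable_inv_one_add_sq.const_mul C).mono'
    continuous_bumpHat.aestronglyMeasurable (ae_of_all _ fun t => ?_)
  simpa [div_eq_mul_inv] using hC t

/-- Inversion applied to an even function: `bumpHat` is integrable and its transform is exactly the
compactly supported bump. -/
theorem ft_bumpHat (x : ℝ) : ft bumpHat x = (bump x : ℂ) := by
  have hpi := Real.pi_pos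
  have hft : Integrable (ft bump) := by
    have : ft bump = fun t => ((2 * Real.pi * bumpHat t : ℝ) : ℂ) := funext ft_bump
    rw [this]
    exact (integrable_bumpHat.const_mul _).ofReal
  have h := ft_inversion bump.continuous integrable_bump hft (-x)
  rw [bump_neg] at h
  rw [h, ft, ← integral_const_mul]
  refine integral_congr_ae (ae_of_all _ fun t => ?_)
  simp only [ft_bump]
  have : (Real.pi : ℂ) ≠ 0 := by exact_mod_cast hpi.ne'
  have e : -Complex.I * (t : ℂ) * ((-x : ℝ) : ℂ) = Complex.I * x * t := by push_cast; ring
  rw [e]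
  push_cast
  field_simp

/-- A localized wave whose Fourier transform lives on the frequency bands `±M + [-w, w]`. -/
def wave (x₀ A w M x : ℝ) : ℝ :=
  2 * A * w * (Real.cos (M * (x - x₀)) * bumpHat (w * (x - x₀)))

theorem continuous_wave (x₀ A w M : ℝ) : Continuous (wave x₀ A w M) := by
  have := continuous_bumpHat
  unfold wave
  fun_prop

theorem wave_apply_self (x₀ A w M : ℝ) : wave x₀ A w M x₀ = 2 * bumpHat 0 * (A * w) := by
  simp [wave]
  ring

/-- The size is governed by `A w / (1 + w²y²)` with `y = x - x₀`. The term `w` covers the height of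
the wave and `1/w` its tail, so a wave with `A(w + 1/w)` small can be subtracted from a density with
Cauchy tails without losing positivity. -/
theorem exists_wave_le (x₀ : ℝ) : ∃ C : ℝ, 0 < C ∧ ∀ A w M x : ℝ, 0 ≤ A → 0 < w →
    |wave x₀ A w M x| ≤ C * (A * (w + 1 / w)) / (1 + x ^ 2) := by
  obtain ⟨C, hC⟩ := exists_bumpHat_le
  have hC0 : 0 < C := by
    have h := hC 0
    have := abs_pos.2 bumpHat_zero_pos.ne'
    norm_num at h
    linarith
  refine ⟨2 * C * (2 * (1 + x₀ ^ 2)), by positivity, fun A w M x hA hw => ?_⟩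
  set y := x - x₀ with hy
  have h1 : |wave x₀ A w M x| ≤ 2 * A * w * (C / (1 + (w * y) ^ 2)) := by
    rw [wave, abs_mul, abs_of_nonneg (by positivity), abs_mul]
    gcongr
    calc _ ≤ 1 * (C / (1 + (w * y) ^ 2)) := by
          gcongr
          · exact Real.abs_cos_le_one _
          · exact hC _
      _ = _ := one_mul _
  have h2 : 1 + x ^ 2 ≤ 2 * (1 + x₀ ^ 2) * (1 + y ^ 2) := by
    have : x = y + x₀ := by rw [hy]; ring
    rw [this]
    nlinarith [sq_nonneg (y - x₀), mul_nonneg (sq_nonneg x₀) (sq_nonneg y)]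
  have h3 : w * (1 + y ^ 2) ≤ (w + 1 / w) * (1 + (w * y) ^ 2) := by
    have : (w + 1 / w) * (1 + (w * y) ^ 2) = w + 1 / w + w ^ 3 * y ^ 2 + w * y ^ 2 := by
      field_simp
      ring
    rw [this]
    have : 0 ≤ 1 / w + w ^ 3 * y ^ 2 := by positivity
    nlinarith
  refine h1.trans ?_
  rw [mul_div_assoc', div_le_div_iff₀ (by positivity) (by positivity)]
  calc 2 * A * w * C * (1 + x ^ 2) ≤ 2 * A * w * C * (2 * (1 + x₀ ^ 2) * (1 + y ^ 2)) := by gcongr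
    _ = 4 * A * C * (1 + x₀ ^ 2) * (w * (1 + y ^ 2)) := by ring
    _ ≤ 4 * A * C * (1 + x₀ ^ 2) * ((w + 1 / w) * (1 + (w * y) ^ 2)) := by gcongr
    _ = _ := by ring

theorem integrable_of_abs_le_cauchy {u : ℝ → ℝ} (hu : Continuous u) {C : ℝ}
    (hC : ∀ x, |u x| ≤ C / (1 + x ^ 2)) : Integrable u := by
  refine (integrable_inv_one_add_sq.const_mul C).mono' hu.aestronglyMeasurable
    (ae_of_all _ fun t => ?_)
  simpa [div_eq_mul_inv] using hC t

theorem integrable_wave (x₀ : ℝ) {A w : ℝ} (M : ℝ) (hA : 0 ≤ A) (hw : 0 < w) :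
    Integrable (wave x₀ A w M) := by
  obtain ⟨C, -, hC⟩ := exists_wave_le x₀
  exact integrable_of_abs_le_cauchy (continuous_wave _ _ _ _) fun x => hC A w M x hA hw

/-- The dilation by `w` stretches the bump to width `w` and the cosine moves it to the two
frequencies `±M`; the factor `2Aw` normalises the height of each copy to `A`. -/
theorem ft_wave (x₀ A M : ℝ) {w : ℝ} (hw : 0 < w) (u : ℝ) :
    ft (wave x₀ A w M) u = A * Complex.exp (Complex.I * u * x₀) *
      ((bump ((u - M) / w) + bump ((u + M) / w) : ℝ) : ℂ) := by
  have hwc : (w : ℂ) ≠ 0 := by exact_mod_cast hw.ne'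
  set F : ℝ → ℂ := fun t => Complex.exp (Complex.I * u * (x₀ + t / w : ℝ)) *
    ((2 * A * w * (Real.cos (M * (t / w)) * bumpHat t) : ℝ) : ℂ) with hF
  have h1 : ft (wave x₀ A w M) u = (1 / w : ℂ) * ∫ t, F t := by
    have e : ft (wave x₀ A w M) u = ∫ x, (fun y => F (w * y)) (x - x₀) := by
      rw [ft]
      refine integral_congr_ae (ae_of_all _ fun x => ?_)
      simp only [hF, wave]
      have : w * (x - x₀) / w = x - x₀ := by field_simp
      rw [this]
      congr 3
      push_cast
      ring
    rw [e, integral_sub_right_eq_self (fun y => F (w * y)), Measure.integral_comp_mul_left,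
      abs_of_pos (by positivity), Complex.real_smul]
    push_cast
    rw [one_div]
  have hint : ∀ v : ℝ, Integrable fun t : ℝ =>
      Complex.exp (Complex.I * v * t) * (bumpHat t : ℂ) := by
    intro v
    refine integrable_bumpHat.ofReal.bdd_mul (c := 1) (by fun_prop) (ae_of_all _ fun t => ?_)
    rw [norm_cexp_I_mul]
  have h2 : ∀ t, F t = (A * w * Complex.exp (Complex.I * u * x₀) : ℂ) *
      (Complex.exp (Complex.I * ((u - M) / w : ℝ) * t) * (bumpHat t : ℂ) +
        Complex.exp (Complex.I * ((u + M) / w : ℝ) * t) * (bumpHat t : ℂ)) := by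
    intro t
    have hcos : ((Real.cos (M * (t / w)) : ℝ) : ℂ) =
        (Complex.exp (Complex.I * M * (t / w)) + Complex.exp (-(Complex.I * M * (t / w)))) / 2 := by
      rw [Complex.ofReal_cos, Complex.cos]
      push_cast
      congr 3 <;> ring
    have e1 : Complex.exp (Complex.I * u * (x₀ + t / w : ℝ)) =
        Complex.exp (Complex.I * u * x₀) * Complex.exp (Complex.I * u * (t / w)) := by
      rw [← Complex.exp_add]
      congr 1
      push_cast
      ring
    have e2 : Complex.exp (Complex.I * ((u - M) / w : ℝ) * t) =
        Complex.exp (Complex.I * u * (t / w)) * Complex.exp (-(Complex.I * M * (t / w))) := by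
      rw [← Complex.exp_add]
      congr 1
      push_cast
      ring
    have e3 : Complex.exp (Complex.I * ((u + M) / w : ℝ) * t) =
        Complex.exp (Complex.I * u * (t / w)) * Complex.exp (Complex.I * M * (t / w)) := by
      rw [← Complex.exp_add]
      congr 1
      push_cast
      ring
    simp only [hF, e1, e2, e3]
    rw [Complex.ofReal_mul, Complex.ofReal_mul (Real.cos _), hcos]
    push_cast
    ring
  rw [h1]
  simp_rw [h2]
  rw [integral_const_mul, integral_add (hint _) (hint _)]
  have h3 := ft_bumpHat ((u - M) / w)
  have h4 := ft_bumpHat ((u + M) / w)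
  rw [ft] at h3 h4
  rw [h3, h4]
  push_cast
  field_simp

theorem ft_comp_mul_left (u : ℝ → ℝ) {s : ℝ} (hs : 0 < s) (x : ℝ) :
    ft (fun t => u (s * t)) x = (1 / s : ℂ) * ft u (x / s) := by
  have hsc : (s : ℂ) ≠ 0 := by exact_mod_cast hs.ne'
  have e : ft (fun t => u (s * t)) x =
      ∫ t : ℝ, (fun y : ℝ => Complex.exp (Complex.I * ((x / s : ℝ) : ℂ) * y) * (u y : ℂ)) (s * t) := by
    rw [ft]
    refine integral_congr_ae (ae_of_all _ fun t => ?_)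
    simp only
    congr 2
    push_cast
    field_simp
  rw [e, Measure.integral_comp_mul_left
    (fun y : ℝ => Complex.exp (Complex.I * ((x / s : ℝ) : ℂ) * y) * (u y : ℂ)), abs_of_pos (by positivity), Complex.real_smul, ft]
  push_cast
  rw [one_div]

theorem ft_const_mul (c : ℝ) (u : ℝ → ℝ) (x : ℝ) : ft (fun t => c * u t) x = c * ft u x := by
  rw [ft, ft, ← integral_const_mul]
  refine integral_congr_ae (ae_of_all _ fun t => ?_)
  simp only
  push_cast
  ring

theorem integrable_bumpHat_sq : Integrable fun t => bumpHat t ^ 2 := by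
  obtain ⟨C, hC⟩ := exists_bumpHat_le
  have h : ∀ t, |bumpHat t| ≤ C := fun t => (hC t).trans <| by
    have := (abs_nonneg _).trans (hC 0)
    norm_num at this
    exact div_le_self this (by nlinarith [sq_nonneg t])
  have h2 := integrable_bumpHat.mul_bdd (c := C) continuous_bumpHat.aestronglyMeasurable
    (ae_of_all _ fun t => h t)
  simpa [sq] using h2

/-- Up to powers of `2π`, `bumpHat²` is the transform of the self-convolution of the bump, which
vanishes outside `[-2, 2]`. The square provides a nonnegative band-limited function. -/
theorem ft_bumpHat_sq_eq_zero {x : ℝ} (hx : 2 ≤ |x|) : ft (fun t => bumpHat t ^ 2) x = 0 := by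
  have hpi := Real.pi_pos
  have hpi' : (Real.pi : ℂ) ≠ 0 := by exact_mod_cast hpi.ne'
  have hb1 : ∀ x, |bump x| ≤ 1 := fun x => by
    rw [abs_of_nonneg bump.nonneg]
    exact bump.le_one
  have hft : ∀ t, ft (smear bump bump) t = (2 * Real.pi : ℂ) ^ 2 * ((bumpHat t ^ 2 : ℝ) : ℂ) := by
    intro t
    rw [ft_smear integrable_bump integrable_bump, ft_bump]
    push_cast
    ring
  have hint : Integrable (ft (smear bump bump)) := by
    rw [show ft (smear bump bump) = _ from funext hft]
    exact integrable_bumpHat_sq.ofReal.const_mul _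
  have h := ft_inversion (continuous_smear integrable_bump bump.continuous hb1)
    (integrable_smear integrable_bump integrable_bump) hint (-x)
  have hzero : smear bump bump (-x) = 0 := by
    rw [smear]
    refine integral_eq_zero_of_ae (ae_of_all _ fun y => ?_)
    simp only [Pi.zero_apply]
    rcases le_or_gt 1 |y| with hy | hy
    · rw [bump_eq_zero hy, zero_mul]
    · rw [bump_eq_zero (x := -x - y), mul_zero]
      have : |x| ≤ |-x - y| + |y| := by
        calc |x| = |(-x - y) + y| := by rw [sub_add_cancel, abs_neg]
          _ ≤ _ := abs_add_le _ _
      linarith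
  rw [hzero] at h
  have e : ∫ y : ℝ, Complex.exp (-Complex.I * y * ((-x : ℝ) : ℂ)) * ft (smear bump bump) y =
      (2 * Real.pi : ℂ) ^ 2 * ft (fun t => bumpHat t ^ 2) x := by
    rw [ft, ← integral_const_mul]
    refine integral_congr_ae (ae_of_all _ fun t => ?_)
    simp only [hft]
    have : -Complex.I * (t : ℂ) * ((-x : ℝ) : ℂ) = Complex.I * x * t := by push_cast; ring
    rw [this]
    ring
  rw [e] at h
  have h2 : (1 / (2 * Real.pi) : ℂ) * (2 * Real.pi : ℂ) ^ 2 ≠ 0 := by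
    refine mul_ne_zero (one_div_ne_zero (mul_ne_zero two_ne_zero hpi')) (pow_ne_zero _ ?_)
    exact mul_ne_zero two_ne_zero hpi'
  rw [← mul_assoc] at h
  simpa [h2] using h.symm

theorem isDensity_cauchy : IsDensity fun x : ℝ => 1 / Real.pi * (1 + x ^ 2)⁻¹ where
  nonneg x := by have := Real.pi_pos; positivity
  integrable := integrable_inv_one_add_sq.const_mul _
  integral_eq_one := by
    rw [integral_const_mul, integral_univ_inv_one_add_sq, one_div,
      inv_mul_cancel₀ Real.pi_ne_zero]

/-- A bounded continuous density with Cauchy tails whose Fourier transform is supported in a given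
neighbourhood of the origin. -/
theorem exists_base_density {σ : ℝ} (hσ : 0 < σ) :
    ∃ (g : ℝ → ℝ) (c C : ℝ), 0 < c ∧ IsDensity g ∧ Continuous g ∧ (∀ x, |g x| ≤ C) ∧
      (∀ x, c / (1 + x ^ 2) ≤ g x) ∧ ∀ x, σ ≤ |x| → ft g x = 0 := by
  have hpi := Real.pi_pos
  -- The base density is the convolution of the normalised `u` with the Cauchy density: `u` confines
  -- the frequencies to `|x| < 2·(σ/2) = σ`, and the Cauchy factor supplies the tails.
  set u : ℝ → ℝ := fun t => bumpHat (σ / 2 * t) ^ 2 with hu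
  have hui : Integrable u := integrable_bumpHat_sq.comp_mul_left' (by positivity)
  have hucont : Continuous u := by
    have := continuous_bumpHat
    fun_prop
  have hN : 0 < ∫ t, u t := by
    rw [integral_pos_iff_support_of_nonneg (fun t => sq_nonneg _) hui]
    refine IsOpen.measure_pos _ hucont.isOpen_support ⟨0, ?_⟩
    simpa [hu] using bumpHat_zero_pos.ne'
  set v : ℝ → ℝ := fun t => (∫ t, u t)⁻¹ * u t with hv
  have hvd : IsDensity v :=
    ⟨fun x => mul_nonneg (inv_nonneg.2 hN.le) (sq_nonneg _), hui.const_mul _, by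
      rw [integral_const_mul, inv_mul_cancel₀ hN.ne']⟩
  obtain ⟨c, hc, hlow⟩ := exists_le_smear hvd (c := 1 / Real.pi) (by positivity)
  set p : ℝ → ℝ := fun x => 1 / Real.pi * (1 + x ^ 2)⁻¹ with hp
  have hpd : IsDensity p := isDensity_cauchy
  have hpc : Continuous p := by
    refine continuous_const.mul (Continuous.inv₀ (by fun_prop) fun x => ?_)
    positivity
  have hpb : ∀ x, |p x| ≤ 1 / Real.pi := by
    intro x
    rw [abs_of_nonneg (hpd.nonneg x)]
    refine mul_le_of_le_one_right (by positivity) (inv_le_one_of_one_le₀ ?_)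
    nlinarith [sq_nonneg x]
  refine ⟨smear v p, c, 1 / Real.pi, hc, hvd.smear hpd, continuous_smear hvd.integrable hpc hpb,
    fun z => ?_, hlow p hpc ⟨_, hpb⟩ fun x => (div_eq_mul_inv _ _).le, fun x hx => ?_⟩
  · rw [abs_of_nonneg ((hvd.smear hpd).nonneg z)]
    calc smear v p z ≤ ∫ y, v y * (1 / Real.pi) :=
          integral_mono (integrable_smear_integrand hvd.integrable hpc hpb z)
            (hvd.integrable.mul_const _) fun y =>
              mul_le_mul_of_nonneg_left ((le_abs_self _).trans (hpb _)) (hvd.nonneg y)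
      _ = 1 / Real.pi := by rw [integral_mul_const, hvd.integral_eq_one, one_mul]
  · rw [ft_smear hvd.integrable hpd.integrable, hv, ft_const_mul, hu,
      ft_comp_mul_left (fun t => bumpHat t ^ 2) (by positivity), ft_bumpHat_sq_eq_zero]
    · simp
    · rw [abs_div, abs_of_pos (by positivity : 0 < σ / 2), le_div_iff₀ (by positivity)]
      linarith

/-! ### Chi-square cost of a wave -/

theorem integrable_of_bounded_support {g : ℝ → ℂ} (hg : AEStronglyMeasurable g) {B R : ℝ}
    (hB : ∀ x, ‖g x‖ ≤ B) (hR : ∀ x, R < |x| → g x = 0) : Integrable g := by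
  have h : IntegrableOn g (Set.Icc (-R) R) :=
    Measure.integrableOn_of_bounded (M := B) (by simp) hg
      (ae_of_all _ hB)
  refine (integrableOn_iff_integrable_of_support_subset fun x hx => ?_).1 h
  by_contra hx'
  refine hx (hR x ?_)
  rw [Set.mem_Icc, ← abs_le] at hx'
  exact not_le.1 hx'

/-- The frequency bands on which the Fourier transform of `wave x₀ A w M` lives. -/
def band (w M : ℝ) : Set ℝ := {u | M - w ≤ |u| ∧ |u| ≤ M + w}

theorem bump_sub_eq_zero {w M u : ℝ} (hw : 0 < w) (hM : w ≤ M) (hu : ¬ (M - w < |u| ∧ |u| < M + w)) :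
    bump ((u - M) / w) = 0 ∧ bump ((u + M) / w) = 0 := by
  constructor <;> refine bump_eq_zero ?_ <;>
    rw [abs_div, abs_of_pos hw, one_le_div hw, le_abs] <;> by_contra! h <;> apply hu
  · rw [abs_of_pos (by linarith)]
    constructor <;> linarith
  · rw [abs_of_neg (by linarith)]
    constructor <;> linarith

theorem ft_wave_eq_zero {x₀ A w M u : ℝ} (hw : 0 < w) (hM : w ≤ M)
    (hu : ¬ (M - w < |u| ∧ |u| < M + w)) : ft (wave x₀ A w M) u = 0 := by
  obtain ⟨h1, h2⟩ := bump_sub_eq_zero hw hM hu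
  rw [ft_wave _ _ _ hw, h1, h2]
  simp

theorem norm_ft_wave_le (x₀ : ℝ) {A w : ℝ} (M u : ℝ) (hA : 0 ≤ A) (hw : 0 < w) :
    ‖ft (wave x₀ A w M) u‖ ≤ 2 * A := by
  rw [ft_wave _ _ _ hw, norm_mul, norm_mul, norm_cexp_I_mul, mul_one, Complex.norm_real,
    Complex.norm_real, Real.norm_of_nonneg hA, mul_comm]
  gcongr
  rw [Real.norm_of_nonneg (add_nonneg bump.nonneg bump.nonneg)]
  have h1 : bump ((u - M) / w) ≤ 1 := bump.le_one
  have h2 : bump ((u + M) / w) ≤ 1 := bump.le_one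
  linarith

/-- Differentiating the phase costs the fixed factor `|x₀|`; differentiating a bump of width `w`
costs `1/w`. -/
theorem exists_deriv_ft_wave_le (x₀ : ℝ) : ∃ C : ℝ, 0 ≤ C ∧ ∀ A w M u : ℝ, 0 ≤ A → 0 < w →
    ∃ d : ℂ, HasDerivAt (ft (wave x₀ A w M)) d u ∧ ‖d‖ ≤ C * (A * (1 + 1 / w)) := by
  obtain ⟨C, hC⟩ := exists_deriv_bump_le
  have hC0 : 0 ≤ C := (abs_nonneg _).trans (hC 0)
  refine ⟨2 * |x₀| + 2 * C, by positivity, fun A w M u hA hw => ?_⟩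
  have hbd : ∀ x, HasDerivAt (bump : ℝ → ℝ) (deriv bump x) x := fun x =>
    ((contDiff_bump (n := 1)).differentiable (by norm_num) x).hasDerivAt
  have h1 : HasDerivAt (fun u : ℝ => bump ((u - M) / w)) (deriv bump ((u - M) / w) * (1 / w)) u :=
    (hbd _).comp u (((hasDerivAt_id u).sub_const M).div_const w)
  have h2 : HasDerivAt (fun u : ℝ => bump ((u + M) / w)) (deriv bump ((u + M) / w) * (1 / w)) u :=
    (hbd _).comp u (((hasDerivAt_id u).add_const M).div_const w)
  have h3 := (h1.add h2).ofReal_comp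
  have h4 : HasDerivAt (fun u : ℝ => Complex.exp (Complex.I * u * x₀))
      (Complex.exp (Complex.I * u * x₀) * (Complex.I * 1 * x₀)) u :=
    (((Complex.ofRealCLM.hasDerivAt (x := u)).const_mul Complex.I).mul_const (x₀ : ℂ)).cexp
  have h5 := (h4.const_mul (A : ℂ)).mul h3
  have e : ft (wave x₀ A w M) = fun u : ℝ => A * Complex.exp (Complex.I * u * x₀) *
      ((bump ((u - M) / w) + bump ((u + M) / w) : ℝ) : ℂ) := funext fun u => ft_wave _ _ _ hw u
  refine ⟨_, by rw [e]; exact h5, ?_⟩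
  have hb1 : bump ((u - M) / w) ≤ 1 := bump.le_one
  have hb2 : bump ((u + M) / w) ≤ 1 := bump.le_one
  refine (norm_add_le _ _).trans ?_
  simp only [norm_mul, norm_cexp_I_mul, Complex.norm_real, Complex.norm_I, norm_one,
    Real.norm_eq_abs, abs_of_nonneg hA, Pi.add_apply]
  have e1 : |bump ((u - M) / w) + bump ((u + M) / w)| ≤ 2 := by
    rw [abs_of_nonneg (add_nonneg bump.nonneg bump.nonneg)]
    linarith
  have e2 : |deriv bump ((u - M) / w) * (1 / w) + deriv bump ((u + M) / w) * (1 / w)| ≤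
      2 * C * (1 / w) := by
    rw [← add_mul, abs_mul, abs_of_pos (by positivity : 0 < 1 / w)]
    gcongr
    exact (abs_add_le _ _).trans (by linarith [hC ((u - M) / w), hC ((u + M) / w)])
  calc A * (1 * (1 * 1 * |x₀|)) * |bump ((u - M) / w) + bump ((u + M) / w)| + A * 1 *
        |deriv bump ((u - M) / w) * (1 / w) + deriv bump ((u + M) / w) * (1 / w)|
      ≤ A * (1 * (1 * 1 * |x₀|)) * 2 + A * 1 * (2 * C * (1 / w)) := by gcongr
    _ = A * (2 * |x₀| * 1 + 2 * C * (1 / w)) := by ring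
    _ ≤ A * (2 * |x₀| * (1 + 1 / w) + 2 * C * (1 + 1 / w)) := by
        gcongr
        · linarith [(by positivity : 0 ≤ 1 / w)]
        · linarith [(by positivity : 0 ≤ 1 / w)]
    _ = _ := by ring

/-- The band consists of two intervals of length `2w`, of total measure at most `4w`. -/
theorem integral_le_of_band {F : ℝ → ℝ} {B w M : ℝ} (hB : 0 ≤ B) (hw : 0 < w)
    (hF : ∀ u ∈ band w M, F u ≤ B) (hF0 : ∀ u ∉ band w M, F u = 0) :
    ∫⁻ u, ENNReal.ofReal (F u) ≤ ENNReal.ofReal (4 * w * B) := by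
  set S := Set.Icc (M - w) (M + w) ∪ Set.Icc (-(M + w)) (-(M - w)) with hS
  have hsub : band w M ⊆ S := by
    rintro u ⟨h1, h2⟩
    rcases le_total 0 u with hu | hu
    · rw [abs_of_nonneg hu] at h1 h2
      exact Or.inl ⟨h1, h2⟩
    · rw [abs_of_nonpos hu] at h1 h2
      exact Or.inr ⟨by linarith, by linarith⟩
  have hSm : MeasurableSet S := measurableSet_Icc.union measurableSet_Icc
  calc ∫⁻ u, ENNReal.ofReal (F u) ≤ ∫⁻ u, S.indicator (fun _ => ENNReal.ofReal B) u := by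
        refine lintegral_mono fun u => ?_
        by_cases hu : u ∈ band w M
        · rw [Set.indicator_of_mem (hsub hu)]
          exact ENNReal.ofReal_le_ofReal (hF u hu)
        · simp [hF0 u hu]
    _ = ENNReal.ofReal B * volume S := by
        rw [lintegral_indicator hSm, setLIntegral_const]
    _ ≤ ENNReal.ofReal B * (ENNReal.ofReal (2 * w) + ENNReal.ofReal (2 * w)) := by
        gcongr
        refine (measure_union_le _ _).trans_eq ?_
        rw [Real.volume_Icc, Real.volume_Icc]
        congr 2 <;> ring
    _ = _ := by
        rw [← ENNReal.ofReal_add (by positivity) (by positivity), ← ENNReal.ofReal_mul hB]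
        congr 1
        ring

/-- Smearing a wave with the noise: the weighted `L²` norm is governed by the size of the Fourier
transform of the noise on the bands. -/
theorem exists_smear_wave_le {f : ℝ → ℝ} (hf : Integrable f) (x₀ : ℝ) : ∃ C : ℝ, 0 ≤ C ∧
    ∀ A w M E : ℝ, 0 ≤ A → 0 < w → w ≤ M → 0 ≤ E →
      (∀ u ∈ band w M, DifferentiableAt ℝ (ft f) u) →
      (∀ u ∈ band w M, ‖ft f u‖ ^ 2 + ‖deriv (ft f) u‖ ^ 2 ≤ E) →
      ∫⁻ z, ENNReal.ofReal ((1 + z ^ 2) * smear f (wave x₀ A w M) z ^ 2) ≤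
        ENNReal.ofReal (C * (A ^ 2 * (w + 1 / w) * E)) := by
  have hpi := Real.pi_pos
  obtain ⟨C, hC0, hC⟩ := exists_deriv_ft_wave_le x₀
  set D := 12 + 4 * C ^ 2 with hD
  refine ⟨1 / (2 * Real.pi) * (4 * D), by positivity, fun A w M E hA hw hM hE hdf hbd => ?_⟩
  obtain ⟨Cw, -, hCw⟩ := exists_wave_le x₀
  set H := wave x₀ A w M with hH
  set k := smear f H with hk
  have hHi : Integrable H := integrable_wave x₀ M hA hw
  have hHc : Continuous H := continuous_wave _ _ _ _
  have hHb : ∀ x, |H x| ≤ Cw * (A * (w + 1 / w)) := fun x => by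
    have h := (hCw A w M x hA hw)
    have h0 := (abs_nonneg _).trans (hCw A w M 0 hA hw)
    norm_num at h0
    refine h.trans (div_le_self (by simpa using h0) (by nlinarith [sq_nonneg x]))
  have hft : ft k = fun u => ft f u * ft H u := funext fun u => ft_smear hf hHi u
  -- Off the closed bands the transform vanishes near each point, hence together with its
  -- derivative; `f*` need only be differentiable on the bands.
  have hnear : ∀ u ∉ band w M, ft k =ᶠ[nhds u] fun _ => 0 := by
    intro u hu
    have hopen : IsOpen (band w M)ᶜ := by
      have : IsClosed (band w M) :=
        (isClosed_le continuous_const continuous_abs).inter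
          (isClosed_le continuous_abs continuous_const)
      exact this.isOpen_compl
    filter_upwards [hopen.mem_nhds hu] with v hv
    rw [hft]
    simp only
    rw [ft_wave_eq_zero hw hM fun h => hv ⟨h.1.le, h.2.le⟩, mul_zero]
  have hder : ∀ u ∈ band w M, ∃ d : ℂ, ‖d‖ ≤ C * (A * (1 + 1 / w)) ∧
      HasDerivAt (ft k) (deriv (ft f) u * ft H u + ft f u * d) u := by
    intro u hu
    obtain ⟨d, hd, hdb⟩ := hC A w M u hA hw
    exact ⟨d, hdb, by rw [hft]; exact (hdf u hu).hasDerivAt.mul hd⟩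
  have hdiff : Differentiable ℝ (ft k) := by
    intro u
    by_cases hu : u ∈ band w M
    · obtain ⟨d, -, hd⟩ := hder u hu
      exact hd.differentiableAt
    · exact (hnear u hu).symm.differentiableAt_iff.1 (differentiableAt_const _)
  have h0 : ∀ u ∉ band w M, ft k u = 0 := fun u hu => (hnear u hu).eq_of_nhds
  have h0' : ∀ u ∉ band w M, deriv (ft k) u = 0 := fun u hu => by
    rw [(hnear u hu).deriv_eq, deriv_const]
  -- A pointwise bound on the bands; multiplied by their measure `4w` it gives the factor `A²(w +
  -- 1/w)E` of the statement.
  set B := D * (A ^ 2 * (1 + 1 / w ^ 2) * E) with hB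
  have hB0 : 0 ≤ B := by positivity
  have hmain : ∀ u ∈ band w M, ‖ft k u‖ ^ 2 + ‖deriv (ft k) u‖ ^ 2 ≤ B := by
    intro u hu
    obtain ⟨d, hdb, hd⟩ := hder u hu
    have hHu := norm_ft_wave_le x₀ M u hA hw
    have hEu := hbd u hu
    rw [hd.deriv, hft]
    simp only [norm_mul]
    set p := ‖ft f u‖ with hp
    set q := ‖deriv (ft f) u‖ with hq
    have h1 : ‖deriv (ft f) u * ft H u + ft f u * d‖ ≤ q * (2 * A) + p * (C * (A * (1 + 1 / w))) := by
      refine (norm_add_le _ _).trans ?_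
      rw [norm_mul, norm_mul]
      gcongr
    have h2 : (p * ‖ft H u‖) ^ 2 ≤ (p * (2 * A)) ^ 2 := by gcongr
    have h3 : ‖deriv (ft f) u * ft H u + ft f u * d‖ ^ 2 ≤
        2 * (q * (2 * A)) ^ 2 + 2 * (p * (C * (A * (1 + 1 / w)))) ^ 2 := by
      refine (pow_le_pow_left₀ (norm_nonneg _) h1 2).trans (add_sq_le.trans_eq (by ring))
    have h4 : (1 + 1 / w) ^ 2 ≤ 2 * (1 + 1 / w ^ 2) := by
      have := add_sq_le (a := (1 : ℝ)) (b := 1 / w)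
      rw [one_pow, one_div_pow] at this
      linarith
    have hp2 : p ^ 2 ≤ E := by linarith [sq_nonneg q]
    have hq2 : q ^ 2 ≤ E := by linarith [sq_nonneg p]
    have hw1 : 1 ≤ 1 + 1 / w ^ 2 := by linarith [(by positivity : 0 ≤ 1 / w ^ 2)]
    calc _ ≤ (p * (2 * A)) ^ 2 + (2 * (q * (2 * A)) ^ 2 +
          2 * (p * (C * (A * (1 + 1 / w)))) ^ 2) := add_le_add h2 h3
      _ = A ^ 2 * (4 * p ^ 2 + 8 * q ^ 2 + 2 * C ^ 2 * p ^ 2 * (1 + 1 / w) ^ 2) := by ring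
      _ ≤ A ^ 2 * (4 * E + 8 * E + 2 * C ^ 2 * E * (2 * (1 + 1 / w ^ 2))) := by gcongr
      _ = A ^ 2 * (12 * E * 1 + 4 * C ^ 2 * E * (1 + 1 / w ^ 2)) := by ring
      _ ≤ A ^ 2 * (12 * E * (1 + 1 / w ^ 2) + 4 * C ^ 2 * E * (1 + 1 / w ^ 2)) := by gcongr
      _ = B := by rw [hB, hD]; ring
  have hall : ∀ u, ‖ft k u‖ ^ 2 + ‖deriv (ft k) u‖ ^ 2 ≤ B := by
    intro u
    by_cases hu : u ∈ band w M
    · exact hmain u hu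
    · simpa [h0 u hu, h0' u hu] using hB0
  have hsup : ∀ u, M + w < |u| → u ∉ band w M := fun u hu h => absurd h.2 (not_le.2 hu)
  have hK1 : ∀ u, ‖ft k u‖ ≤ Real.sqrt B := fun u =>
    Real.le_sqrt_of_sq_le ((le_add_of_nonneg_right (sq_nonneg _)).trans (hall u))
  have hK2 : ∀ u, ‖deriv (ft k) u‖ ≤ Real.sqrt B := fun u =>
    Real.le_sqrt_of_sq_le ((le_add_of_nonneg_left (sq_nonneg _)).trans (hall u))
  have hm1 : AEStronglyMeasurable (ft k) := hdiff.continuous.aestronglyMeasurable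
  have hm2 : AEStronglyMeasurable (deriv (ft k)) := (stronglyMeasurable_deriv _).aestronglyMeasurable
  have i1 := integrable_of_bounded_support hm1 hK1 fun u hu => h0 u (hsup u hu)
  have i2 := integrable_of_bounded_support hm2 hK2 fun u hu => h0' u (hsup u hu)
  have i1' : Integrable fun u => ‖ft k u‖ ^ 2 := by
    simpa [sq] using i1.norm.mul_bdd (c := Real.sqrt B) hm1.norm
      (ae_of_all _ fun u => by simpa using hK1 u)
  have i2' : Integrable fun u => ‖deriv (ft k) u‖ ^ 2 := by
    simpa [sq] using i2.norm.mul_bdd (c := Real.sqrt B) hm2.norm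
      (ae_of_all _ fun u => by simpa using hK2 u)
  refine (lintegral_one_add_sq_mul_sq_le (continuous_smear hf hHc hHb)
    (integrable_smear hf hHi) i1 hdiff i2 i1' i2').trans (ENNReal.ofReal_le_ofReal ?_)
  have h5 : ∫ u, (‖ft k u‖ ^ 2 + ‖deriv (ft k) u‖ ^ 2) ≤ 4 * w * B := by
    have h := integral_le_of_band hB0 hw hmain fun u hu => by simp [h0 u hu, h0' u hu]
    have i3 : Integrable fun u => ‖ft k u‖ ^ 2 + ‖deriv (ft k) u‖ ^ 2 := i1'.add i2'
    rw [← ofReal_integral_eq_lintegral_ofReal i3 (ae_of_all _ fun u => by positivity)] at h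
    exact (ENNReal.ofReal_le_ofReal_iff (by positivity)).1 h
  calc _ ≤ 1 / (2 * Real.pi) * (4 * w * B) := by gcongr
    _ = _ := by rw [hB]; field_simp

/-! ### General lower bounds from two densities differing by a wave -/

section

variable {Λ : Set Smoothness} {φ : ℕ → Smoothness → ℝ} {f : ℝ → ℝ} {B A₁ R : ℝ}

theorem ft_add {u v : ℝ → ℝ} (hu : Integrable u) (hv : Integrable v) (x : ℝ) :
    ft (fun t => u t + v t) x = ft u x + ft v x := by
  have hint : ∀ {u : ℝ → ℝ}, Integrable u →
      Integrable fun t : ℝ => Complex.exp (Complex.I * x * t) * (u t : ℂ) := by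
    intro u hu
    refine hu.ofReal.bdd_mul (c := 1) (by fun_prop) (ae_of_all _ fun t => ?_)
    rw [norm_cexp_I_mul]
  rw [ft, ft, ft, ← integral_add (hint hu) (hint hv)]
  refine integral_congr_ae (ae_of_all _ fun t => ?_)
  simp only
  push_cast
  ring

theorem ParamsWithin.weight_le (hΛ : ParamsWithin Λ B A₁ R) {l : Smoothness} (hl : l ∈ Λ) {x : ℝ}
    (hx : |x| ≤ 1) : weight l x ≤ 2 ^ B * Real.exp (2 * A₁) := by
  obtain ⟨⟨hb, hb'⟩, ⟨ha, ha'⟩, ⟨hr, hr'⟩⟩ := hΛ l hl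
  have h1 : |x| ^ l.r ≤ 1 := Real.rpow_le_one (abs_nonneg _) hx hr
  have h2 : x ^ 2 + 1 ≤ 2 := by
    have : x ^ 2 ≤ 1 := by rwa [sq_le_one_iff_abs_le_one]
    linarith
  have h3 : (x ^ 2 + 1) ^ l.b ≤ 2 ^ B :=
    (Real.rpow_le_rpow (by positivity) h2 hb).trans
      (Real.rpow_le_rpow_of_exponent_le (by norm_num) hb')
  have h4 : 2 * l.a * |x| ^ l.r ≤ 2 * A₁ := by
    calc 2 * l.a * |x| ^ l.r ≤ 2 * l.a * 1 := by gcongr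
      _ ≤ 2 * A₁ := by linarith
  exact mul_le_mul h3 (Real.exp_le_exp.2 h4) (Real.exp_pos _).le (by positivity)

/-- On `[-σ, σ]` with `σ ≤ 1` the weights of all classes in `Λ` share one bound. A base density with
`σ` small therefore belongs to all these classes at once, which lets it be charged with the rate of
any of them. -/
theorem ft_density_lintegral_le {g : ℝ → ℝ} (hg : IsDensity g) (hΛ : ParamsWithin Λ B A₁ R)
    {σ : ℝ} (hσ1 : σ ≤ 1) (hσ : ∀ x, σ ≤ |x| → ft g x = 0) {l : Smoothness} (hl : l ∈ Λ) :
    ∫⁻ x, ENNReal.ofReal (‖ft g x‖ ^ 2 * weight l x) ≤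
      ENNReal.ofReal (2 * σ * (2 ^ B * Real.exp (2 * A₁))) := by
  set W := (2 : ℝ) ^ B * Real.exp (2 * A₁) with hW
  calc ∫⁻ x, ENNReal.ofReal (‖ft g x‖ ^ 2 * weight l x)
      ≤ ∫⁻ x, (Set.Icc (-σ) σ).indicator (fun _ => ENNReal.ofReal W) x := by
        refine lintegral_mono fun x => ?_
        by_cases hx : |x| ≤ σ
        · rw [Set.indicator_of_mem (Set.mem_Icc.2 (abs_le.1 hx))]
          refine ENNReal.ofReal_le_ofReal ?_
          calc ‖ft g x‖ ^ 2 * weight l x ≤ 1 * W := by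
                have := hg.norm_ft_le_one x
                have := weight_pos l x
                gcongr
                · exact pow_le_one₀ (norm_nonneg _) (by assumption)
                · exact hΛ.weight_le hl (hx.trans hσ1)
            _ = W := one_mul _
        · simp [hσ x (not_le.1 hx).le]
    _ = ENNReal.ofReal W * ENNReal.ofReal (σ - -σ) := by
        rw [lintegral_indicator measurableSet_Icc, setLIntegral_const, Real.volume_Icc]
    _ = _ := by
        rw [← ENNReal.ofReal_mul (by positivity)]
        congr 1
        ring

theorem mem_smoothClass_of_lintegral_le {g : ℝ → ℝ} {l : Smoothness} (hg : IsDensity g)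
    (hc : Continuous g) (h : ∫⁻ x, ENNReal.ofReal (‖ft g x‖ ^ 2 * weight l x) ≤
      ENNReal.ofReal (2 * Real.pi * l.L)) : g ∈ smoothClass l := by
  refine ⟨hg, hc, ?_⟩
  simpa only [weight, mul_assoc] using h

/-- The squared transform is at most `4A²` on bands of total measure `4w`. -/
theorem lintegral_ft_wave_le (x₀ : ℝ) {A w M W : ℝ} (hA : 0 ≤ A) (hw : 0 < w) (hM : w ≤ M)
    {l : Smoothness} (hW : ∀ u ∈ Set.Icc (M - w) (M + w), weight l u ≤ W) :
    ∫⁻ x, ENNReal.ofReal (‖ft (wave x₀ A w M) x‖ ^ 2 * weight l x) ≤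
      ENNReal.ofReal (16 * (A ^ 2 * w * W)) := by
  have hW' : ∀ u ∈ band w M, weight l u ≤ W := by
    rintro u ⟨h1, h2⟩
    rcases le_total 0 u with hu | hu
    · rw [abs_of_nonneg hu] at h1 h2
      exact hW u ⟨h1, h2⟩
    · rw [abs_of_nonpos hu] at h1 h2
      rw [← weight_neg]
      exact hW (-u) ⟨h1, h2⟩
  have hW0 : 0 ≤ W := (weight_pos l M).le.trans (hW M ⟨by linarith, by linarith⟩)
  refine (integral_le_of_band (B := 4 * A ^ 2 * W) (M := M) (by positivity) hw ?_ ?_).trans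
    (ENNReal.ofReal_le_ofReal (by linarith))
  · intro u hu
    have h1 := norm_ft_wave_le x₀ M u hA hw
    have h2 := weight_pos l u
    calc ‖ft (wave x₀ A w M) u‖ ^ 2 * weight l u ≤ (2 * A) ^ 2 * W := by
          gcongr
          exact hW' u hu
      _ = _ := by ring
  · intro u hu
    rw [ft_wave_eq_zero hw hM fun h => hu ⟨h.1.le, h.2.le⟩]
    simp

/-- Lower bounds from two densities which differ by a localized wave: the perturbed density belongs
to the class with parameter `l₁`, the unperturbed one to the class with parameter `l₂`. -/
theorem lowerBound_of_waves (hf : IsDensity f) (x₀ : ℝ) {L₀ M₀ : ℝ} (hL₀ : 0 < L₀)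
    (hΛ : ParamsWithin Λ B A₁ R) (hL : ∀ l ∈ Λ, L₀ ≤ l.L)
    (hd : ∀ u, M₀ ≤ |u| → DifferentiableAt ℝ (ft f) u) :
    ∃ c κ : ℝ, 0 < c ∧ 0 < κ ∧ ∀ C : ℝ, 0 < C →
      (∀ᶠ n : ℕ in atTop, ∃ l₁ ∈ Λ, ∃ l₂ ∈ Λ, ∃ A w M W E : ℝ, 0 ≤ A ∧ 0 < w ∧ 0 ≤ E ∧
        1 ≤ M - w ∧ M₀ ≤ M - w ∧ A * (w + 1 / w) ≤ c ∧ A ^ 2 * w * W ≤ c ∧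
        (∀ u ∈ Set.Icc (M - w) (M + w), weight l₁ u ≤ W) ∧
        (∀ u ∈ band w M, ‖ft f u‖ ^ 2 + ‖deriv (ft f) u‖ ^ 2 ≤ E) ∧
        0 < φ n l₁ ∧ 0 < φ n l₂ ∧ φ n l₁ ≤ C * (A * w) ^ 2 ∧
        Real.exp (κ * (n * (A ^ 2 * (w + 1 / w) * E))) * φ n l₂ ≤ C * (A * w) ^ 2) →
      LowerBound f x₀ Λ φ := by
  have hpi := Real.pi_gt_three
  set W₀ := (2 : ℝ) ^ B * Real.exp (2 * A₁) with hW₀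
  have hW₀0 : 0 < W₀ := by positivity
  -- With this `σ` the base density uses at most `2L₀` of the budget `2πL` of a class.
  set σ := min 1 (L₀ / W₀) with hσ
  have hσ0 : 0 < σ := lt_min one_pos (by positivity)
  have hσW : σ * W₀ ≤ L₀ := by
    calc σ * W₀ ≤ L₀ / W₀ * W₀ := by gcongr; exact min_le_right _ _
      _ = L₀ := div_mul_cancel₀ _ hW₀0.ne'
  obtain ⟨g₀, c₀, C₀, hc₀, hg₀, hg₀c, hg₀b, hg₀l, hg₀σ⟩ := exists_base_density hσ0
  obtain ⟨c₁, hc₁, hsm⟩ := exists_le_smear hf hc₀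
  have hh₀l := hsm g₀ hg₀c ⟨C₀, hg₀b⟩ hg₀l
  obtain ⟨C₁, hC₁, hwave⟩ := exists_wave_le x₀
  obtain ⟨C₂, hC₂, hchi⟩ := exists_smear_wave_le hf.integrable x₀
  have hb0 := bumpHat_zero_pos
  -- `c₀ / C₁` keeps the perturbed function nonnegative and `L₀ / 16` keeps it in its class. `κ` is
  -- the chi-square constant over the Cauchy constant of the smeared density, with `1` added for
  -- strict positivity.
  refine ⟨min (c₀ / C₁) (L₀ / 16), (C₂ + 1) / c₁, lt_min (by positivity) (by positivity),
    by positivity, fun C hC hev => ?_⟩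
  refine ⟨bumpHat 0 ^ 2 / C, by positivity, ?_⟩
  filter_upwards [hev] with n hn
  obtain ⟨l₁, hl₁, l₂, hl₂, A, w, M, W, E, hA, hw, hE, hM1, hM₀, hAw, hAW, hW, hEb, hφ₁, hφ₂,
    hr₁, hr₂⟩ := hn
  have hwM : w ≤ M := by linarith
  set H := wave x₀ A w M with hH
  have hHi : Integrable H := integrable_wave x₀ M hA hw
  have hHc : Continuous H := continuous_wave _ _ _ _
  have hHabs : ∀ x, |H x| ≤ c₀ / (1 + x ^ 2) := by
    intro x
    refine (hwave A w M x hA hw).trans ?_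
    gcongr
    calc C₁ * (A * (w + 1 / w)) ≤ C₁ * (c₀ / C₁) := by
          gcongr
          exact hAw.trans (min_le_left _ _)
      _ = c₀ := mul_div_cancel₀ _ hC₁.ne'
  have hHb : ∀ x, |H x| ≤ c₀ := fun x =>
    (hHabs x).trans (div_le_self hc₀.le (by nlinarith [sq_nonneg x]))
  have hH0 : ft H 0 = 0 := by
    refine ft_wave_eq_zero hw hwM fun h => ?_
    rw [abs_zero] at h
    linarith [h.1]
  have hHint : ∫ x, H x = 0 := by
    rw [ft_zero] at hH0
    exact_mod_cast hH0
  set g₁ : ℝ → ℝ := fun x => g₀ x + H x with hg₁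
  have hg₁d : IsDensity g₁ := by
    refine ⟨fun x => ?_, hg₀.integrable.add hHi, ?_⟩
    · have h1 := hg₀l x
      have h2 := neg_le_of_abs_le (hHabs x)
      simp only [hg₁]
      linarith
    · simp only [hg₁]
      rw [integral_add hg₀.integrable hHi, hg₀.integral_eq_one, hHint, add_zero]
  have hg₁c : Continuous g₁ := hg₀c.add hHc
  have hL1 := hL l₁ hl₁
  have hmem₂ : g₀ ∈ smoothClass l₂ := by
    refine mem_smoothClass_of_lintegral_le hg₀ hg₀c
      ((ft_density_lintegral_le hg₀ hΛ (min_le_left _ _) hg₀σ hl₂).trans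
        (ENNReal.ofReal_le_ofReal ?_))
    have := hL l₂ hl₂
    calc 2 * σ * W₀ ≤ 2 * L₀ := by linarith
      _ ≤ 2 * Real.pi * l₂.L := by nlinarith
  have hmem₁ : g₁ ∈ smoothClass l₁ := by
    refine mem_smoothClass_of_lintegral_le hg₁d hg₁c ?_
    have hr : 0 ≤ l₁.r := (hΛ l₁ hl₁).2.2.1
    have hwc := (continuous_weight hr).measurable
    have hm0 := (continuous_ft hg₀.integrable).measurable
    have hm1 := (continuous_ft hHi).measurable
    calc ∫⁻ x, ENNReal.ofReal (‖ft g₁ x‖ ^ 2 * weight l₁ x)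
        ≤ ∫⁻ x, (2 * ENNReal.ofReal (‖ft g₀ x‖ ^ 2 * weight l₁ x) +
            2 * ENNReal.ofReal (‖ft H x‖ ^ 2 * weight l₁ x)) := by
          refine lintegral_mono fun x => ?_
          have hw0 := weight_pos l₁ x
          have e2 : (2 : ENNReal) = ENNReal.ofReal 2 := by norm_num
          rw [e2, ← ENNReal.ofReal_mul (by norm_num), ← ENNReal.ofReal_mul (by norm_num),
            ← ENNReal.ofReal_add (by positivity) (by positivity)]
          refine ENNReal.ofReal_le_ofReal ?_
          rw [hg₁, ft_add hg₀.integrable hHi]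
          have h1 : ‖ft g₀ x + ft H x‖ ^ 2 ≤ 2 * (‖ft g₀ x‖ ^ 2 + ‖ft H x‖ ^ 2) :=
            (pow_le_pow_left₀ (norm_nonneg _) (norm_add_le _ _) 2).trans add_sq_le
          nlinarith
      _ = 2 * (∫⁻ x, ENNReal.ofReal (‖ft g₀ x‖ ^ 2 * weight l₁ x)) +
            2 * ∫⁻ x, ENNReal.ofReal (‖ft H x‖ ^ 2 * weight l₁ x) := by
          rw [lintegral_add_left (by fun_prop), lintegral_const_mul _ (by fun_prop),
            lintegral_const_mul _ (by fun_prop)]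
      _ ≤ 2 * ENNReal.ofReal (2 * σ * W₀) + 2 * ENNReal.ofReal (16 * (A ^ 2 * w * W)) := by
          gcongr
          · exact ft_density_lintegral_le hg₀ hΛ (min_le_left _ _) hg₀σ hl₁
          · exact lintegral_ft_wave_le x₀ hA hw hwM hW
      -- The two contributions add up to `6L₀`, which fits into `2πL` because `π > 3`.
      _ ≤ 2 * ENNReal.ofReal (2 * L₀) + 2 * ENNReal.ofReal L₀ := by
          have h1 := hAW.trans (min_le_right _ _)
          refine add_le_add ?_ ?_
          · exact mul_le_mul_right (ENNReal.ofReal_le_ofReal (by linarith)) _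
          · exact mul_le_mul_right (ENNReal.ofReal_le_ofReal (by linarith)) _
      _ ≤ _ := by
          have e2 : (2 : ENNReal) = ENNReal.ofReal 2 := by norm_num
          rw [e2, ← ENNReal.ofReal_mul (by norm_num), ← ENNReal.ofReal_mul (by norm_num),
            ← ENNReal.ofReal_add (by positivity) (by positivity)]
          refine ENNReal.ofReal_le_ofReal ?_
          nlinarith
  set k := smear f H with hk
  have hk1 : smear f g₁ = fun z => smear f g₀ z + k z := by
    ext z
    rw [hk, smear, smear, smear, ← integral_add
      (integrable_smear_integrand hf.integrable hg₀c hg₀b z)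
      (integrable_smear_integrand hf.integrable hHc hHb z)]
    simp only [hg₁, mul_add]
  have hkint : ∫ z, k z = 0 := by
    have h : ft k 0 = 0 := by rw [hk, ft_smear hf.integrable hHi, hH0, mul_zero]
    rw [ft_zero] at h
    exact_mod_cast h
  have hkc : Continuous k := continuous_smear hf.integrable hHc hHb
  have hband : ∀ u ∈ band w M, M₀ ≤ |u| := fun u hu => hM₀.trans hu.1
  set X := C₂ * (A ^ 2 * (w + 1 / w) * E) with hX
  have hX0 : 0 ≤ X := by positivity
  have hchi' := lintegral_sq_div_le (hf.smear hg₀) (integrable_smear hf.integrable hHi) hkint hc₁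
    hX0 hh₀l hkc (hchi A w M E hA hw hwM hE (fun u hu => hd u (hband u hu)) hEb)
  refine le_iInf fun T => le_iInf fun hT => ?_
  set S := ⨆ l ∈ Λ, ⨆ g ∈ smoothClass l, risk f x₀ n T g / ENNReal.ofReal (φ n l) with hS
  have hle : ∀ l ∈ Λ, ∀ g ∈ smoothClass l, 0 < φ n l →
      risk f x₀ n T g ≤ S * ENNReal.ofReal (φ n l) := by
    intro l hl g hg hφ
    rw [← ENNReal.div_le_iff (by simpa using hφ) ENNReal.ofReal_ne_top]
    exact le_iSup₂_of_le l hl (le_iSup₂_of_le g hg le_rfl)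
  have hcont₁ : Continuous (smear f g₁) := by
    rw [hk1]
    exact (continuous_smear hf.integrable hg₀c hg₀b).add hkc
  have hkey := risk_two_point (g₀ := g₀) (g₁ := g₁) (hf.smear hg₀) (hf.smear hg₁d)
    (continuous_smear hf.integrable hg₀c hg₀b).measurable hcont₁.measurable
    (fun z => lt_of_lt_of_le (by positivity) (hh₀l z)) (law_conv_eq hf hg₀) (law_conv_eq hf hg₁d)
    (X := X / c₁) (by rw [hk1]; exact hchi') (by positivity) x₀ hT
  have hval : (g₁ x₀ - g₀ x₀) ^ 2 = 4 * bumpHat 0 ^ 2 * (A * w) ^ 2 := by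
    simp only [hg₁, add_sub_cancel_left]
    rw [hH, wave_apply_self]
    ring
  -- Only the product of the likelihood factor with the rate at `l₂` must stay below the squared
  -- gap; a faster rate at `l₂` leaves room for a large exponential.
  have hexp : Real.exp (n * (X / c₁)) * φ n l₂ ≤ C * (A * w) ^ 2 := by
    refine le_trans (mul_le_mul_of_nonneg_right (Real.exp_le_exp.2 ?_) hφ₂.le) hr₂
    have h1 : (n : ℝ) * (X / c₁) = C₂ / c₁ * (n * (A ^ 2 * (w + 1 / w) * E)) := by
      rw [hX]; ring
    rw [h1]
    gcongr
    linarith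
  have hAw0 : 0 < (A * w) ^ 2 := by
    have h1 : 0 < C * (A * w) ^ 2 := hφ₁.trans_le hr₁
    exact (mul_pos_iff_of_pos_left hC).1 h1
  have hfin : ENNReal.ofReal (4 * bumpHat 0 ^ 2 * (A * w) ^ 2) ≤
      S * ENNReal.ofReal (4 * (C * (A * w) ^ 2)) := by
    rw [← hval]
    refine hkey.trans ?_
    have e4 : ENNReal.ofReal (4 * (C * (A * w) ^ 2)) =
        2 * ENNReal.ofReal (C * (A * w) ^ 2) + 2 * ENNReal.ofReal (C * (A * w) ^ 2) := by
      rw [ENNReal.ofReal_mul (by norm_num), ← add_mul]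
      norm_num
    calc _ ≤ 2 * (S * ENNReal.ofReal (φ n l₁)) +
          2 * ENNReal.ofReal (Real.exp (n * (X / c₁))) * (S * ENNReal.ofReal (φ n l₂)) := by
          gcongr
          · exact hle l₁ hl₁ g₁ hmem₁ hφ₁
          · exact hle l₂ hl₂ g₀ hmem₂ hφ₂
      _ = S * (2 * ENNReal.ofReal (φ n l₁) +
            2 * ENNReal.ofReal (Real.exp (n * (X / c₁)) * φ n l₂)) := by
          rw [ENNReal.ofReal_mul (Real.exp_pos _).le]
          ring
      _ ≤ _ := by
          rw [e4]
          gcongr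
  rw [← ENNReal.div_le_iff (by simpa using by positivity) ENNReal.ofReal_ne_top,
    ← ENNReal.ofReal_div_of_pos (by positivity)] at hfin
  refine le_trans (le_of_eq ?_) hfin
  have hA0 : A ≠ 0 := by
    rintro rfl
    simp at hAw0
  congr 1
  field_simp

end

section

variable {Λ : Set Smoothness} {φ : ℕ → Smoothness → ℝ} {f : ℝ → ℝ} {γ α ρ B A₁ R : ℝ}

/-- Size of the Fourier transform of the noise and of its derivative near infinity. -/
theorem IsNoise.exists_energy_le (hf : IsNoise f γ α ρ) {s p : ℝ} (hD : DerivDecay f s α ρ)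
    (hps : p ≤ s) (hpγ : p ≤ γ) : ∃ C M₀ : ℝ, 0 < C ∧ 1 ≤ M₀ ∧ ∀ u, M₀ ≤ |u| →
      DifferentiableAt ℝ (ft f) u ∧ ‖ft f u‖ ^ 2 + ‖deriv (ft f) u‖ ^ 2 ≤
        C * (|u| ^ (-2 * p) * Real.exp (-2 * α * |u| ^ ρ)) := by
  obtain ⟨κ₀, κ₁, -, hb⟩ := hf.bounds
  obtain ⟨C, M, hD⟩ := hD
  have hγ := hf.gamma_nonneg
  refine ⟨κ₁ ^ 2 + C ^ 2 + 1, max 1 M, by positivity, le_max_left _ _, fun u hu => ?_⟩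
  have hu1 : 1 ≤ |u| := (le_max_left _ _).trans hu
  have hu0 : 0 < |u| := by linarith
  obtain ⟨hd, hdb⟩ := hD u ((le_max_right _ _).trans hu)
  refine ⟨hd, ?_⟩
  set e := Real.exp (-α * |u| ^ ρ) with he
  have he2 : Real.exp (-2 * α * |u| ^ ρ) = e ^ 2 := by
    rw [he, ← Real.exp_nat_mul]
    congr 1
    push_cast
    ring
  have hp2 : |u| ^ (-2 * p) = (|u| ^ (-p)) ^ 2 := by
    rw [← Real.rpow_natCast, ← Real.rpow_mul hu0.le]
    congr 1
    push_cast
    ring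
  have h1 : (u ^ 2 + 1) ^ (-γ / 2) ≤ |u| ^ (-p) := by
    calc (u ^ 2 + 1) ^ (-γ / 2) ≤ (|u| ^ 2) ^ (-γ / 2) := by
          refine Real.rpow_le_rpow_of_nonpos (by positivity) ?_ (by linarith)
          rw [sq_abs]
          linarith
      _ = |u| ^ (-γ) := by
          rw [← Real.rpow_natCast, ← Real.rpow_mul hu0.le]
          congr 1
          push_cast
          ring
      _ ≤ |u| ^ (-p) := Real.rpow_le_rpow_of_exponent_le hu1 (by linarith)
  have h2 : |u| ^ (-s) ≤ |u| ^ (-p) := Real.rpow_le_rpow_of_exponent_le hu1 (by linarith)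
  have h3 : ‖ft f u‖ ≤ |κ₁| * |u| ^ (-p) * e := by
    refine (hb u).2.trans ?_
    gcongr
    exact le_abs_self _
  have h4 : ‖deriv (ft f) u‖ ≤ |C| * |u| ^ (-p) * e := by
    refine hdb.trans ?_
    gcongr
    exact le_abs_self _
  rw [he2, hp2]
  calc ‖ft f u‖ ^ 2 + ‖deriv (ft f) u‖ ^ 2
      ≤ (|κ₁| * |u| ^ (-p) * e) ^ 2 + (|C| * |u| ^ (-p) * e) ^ 2 := by gcongr
    _ = (κ₁ ^ 2 + C ^ 2) * ((|u| ^ (-p)) ^ 2 * e ^ 2) := by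
        rw [mul_pow, mul_pow, mul_pow, mul_pow, sq_abs, sq_abs]
        ring
    _ ≤ _ := mul_le_mul_of_nonneg_right (by linarith) (by positivity)

theorem weight_le_of_le {l : Smoothness} (hb : 0 ≤ l.b) (hbB : l.b ≤ B) (ha : 0 ≤ l.a)
    (hr : 0 ≤ l.r) {x X : ℝ} (hx : 1 ≤ x) (hxX : x ≤ X) :
    weight l x ≤ 2 ^ B * (X ^ (2 * l.b) * Real.exp (2 * l.a * X ^ l.r)) := by
  have hX : 1 ≤ X := hx.trans hxX
  have h1 : (x ^ 2 + 1) ^ l.b ≤ 2 ^ B * X ^ (2 * l.b) := by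
    refine (sq_add_one_rpow_le hb hx).trans ?_
    have := Real.rpow_le_rpow (by linarith) hxX (by linarith : 0 ≤ 2 * l.b)
    have := Real.rpow_le_rpow_of_exponent_le (by norm_num : (1 : ℝ) ≤ 2) hbB
    gcongr
  have h2 : |x| ^ l.r ≤ X ^ l.r := by
    rw [abs_of_pos (by linarith)]
    exact Real.rpow_le_rpow (by linarith) hxX hr
  rw [weight, ← mul_assoc]
  gcongr

/-- Lower bounds from perturbations living on the frequency band `[Y, Y + 2w]`. -/
theorem lowerBound_of_bands (hf : IsNoise f γ α ρ) {s p : ℝ} (hD : DerivDecay f s α ρ)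
    (hps : p ≤ s) (hpγ : p ≤ γ) (x₀ : ℝ) {L₀ : ℝ} (hL₀ : 0 < L₀)
    (hΛ : ParamsWithin Λ B A₁ R) (hL : ∀ l ∈ Λ, L₀ ≤ l.L) :
    ∃ c κ Y₀ : ℝ, 0 < c ∧ 0 < κ ∧ 1 ≤ Y₀ ∧ ∀ C : ℝ, 0 < C →
      (∀ᶠ n : ℕ in atTop, ∃ l₁ ∈ Λ, ∃ l₂ ∈ Λ, ∃ a w Y : ℝ, 0 ≤ a ∧ 0 < w ∧ Y₀ ≤ Y ∧ w ≤ Y ∧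
        a * (w + 1 / w) ^ 2 ≤ c ∧
        a * w * ((Y + 2 * w) ^ (2 * l₁.b) * Real.exp (2 * l₁.a * (Y + 2 * w) ^ l₁.r)) ≤ c ∧
        0 < φ n l₁ ∧ 0 < φ n l₂ ∧ φ n l₁ ≤ C * (a * w ^ 2) ∧
        Real.exp (κ * (n * (a * (w + 1 / w) * (Y ^ (-2 * p) * Real.exp (-2 * α * Y ^ ρ))))) *
          φ n l₂ ≤ C * (a * w ^ 2)) →
      LowerBound f x₀ Λ φ := by
  obtain ⟨C₁, M₀, hC₁, hM₀, hE⟩ := hf.exists_energy_le hD hps hpγ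
  obtain ⟨c, κ, hc, hκ, H⟩ := lowerBound_of_waves hf.density x₀ hL₀ hΛ hL fun u hu => (hE u hu).1
  have hα := hf.alpha_nonneg
  have hρ := hf.rho_nonneg
  refine ⟨min (c ^ 2) (c / 2 ^ B), κ * (C₁ * 3 ^ |-2 * p|), M₀, by positivity, by positivity, hM₀,
    fun C hC hev => H C hC ?_⟩
  filter_upwards [hev] with n hn
  obtain ⟨l₁, hl₁, l₂, hl₂, a, w, Y, ha, hw, hY, hwY, h1, h2, h3, h4, h5, h6⟩ := hn
  obtain ⟨⟨hb, hb'⟩, ⟨ha1, -⟩, ⟨hr, -⟩⟩ := hΛ l₁ hl₁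
  have hY1 : 1 ≤ Y := hM₀.trans hY
  have hY0 : 0 < Y := by linarith
  have e1 : Y + w - w = Y := by ring
  have e2 : Y + w + w = Y + 2 * w := by ring
  have hsq : Real.sqrt a ^ 2 = a := Real.sq_sqrt ha
  set F := Y ^ (-2 * p) * Real.exp (-2 * α * Y ^ ρ) with hF
  -- The parameter `a` is the squared amplitude. The bands are centred at `Y + w`, and `w ≤ Y` keeps
  -- them within `[Y, 3Y]` in absolute value, whence the factor `3^{|2p|}` for the polynomial part
  -- of the energy.
  refine ⟨l₁, hl₁, l₂, hl₂, Real.sqrt a, w, Y + w,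
    2 ^ B * ((Y + 2 * w) ^ (2 * l₁.b) * Real.exp (2 * l₁.a * (Y + 2 * w) ^ l₁.r)),
    C₁ * 3 ^ |-2 * p| * F,
    Real.sqrt_nonneg _, hw, by positivity, by rwa [e1], by rwa [e1], ?_, ?_, ?_, ?_, h3, h4, ?_, ?_⟩
  · refine (Real.sqrt_le_sqrt (h1.trans (min_le_left _ _))).trans' (le_of_eq ?_) |>.trans_eq
      (Real.sqrt_sq hc.le)
    rw [Real.sqrt_mul ha, Real.sqrt_sq (by positivity)]
  · rw [hsq]
    have := h2.trans (min_le_right _ _)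
    rw [le_div_iff₀ (by positivity)] at this
    linarith
  · rw [e1, e2]
    intro u hu
    exact weight_le_of_le hb hb' ha1 hr (hY1.trans hu.1) hu.2
  · rintro u ⟨hu1, hu2⟩
    rw [e1] at hu1
    rw [e2] at hu2
    refine (hE u (hY.trans hu1)).2.trans ?_
    have g1 : |u| ^ (-2 * p) ≤ 3 ^ |-2 * p| * Y ^ (-2 * p) :=
      rpow_le_mul_rpow (by linarith) hY0 (by linarith) (by linarith) le_rfl
    have g2 : Real.exp (-2 * α * |u| ^ ρ) ≤ Real.exp (-2 * α * Y ^ ρ) := by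
      rw [Real.exp_le_exp]
      have := Real.rpow_le_rpow hY0.le hu1 hρ
      nlinarith
    calc C₁ * (|u| ^ (-2 * p) * Real.exp (-2 * α * |u| ^ ρ))
        ≤ C₁ * ((3 ^ |-2 * p| * Y ^ (-2 * p)) * Real.exp (-2 * α * Y ^ ρ)) := by gcongr
      _ = _ := by rw [hF]; ring
  · rwa [mul_pow, hsq]
  · rw [mul_pow, hsq]
    refine le_trans (le_of_eq ?_) h6
    congr 2
    ring

end

/-! ### Lower bounds over Sobolev classes -/

section

variable {f : ℝ → ℝ} {γ α ρ : ℝ}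

theorem SobolevBox.paramsWithin {lo hi : Smoothness} (h : SobolevBox lo hi) :
    ParamsWithin (box lo hi) hi.b 0 0 := by
  rintro l ⟨⟨hb, hb'⟩, ⟨ha, ha'⟩, ⟨hr, hr'⟩, -⟩
  rw [h.lo_a] at ha
  rw [h.hi_a] at ha'
  rw [h.lo_r] at hr
  rw [h.hi_r] at hr'
  exact ⟨⟨by linarith [h.b_pos], hb'⟩, ⟨ha, ha'⟩, ⟨hr, hr'⟩⟩

theorem SobolevBox.lo_mem {lo hi : Smoothness} (h : SobolevBox lo hi) : lo ∈ box lo hi :=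
  ⟨⟨le_rfl, h.b_le⟩, ⟨le_rfl, by rw [h.lo_a, h.hi_a]⟩, ⟨le_rfl, by rw [h.lo_r, h.hi_r]⟩,
    le_rfl, h.L_le⟩

/-- Perturbations living on `[Y, 3Y]` with amplitude adapted to a Sobolev class. -/
theorem sobolev_band_bounds {c c₀ b Y : ℝ} (hc₀ : 0 < c₀) (hb : 1 / 2 < b) (hY : 1 ≤ Y)
    (h1 : 4 * c₀ ≤ c) (h2 : c₀ * 3 ^ (2 * b) ≤ c) :
    c₀ * Y ^ (-2 * b - 1) * (Y + 1 / Y) ^ 2 ≤ c ∧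
      c₀ * Y ^ (-2 * b - 1) * Y * (Y + 2 * Y) ^ (2 * b) ≤ c ∧
      c₀ * Y ^ (-2 * b - 1) * Y ^ 2 = c₀ * Y ^ (1 - 2 * b) ∧
      c₀ * Y ^ (-2 * b - 1) * (Y + 1 / Y) ≤ 2 * c₀ * Y ^ (-2 * b) := by
  have hY0 : 0 < Y := by linarith
  have hinv : 1 / Y ≤ Y := by
    rw [div_le_iff₀ hY0]
    nlinarith
  have hinv0 : 0 < 1 / Y := by positivity
  have e1 : Y ^ (-2 * b - 1) * Y ^ 2 = Y ^ (1 - 2 * b) := by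
    rw [← Real.rpow_natCast Y 2, ← Real.rpow_add hY0]
    congr 1
    push_cast
    ring
  have e2 : Y ^ (-2 * b - 1) * Y = Y ^ (-2 * b) := by
    rw [← Real.rpow_add_one hY0.ne']
    congr 1
    ring
  refine ⟨?_, ?_, by rw [mul_assoc, e1], ?_⟩
  · have h3 : Y ^ (1 - 2 * b) ≤ 1 := Real.rpow_le_one_of_one_le_of_nonpos hY (by linarith)
    calc c₀ * Y ^ (-2 * b - 1) * (Y + 1 / Y) ^ 2 ≤ c₀ * Y ^ (-2 * b - 1) * (2 * Y) ^ 2 := by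
          gcongr
          linarith
      _ = 4 * c₀ * (Y ^ (-2 * b - 1) * Y ^ 2) := by ring
      _ ≤ 4 * c₀ * 1 := by rw [e1]; gcongr
      _ ≤ c := by linarith
  · have e3 : Y + 2 * Y = 3 * Y := by ring
    have e4 : Y ^ (-2 * b) * Y ^ (2 * b) = 1 := by
      rw [← Real.rpow_add hY0]
      simp
    calc c₀ * Y ^ (-2 * b - 1) * Y * (Y + 2 * Y) ^ (2 * b)
        = c₀ * 3 ^ (2 * b) * ((Y ^ (-2 * b - 1) * Y) * Y ^ (2 * b)) := by
          rw [e3, Real.mul_rpow (by norm_num) hY0.le]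
          ring
      _ ≤ c := by rwa [e2, e4, mul_one]
  · calc c₀ * Y ^ (-2 * b - 1) * (Y + 1 / Y) ≤ c₀ * Y ^ (-2 * b - 1) * (2 * Y) := by
          gcongr
          linarith
      _ = 2 * c₀ * (Y ^ (-2 * b - 1) * Y) := by ring
      _ = _ := by rw [e2]

/-- Adaptive lower bound over Sobolev classes, ordinary smooth noise. -/
theorem lowerBound_sobolev_ordinary (hf : IsNoise f γ α ρ) (hρ : ρ = 0) (x₀ : ℝ)
    {lo hi : Smoothness} (hbox : SobolevBox lo hi) (hlt : lo.b < hi.b)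
    (hD : DerivDecay f (γ + 1) 0 0) : LowerBound f x₀ (box lo hi) (rateSobOrd γ) := by
  obtain ⟨hα, hγ⟩ := hf.ordinary hρ
  subst hα hρ
  have hb1 := hbox.b_pos
  obtain ⟨c, κ, Y₀, hc, hκ, hY₀, H⟩ := lowerBound_of_bands (φ := rateSobOrd γ) hf hD
    (by linarith : γ ≤ γ + 1) le_rfl x₀ hbox.L_pos hbox.paramsWithin fun l hl => hl.2.2.2.1
  set q := 2 * lo.b + 2 * γ with hq
  have hq0 : 0 < q := by linarith
  set e₁ := (2 * lo.b - 1) / (2 * lo.b + 2 * γ) with he₁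
  set e₂ := (2 * hi.b - 1) / (2 * hi.b + 2 * γ) with he₂
  have he : e₁ < e₂ := by
    rw [he₁, he₂, div_lt_div_iff₀ (by linarith) (by linarith)]
    nlinarith
  -- The first two entries are the positivity and class constraints. The third makes `e^{nX}`, a
  -- small power of `n`, no larger than the ratio of the rates at `lo.b` and `hi.b`.
  set c₀ := min (c / 4) (min (c / 3 ^ (2 * lo.b)) ((e₂ - e₁) / (4 * κ))) with hc₀
  have hc₀0 : 0 < c₀ := by
    have : 0 < e₂ - e₁ := by linarith
    positivity
  have g1 : 4 * c₀ ≤ c := by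
    have := min_le_left (c / 4) (min (c / 3 ^ (2 * lo.b)) ((e₂ - e₁) / (4 * κ)))
    linarith
  have g2 : c₀ * 3 ^ (2 * lo.b) ≤ c := by
    rw [← le_div_iff₀ (by positivity)]
    exact (min_le_right _ _).trans (min_le_left _ _)
  have g3 : 4 * κ * c₀ ≤ e₂ - e₁ := by
    rw [mul_comm, ← le_div_iff₀ (by positivity)]
    exact (min_le_right _ _).trans (min_le_right _ _)
  refine H (1 / c₀) (by positivity) ?_
  filter_upwards [eventually_le_log 1, eventually_log_rpow_le 2 one_pos one_pos,
    eventually_log_rpow_le 1 (by positivity : 0 < 1 / Y₀ ^ q) one_pos, eventually_gt_atTop 0]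
    with n h1 h2 h3 hn
  have hn' : (0 : ℝ) < n := by exact_mod_cast hn
  rw [Real.rpow_one] at h2 h3
  rw [Real.rpow_one, div_mul_eq_mul_div, one_mul, le_div_iff₀ (by positivity)] at h3
  rw [Real.rpow_two, one_mul] at h2
  have hlog : 0 < Real.log n := by linarith
  set N := (n : ℝ) / Real.log n with hN
  have hNY : Y₀ ^ q ≤ N := by
    rw [hN, le_div_iff₀ hlog]
    linarith
  have hN1 : 1 ≤ N := (Real.one_le_rpow hY₀ hq0.le).trans hNY
  have hN0 : 0 < N := by linarith
  -- The likelihood factor is a power of `n`, the rates are powers of `n / log n`; this inequality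
  -- puts them on one scale at the cost of doubling the exponent.
  have hnN : (n : ℝ) ≤ N ^ 2 := by
    rw [hN, div_pow, le_div_iff₀ (by positivity), sq (n : ℝ)]
    gcongr
  -- At this frequency `Y^{-2b-2γ} = log n / n`, so `nX` is a small multiple of `log n`; it would be
  -- bounded if `N` were replaced by `n`. This is the logarithmic loss.
  set Y := N ^ (1 / q) with hY
  have hYY₀ : Y₀ ≤ Y := by
    calc Y₀ = (Y₀ ^ q) ^ (1 / q) := by
          rw [← Real.rpow_mul (by linarith), mul_one_div_cancel hq0.ne', Real.rpow_one]
      _ ≤ Y := Real.rpow_le_rpow (by positivity) hNY (by positivity)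
  have hY1 : 1 ≤ Y := hY₀.trans hYY₀
  have hY0 : 0 < Y := by linarith
  obtain ⟨s1, s2, s3, s4⟩ := sobolev_band_bounds hc₀0 hb1 hY1 g1 g2
  have hrate : rateSobOrd γ n lo = Y ^ (1 - 2 * lo.b) := by
    rw [rateSobOrd, ← hN, hY, ← Real.rpow_mul hN0.le]
    congr 1
    rw [← hq]
    field_simp
    ring
  have hrate1 : rateSobOrd γ n lo = N ^ (-e₁) := by
    rw [rateSobOrd, ← hN, neg_div]
  have hmem : ({lo with b := hi.b} : Smoothness) ∈ box lo hi :=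
    ⟨⟨hbox.b_le, le_rfl⟩, hbox.lo_mem.2⟩
  have hrate2 : rateSobOrd γ n {lo with b := hi.b} = N ^ (-e₂) := by
    rw [rateSobOrd, ← hN, neg_div]
  refine ⟨lo, hbox.lo_mem, {lo with b := hi.b}, hmem, c₀ * Y ^ (-2 * lo.b - 1), Y, Y, by positivity,
    hY0, hYY₀, le_rfl, s1, ?_, ?_, ?_, ?_, ?_⟩
  · simpa [hbox.lo_a] using s2
  · rw [hrate1]; positivity
  · rw [hrate2]; positivity
  · rw [s3, hrate, ← mul_assoc, one_div_mul_cancel hc₀0.ne', one_mul]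
  · rw [s3, ← hrate, hrate1, hrate2]
    have e0 : 1 / c₀ * (c₀ * N ^ (-e₁)) = N ^ (-e₁) := by field_simp
    rw [e0]
    have hYq : Y ^ (-2 * lo.b) * Y ^ (-2 * γ) = N⁻¹ := by
      rw [← Real.rpow_add hY0, hY, ← Real.rpow_mul hN0.le, ← Real.rpow_neg_one]
      congr 1
      field_simp
      rw [hq]
      ring
    have hexp : κ * (n * (c₀ * Y ^ (-2 * lo.b - 1) * (Y + 1 / Y) *
        (Y ^ (-2 * γ) * Real.exp (-2 * 0 * Y ^ (0 : ℝ))))) ≤ 2 * κ * c₀ * Real.log n := by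
      calc _ = κ * n * (c₀ * Y ^ (-2 * lo.b - 1) * (Y + 1 / Y)) * Y ^ (-2 * γ) := by
            simp only [mul_zero, zero_mul, Real.exp_zero]
            ring
        _ ≤ κ * n * (2 * c₀ * Y ^ (-2 * lo.b)) * Y ^ (-2 * γ) := by gcongr
        _ = 2 * κ * c₀ * n * (Y ^ (-2 * lo.b) * Y ^ (-2 * γ)) := by ring
        _ = _ := by
            rw [hYq, hN]
            field_simp
    calc _ ≤ Real.exp (2 * κ * c₀ * Real.log n) * N ^ (-e₂) := by gcongr
      _ = (n : ℝ) ^ (2 * κ * c₀) * N ^ (-e₂) := by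
          rw [Real.rpow_def_of_pos hn', mul_comm (Real.log n)]
      _ ≤ (N ^ 2) ^ (2 * κ * c₀) * N ^ (-e₂) := by gcongr
      _ = N ^ (4 * κ * c₀ - e₂) := by
          rw [← Real.rpow_natCast N 2, ← Real.rpow_mul hN0.le, ← Real.rpow_add hN0]
          congr 1
          push_cast
          ring
      _ ≤ N ^ (-e₁) := Real.rpow_le_rpow_of_exponent_le hN1 (by linarith)

/-- Lower bound over Sobolev classes, supersmooth noise. -/
theorem lowerBound_sobolev_supersmooth (hf : IsNoise f γ α ρ) (hρ : 0 < ρ) (x₀ : ℝ)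
    {lo hi : Smoothness} (hbox : SobolevBox lo hi)
    (hD : DerivDecay f (1 - ρ) α ρ) : LowerBound f x₀ (box lo hi) (rateSobSuper ρ) := by
  have hα := hf.alpha_pos hρ
  have hb1 := hbox.b_pos
  -- The polynomial part of the energy is immaterial here, so the weaker of the bounds on `f*` and
  -- on its derivative is used for both.
  set p := min (1 - ρ) γ with hp
  obtain ⟨c, κ, Y₀, hc, hκ, hY₀, H⟩ := lowerBound_of_bands (φ := rateSobSuper ρ) hf hD
    (min_le_left _ _ : p ≤ 1 - ρ) (min_le_right _ _) x₀ hbox.L_pos hbox.paramsWithin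
    fun l hl => hl.2.2.2.1
  -- With `Y^ρ = log n / α` the energy has exponential factor `n^{-2}`, which kills `n` together
  -- with all polynomial factors in `Y`. The rate sees only the constant in front of `log n`.
  set K := 1 / α with hK
  have hK0 : 0 < K := by positivity
  set c₀ := min (c / 4) (c / 3 ^ (2 * lo.b)) with hc₀
  have hc₀0 : 0 < c₀ := by positivity
  have g1 : 4 * c₀ ≤ c := by
    have := min_le_left (c / 4) (c / 3 ^ (2 * lo.b))
    linarith
  have g2 : c₀ * 3 ^ (2 * lo.b) ≤ c := by
    rw [← le_div_iff₀ (by positivity)]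
    exact min_le_right _ _
  set C := Real.exp (2 * κ * c₀) * K ^ ((2 * lo.b - 1) / ρ) / c₀ with hC
  have hC0 : 0 < C := by positivity
  set r := 2 * |p| / ρ with hr
  refine H C hC0 ?_
  filter_upwards [eventually_le_log 1, eventually_log_rpow_le r (by positivity : 0 < K ^ (-r))
    one_pos, eventually_le_log (Y₀ ^ ρ / K), eventually_gt_atTop 0] with n h1 h2 h3 hn
  have hn' : (0 : ℝ) < n := by exact_mod_cast hn
  have hlog : 0 < Real.log n := by linarith
  rw [Real.rpow_one, Real.rpow_neg hK0.le, inv_mul_eq_div, le_div_iff₀ (by positivity), mul_comm,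
    ← Real.mul_rpow hK0.le hlog.le] at h2
  rw [div_le_iff₀ hK0, mul_comm] at h3
  set N := K * Real.log n with hN
  have hN0 : 0 < N := by positivity
  set Y := N ^ (1 / ρ) with hY
  have hYρ : Y ^ ρ = N := by
    rw [hY, ← Real.rpow_mul hN0.le, one_div_mul_cancel hρ.ne', Real.rpow_one]
  have hYY₀ : Y₀ ≤ Y := by
    calc Y₀ = (Y₀ ^ ρ) ^ (1 / ρ) := by
          rw [← Real.rpow_mul (by linarith), mul_one_div_cancel hρ.ne', Real.rpow_one]
      _ ≤ Y := Real.rpow_le_rpow (by positivity) h3 (by positivity)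
  have hY1 : 1 ≤ Y := hY₀.trans hYY₀
  have hY0 : 0 < Y := by linarith
  obtain ⟨s1, s2, s3, s4⟩ := sobolev_band_bounds hc₀0 hb1 hY1 g1 g2
  have hrate : rateSobSuper ρ n lo = K ^ ((2 * lo.b - 1) / ρ) * Y ^ (1 - 2 * lo.b) := by
    have e1 : Y ^ (1 - 2 * lo.b) = N ^ (-((2 * lo.b - 1) / ρ)) := by
      rw [hY, ← Real.rpow_mul hN0.le]
      congr 1
      ring
    rw [rateSobSuper, e1, hN, Real.mul_rpow hK0.le hlog.le, ← mul_assoc, ← Real.rpow_add hK0,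
      add_neg_cancel, Real.rpow_zero, one_mul, neg_div]
  have hrate0 : 0 < rateSobSuper ρ n lo := by rw [hrate]; positivity
  have hmain : Real.exp (2 * κ * c₀) * rateSobSuper ρ n lo ≤
      C * (c₀ * Y ^ (-2 * lo.b - 1) * Y ^ 2) := by
    rw [s3, hrate, hC]
    refine le_of_eq ?_
    field_simp
  -- Both densities are taken in one class: `nX` is bounded and there is no adaptation loss to
  -- detect.
  refine ⟨lo, hbox.lo_mem, lo, hbox.lo_mem, c₀ * Y ^ (-2 * lo.b - 1), Y, Y, by positivity,
    hY0, hYY₀, le_rfl, s1, ?_, hrate0, hrate0, ?_, ?_⟩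
  · simpa [hbox.lo_a] using s2
  · refine le_trans (le_mul_of_one_le_left hrate0.le ?_) hmain
    exact Real.one_le_exp (by positivity)
  · refine le_trans (mul_le_mul_of_nonneg_right (Real.exp_le_exp.2 ?_) hrate0.le) hmain
    have e1 : Real.exp (-2 * α * Y ^ ρ) = ((n : ℝ) ^ 2)⁻¹ := by
      rw [hYρ, ← Real.rpow_natCast, ← Real.rpow_neg hn'.le, Real.rpow_def_of_pos hn']
      congr 1
      rw [hN, hK]
      field_simp
      norm_num
    have e2 : Y ^ (-2 * lo.b) ≤ 1 := Real.rpow_le_one_of_one_le_of_nonpos hY1 (by linarith)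
    have e3 : Y ^ (-2 * p) ≤ n := by
      calc Y ^ (-2 * p) ≤ Y ^ (2 * |p|) :=
            Real.rpow_le_rpow_of_exponent_le hY1 (by linarith [neg_le_abs p])
        _ = N ^ r := by
            rw [hY, ← Real.rpow_mul hN0.le, hr]
            congr 1
            ring
        _ ≤ n := h2
    rw [e1]
    calc κ * (n * (c₀ * Y ^ (-2 * lo.b - 1) * (Y + 1 / Y) * (Y ^ (-2 * p) * ((n : ℝ) ^ 2)⁻¹)))
        ≤ κ * (n * (2 * c₀ * Y ^ (-2 * lo.b) * (n * ((n : ℝ) ^ 2)⁻¹))) := by gcongr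
      _ ≤ κ * (n * (2 * c₀ * 1 * (n * ((n : ℝ) ^ 2)⁻¹))) := by gcongr
      _ = 2 * κ * c₀ := by field_simp

end

/-! ### Lower bound for supersmooth densities and ordinary smooth noise -/

section

variable {f : ℝ → ℝ} {γ α ρ : ℝ}

theorem SupersmoothBox.lo_mem {lo hi : Smoothness} (h : SupersmoothBox lo hi) : lo ∈ box lo hi :=
  ⟨⟨le_rfl, h.b_le⟩, ⟨le_rfl, h.a_le⟩, ⟨le_rfl, h.r_le⟩, le_rfl, h.L_le⟩

theorem SupersmoothBox.mem_of_r {lo hi : Smoothness} (h : SupersmoothBox lo hi) {r : ℝ}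
    (h1 : lo.r ≤ r) (h2 : r ≤ hi.r) : ({lo with r := r} : Smoothness) ∈ box lo hi :=
  ⟨⟨le_rfl, h.b_le⟩, ⟨le_rfl, h.a_le⟩, ⟨h1, h2⟩, le_rfl, h.L_le⟩

/-- Adaptive lower bound over classes of supersmooth densities, ordinary smooth noise. -/
theorem lowerBound_supersmooth_ordinary (hf : IsNoise f γ α ρ) (hρ : ρ = 0) (x₀ : ℝ)
    {lo hi : Smoothness} (hbox : SupersmoothBox lo hi) (hlt : lo.r < hi.r)
    (hD : DerivDecay f (γ + 1) 0 0) : LowerBound f x₀ (box lo hi) (rateSuperOrd γ) := by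
  obtain ⟨hα, hγ⟩ := hf.ordinary hρ
  subst hα hρ
  have hb := hbox.b_nonneg
  have ha := hbox.a_pos
  have hr := hbox.r_pos
  obtain ⟨c, κ, Y₀, hc, hκ, hY₀, H⟩ := lowerBound_of_bands (φ := rateSuperOrd γ) hf hD
    (by linarith : γ ≤ γ + 1) le_rfl x₀ hbox.L_pos hbox.paramsWithin fun l hl => hl.2.2.2.1
  set q := (2 * γ + 1) / lo.r with hq
  set q' := (2 * γ + 2 * lo.b) / lo.r with hq'
  have hqq : (2 * γ + 1) / hi.r < q := div_lt_div_of_pos_left (by linarith) hr hlt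
  -- Chosen so that `(log n)^{2κc₀}` is exactly the ratio of the rates at `lo.r` and `hi.r`.
  set c₀ := (q - (2 * γ + 1) / hi.r) / (2 * κ) with hc₀
  have hc₀0 : 0 < c₀ := div_pos (by linarith) (by positivity)
  -- The upper end `X = 3Y` of the band satisfies `4a X^r = log n`, so the class weight there is
  -- only `n^{1/2}` times a power of `log n`. The class constraint is slack and the amplitude is
  -- limited by the chi-square distance alone.
  set D := (4 * lo.a) with hD'
  have hD0 : 0 < D := by positivity
  set C := 3 ^ (2 * γ + 1) * D ^ q / c₀ with hC
  refine H C (by positivity) ?_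
  filter_upwards [eventually_le_log 1, eventually_le_log_log 1,
    eventually_log_rpow_le (1 + q) (by positivity : 0 < c * D ^ q / (4 * c₀)) one_pos,
    eventually_log_rpow_le (1 + q') (by positivity : 0 < c * D ^ q' / c₀)
      (by norm_num : (0 : ℝ) < 1 / 2),
    eventually_le_log (D * (3 * Y₀) ^ lo.r), eventually_gt_atTop 0] with n h1 h2 h3 h4 h5 hn
  have hn' : (0 : ℝ) < n := by exact_mod_cast hn
  set S := Real.log n with hS
  have hS0 : 0 < S := by linarith
  set LL := Real.log S with hLL
  have hLL0 : 0 < LL := by linarith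
  have hLLS : LL ≤ S := (Real.log_le_sub_one_of_pos hS0).trans (by linarith)
  set X := (S / D) ^ (1 / lo.r) with hX
  have hX0 : 0 < X := by positivity
  have hXpow : ∀ e : ℝ, X ^ e = S ^ (e / lo.r) / D ^ (e / lo.r) := by
    intro e
    rw [hX, ← Real.rpow_mul (by positivity), Real.div_rpow hS0.le hD0.le]
    congr 2 <;> ring
  set Y := X / 3 with hY
  have hX3 : X = 3 * Y := by rw [hY]; ring
  have hYY₀ : Y₀ ≤ Y := by
    have : 3 * Y₀ ≤ X := by
      calc 3 * Y₀ = ((3 * Y₀) ^ lo.r) ^ (1 / lo.r) := by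
            rw [← Real.rpow_mul (by linarith), mul_one_div_cancel hr.ne', Real.rpow_one]
        _ ≤ X := by
            refine Real.rpow_le_rpow (by positivity) ?_ (by positivity)
            rw [le_div_iff₀ hD0]
            linarith
    rw [hY]
    linarith
  have hY1 : 1 ≤ Y := hY₀.trans hYY₀
  have hY0 : 0 < Y := by linarith
  have hYX : Y ≤ X := by linarith
  have hinv : 1 / Y ≤ Y := by
    rw [div_le_iff₀ hY0]
    nlinarith
  have hinv0 : 0 < 1 / Y := by positivity
  have hsum : Y + 1 / Y ≤ 2 * Y := by linarith
  have k1 : Y ^ (2 * γ - 1) * Y ^ 2 = Y ^ (2 * γ + 1) := by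
    rw [← Real.rpow_natCast Y 2, ← Real.rpow_add hY0]
    congr 1
    push_cast
    ring
  have k2 : Y ^ (2 * γ - 1) * Y = Y ^ (2 * γ) := by
    rw [← Real.rpow_add_one hY0.ne']
    congr 1
    ring
  -- This amplitude makes `nX` of order `log log n`, matching the logarithm of the ratio of the two
  -- rates.
  set amp := c₀ * LL * Y ^ (2 * γ - 1) / n with hamp
  have hamp0 : 0 ≤ amp := by positivity
  have hrate1 : rateSuperOrd γ n lo = C * (amp * Y ^ 2) := by
    have e1 : Y ^ (2 * γ + 1) = S ^ q / D ^ q / 3 ^ (2 * γ + 1) := by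
      rw [hY, Real.div_rpow hX0.le (by norm_num), hXpow]
    have e2 : amp * Y ^ 2 = c₀ * LL * Y ^ (2 * γ + 1) / n := by rw [← k1, hamp]; ring
    rw [rateSuperOrd, e2, e1, hC]
    field_simp
    rw [← hq, ← hS, ← hLL]
  have hpos1 : 0 < rateSuperOrd γ n lo := by rw [hrate1]; positivity
  have hrate2 : rateSuperOrd γ n {lo with r := hi.r} = LL * S ^ ((2 * γ + 1) / hi.r) / n := rfl
  refine ⟨lo, hbox.lo_mem, {lo with r := hi.r}, hbox.mem_of_r hlt.le le_rfl, amp, Y, Y, hamp0,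
    hY0, hYY₀, le_rfl, ?_, ?_, hpos1, ?_, hrate1.le, ?_⟩
  · rw [Real.rpow_one] at h3
    calc amp * (Y + 1 / Y) ^ 2 ≤ amp * (2 * Y) ^ 2 := by gcongr
      _ = 4 * c₀ * (LL * (Y ^ (2 * γ - 1) * Y ^ 2)) / n := by rw [hamp]; ring
      _ ≤ 4 * c₀ * (S * X ^ (2 * γ + 1)) / n := by
          rw [k1]
          gcongr
      _ = 4 * c₀ * (S ^ (1 + q) / D ^ q) / n := by
          rw [hXpow, Real.rpow_add hS0, Real.rpow_one]
          ring
      _ ≤ 4 * c₀ * ((c * D ^ q / (4 * c₀) * n) / D ^ q) / n := by gcongr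
      _ = c := by field_simp
  · have e1 : Y + 2 * Y = X := by rw [hY]; ring
    have e2 : Real.exp (2 * lo.a * X ^ lo.r) = (n : ℝ) ^ (1 / 2 : ℝ) := by
      rw [hXpow, div_self hr.ne', Real.rpow_one, Real.rpow_one, Real.rpow_def_of_pos hn', ← hS, hD']
      congr 1
      field_simp
      norm_num
    have e3 : X ^ (2 * γ) * X ^ (2 * lo.b) = S ^ q' / D ^ q' := by
      rw [← Real.rpow_add hX0, hXpow]
    rw [e1, e2]
    calc amp * Y * (X ^ (2 * lo.b) * (n : ℝ) ^ (1 / 2 : ℝ))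
        = c₀ * (LL * ((Y ^ (2 * γ - 1) * Y) * X ^ (2 * lo.b))) * (n : ℝ) ^ (1 / 2 : ℝ) / n := by
          rw [hamp]; ring
      _ ≤ c₀ * (S * (X ^ (2 * γ) * X ^ (2 * lo.b))) * (n : ℝ) ^ (1 / 2 : ℝ) / n := by
          rw [k2]
          gcongr
      _ = c₀ * (S ^ (1 + q') / D ^ q') * (n : ℝ) ^ (1 / 2 : ℝ) / n := by
          rw [e3, Real.rpow_add hS0, Real.rpow_one]
          ring
      _ ≤ c₀ * ((c * D ^ q' / c₀ * (n : ℝ) ^ (1 / 2 : ℝ)) / D ^ q') * (n : ℝ) ^ (1 / 2 : ℝ) / n := by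
          gcongr
      _ = c * ((n : ℝ) ^ (1 / 2 : ℝ) * (n : ℝ) ^ (1 / 2 : ℝ)) / n := by field_simp
      _ = c := by
          rw [← Real.rpow_add hn']
          norm_num
          field_simp
  · rw [hrate2]; positivity
  · rw [← hrate1, hrate2]
    have e1 : κ * (n * (amp * (Y + 1 / Y) * (Y ^ (-2 * γ) * Real.exp (-2 * 0 * Y ^ (0 : ℝ))))) ≤
        LL * (2 * κ * c₀) := by
      have e2 : Y ^ (2 * γ) * Y ^ (-2 * γ) = 1 := by
        rw [← Real.rpow_add hY0]
        simp
      calc _ = κ * (n * (amp * (Y + 1 / Y) * Y ^ (-2 * γ))) := by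
            simp only [mul_zero, zero_mul, Real.exp_zero, mul_one]
        _ ≤ κ * (n * (amp * (2 * Y) * Y ^ (-2 * γ))) := by gcongr
        _ = LL * (2 * κ * c₀) * ((Y ^ (2 * γ - 1) * Y) * Y ^ (-2 * γ)) := by
            rw [hamp]
            field_simp
        _ = _ := by rw [k2, e2, mul_one]
    calc _ ≤ Real.exp (LL * (2 * κ * c₀)) * (LL * S ^ ((2 * γ + 1) / hi.r) / n) := by gcongr
      _ = LL * (S ^ (2 * κ * c₀) * S ^ ((2 * γ + 1) / hi.r)) / n := by
          rw [Real.rpow_def_of_pos hS0 (2 * κ * c₀)]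
          ring
      _ = LL * S ^ q / n := by
          rw [← Real.rpow_add hS0]
          congr 3
          rw [hc₀]
          field_simp
          ring
      _ = _ := rfl

end

/-! ### Perturbations just below the cutoff, for `ρ ≤ r` -/

section

variable {Λ : Set Smoothness} {φ : ℕ → Smoothness → ℝ} {f : ℝ → ℝ} {γ α ρ B A₁ R : ℝ}

theorem eventually_rpow_mul_exp_le (P : ℝ) {c s K : ℝ} (hc : 0 < c) (hs : 0 < s) (hK : 0 < K) :
    ∀ᶠ x : ℝ in atTop, x ^ P * Real.exp (-c * x ^ s) ≤ K := by
  have h := ((tendsto_rpow_mul_exp_neg_mul_atTop_nhds_zero (P / s) c hc).comp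
    (tendsto_rpow_atTop hs)).eventually (ge_mem_nhds hK)
  filter_upwards [h, eventually_gt_atTop 0] with x hx hx0
  simp only [Function.comp] at hx
  rwa [← Real.rpow_mul hx0.le, mul_div_cancel₀ _ hs.ne'] at hx

/-- A one-sided estimate for the increments of a power function. -/
theorem rpow_sub_le {ρ r T w : ℝ} (hρ : 0 < ρ) (hρ1 : ρ ≤ 1) (hr : ρ ≤ r) (hT : 0 < T)
    (hw : 0 ≤ w) (hwT : w ≤ T) : (T - w) ^ r ≤ T ^ r - ρ * (w / T) * T ^ r := by
  have hy : w / T ≤ 1 := (div_le_one hT).2 hwT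
  have hy0 : 0 ≤ w / T := by positivity
  have e : T - w = T * (1 - w / T) := by field_simp
  have h1 : (1 - w / T) ^ r ≤ 1 - ρ * (w / T) := by
    -- The base is at most one, so the exponent may be lowered to `ρ ≤ 1`, where Bernoulli's
    -- inequality applies.
    calc (1 - w / T) ^ r ≤ (1 - w / T) ^ ρ :=
          Real.rpow_le_rpow_of_exponent_ge_of_imp (by linarith) (by linarith) hr
            fun _ h => absurd h (hρ.trans_le hr).ne'
      _ = (1 + -(w / T)) ^ ρ := by rw [sub_eq_add_neg]
      _ ≤ 1 + ρ * -(w / T) := rpow_one_add_le_one_add_mul_self (by linarith) hρ.le hρ1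
      _ = _ := by ring
  rw [e, Real.mul_rpow hT.le (by linarith)]
  calc T ^ r * (1 - w / T) ^ r ≤ T ^ r * (1 - ρ * (w / T)) := by gcongr
    _ = _ := by ring

/-- Lower bounds from perturbations living just below the cutoff frequency. -/
theorem lowerBound_near_cutoff (hf : IsNoise f γ α ρ) (hρ : 0 < ρ) (hρ1 : ρ ≤ 1)
    (hD : DerivDecay f γ α ρ) (x₀ : ℝ) {L₀ : ℝ} (hL₀ : 0 < L₀) (hΛ : ParamsWithin Λ B A₁ R)
    (hL : ∀ l ∈ Λ, L₀ ≤ l.L) {l₁ l₂ : Smoothness} (hl₁ : l₁ ∈ Λ) (hl₂ : l₂ ∈ Λ)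
    (ha : 0 < l₁.a) (hr : ρ ≤ l₁.r) {τ : ℝ} (hτ : τ ≤ ρ)
    (hτr : ∀ᶠ x : ℝ in atTop, x ^ τ * Real.exp (-(l₁.a * ρ / 3) * x ^ (l₁.r - ρ)) ≤ 1)
    {t : ℕ → ℝ} (ht : Tendsto t atTop atTop) {c₁ : ℝ} (hc₁ : 0 < c₁)
    (hcut : ∀ᶠ n : ℕ in atTop, cutoffFn γ α ρ l₁ (t n) ≤ c₁ * n) {C₁ ε : ℝ} (hC₁ : 0 < C₁)
    (hε : 0 < ε)
    (hφ : ∀ᶠ n : ℕ in atTop, 0 < φ n l₁ ∧ 0 < φ n l₂ ∧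
      φ n l₁ ≤ C₁ * ((t n) ^ (2 * γ + 1 - ρ + τ) * Real.exp (2 * α * (t n) ^ ρ) / n) ∧
      Real.exp (ε * (t n) ^ τ) * φ n l₂ ≤
        C₁ * ((t n) ^ (2 * γ + 1 - ρ + τ) * Real.exp (2 * α * (t n) ^ ρ) / n)) :
    LowerBound f x₀ Λ φ := by
  have hα := hf.alpha_pos hρ
  have hγ := hf.gamma_nonneg
  obtain ⟨c, κ, Y₀, hc, hκ, hY₀, H⟩ := lowerBound_of_bands (φ := φ) hf hD le_rfl le_rfl x₀ hL₀
    hΛ hL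
  obtain ⟨⟨hb, -⟩, -, -⟩ := hΛ l₁ hl₁
  -- `222 = 37·6`, from `w + 1/w ≤ 37w` and `1/w = 6T^{ρ-1}`; the other factors compare powers and
  -- exponentials at `Y` with those at `T`.
  set κ' := 222 * κ * (2 ^ (2 * γ) * Real.exp α) with hκ'
  have hκ'0 : 0 < κ' := by positivity
  set c₀ := min (c / (37 ^ 2 * c₁)) (ε / κ') with hc₀
  have hc₀0 : 0 < c₀ := by positivity
  have g1 : c₀ * (37 ^ 2 * c₁) ≤ c := by
    rw [← le_div_iff₀ (by positivity)]
    exact min_le_left _ _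
  have g2 : c₀ * κ' ≤ ε := by
    rw [← le_div_iff₀ hκ'0]
    exact min_le_right _ _
  have hcc : 0 < c₀ * c₁ := by positivity
  refine H (C₁ / c₀) (by positivity) ?_
  filter_upwards [hcut, hφ, ht.eventually hτr, ht.eventually_ge_atTop (2 * Y₀),
    ht.eventually (eventually_rpow_mul_exp_le 1 (by positivity : 0 < 2 * l₁.a)
      (by linarith : 0 < l₁.r) one_pos), eventually_gt_atTop 0] with n h1 h2 h3 h4 h5 hn
  obtain ⟨p1, p2, p3, p4⟩ := h2
  have hn' : (0 : ℝ) < n := by exact_mod_cast hn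
  set T := t n with hT
  have hT1 : 1 ≤ T := by linarith
  have hT0 : 0 < T := by linarith
  -- A shift of this size changes `T^ρ` by a bounded amount, so the noise exponential stays
  -- comparable on the band `[T - 3w, T - w]`. Since the band stops `w` short of the cutoff, the
  -- class weight gains the factor `exp(-(aρ/3) T^{r-ρ})`. This pays for an extra `T^τ` in the
  -- squared amplitude.
  set w := T ^ (1 - ρ) / 6 with hw
  have hTw1 : 1 ≤ T ^ (1 - ρ) := Real.one_le_rpow hT1 (by linarith)
  have hTwT : T ^ (1 - ρ) ≤ T := by
    calc T ^ (1 - ρ) ≤ T ^ (1 : ℝ) := Real.rpow_le_rpow_of_exponent_le hT1 (by linarith)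
      _ = T := Real.rpow_one T
  have hw0 : 0 < w := by positivity
  have hwT : 3 * w ≤ T / 2 := by rw [hw]; linarith
  have hsum : w + 1 / w ≤ 37 * w := by
    -- Holds because `w ≥ 1/6`, which uses `ρ ≤ 1`.
    have h : 1 / w ≤ 36 * w := by
      rw [div_le_iff₀ hw0, hw]
      nlinarith
    linarith
  have hinv : 1 / w = 6 * T ^ (ρ - 1) := by
    rw [hw, one_div_div, div_eq_mul_inv, ← Real.rpow_neg hT0.le]
    congr 2
    ring
  have hwdiv : w / T = T ^ (-ρ) / 6 := by
    rw [hw, div_right_comm]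
    congr 1
    rw [← Real.rpow_sub_one hT0.ne']
    congr 1
    ring
  set F := T ^ (2 * γ + 1 - ρ + τ) * Real.exp (2 * α * T ^ ρ) / n with hF
  have hF0 : 0 < F := by positivity
  set Y := T - 3 * w with hY
  have hYT : T / 2 ≤ Y := by rw [hY]; linarith
  have hY0 : 0 < Y := by linarith
  have hFle : F ≤ c₁ * (T ^ (1 - ρ + τ - 2 * l₁.b) * Real.exp (-(2 * l₁.a) * T ^ l₁.r)) := by
    rw [hF, div_le_iff₀ hn']
    have e1 : Real.exp (2 * α * T ^ ρ) = Real.exp (-(2 * l₁.a) * T ^ l₁.r) *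
        Real.exp (2 * α * T ^ ρ + 2 * l₁.a * T ^ l₁.r) := by
      rw [← Real.exp_add]
      congr 1
      ring
    have e2 : T ^ (2 * γ + 1 - ρ + τ) =
        T ^ (1 - ρ + τ - 2 * l₁.b) * T ^ (2 * l₁.b + 2 * γ) := by
      rw [← Real.rpow_add hT0]
      congr 1
      ring
    calc _ = (T ^ (1 - ρ + τ - 2 * l₁.b) * Real.exp (-(2 * l₁.a) * T ^ l₁.r)) *
          cutoffFn γ α ρ l₁ T := by rw [e1, e2, cutoffFn]; ring
      _ ≤ (T ^ (1 - ρ + τ - 2 * l₁.b) * Real.exp (-(2 * l₁.a) * T ^ l₁.r)) * (c₁ * n) := by gcongr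
      _ = _ := by ring
  have hamp : c₀ * F / w ^ 2 * w ^ 2 = c₀ * F := by field_simp
  refine ⟨l₁, hl₁, l₂, hl₂, c₀ * F / w ^ 2, w, Y, by positivity, hw0, by linarith, by linarith,
    ?_, ?_, p1, p2, ?_, ?_⟩
  · calc c₀ * F / w ^ 2 * (w + 1 / w) ^ 2 ≤ c₀ * F / w ^ 2 * (37 * w) ^ 2 := by gcongr
      _ = 37 ^ 2 * c₀ * F := by field_simp
      _ ≤ 37 ^ 2 * c₀ * (c₁ * (T ^ (1 : ℝ) * Real.exp (-(2 * l₁.a) * T ^ l₁.r))) := by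
          refine mul_le_mul_of_nonneg_left (hFle.trans ?_) (by positivity)
          have : T ^ (1 - ρ + τ - 2 * l₁.b) ≤ T ^ (1 : ℝ) :=
            Real.rpow_le_rpow_of_exponent_le hT1 (by linarith)
          gcongr
      _ ≤ 37 ^ 2 * c₀ * (c₁ * 1) := by gcongr
      _ = c₀ * (37 ^ 2 * c₁) := by ring
      _ ≤ c := g1
  · have e0 : Y + 2 * w = T - w := by rw [hY]; ring
    have e1 : (T - w) ^ (2 * l₁.b) ≤ T ^ (2 * l₁.b) :=
      Real.rpow_le_rpow (by linarith) (by linarith) (by linarith)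
    have e2 : Real.exp (2 * l₁.a * (T - w) ^ l₁.r) ≤
        Real.exp (2 * l₁.a * T ^ l₁.r) * Real.exp (-(l₁.a * ρ / 3) * T ^ (l₁.r - ρ)) := by
      rw [← Real.exp_add, Real.exp_le_exp]
      have h := rpow_sub_le hρ hρ1 hr hT0 hw0.le (by linarith)
      have e3 : ρ * (w / T) * T ^ l₁.r = ρ / 6 * T ^ (l₁.r - ρ) := by
        have : T ^ (l₁.r - ρ) = T ^ l₁.r * T ^ (-ρ) := by
          rw [← Real.rpow_add hT0, sub_eq_add_neg]
        rw [hwdiv, this]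
        ring
      rw [e3] at h
      have := mul_le_mul_of_nonneg_left h (by positivity : 0 ≤ 2 * l₁.a)
      linarith
    have e4 : T ^ (1 - ρ + τ - 2 * l₁.b) * T ^ (ρ - 1) * T ^ (2 * l₁.b) = T ^ τ := by
      rw [← Real.rpow_add hT0, ← Real.rpow_add hT0]
      congr 1
      ring
    have e5 : Real.exp (-(2 * l₁.a) * T ^ l₁.r) * Real.exp (2 * l₁.a * T ^ l₁.r) = 1 := by
      rw [← Real.exp_add]
      simp
    have hTw : 0 ≤ T - w := by linarith
    rw [e0]
    calc c₀ * F / w ^ 2 * w * ((T - w) ^ (2 * l₁.b) * Real.exp (2 * l₁.a * (T - w) ^ l₁.r))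
        = c₀ * F * (1 / w) *
          ((T - w) ^ (2 * l₁.b) * Real.exp (2 * l₁.a * (T - w) ^ l₁.r)) := by field_simp
      _ ≤ c₀ * (c₁ * (T ^ (1 - ρ + τ - 2 * l₁.b) * Real.exp (-(2 * l₁.a) * T ^ l₁.r))) * (1 / w) *
          (T ^ (2 * l₁.b) * (Real.exp (2 * l₁.a * T ^ l₁.r) *
            Real.exp (-(l₁.a * ρ / 3) * T ^ (l₁.r - ρ)))) := by gcongr
      _ = 6 * c₀ * c₁ * ((T ^ (1 - ρ + τ - 2 * l₁.b) * T ^ (ρ - 1) * T ^ (2 * l₁.b)) *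
          Real.exp (-(l₁.a * ρ / 3) * T ^ (l₁.r - ρ))) *
          (Real.exp (-(2 * l₁.a) * T ^ l₁.r) * Real.exp (2 * l₁.a * T ^ l₁.r)) := by
          rw [hinv]; ring
      _ = 6 * c₀ * c₁ * (T ^ τ * Real.exp (-(l₁.a * ρ / 3) * T ^ (l₁.r - ρ))) := by
          rw [e4, e5, mul_one]
      _ ≤ 6 * c₀ * c₁ * 1 := by gcongr
      _ ≤ c := by linarith
  · rw [hamp]
    refine p3.trans_eq ?_
    field_simp
  · rw [hamp]
    refine le_trans (mul_le_mul_of_nonneg_right (Real.exp_le_exp.2 ?_) p2.le)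
      (p4.trans_eq (by field_simp))
    have e1 : Y ^ (-2 * γ) ≤ 2 ^ (2 * γ) * T ^ (-(2 * γ)) := by
      calc Y ^ (-2 * γ) ≤ (T / 2) ^ (-2 * γ) :=
            Real.rpow_le_rpow_of_nonpos (by positivity) hYT (by linarith)
        _ = _ := by
            rw [Real.div_rpow hT0.le (by norm_num), neg_mul, Real.rpow_neg (by norm_num : (0:ℝ) ≤ 2),
              div_inv_eq_mul, mul_comm]
    have e2 : Real.exp (-2 * α * Y ^ ρ) ≤ Real.exp α * Real.exp (-(2 * α * T ^ ρ)) := by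
      rw [← Real.exp_add, Real.exp_le_exp]
      have hy : 3 * w / T = T ^ (-ρ) / 2 := by rw [mul_div_assoc, hwdiv]; ring
      have hy0 : 0 < T ^ (-ρ) := by positivity
      have hy1 : T ^ (-ρ) ≤ 1 := Real.rpow_le_one_of_one_le_of_nonpos hT1 (by linarith)
      have e3 : Y = T * (1 - T ^ (-ρ) / 2) := by
        rw [← hy, hY]
        field_simp
      have e4 : T ^ ρ * T ^ (-ρ) = 1 := by
        rw [← Real.rpow_add hT0]
        simp
      have h := one_sub_le_rpow (y := T ^ (-ρ) / 2) (p := ρ) (by positivity) (by linarith) hρ1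
      have h' := mul_le_mul_of_nonneg_left h (by positivity : 0 ≤ T ^ ρ)
      rw [e3, Real.mul_rpow hT0.le (by linarith)]
      have h'' : T ^ ρ - 1 / 2 ≤ T ^ ρ * (1 - T ^ (-ρ) / 2) ^ ρ := by linarith
      have := mul_le_mul_of_nonneg_left h'' (by positivity : 0 ≤ 2 * α)
      linarith
    have e3 : T ^ (2 * γ + 1 - ρ + τ) * T ^ (ρ - 1) * T ^ (-(2 * γ)) = T ^ τ := by
      rw [← Real.rpow_add hT0, ← Real.rpow_add hT0]
      congr 1
      ring
    have e4 : Real.exp (2 * α * T ^ ρ) * Real.exp (-(2 * α * T ^ ρ)) = 1 := by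
      rw [← Real.exp_add]
      simp
    calc κ * (n * (c₀ * F / w ^ 2 * (w + 1 / w) * (Y ^ (-2 * γ) * Real.exp (-2 * α * Y ^ ρ))))
        ≤ κ * (n * (c₀ * F / w ^ 2 * (37 * w) * ((2 ^ (2 * γ) * T ^ (-(2 * γ))) *
          (Real.exp α * Real.exp (-(2 * α * T ^ ρ)))))) := by gcongr
      _ = 37 * κ * c₀ * (n * F) * (1 / w) * (2 ^ (2 * γ) * T ^ (-(2 * γ)) *
          (Real.exp α * Real.exp (-(2 * α * T ^ ρ)))) := by
          field_simp
      _ = c₀ * κ' * (T ^ (2 * γ + 1 - ρ + τ) * T ^ (ρ - 1) * T ^ (-(2 * γ))) *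
          (Real.exp (2 * α * T ^ ρ) * Real.exp (-(2 * α * T ^ ρ))) := by
          rw [hinv, hF, mul_div_cancel₀ _ hn'.ne', hκ']
          ring
      _ = c₀ * κ' * T ^ τ := by rw [e3, e4, mul_one]
      _ ≤ ε * T ^ τ := by gcongr

end

/-! ### Lower bounds for supersmooth densities and noise with `ρ ≤ r` -/

section

variable {f : ℝ → ℝ} {γ α ρ : ℝ}

/-- Cutoffs for larger exponents `r` are of smaller order. -/
theorem exists_cutoff_le_mul (hγ : 0 ≤ γ) (hα : 0 ≤ α) {l₁ l₂ : Smoothness}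
    (hb₁ : 0 ≤ l₁.b) (hb₂ : 0 ≤ l₂.b) (ha₂ : 0 < l₂.a) (hr₁ : 0 < l₁.r)
    (hρr : ρ ≤ l₁.r) (hr : l₁.r < l₂.r) {c η : ℝ} (hc : 1 ≤ c) (hη : 0 < η) :
    ∃ T₀ : ℝ, ∀ T₁ T₂ : ℝ, T₀ ≤ T₁ → 1 ≤ T₁ → 1 ≤ T₂ →
      cutoffFn γ α ρ l₂ T₂ ≤ c * cutoffFn γ α ρ l₁ T₁ → T₂ ≤ η * T₁ := by
  set P := 2 * l₁.b + 2 * γ with hP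
  -- All factors for the first class, powers included through `log T ≤ T^r / r`, are put under one
  -- exponential `e^{K T₁^{r₁}}`. The second is at least `e^{2a₂ T₂^{r₂}}`, and `r₂ > r₁` forces
  -- `T₂` to be much smaller than `T₁`.
  set K := Real.log c + P / l₁.r + 2 * α + 2 * l₁.a with hK
  obtain ⟨T₀, hT₀⟩ := ((tendsto_rpow_atTop (by linarith : 0 < l₂.r - l₁.r)).eventually_gt_atTop
    (K / (2 * l₂.a * η ^ l₂.r))).exists_forall_of_atTop
  refine ⟨T₀, fun T₁ T₂ hT hT₁ hT₂ hle => ?_⟩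
  by_contra! hlt
  have hT10 : 0 < T₁ := by linarith
  have h1 : Real.exp (2 * l₂.a * T₂ ^ l₂.r) ≤ cutoffFn γ α ρ l₂ T₂ := by
    have e1 : 1 ≤ T₂ ^ (2 * l₂.b + 2 * γ) := Real.one_le_rpow hT₂ (by linarith)
    have e2 : Real.exp (2 * l₂.a * T₂ ^ l₂.r) ≤
        Real.exp (2 * α * T₂ ^ ρ + 2 * l₂.a * T₂ ^ l₂.r) := by
      rw [Real.exp_le_exp]
      have : 0 ≤ 2 * α * T₂ ^ ρ := by positivity
      linarith
    exact e2.trans (le_mul_of_one_le_left (Real.exp_pos _).le e1)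
  have h2 : cutoffFn γ α ρ l₁ T₁ ≤ Real.exp ((P / l₁.r + 2 * α + 2 * l₁.a) * T₁ ^ l₁.r) := by
    have e1 : T₁ ^ (2 * l₁.b + 2 * γ) ≤ Real.exp (P / l₁.r * T₁ ^ l₁.r) := by
      rw [← hP, Real.rpow_def_of_pos hT10, Real.exp_le_exp]
      have := Real.log_le_rpow_div hT10.le hr₁
      calc Real.log T₁ * P ≤ T₁ ^ l₁.r / l₁.r * P := by gcongr
        _ = _ := by ring
    have e2 : T₁ ^ ρ ≤ T₁ ^ l₁.r := Real.rpow_le_rpow_of_exponent_le hT₁ hρr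
    rw [cutoffFn]
    calc _ ≤ Real.exp (P / l₁.r * T₁ ^ l₁.r) *
          Real.exp (2 * α * T₁ ^ l₁.r + 2 * l₁.a * T₁ ^ l₁.r) := by gcongr
      _ = _ := by
          rw [← Real.exp_add]
          congr 1
          ring
  have h3 : Real.exp (2 * l₂.a * T₂ ^ l₂.r) ≤ Real.exp (K * T₁ ^ l₁.r) := by
    have hlog := Real.log_nonneg hc
    have hT1r : 1 ≤ T₁ ^ l₁.r := Real.one_le_rpow hT₁ hr₁.le
    calc _ ≤ c * Real.exp ((P / l₁.r + 2 * α + 2 * l₁.a) * T₁ ^ l₁.r) :=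
          h1.trans (hle.trans (by gcongr))
      _ = Real.exp (Real.log c * 1 + (P / l₁.r + 2 * α + 2 * l₁.a) * T₁ ^ l₁.r) := by
          rw [Real.exp_add, mul_one, Real.exp_log (by linarith)]
      _ ≤ Real.exp (Real.log c * T₁ ^ l₁.r + (P / l₁.r + 2 * α + 2 * l₁.a) * T₁ ^ l₁.r) := by
          gcongr
      _ = _ := by
          congr 1
          rw [hK]
          ring
  rw [Real.exp_le_exp] at h3
  have h4 : (η * T₁) ^ l₂.r ≤ T₂ ^ l₂.r :=
    Real.rpow_le_rpow (by positivity) hlt.le (by linarith)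
  have h5 : (η * T₁) ^ l₂.r = η ^ l₂.r * (T₁ ^ (l₂.r - l₁.r) * T₁ ^ l₁.r) := by
    rw [Real.mul_rpow hη.le hT10.le, ← Real.rpow_add hT10, sub_add_cancel]
  have h6 := hT₀ T₁ hT
  rw [div_lt_iff₀ (by positivity)] at h6
  have hpos : 0 < T₁ ^ l₁.r := by positivity
  have h7 := mul_lt_mul_of_pos_right h6 hpos
  have h8 := mul_le_mul_of_nonneg_left h4 (by positivity : 0 ≤ 2 * l₂.a)
  rw [h5] at h8
  linarith

/-- Adaptive lower bound when the densities are at least as smooth as the noise. -/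
theorem lowerBound_supersmooth_supersmooth (hf : IsNoise f γ α ρ) (hρ : 0 < ρ) (hρ1 : ρ ≤ 1)
    (x₀ : ℝ) {lo hi : Smoothness} (hbox : SupersmoothBox lo hi) (hρr : ρ ≤ lo.r)
    (hlt : lo.r < hi.r) {m : ℕ → Smoothness → ℝ} (hm : IsCutoff γ α ρ (box lo hi) m)
    (hD : DerivDecay f γ α ρ) :
    LowerBound f x₀ (box lo hi) (fun n l => (m n l) ^ ρ * varTerm γ α ρ n (m n l)) := by
  have hα := hf.alpha_pos hρ
  have hγ := hf.gamma_nonneg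
  have hpi := Real.pi_gt_three
  have hΛ := hbox.paramsWithin
  obtain ⟨c, hc, hcut⟩ := hm.exists_bounds hγ hΛ
  have hlarge := hΛ.eventually_le hγ hα.le hρ.le (by linarith) hcut
  -- The midpoint makes the exponent strictly larger than `ρ` even if `lo.r = ρ`. Then `T^ρ
  -- e^{-cT^{r-ρ}}` tends to zero for every `c > 0`, so the amplitude can carry the extra factor
  -- `T^ρ`; the class `l₂` above it has a smaller cutoff.
  set l₁ : Smoothness := {lo with r := (lo.r + hi.r) / 2} with hl₁
  set l₂ : Smoothness := {lo with r := hi.r} with hl₂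
  have hmem₁ : l₁ ∈ box lo hi := hbox.mem_of_r (by linarith) (by linarith)
  have hmem₂ : l₂ ∈ box lo hi := hbox.mem_of_r hlt.le le_rfl
  have hr1 : ρ < l₁.r := by simp only [hl₁]; linarith
  have hr2 : l₁.r < l₂.r := by simp only [hl₁, hl₂]; linarith
  -- With `T₂ ≤ η T₁` one has `T₂^ρ ≤ T₁^ρ / 2`, so the rate at `l₂` is smaller by at least
  -- `e^{-αT₁^ρ}`. The likelihood factor may therefore grow like `e^{αT₁^ρ}`, which explains `ε = α`
  -- below.
  set η := min 1 ((2 : ℝ)⁻¹ ^ (1 / ρ)) with hη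
  have hη0 : 0 < η := by positivity
  obtain ⟨T₀, hT₀⟩ := exists_cutoff_le_mul (ρ := ρ) hγ hα.le (l₁ := l₁) (l₂ := l₂) hbox.b_nonneg
    hbox.b_nonneg hbox.a_pos (by linarith) hr1.le hr2 (c := c * c)
    (by nlinarith) hη0
  refine lowerBound_near_cutoff (t := fun n => Real.pi * m n l₁) (τ := ρ) (c₁ := c) (C₁ := 1)
    (ε := α) hf hρ hρ1 hD x₀ hbox.L_pos hΛ (fun l hl => hl.2.2.2.1) hmem₁ hmem₂ hbox.a_pos hr1.le
    le_rfl ?_ ?_ (by linarith) ?_ one_pos hα ?_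
  · have := hbox.a_pos
    exact eventually_rpow_mul_exp_le ρ (by simp only [hl₁]; positivity) (by linarith) one_pos
  · rw [tendsto_atTop]
    intro K
    filter_upwards [hlarge K] with n h
    exact h l₁ hmem₁
  · filter_upwards [hcut] with n h
    exact (h l₁ hmem₁).2.2
  · filter_upwards [hcut, hlarge (max T₀ 1), eventually_gt_atTop 0] with n h1 h2 hn
    have hn' : (0 : ℝ) < n := by exact_mod_cast hn
    obtain ⟨hm1, hge1, -⟩ := h1 l₁ hmem₁
    obtain ⟨hm2, -, hle2⟩ := h1 l₂ hmem₂
    have hT1 := h2 l₁ hmem₁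
    have hT2 := h2 l₂ hmem₂
    have hrate : ∀ l, 0 < m n l → (m n l) ^ ρ * varTerm γ α ρ n (m n l) =
        (m n l) ^ (2 * γ + 1) * Real.exp (2 * α * (Real.pi * m n l) ^ ρ) / n := by
      intro l hl
      rw [varTerm, ← mul_div_assoc, ← mul_assoc, ← Real.rpow_add hl]
      congr 3
      ring
    have hexp : 2 * γ + 1 - ρ + ρ = 2 * γ + 1 := by ring
    have hmT : ∀ l, 0 < m n l → (m n l) ^ (2 * γ + 1) ≤ (Real.pi * m n l) ^ (2 * γ + 1) := by
      intro l hl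
      exact Real.rpow_le_rpow hl.le (by nlinarith) (by linarith)
    rw [hrate l₁ hm1, hrate l₂ hm2, hexp, one_mul]
    refine ⟨by positivity, by positivity, ?_, ?_⟩
    · have := hmT l₁ hm1
      gcongr
    · set T₁ := Real.pi * m n l₁ with hT₁
      set T₂ := Real.pi * m n l₂ with hT₂
      have hT11 : 1 ≤ T₁ := (le_max_right _ _).trans hT1
      have hT21 : 1 ≤ T₂ := (le_max_right _ _).trans hT2
      have hratio := hT₀ T₁ T₂ ((le_max_left _ _).trans hT1) hT11 hT21 (by
        refine hle2.trans ?_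
        rw [mul_assoc]
        gcongr)
      have hT12 : T₂ ≤ T₁ := hratio.trans (by
        have := min_le_left 1 ((2 : ℝ)⁻¹ ^ (1 / ρ))
        nlinarith)
      have hhalf : T₂ ^ ρ ≤ 1 / 2 * T₁ ^ ρ := by
        calc T₂ ^ ρ ≤ ((2 : ℝ)⁻¹ ^ (1 / ρ) * T₁) ^ ρ := by
              refine Real.rpow_le_rpow (by linarith) (hratio.trans ?_) hρ.le
              gcongr
              exact min_le_right _ _
          _ = 1 / 2 * T₁ ^ ρ := by
              rw [Real.mul_rpow (by positivity) (by linarith), ← Real.rpow_mul (by norm_num),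
                one_div_mul_cancel hρ.ne', Real.rpow_one]
              norm_num
      have h3 : (m n l₂) ^ (2 * γ + 1) ≤ T₁ ^ (2 * γ + 1) :=
        (hmT l₂ hm2).trans (Real.rpow_le_rpow (by linarith) hT12 (by linarith))
      have h4 : Real.exp (α * T₁ ^ ρ) * Real.exp (2 * α * T₂ ^ ρ) ≤ Real.exp (2 * α * T₁ ^ ρ) := by
        rw [← Real.exp_add, Real.exp_le_exp]
        have := mul_le_mul_of_nonneg_left hhalf (by positivity : 0 ≤ 2 * α)
        linarith
      calc Real.exp (α * T₁ ^ ρ) *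
            ((m n l₂) ^ (2 * γ + 1) * Real.exp (2 * α * T₂ ^ ρ) / n)
          = (m n l₂) ^ (2 * γ + 1) * (Real.exp (α * T₁ ^ ρ) * Real.exp (2 * α * T₂ ^ ρ)) / n := by
            ring
        _ ≤ _ := by gcongr

/-- Minimax lower bound over a single class of densities at least as smooth as the noise. -/
theorem lowerBound_single (hf : IsNoise f γ α ρ) (hρ : 0 < ρ) (hρ1 : ρ ≤ 1) (x₀ : ℝ)
    {l : Smoothness} (hb : 0 ≤ l.b) (ha : 0 < l.a) (hρr : ρ ≤ l.r) (hL : 0 < l.L)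
    {m : ℕ → Smoothness → ℝ} (hm : IsCutoff γ α ρ {l} m) (hD : DerivDecay f γ α ρ) :
    LowerBound f x₀ {l} (fun n l => varTerm γ α ρ n (m n l)) := by
  have hα := hf.alpha_pos hρ
  have hγ := hf.gamma_nonneg
  have hpi := Real.pi_gt_three
  have hΛ : ParamsWithin {l} l.b l.a l.r := fun l' hl' => by
    rw [Set.mem_singleton_iff.1 hl']
    exact ⟨⟨hb, le_rfl⟩, ⟨ha.le, le_rfl⟩, ⟨by linarith, le_rfl⟩⟩
  obtain ⟨c, hc, hcut⟩ := hm.exists_bounds hγ hΛ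
  have hlarge := hΛ.eventually_le hγ hα.le hρ.le (by linarith) hcut
  -- With `τ = 0` and both densities in one class, the likelihood factor is at most `e`, absorbed in
  -- `C₁`.
  refine lowerBound_near_cutoff (t := fun n => Real.pi * m n l) (τ := 0) (c₁ := c)
    (C₁ := Real.exp 1) (ε := 1) hf hρ hρ1 hD x₀ hL hΛ
    (fun l' hl' => by rw [Set.mem_singleton_iff.1 hl']) rfl rfl ha hρr
    hρ.le ?_ ?_ (by linarith) ?_ (Real.exp_pos _) one_pos ?_
  · filter_upwards [eventually_ge_atTop (0 : ℝ)] with x hx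
    rw [Real.rpow_zero, one_mul, Real.exp_le_one_iff, neg_mul]
    have : 0 ≤ l.a * ρ / 3 * x ^ (l.r - ρ) := by positivity
    linarith
  · rw [tendsto_atTop]
    intro K
    filter_upwards [hlarge K] with n h
    exact h l rfl
  · filter_upwards [hcut] with n h
    exact (h l rfl).2.2
  · filter_upwards [hcut, eventually_gt_atTop 0] with n h1 hn
    have hn' : (0 : ℝ) < n := by exact_mod_cast hn
    obtain ⟨hm1, -, -⟩ := h1 l rfl
    have hpos : 0 < varTerm γ α ρ n (m n l) := by
      rw [varTerm]
      positivity
    have hle : varTerm γ α ρ n (m n l) ≤ (Real.pi * m n l) ^ (2 * γ + 1 - ρ + 0) *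
        Real.exp (2 * α * (Real.pi * m n l) ^ ρ) / n := by
      rw [varTerm, add_zero]
      have : (m n l) ^ (2 * γ + 1 - ρ) ≤ (Real.pi * m n l) ^ (2 * γ + 1 - ρ) :=
        Real.rpow_le_rpow hm1.le (by nlinarith) (by linarith)
      gcongr
    refine ⟨hpos, hpos, ?_, ?_⟩
    · refine hle.trans (le_mul_of_one_le_left (hpos.le.trans hle) ?_)
      exact Real.one_le_exp zero_le_one
    · rw [Real.rpow_zero, mul_one]
      gcongr

end

/-! ### Lower bound when the noise is smoother than the densities -/

section

variable {f : ℝ → ℝ} {γ α ρ : ℝ}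

/-- A band of width of order `Y^{1-r}` at frequency `Y` changes `Y^r` by a bounded amount, so the
class weight is comparable at both ends. The estimate follows from `1 + x ≤ e^x` and `e^y ≤ 1 + y
e^{2r}` for `0 ≤ y ≤ 2r`. -/
theorem add_two_mul_rpow_le {Y r : ℝ} (hY : 1 ≤ Y) (hr : 0 ≤ r) :
    (Y + 2 * Y ^ (1 - r)) ^ r ≤ Y ^ r + 2 * r * Real.exp (2 * r) := by
  have hY0 : 0 < Y := by linarith
  have hz0 : 0 < Y ^ (-r) := by positivity
  have hz1 : Y ^ (-r) ≤ 1 := Real.rpow_le_one_of_one_le_of_nonpos hY (by linarith)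
  have e1 : Y + 2 * Y ^ (1 - r) = Y * (1 + 2 * Y ^ (-r)) := by
    rw [sub_eq_add_neg, Real.rpow_add hY0, Real.rpow_one]
    ring
  have e2 : Y ^ r * Y ^ (-r) = 1 := by
    rw [← Real.rpow_add hY0]
    simp
  set y := 2 * r * Y ^ (-r) with hy
  have hy2 : y ≤ 2 * r := by
    rw [hy]
    exact mul_le_of_le_one_right (by positivity) hz1
  have h1 : (1 + 2 * Y ^ (-r)) ^ r ≤ Real.exp y := by
    calc (1 + 2 * Y ^ (-r)) ^ r ≤ (Real.exp (2 * Y ^ (-r))) ^ r := by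
          refine Real.rpow_le_rpow (by positivity) ?_ hr
          linarith [Real.add_one_le_exp (2 * Y ^ (-r))]
      _ = Real.exp y := by
          rw [← Real.exp_mul, hy]
          congr 1
          ring
  have h2 : Real.exp y ≤ 1 + y * Real.exp (2 * r) := by
    have h3 := Real.add_one_le_exp (-y)
    have h4 := mul_le_mul_of_nonneg_right h3 (Real.exp_pos y).le
    rw [← Real.exp_add, neg_add_cancel, Real.exp_zero] at h4
    have h5 : y * Real.exp y ≤ y * Real.exp (2 * r) := by gcongr
    linarith
  rw [e1, Real.mul_rpow hY0.le (by positivity)]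
  calc Y ^ r * (1 + 2 * Y ^ (-r)) ^ r ≤ Y ^ r * (1 + y * Real.exp (2 * r)) := by
        gcongr
        exact h1.trans h2
    _ = Y ^ r + 2 * r * Real.exp (2 * r) * (Y ^ r * Y ^ (-r)) := by rw [hy]; ring
    _ = _ := by rw [e2, mul_one]

/-- The frequency obtained from `T` by adding `K log T` to `T ^ ρ`. -/
theorem shifted_frequency_bounds {T K r ρ : ℝ} (hT : 1 ≤ T) (hK : 0 ≤ K) (hr : 0 ≤ r)
    (hrρ : r < ρ) (hlog : K * Real.log T ≤ T ^ (ρ - r)) {Y : ℝ}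
    (hY : Y = (T ^ ρ + K * Real.log T) ^ (1 / ρ)) :
    Y ^ ρ = T ^ ρ + K * Real.log T ∧ T ≤ Y ∧ Y ≤ 2 ^ (1 / ρ) * T ∧ Y ^ r ≤ T ^ r + 1 := by
  have hT0 : 0 < T := by linarith
  have hρ : 0 < ρ := by linarith
  have hKl : 0 ≤ K * Real.log T := mul_nonneg hK (Real.log_nonneg hT)
  have hTρ : 0 < T ^ ρ := by positivity
  have hTr : (T ^ ρ) ^ (1 / ρ) = T := by
    rw [← Real.rpow_mul hT0.le, mul_one_div_cancel hρ.ne', Real.rpow_one]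
  have hle : T ^ (ρ - r) ≤ T ^ ρ := Real.rpow_le_rpow_of_exponent_le hT (by linarith)
  have h1 : Y ^ ρ = T ^ ρ + K * Real.log T := by
    rw [hY, ← Real.rpow_mul (by linarith), one_div_mul_cancel hρ.ne', Real.rpow_one]
  have h2 : T ≤ Y := by
    calc T = (T ^ ρ) ^ (1 / ρ) := hTr.symm
      _ ≤ Y := by
        rw [hY]
        exact Real.rpow_le_rpow hTρ.le (by linarith) (by positivity)
  have hY0 : 0 < Y := by linarith
  refine ⟨h1, h2, ?_, ?_⟩
  · calc Y ≤ (2 * T ^ ρ) ^ (1 / ρ) := by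
          rw [hY]
          exact Real.rpow_le_rpow (by linarith) (by linarith) (by positivity)
      _ = _ := by rw [Real.mul_rpow (by norm_num) hTρ.le, hTr]
  · have h3 : T ^ (ρ - r) ≤ Y ^ (ρ - r) := Real.rpow_le_rpow hT0.le h2 (by linarith)
    -- The lowering lemma is used in reverse: `Y` plays the role of the upper frequency and `T` that
    -- of the lowered one.
    have h := rpow_sub_one_le_of_shift (s := T ^ ρ) (x := K * Real.log T) hY0 hr hrρ.le hρ hKl
      (by linarith) (by linarith) (by linarith)
    rw [hTr] at h
    linarith

set_option maxHeartbeats 1600000 in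
/-- Lower bound when the noise is smoother than the densities. -/
theorem lowerBound_smoother_noise (hf : IsNoise f γ α ρ) (hρ : 0 < ρ) (x₀ : ℝ)
    {lo hi : Smoothness} (hbox : SupersmoothBox lo hi) (hir : hi.r < ρ)
    {m : ℕ → Smoothness → ℝ} (hm : IsCutoff γ α ρ (box lo hi) m)
    (hD : DerivDecay f (1 - ρ) α ρ) :
    LowerBound f x₀ (box lo hi) (fun n l => biasTerm l (m n l)) := by
  have hα := hf.alpha_pos hρ
  have hγ := hf.gamma_nonneg
  have hpi := Real.pi_gt_three
  have hΛ := hbox.paramsWithin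
  have hb := hbox.b_nonneg
  have ha := hbox.a_pos
  have hr := hbox.r_pos
  have hrρ : lo.r < ρ := hbox.r_le.trans_lt hir
  obtain ⟨c₁, hc₁, hcut⟩ := hm.exists_bounds hγ hΛ
  have hlarge := hΛ.eventually_le hγ hα.le hρ.le (by linarith) hcut
  have ht : Tendsto (fun n => Real.pi * m n lo) atTop atTop := by
    rw [tendsto_atTop]
    intro K
    filter_upwards [hlarge K] with n h
    exact h lo hbox.lo_mem
  set p := min (1 - ρ) γ with hp
  obtain ⟨c, κ, Y₀, hc, hκ, hY₀, H⟩ := lowerBound_of_bands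
    (φ := fun n l => biasTerm l (m n l)) hf hD
    (min_le_left _ _ : p ≤ 1 - ρ) (min_le_right _ _) x₀ hbox.L_pos hΛ fun l hl => hl.2.2.2.1
  set b := lo.b with hbdef
  set a := lo.a with hadef
  set r := lo.r with hrdef
  -- `Q` dominates the total power of `Y` occurring in `nX`. Raising `T^ρ` by `K log T` with `K =
  -- Q/(2α)` multiplies the noise exponential by `T^{-Q}`, so `nX` remains bounded.
  set Q := 2 * b + 2 * γ + 2 * r + 2 * |p| with hQ
  have hQ0 : 0 ≤ Q := by positivity
  set K := Q / (2 * α) with hK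
  have hK0 : 0 ≤ K := by positivity
  obtain ⟨T₀, hT₀1, hT₀⟩ := exists_log_shift K (by linarith : 0 < ρ - r)
  set D := (2 : ℝ) ^ (1 / ρ) with hDdef
  have hD1 : 1 ≤ D := Real.one_le_rpow (by norm_num) (by positivity)
  set G := 2 * r * Real.exp (2 * r) with hG
  set c₀ := c / (3 ^ (2 * b) * Real.exp (2 * a * (1 + G))) with hc₀
  have hc₀0 : 0 < c₀ := by positivity
  set G₃ := 2 * κ * c₁ * c₀ * D ^ Q with hG₃
  have hG₃0 : 0 ≤ G₃ := by positivity
  set e := -2 * b + 1 - r with he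
  set C := Real.exp G₃ * (D * Real.pi) ^ |e| / c₀ with hC
  refine H C (by positivity) ?_
  filter_upwards [hcut, ht.eventually_ge_atTop (max T₀ Y₀),
    ht.eventually (eventually_rpow_mul_exp_le (1 + 3 * r) (by positivity : 0 < 2 * a) hr
      (by positivity : 0 < c / (4 * c₀ * D ^ (1 + 3 * r)))), eventually_gt_atTop 0]
    with n h1 h2 h3 hn
  obtain ⟨hm0, hge, -⟩ := h1 lo hbox.lo_mem
  have hn' : (0 : ℝ) < n := by exact_mod_cast hn
  set T := Real.pi * m n lo with hT
  have hTT₀ : T₀ ≤ T := (le_max_left _ _).trans h2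
  have hTY₀ : Y₀ ≤ T := (le_max_right _ _).trans h2
  have hT1 : 1 ≤ T := hY₀.trans hTY₀
  have hT0 : 0 < T := by linarith
  set Y := (T ^ ρ + K * Real.log T) ^ (1 / ρ) with hY
  obtain ⟨y1, y2, y3, y4⟩ := shifted_frequency_bounds hT1 hK0 hr.le hrρ
    (by linarith [hT₀ T hTT₀, Real.rpow_pos_of_pos hT0 (ρ - r)]) hY
  have hY1 : 1 ≤ Y := hT1.trans y2
  have hY0 : 0 < Y := by linarith
  -- The widest band on which the weight `e^{2ax^r}` stays comparable. It shrinks when `r > 1`,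
  -- hence the crude bound on `w + 1/w` that follows; polynomial losses are absorbed by `Q`.
  set w := Y ^ (1 - r) with hw
  have hw0 : 0 < w := by positivity
  have hwY : w ≤ Y := by
    calc w ≤ Y ^ (1 : ℝ) := Real.rpow_le_rpow_of_exponent_le hY1 (by linarith)
      _ = Y := Real.rpow_one Y
  have hsum : w + 1 / w ≤ 2 * Y ^ (1 + r) := by
    have e1 : w ≤ Y ^ (1 + r) := Real.rpow_le_rpow_of_exponent_le hY1 (by linarith)
    have e2 : 1 / w ≤ Y ^ (1 + r) := by
      rw [hw, one_div, ← Real.rpow_neg hY0.le]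
      exact Real.rpow_le_rpow_of_exponent_le hY1 (by linarith)
    linarith
  -- The amplitude meets the class constraint up to constants. The shift changes `T^r` by at most
  -- one, so `e^{-2aT^r}` may be written at `T`, and `amp * w²` is the bias term at the cutoff up to
  -- a constant.
  set amp := c₀ * Y ^ (-2 * b + r - 1) * Real.exp (-(2 * a) * T ^ r) with hamp
  have hamp0 : 0 < amp := by positivity
  have hmain : Real.exp G₃ * biasTerm lo (m n lo) ≤ C * (amp * w ^ 2) := by
    have e1 : amp * w ^ 2 = c₀ * Y ^ e * Real.exp (-(2 * a) * T ^ r) := by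
      have : Y ^ (-2 * b + r - 1) * w ^ 2 = Y ^ e := by
        rw [hw, ← Real.rpow_natCast, ← Real.rpow_mul hY0.le, ← Real.rpow_add hY0]
        congr 1
        rw [he]
        push_cast
        ring
      rw [← this, hamp]
      ring
    have e2 : (m n lo) ^ e ≤ (D * Real.pi) ^ |e| * Y ^ e := by
      have hDpi : 1 ≤ D * Real.pi := by nlinarith
      have hmY : m n lo ≤ Y := le_trans (by rw [hT]; nlinarith) y2
      refine rpow_le_mul_rpow hm0 hY0 ?_ ?_ le_rfl
      · exact hmY.trans (le_mul_of_one_le_left hY0.le hDpi)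
      · rw [mul_assoc]
        exact y3
    rw [e1, hC]
    calc Real.exp G₃ * biasTerm lo (m n lo)
        = Real.exp G₃ * ((m n lo) ^ e * Real.exp (-(2 * a) * T ^ r)) := by
          rw [biasTerm, neg_mul 2 lo.a]
      _ ≤ Real.exp G₃ * (((D * Real.pi) ^ |e| * Y ^ e) * Real.exp (-(2 * a) * T ^ r)) := by gcongr
      _ = _ := by field_simp
  have hpos : 0 < biasTerm lo (m n lo) := by
    rw [biasTerm]
    positivity
  refine ⟨lo, hbox.lo_mem, lo, hbox.lo_mem, amp, w, Y, hamp0.le, hw0, hTY₀.trans y2, hwY,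
    ?_, ?_, hpos, hpos, ?_, ?_⟩
  · calc amp * (w + 1 / w) ^ 2 ≤ amp * (2 * Y ^ (1 + r)) ^ 2 := by gcongr
      _ = 4 * c₀ * (Y ^ (-2 * b + r - 1) * (Y ^ (1 + r)) ^ 2) * Real.exp (-(2 * a) * T ^ r) := by
          rw [hamp]; ring
      _ ≤ 4 * c₀ * Y ^ (1 + 3 * r) * Real.exp (-(2 * a) * T ^ r) := by
          gcongr
          rw [← Real.rpow_natCast, ← Real.rpow_mul hY0.le, ← Real.rpow_add hY0]
          refine Real.rpow_le_rpow_of_exponent_le hY1 ?_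
          push_cast
          linarith
      _ ≤ 4 * c₀ * (D * T) ^ (1 + 3 * r) * Real.exp (-(2 * a) * T ^ r) := by gcongr
      _ = 4 * c₀ * D ^ (1 + 3 * r) * (T ^ (1 + 3 * r) * Real.exp (-(2 * a) * T ^ r)) := by
          rw [Real.mul_rpow (by linarith) hT0.le]
          ring
      _ ≤ 4 * c₀ * D ^ (1 + 3 * r) * (c / (4 * c₀ * D ^ (1 + 3 * r))) := by gcongr
      _ = c := by field_simp
  · have e1 : (Y + 2 * w) ^ r ≤ T ^ r + (1 + G) := by
      have := add_two_mul_rpow_le hY1 hr.le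
      linarith
    have e2 : (Y + 2 * w) ^ (2 * b) ≤ 3 ^ (2 * b) * Y ^ (2 * b) := by
      rw [← Real.mul_rpow (by norm_num) hY0.le]
      exact Real.rpow_le_rpow (by positivity) (by linarith) (by linarith)
    have e3 : Y ^ (-2 * b + r - 1) * w * Y ^ (2 * b) = 1 := by
      rw [hw, ← Real.rpow_add hY0, ← Real.rpow_add hY0, ← Real.rpow_zero Y]
      congr 1
      ring
    calc amp * w * ((Y + 2 * w) ^ (2 * b) * Real.exp (2 * a * (Y + 2 * w) ^ r))
        ≤ amp * w * ((3 ^ (2 * b) * Y ^ (2 * b)) * Real.exp (2 * a * (T ^ r + (1 + G)))) := by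
          gcongr
      _ = c₀ * 3 ^ (2 * b) * (Y ^ (-2 * b + r - 1) * w * Y ^ (2 * b)) *
          (Real.exp (-(2 * a) * T ^ r) * Real.exp (2 * a * (T ^ r + (1 + G)))) := by
          rw [hamp]; ring
      _ = c₀ * (3 ^ (2 * b) * Real.exp (2 * a * (1 + G))) := by
          rw [e3, ← Real.exp_add, mul_one, mul_assoc]
          congr 3
          ring
      _ ≤ c := by rw [hc₀, div_mul_cancel₀ _ (by positivity)]
  · refine le_trans (le_mul_of_one_le_left hpos.le ?_) hmain
    exact Real.one_le_exp hG₃0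
  · refine le_trans (mul_le_mul_of_nonneg_right (Real.exp_le_exp.2 ?_) hpos.le) hmain
    have e1 : Real.exp (-2 * α * Y ^ ρ) = Real.exp (-(2 * α * T ^ ρ)) * T ^ (-Q) := by
      rw [y1, Real.rpow_def_of_pos hT0 (-Q), ← Real.exp_add, hK]
      congr 1
      field_simp
      ring
    have e2 : Real.exp (2 * α * T ^ ρ + 2 * a * T ^ r) * Real.exp (-(2 * a) * T ^ r) *
        Real.exp (-(2 * α * T ^ ρ)) = 1 := by
      rw [← Real.exp_add, ← Real.exp_add, ← Real.exp_zero]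
      congr 1
      ring
    have e3 : Y ^ (2 * b + 2 * γ) * Y ^ (-2 * b + r - 1) * Y ^ (1 + r) * Y ^ (-2 * p) ≤ Y ^ Q := by
      rw [← Real.rpow_add hY0, ← Real.rpow_add hY0, ← Real.rpow_add hY0]
      refine Real.rpow_le_rpow_of_exponent_le hY1 ?_
      rw [hQ]
      linarith [neg_le_abs p]
    have e4 : T ^ Q * T ^ (-Q) = 1 := by
      rw [← Real.rpow_add hT0]
      simp
    have hTY : T ^ (2 * b + 2 * γ) ≤ Y ^ (2 * b + 2 * γ) :=
      Real.rpow_le_rpow hT0.le y2 (by linarith)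
    have hn_le : (n : ℝ) ≤ c₁ * (Y ^ (2 * b + 2 * γ) *
        Real.exp (2 * α * T ^ ρ + 2 * a * T ^ r)) := by
      refine hge.trans ?_
      rw [cutoffFn]
      gcongr
    calc κ * (n * (amp * (w + 1 / w) * (Y ^ (-2 * p) * Real.exp (-2 * α * Y ^ ρ))))
        ≤ κ * ((c₁ * (Y ^ (2 * b + 2 * γ) * Real.exp (2 * α * T ^ ρ + 2 * a * T ^ r))) *
          (amp * (2 * Y ^ (1 + r)) * (Y ^ (-2 * p) *
            (Real.exp (-(2 * α * T ^ ρ)) * T ^ (-Q))))) := by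
          rw [e1]
          gcongr
      _ = 2 * κ * c₁ * c₀ *
          (Y ^ (2 * b + 2 * γ) * Y ^ (-2 * b + r - 1) * Y ^ (1 + r) * Y ^ (-2 * p)) * T ^ (-Q) *
          (Real.exp (2 * α * T ^ ρ + 2 * a * T ^ r) * Real.exp (-(2 * a) * T ^ r) *
            Real.exp (-(2 * α * T ^ ρ))) := by
          rw [hamp]; ring
      _ = 2 * κ * c₁ * c₀ *
          (Y ^ (2 * b + 2 * γ) * Y ^ (-2 * b + r - 1) * Y ^ (1 + r) * Y ^ (-2 * p)) * T ^ (-Q) := by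
          rw [e2, mul_one]
      _ ≤ 2 * κ * c₁ * c₀ * (D * T) ^ Q * T ^ (-Q) := by
          gcongr
          exact e3.trans (Real.rpow_le_rpow hY0.le y3 hQ0)
      _ = G₃ * (T ^ Q * T ^ (-Q)) := by
          rw [Real.mul_rpow (by linarith) hT0.le, hG₃]
          ring
      _ = G₃ := by rw [e4, mul_one]

end

end Deconv

end

theorem theorem4p1 (f : ℝ → ℝ) (γ α ρ : ℝ) (hf : Deconv.IsNoise f γ α ρ) (x₀ : ℝ) :
    -- `r = 0`, `ρ = 0`
    (ρ = 0 → ∀ lo hi : Deconv.Smoothness, Deconv.SobolevBox lo hi →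
      Deconv.Attained f x₀ (Deconv.box lo hi) (Deconv.rateSobOrd γ) ∧
      (lo.b < hi.b → Deconv.DerivDecay f (γ + 1) 0 0 →
        Deconv.LowerBound f x₀ (Deconv.box lo hi) (Deconv.rateSobOrd γ))) ∧
    -- `r > 0`, `ρ = 0`
    (ρ = 0 → ∀ lo hi : Deconv.Smoothness, Deconv.SupersmoothBox lo hi →
      Deconv.Attained f x₀ (Deconv.box lo hi) (Deconv.rateSuperOrd γ) ∧
      (lo.r < hi.r → Deconv.DerivDecay f (γ + 1) 0 0 →
        Deconv.LowerBound f x₀ (Deconv.box lo hi) (Deconv.rateSuperOrd γ))) ∧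
    -- `r = 0`, `ρ > 0` (no loss)
    (0 < ρ → ∀ lo hi : Deconv.Smoothness, Deconv.SobolevBox lo hi →
      Deconv.Attained f x₀ (Deconv.box lo hi) (Deconv.rateSobSuper ρ) ∧
      (Deconv.DerivDecay f (1 - ρ) α ρ →
        Deconv.LowerBound f x₀ (Deconv.box lo hi) (Deconv.rateSobSuper ρ))) ∧
    -- `0 < r < ρ` (no loss)
    (0 < ρ → ∀ lo hi : Deconv.Smoothness, Deconv.SupersmoothBox lo hi → hi.r < ρ →
      ∀ m : ℕ → Deconv.Smoothness → ℝ, Deconv.IsCutoff γ α ρ (Deconv.box lo hi) m →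
      Deconv.Attained f x₀ (Deconv.box lo hi) (fun n l => Deconv.biasTerm l (m n l)) ∧
      (Deconv.DerivDecay f (1 - ρ) α ρ →
        Deconv.LowerBound f x₀ (Deconv.box lo hi)
          (fun n l => Deconv.biasTerm l (m n l)))) ∧
    -- `r ≥ ρ > 0`, `ρ ≤ 1`
    (0 < ρ → ρ ≤ 1 → ∀ lo hi : Deconv.Smoothness, Deconv.SupersmoothBox lo hi → ρ ≤ lo.r →
      ∀ m : ℕ → Deconv.Smoothness → ℝ, Deconv.IsCutoff γ α ρ (Deconv.box lo hi) m →
      Deconv.Attained f x₀ (Deconv.box lo hi)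
        (fun n l => (m n l) ^ ρ * Deconv.varTerm γ α ρ n (m n l)) ∧
      (lo.r < hi.r → Deconv.DerivDecay f γ α ρ →
        Deconv.LowerBound f x₀ (Deconv.box lo hi)
          (fun n l => (m n l) ^ ρ * Deconv.varTerm γ α ρ n (m n l)))) ∧
    -- minimax rate over one class, `r ≥ ρ > 0`, `ρ ≤ 1`
    (0 < ρ → ρ ≤ 1 → ∀ l : Deconv.Smoothness, 0 ≤ l.b → 0 < l.a → ρ ≤ l.r → 0 < l.L →
      ∀ m : ℕ → Deconv.Smoothness → ℝ, Deconv.IsCutoff γ α ρ {l} m →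
      Deconv.Attained f x₀ {l} (fun n l => Deconv.varTerm γ α ρ n (m n l)) ∧
      (Deconv.DerivDecay f γ α ρ →
        Deconv.LowerBound f x₀ {l} (fun n l => Deconv.varTerm γ α ρ n (m n l)))) := by
  refine ⟨fun h0 lo hi hbox => ⟨?_, fun hlt hD => ?_⟩, fun h0 lo hi hbox => ⟨?_, fun hlt hD => ?_⟩,
    fun hρ lo hi hbox => ⟨?_, fun hD => ?_⟩, fun hρ lo hi hbox hir m hm => ⟨?_, fun hD => ?_⟩,
    fun hρ hρ1 lo hi hbox hρr m hm => ⟨?_, fun hlt hD => ?_⟩,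
    fun hρ hρ1 l hb ha hρr hL m hm => ⟨?_, fun hD => ?_⟩⟩
  · exact Deconv.attained_sobolev_ordinary hf h0 x₀ hbox
  · exact Deconv.lowerBound_sobolev_ordinary hf h0 x₀ hbox hlt hD
  · exact Deconv.attained_supersmooth_ordinary hf h0 x₀ hbox
  · exact Deconv.lowerBound_supersmooth_ordinary hf h0 x₀ hbox hlt hD
  · exact Deconv.attained_sobolev_supersmooth hf hρ x₀ hbox
  · exact Deconv.lowerBound_sobolev_supersmooth hf hρ x₀ hbox hD
  · exact Deconv.attained_smoother_noise hf hρ x₀ hbox hir hm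
  · exact Deconv.lowerBound_smoother_noise hf hρ x₀ hbox hir hm hD
  · exact Deconv.attained_supersmooth_supersmooth hf hρ hρ1 x₀ hbox hm
  · exact Deconv.lowerBound_supersmooth_supersmooth hf hρ hρ1 x₀ hbox hρr hlt hm hD
  · exact Deconv.attained_single hf hρ hρ1 x₀ hb ha hρr hL hm
  · exact Deconv.lowerBound_single hf hρ hρ1 x₀ hb ha hρr hL hm hD
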